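/- Let $\overline X$ be a compact smooth manifold with boundary $Y$ and interior $X$, let $h$ be a smooth Riemannian metric on $\overline X$, and let $\alpha\in C^\infty(\overline X)$ be a boundary defining function ($\alpha>0$ in $X$, $\alpha=0$ and $d\alpha\neq0$ at $Y$). Assume that there is a collar neighbourhood $[0,\epsilon)_\alpha\times Y_y$ of $Y$ in which $$h=\tilde\beta(\alpha^2,y)^2\,d\alpha^2+k(\alpha^2,y,dy),$$ where $\tilde\beta>0$ and $k$ are smooth on $[0,\epsilon^2)\times Y$ and $\beta:=\tilde\beta(0,\cdot)$ is constant on each connected component of $Y$. Consider the spacetime $\mathbb R_t\times X$ with metric $g=\alpha^2\,dt^2-h$, and write complex differential forms (of mixed degree) on it as $u=u_T+\alpha\,dt\wedge u_N$ with $u_T,u_N$ forms on $X$. Let $d_X$ be the exterior derivative on $X$, $\delta_X$ its formal $L^2(X,|dh|;H)$-adjoint, where $H$ is the fibre inner product on forms induced by $h$ and $|dh|$ is the Riemannian volume density. For $\sigma\in\mathbb C$, conjugating the exterior derivative $d$ and the codifferential $\delta_g$ on $\mathbb R_t\times X$ by $e^{-it\sigma}$ gives the operators, acting on $t$-independent pairs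 $(u_T,u_N)$, $$\hat d(\sigma)=\begin{pmatrix} d_X&0\\ -i\sigma\alpha^{-1}&-\alpha^{-1}d_X\alpha\end{pmatrix},\qquad \hat\delta(\sigma)=\begin{pmatrix}-\alpha^{-1}\delta_X\alpha& i\sigma\alpha^{-1}\\ 0&\delta_X\end{pmatrix}.$$ Let $C^\infty_{(\sigma)}$ be the space of all $u=(u_T,u_N)$ which are smooth in $X$ and which in the collar have the form $u_T=u_{TT}+d\alpha\wedge u_{TN}$, $u_N=u_{NT}+d\alpha\wedge u_{NN}$ with $$u_{TT}=\alpha^{-i\beta\sigma}v_{TT},\quad u_{TN}=\alpha^{-i\beta\sigma}(\alpha v_{TN}+\beta\alpha^{-1}v_{NT}),\quad u_{NT}=\alpha^{-i\beta\sigma}\alpha^{-1}v_{NT},\quad u_{NN}=\alpha^{-i\beta\sigma}v_{NN},$$ where $v_{\bullet\bullet}=v_{\bullet\bullet}(\alpha^2,y)$ are forms on $Y$ depending smoothly on $(\mu,y)\in[0,\epsilon^2)\times Y$, $\mu=\alpha^2$. Let $\|u\|^2=\int_X\bigl(H(u_T,u_T)+H(u_N,u_N)\bigr)\,\alpha\,|dh|$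 be the norm of $L^2(\alpha|dh|;H\oplus H)$. **Proposition.** There is a constant $C>0$ such that for all $\sigma\in\mathbb C$ with $\operatorname{Im}\sigma>0$ and all $u\in C^\infty_{(\sigma)}$, both $u$ and $(\hat d(\sigma)+\hat\delta(\sigma))u$ lie in $L^2(\alpha|dh|;H\oplus H)$ and $$\|u\|_{L^2(\alpha|dh|;H\oplus H)}\le C\,\frac{|\sigma|}{|\operatorname{Im}\sigma|^2}\,\bigl\|(\hat d(\sigma)+\hat\delta(\sigma))u\bigr\|_{L^2(\alpha|dh|;H\oplus H)}.$$ In particular there are no resonant states in the open upper half-plane: if $\operatorname{Im}\sigma>0$, $u\in C^\infty_{(\sigma)}$ and $(\hat d(\sigma)+\hat\delta(\sigma))u=0$ in $X$, then $u=0$ in $X$. -/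

import Mathlib

open Set MeasureTheory Manifold
open scoped ContDiff

noncomputable section

/-! ### Complex differential forms on a manifold (possibly with boundary) -/

section Forms

variable {E : Type*} [NormedAddCommGroup E] [NormedSpace ℝ E] {H : Type*} [TopologicalSpace H]

/-- Complex-valued differential `k`-forms on `M` (no regularity is imposed). -/
abbrev FormField (I : ModelWithCorners ℝ E H) (M : Type*) [TopologicalSpace M] [ChartedSpace H M]
    (k : ℕ) : Type _ :=
  (x : M) → (TangentSpace I x) [⋀^Fin k]→L[ℝ] ℂ

/-- Sections of the full exterior algebra bundle, graded by form degree; the components of degree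
larger than the dimension vanish automatically. -/
abbrev MixedForm (I : ModelWithCorners ℝ E H) (M : Type*) [TopologicalSpace M] [ChartedSpace H M] :
    Type _ :=
  (k : ℕ) → FormField I M k

variable {I : ModelWithCorners ℝ E H} {M : Type*} [TopologicalSpace M] [ChartedSpace H M]

/-- The coordinate expression of a form in the chart at `c`, i.e. its pull-back under the inverse
of that chart. -/
def FormField.inChart {k : ℕ} (ξ : FormField I M k) (c : M) (z : E) : E [⋀^Fin k]→L[ℝ] ℂ :=
  (ξ ((extChartAt I c).symm z)).compContinuousLinearMap
    (mfderivWithin 𝓘(ℝ, E) I (extChartAt I c).symm (range I) z : E →L[ℝ] TangentSpace I _)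

/-- Smoothness of a form on a subset `U` (used for open `U`): its coordinate expressions in all
charts are smooth. -/
def FormField.SmoothOn {k : ℕ} (ξ : FormField I M k) (U : Set M) : Prop :=
  ∀ c : M, ContDiffOn ℝ ∞ (ξ.inChart c) ((extChartAt I c).target ∩ (extChartAt I c).symm ⁻¹' U)

/-- The exterior derivative of a `k`-form, computed at `x` in the chart at `x`. -/
def FormField.extD {k : ℕ} (ξ : FormField I M k) : FormField I M (k + 1) := fun x =>
  (extDerivWithin (ξ.inChart x) (range I) (extChartAt I x x)).compContinuousLinearMap
    (mfderiv I 𝓘(ℝ, E) (extChartAt I x) x : TangentSpace I x →L[ℝ] E)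

/-- Smoothness of a form of mixed degree. -/
def MixedForm.SmoothOn (ξ : MixedForm I M) (U : Set M) : Prop := ∀ k, (ξ k).SmoothOn U

/-- The exterior derivative of a form of mixed degree. -/
def MixedForm.extD (ξ : MixedForm I M) : MixedForm I M
  | 0 => 0
  | k + 1 => (ξ k).extD

/-- Multiplication of a form of mixed degree by a complex-valued function. -/
def MixedForm.mulFun (a : M → ℂ) (ξ : MixedForm I M) : MixedForm I M := fun k x => a x • ξ k x

/-- A family of forms on `M`, depending on a parameter `μ ∈ [0, r)`, which is jointly smooth on
`[0, r) × M` (up to and including `μ = 0`). -/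
def SmoothFormFamily (r : ℝ) (ξ : ℝ → MixedForm I M) : Prop :=
  ∀ (k : ℕ) (c : M), ContDiffOn ℝ ∞ (fun p : ℝ × E => (ξ p.1 k).inChart c p.2)
    (Ico 0 r ×ˢ (extChartAt I c).target)

end Forms

/-! ### Fibre inner products, volume and codifferential of a Riemannian metric -/

section Metric

variable {d : ℕ} {H : Type*} [TopologicalSpace H]
  {I : ModelWithCorners ℝ (EuclideanSpace ℝ (Fin d)) H}
  {M : Type*} [TopologicalSpace M] [ChartedSpace H M] [IsManifold I ∞ M]

/-- Smooth Riemannian metrics on `M`. -/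
abbrev SmoothMetric (I : ModelWithCorners ℝ (EuclideanSpace ℝ (Fin d)) H) (M : Type*)
    [TopologicalSpace M] [ChartedSpace H M] [IsManifold I ∞ M] : Type _ :=
  Bundle.ContMDiffRiemannianMetric I ∞ (EuclideanSpace ℝ (Fin d))
    (fun x : M => TangentSpace I x)

/-- The `i`-th vector of the standard frame of `T_x M ≅ ℝ^d`. -/
def stdVec (I : ModelWithCorners ℝ (EuclideanSpace ℝ (Fin d)) H) (x : M) (i : Fin d) :
    TangentSpace I x :=
  (EuclideanSpace.single i (1 : ℝ) : EuclideanSpace ℝ (Fin d))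

/-- The Gram matrix of the metric at `x` in the standard frame. -/
def gram (h : SmoothMetric I M) (x : M) : Matrix (Fin d) (Fin d) ℝ :=
  Matrix.of fun i j => h.inner x (stdVec I x i) (stdVec I x j)

/-- The Hermitian inner product which the metric induces on complex `k`-covectors at `x`:
`(1/k!) ∑ h^{i₁j₁} ⋯ h^{iₖjₖ} ξ_{i₁…iₖ} conj(η_{j₁…jₖ})`, so that `e^{i₁} ∧ … ∧ e^{iₖ}`,
`i₁ < … < iₖ`, is orthonormal if `(e^i)` is an orthonormal coframe. -/
def fiberInner (h : SmoothMetric I M) (k : ℕ) (x : M)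
    (ξ η : (TangentSpace I x) [⋀^Fin k]→L[ℝ] ℂ) : ℂ :=
  ((k.factorial : ℂ))⁻¹ * ∑ i : Fin k → Fin d, ∑ j : Fin k → Fin d,
    ((∏ a, (gram h x)⁻¹ (i a) (j a) : ℝ) : ℂ) *
      ξ (fun a => stdVec I x (i a)) * (starRingEnd ℂ) (η (fun a => stdVec I x (j a)))

/-- The pointwise squared norm of a form of mixed degree. -/
def fiberNormSq (h : SmoothMetric I M) (ξ : MixedForm I M) (x : M) : ℝ :=
  ∑ k ∈ Finset.range (d + 1), (fiberInner h k x (ξ k x) (ξ k x)).re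

/-- The matrix `h_{ij}` of the metric in the coordinates of the chart at `c`. -/
def gramInChart (h : SmoothMetric I M) (c : M) (z : EuclideanSpace ℝ (Fin d)) :
    Matrix (Fin d) (Fin d) ℝ :=
  let D : EuclideanSpace ℝ (Fin d) →L[ℝ] TangentSpace I ((extChartAt I c).symm z) :=
    mfderivWithin 𝓘(ℝ, EuclideanSpace ℝ (Fin d)) I (extChartAt I c).symm (range I) z
  Matrix.of fun i j => h.inner ((extChartAt I c).symm z)
    (D (EuclideanSpace.single i (1 : ℝ))) (D (EuclideanSpace.single j (1 : ℝ)))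

/-- The Riemannian volume measure `|dh|`: the measure which in every chart is `√(det h_{ij}) dz`.
The local measures agree on overlaps of charts, so their supremum is the measure glued from
them. -/
def riemannianVolume [MeasurableSpace M] (h : SmoothMetric I M) : Measure M :=
  ⨆ c : M, Measure.map (extChartAt I c).symm
    ((volume.restrict (extChartAt I c).target).withDensity
      fun z => ENNReal.ofReal (Real.sqrt (gramInChart h c z).det))

/-- `η` is the codifferential `δξ` of the `(k+1)`-form `ξ` on the interior of `M`: `δ` is the formal
adjoint of the exterior derivative with respect to the volume and the fibre inner products of the
metric, i.e. `η` is the smooth form with `∫ ⟨φ, η⟩ |dh| = ∫ ⟨dφ, ξ⟩ |dh|` for all smooth `k`-forms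
`φ` with compact support in the interior. -/
def IsCodifferential [MeasurableSpace M] (h : SmoothMetric I M) {k : ℕ}
    (ξ : FormField I M (k + 1)) (η : FormField I M k) : Prop :=
  η.SmoothOn (I.interior M) ∧
  ∀ φ : FormField I M k, φ.SmoothOn (I.interior M) →
    (∃ K : Set M, IsCompact K ∧ K ⊆ I.interior M ∧ ∀ x, x ∉ K → φ x = 0) →
    ∫ x in I.interior M, fiberInner h k x (φ x) (η x) ∂(riemannianVolume h) =
      ∫ x in I.interior M, fiberInner h (k + 1) x (φ.extD x) (ξ x) ∂(riemannianVolume h)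

/-- The codifferential of a form of mixed degree. -/
def MixedForm.IsCodifferential [MeasurableSpace M] (h : SmoothMetric I M)
    (ξ η : MixedForm I M) : Prop :=
  ∀ k, _root_.IsCodifferential h (ξ (k + 1)) (η k)

end Metric

/-! ### The spatial geometry `(X̄, h, α)` of the spacetime `g = α² dt² - h` -/

section Setup

/-- The coordinate vector `∂_s` of a map `Φ : ℝ × Y → X` at `(s, y)`. -/
def collarRadial {m d : ℕ} {H : Type*} [TopologicalSpace H]
    (I : ModelWithCorners ℝ (EuclideanSpace ℝ (Fin d)) H)
    {X : Type*} [TopologicalSpace X] [ChartedSpace H X]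
    {Y : Type*} [TopologicalSpace Y] [ChartedSpace (EuclideanSpace ℝ (Fin m)) Y]
    (Φ : ℝ × Y → X) (s : ℝ) (y : Y) : TangentSpace I (Φ (s, y)) :=
  (mfderiv 𝓘(ℝ, ℝ) I (fun s' : ℝ => Φ (s', y)) s : ℝ →L[ℝ] TangentSpace I (Φ (s, y))) 1

/-- The differential at `y` of the slice `Φ(s, ·) : Y → X`. -/
def collarTangential {m d : ℕ} {H : Type*} [TopologicalSpace H]
    (I : ModelWithCorners ℝ (EuclideanSpace ℝ (Fin d)) H)
    {X : Type*} [TopologicalSpace X] [ChartedSpace H X]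
    {Y : Type*} [TopologicalSpace Y] [ChartedSpace (EuclideanSpace ℝ (Fin m)) Y]
    (Φ : ℝ × Y → X) (s : ℝ) (y : Y) :
    TangentSpace (𝓡 m) y →L[ℝ] TangentSpace I (Φ (s, y)) :=
  mfderiv (𝓡 m) I (fun y' : Y => Φ (s, y')) y

/-- A compact manifold `X̄` with boundary (the type `X`) of dimension `m + 1`, with a smooth
Riemannian metric `h`, a boundary defining function `α`, and a collar `[0, ε)_α × Y` of the boundary
`Y` in which `h = β̃(α², y)² dα² + k(α², y, dy)`, with `β̃(0, y) > 0` locally constant. -/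
structure StaticGeometry (m : ℕ)
    (X : Type*) [TopologicalSpace X] [ChartedSpace (EuclideanHalfSpace (m + 1)) X]
    [IsManifold (𝓡∂ (m + 1)) ∞ X]
    (Y : Type*) [TopologicalSpace Y] [ChartedSpace (EuclideanSpace ℝ (Fin m)) Y]
    [IsManifold (𝓡 m) ∞ Y] where
  /-- The Riemannian metric `h` on `X̄`, smooth up to the boundary. -/
  h : SmoothMetric (𝓡∂ (m + 1)) X
  /-- The boundary defining function. -/
  α : X → ℝ
  α_smooth : ContMDiff (𝓡∂ (m + 1)) 𝓘(ℝ, ℝ) ∞ α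
  α_pos : ∀ x ∈ (𝓡∂ (m + 1)).interior X, 0 < α x
  α_boundary : ∀ x ∈ (𝓡∂ (m + 1)).boundary X, α x = 0
  dα_boundary : ∀ x ∈ (𝓡∂ (m + 1)).boundary X, mfderiv (𝓡∂ (m + 1)) 𝓘(ℝ, ℝ) α x ≠ 0
  /-- The width of the collar. -/
  ε : ℝ
  ε_pos : 0 < ε
  /-- The collar, a diffeomorphism of `[0, ε) × Y` onto an open neighbourhood of the boundary; only
  its values on `[0, ε) × Y` matter. -/
  Φ : ℝ × Y → X
  Φ_smooth : ContMDiffOn (𝓘(ℝ, ℝ).prod (𝓡 m)) (𝓡∂ (m + 1)) ∞ Φ (Ico 0 ε ×ˢ univ)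
  Φ_open : IsOpen (Φ '' (Ico 0 ε ×ˢ univ))
  Φ_boundary : (𝓡∂ (m + 1)).boundary X ⊆ Φ '' (Ico 0 ε ×ˢ univ)
  /-- The inverse of the collar. -/
  Ψ : X → ℝ × Y
  Ψ_left_inv : ∀ p ∈ Ico 0 ε ×ˢ (univ : Set Y), Ψ (Φ p) = p
  Ψ_smooth : ContMDiffOn (𝓡∂ (m + 1)) (𝓘(ℝ, ℝ).prod (𝓡 m)) ∞ Ψ (Φ '' (Ico 0 ε ×ˢ univ))
  /-- The first coordinate of the collar is `α`. -/
  α_collar : ∀ s ∈ Ico 0 ε, ∀ y : Y, α (Φ (s, y)) = s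
  /-- The function `β̃(μ, y)`, smooth on `[0, ε²) × Y`. -/
  βt : ℝ × Y → ℝ
  βt_smooth : ContMDiffOn (𝓘(ℝ, ℝ).prod (𝓡 m)) 𝓘(ℝ, ℝ) ∞ βt (Ico 0 (ε ^ 2) ×ˢ univ)
  βt_pos : ∀ p ∈ Ico 0 (ε ^ 2) ×ˢ (univ : Set Y), 0 < βt p
  βt_zero : IsLocallyConstant fun y : Y => βt ((0 : ℝ), y)
  /-- The family of metrics `k(μ, y, dy)` on `Y`, smooth on `[0, ε²) × Y`. -/
  k : ℝ → (y : Y) → TangentSpace (𝓡 m) y →L[ℝ] TangentSpace (𝓡 m) y →L[ℝ] ℝ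
  k_smooth : ∀ (c : Y) (v w : EuclideanSpace ℝ (Fin m)),
    ContDiffOn ℝ ∞ (fun p : ℝ × EuclideanSpace ℝ (Fin m) =>
      let D : EuclideanSpace ℝ (Fin m) →L[ℝ] TangentSpace (𝓡 m) ((extChartAt (𝓡 m) c).symm p.2) :=
        mfderivWithin 𝓘(ℝ, EuclideanSpace ℝ (Fin m)) (𝓡 m) (extChartAt (𝓡 m) c).symm
          (range (𝓡 m)) p.2
      k p.1 ((extChartAt (𝓡 m) c).symm p.2) (D v) (D w))
      (Ico 0 (ε ^ 2) ×ˢ (extChartAt (𝓡 m) c).target)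
  h_radial : ∀ s ∈ Ioo 0 ε, ∀ y : Y,
    h.inner (Φ (s, y)) (collarRadial (m := m) (𝓡∂ (m + 1)) Φ s y) (collarRadial (m := m) (𝓡∂ (m + 1)) Φ s y) =
      βt (s ^ 2, y) ^ 2
  h_mixed : ∀ s ∈ Ioo 0 ε, ∀ (y : Y) (v : TangentSpace (𝓡 m) y),
    h.inner (Φ (s, y)) (collarRadial (m := m) (𝓡∂ (m + 1)) Φ s y)
      (collarTangential (m := m) (𝓡∂ (m + 1)) Φ s y v) = 0
  h_tangential : ∀ s ∈ Ioo 0 ε, ∀ (y : Y) (v w : TangentSpace (𝓡 m) y),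
    h.inner (Φ (s, y)) (collarTangential (m := m) (𝓡∂ (m + 1)) Φ s y v)
      (collarTangential (m := m) (𝓡∂ (m + 1)) Φ s y w) = k (s ^ 2) y v w

namespace StaticGeometry

variable {m : ℕ}
  {X : Type*} [TopologicalSpace X] [ChartedSpace (EuclideanHalfSpace (m + 1)) X]
  [IsManifold (𝓡∂ (m + 1)) ∞ X]
  {Y : Type*} [TopologicalSpace Y] [ChartedSpace (EuclideanSpace ℝ (Fin m)) Y]
  [IsManifold (𝓡 m) ∞ Y]

/-- Forms `u = u_T + α dt ∧ u_N` on the spacetime with `t`-independent `u_T`, `u_N`, written as pairs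
`(u_T, u_N)` of forms on `X`. -/
abbrev Form (_S : StaticGeometry m X Y) : Type _ :=
  MixedForm (𝓡∂ (m + 1)) X × MixedForm (𝓡∂ (m + 1)) X

/-- The part `ξ_T` of `ξ = ξ_T + dα ∧ ξ_N` in the collar, a form on `Y` depending on `α = s`. -/
def collarT (S : StaticGeometry m X Y) (ξ : MixedForm (𝓡∂ (m + 1)) X) (s : ℝ) :
    MixedForm (𝓡 m) Y := fun k y =>
  (ξ k (S.Φ (s, y))).compContinuousLinearMap (collarTangential (m := m) (𝓡∂ (m + 1)) S.Φ s y)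

/-- The part `ξ_N` of `ξ = ξ_T + dα ∧ ξ_N` in the collar, a form on `Y` depending on `α = s`: the
contraction of `ξ` with `∂_α`, restricted to the slice. -/
def collarN (S : StaticGeometry m X Y) (ξ : MixedForm (𝓡∂ (m + 1)) X) (s : ℝ) :
    MixedForm (𝓡 m) Y := fun k y =>
  (ContinuousAlternatingMap.curryLeft (E := EuclideanSpace ℝ (Fin (m + 1)))
    (ξ (k + 1) (S.Φ (s, y))) (collarRadial (m := m) (𝓡∂ (m + 1)) S.Φ s y)).compContinuousLinearMap
      (collarTangential (m := m) (𝓡∂ (m + 1)) S.Φ s y)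

/-- The factor `α^{-iβσ}` in the collar, with `β = β̃(0, y)`. -/
def phase (S : StaticGeometry m X Y) (σ : ℂ) (s : ℝ) (y : Y) : ℂ :=
  (s : ℂ) ^ (-(Complex.I * (S.βt (0, y) : ℂ) * σ))

/-- The space `C^∞_(σ)`: pairs `(u_T, u_N)` of forms which are smooth in the interior of `X̄` and
which in the collar satisfy, with `v_{••}(α², y)` smooth up to the boundary,
`u_TT = α^{-iβσ} v_TT`, `u_TN = α^{-iβσ} (α v_TN + β α⁻¹ v_NT)`, `u_NT = α^{-iβσ} α⁻¹ v_NT`,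
`u_NN = α^{-iβσ} v_NN`. -/
def asymptoticSpace (S : StaticGeometry m X Y) (σ : ℂ) : Set S.Form :=
  {u | u.1.SmoothOn ((𝓡∂ (m + 1)).interior X) ∧ u.2.SmoothOn ((𝓡∂ (m + 1)).interior X) ∧
    ∃ vTT vTN vNT vNN : ℝ → MixedForm (𝓡 m) Y,
      SmoothFormFamily (S.ε ^ 2) vTT ∧ SmoothFormFamily (S.ε ^ 2) vTN ∧
      SmoothFormFamily (S.ε ^ 2) vNT ∧ SmoothFormFamily (S.ε ^ 2) vNN ∧
      ∀ s ∈ Ioo 0 S.ε, ∀ (k : ℕ) (y : Y),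
        S.collarT u.1 s k y = S.phase σ s y • vTT (s ^ 2) k y ∧
        S.collarN u.1 s k y = S.phase σ s y •
          ((s : ℂ) • vTN (s ^ 2) k y + ((S.βt (0, y) : ℂ) * (s : ℂ)⁻¹) • vNT (s ^ 2) k y) ∧
        S.collarT u.2 s k y = S.phase σ s y • ((s : ℂ)⁻¹ • vNT (s ^ 2) k y) ∧
        S.collarN u.2 s k y = S.phase σ s y • vNN (s ^ 2) k y}

/-- `d̂(σ) = (d_X, 0; -iσα⁻¹, -α⁻¹ d_X α)`. -/
def dHat (S : StaticGeometry m X Y) (σ : ℂ) (u : S.Form) : S.Form :=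
  (u.1.extD,
    u.1.mulFun (fun x => -(Complex.I * σ * (S.α x : ℂ)⁻¹)) +
      ((u.2.mulFun fun x => (S.α x : ℂ)).extD).mulFun fun x => -(S.α x : ℂ)⁻¹)

/-- `w = δ̂(σ) u`, where `δ̂(σ) = (-α⁻¹ δ_X α, iσα⁻¹; 0, δ_X)`; in the interior of `X̄`. -/
def IsDeltaHat [MeasurableSpace X] (S : StaticGeometry m X Y) (σ : ℂ) (u w : S.Form) : Prop :=
  ∃ p q : MixedForm (𝓡∂ (m + 1)) X,
    (u.1.mulFun fun x => (S.α x : ℂ)).IsCodifferential S.h p ∧ u.2.IsCodifferential S.h q ∧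
    ∀ x ∈ (𝓡∂ (m + 1)).interior X, ∀ k : ℕ,
      w.1 k x = -((S.α x : ℂ)⁻¹ • p k x) + (Complex.I * σ * (S.α x : ℂ)⁻¹) • u.2 k x ∧
      w.2 k x = q k x

/-- The norm of `L²(α|dh|; H ⊕ H)` over the interior of `X̄`, with values in `[0, ∞]`. -/
def L2norm [MeasurableSpace X] (S : StaticGeometry m X Y) (u : S.Form) : ENNReal :=
  (∫⁻ x in (𝓡∂ (m + 1)).interior X,
    ENNReal.ofReal (S.α x * (fiberNormSq S.h u.1 x + fiberNormSq S.h u.2 x))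
      ∂(riemannianVolume S.h)) ^ (1 / 2 : ℝ)

end StaticGeometry

end Setup

end

noncomputable section

section AltInner

variable {d k : ℕ}

/-- The `i`-th standard basis vector of Euclidean space. -/
abbrev basisVec (i : Fin d) : EuclideanSpace ℝ (Fin d) := EuclideanSpace.single i (1 : ℝ)

/-- The unnormalised sesquilinear pairing of two functions on `k`-tuples of vectors that is
induced by a matrix of coefficients. -/
def tensorPair (G : Matrix (Fin d) (Fin d) ℝ) (k : ℕ)
    (ζ η : (Fin k → EuclideanSpace ℝ (Fin d)) → ℂ) : ℂ :=
  ∑ i : Fin k → Fin d, ∑ j : Fin k → Fin d,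
    ((∏ a, G (i a) (j a) : ℝ) : ℂ) *
      ζ (fun a => basisVec (i a)) * (starRingEnd ℂ) (η (fun a => basisVec (j a)))

/-- The sesquilinear form on alternating forms induced by a matrix of coefficients (the inverse of
a Gram matrix). -/
def altInner (G : Matrix (Fin d) (Fin d) ℝ)
    (ζ η : EuclideanSpace ℝ (Fin d) [⋀^Fin k]→L[ℝ] ℂ) : ℂ :=
  ((k.factorial : ℂ))⁻¹ * tensorPair G k ζ η

lemma altInner_add_left (G : Matrix (Fin d) (Fin d) ℝ)
    (ζ ζ' η : EuclideanSpace ℝ (Fin d) [⋀^Fin k]→L[ℝ] ℂ) :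
    altInner G (ζ + ζ') η = altInner G ζ η + altInner G ζ' η := by
  simp only [altInner, tensorPair, ContinuousAlternatingMap.add_apply, mul_add, add_mul,
    Finset.sum_add_distrib]

lemma altInner_smul_left (G : Matrix (Fin d) (Fin d) ℝ) (c : ℂ)
    (ζ η : EuclideanSpace ℝ (Fin d) [⋀^Fin k]→L[ℝ] ℂ) :
    altInner G (c • ζ) η = c * altInner G ζ η := by
  simp only [altInner, tensorPair, ContinuousAlternatingMap.smul_apply, Finset.mul_sum,
    smul_eq_mul]
  refine Finset.sum_congr rfl fun i _ => Finset.sum_congr rfl fun j _ => ?_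
  ring

lemma altInner_smul_right (G : Matrix (Fin d) (Fin d) ℝ) (c : ℂ)
    (ζ η : EuclideanSpace ℝ (Fin d) [⋀^Fin k]→L[ℝ] ℂ) :
    altInner G ζ (c • η) = (starRingEnd ℂ) c * altInner G ζ η := by
  simp only [altInner, tensorPair, ContinuousAlternatingMap.smul_apply, Finset.mul_sum,
    smul_eq_mul, map_mul]
  refine Finset.sum_congr rfl fun i _ => Finset.sum_congr rfl fun j _ => ?_
  ring

lemma altInner_add_right (G : Matrix (Fin d) (Fin d) ℝ)
    (ζ η η' : EuclideanSpace ℝ (Fin d) [⋀^Fin k]→L[ℝ] ℂ) :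
    altInner G ζ (η + η') = altInner G ζ η + altInner G ζ η' := by
  simp only [altInner, tensorPair, ContinuousAlternatingMap.add_apply, mul_add, map_add,
    Finset.sum_add_distrib]

lemma altInner_conj_symm {G : Matrix (Fin d) (Fin d) ℝ} (hG : G.IsSymm)
    (ζ η : EuclideanSpace ℝ (Fin d) [⋀^Fin k]→L[ℝ] ℂ) :
    (starRingEnd ℂ) (altInner G ζ η) = altInner G η ζ := by
  simp only [altInner, tensorPair, map_mul, map_sum, map_inv₀, Complex.conj_conj, map_natCast,
    Complex.conj_ofReal]
  rw [Finset.sum_comm]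
  congr 1
  refine Finset.sum_congr rfl fun i _ => Finset.sum_congr rfl fun j _ => ?_
  rw [Finset.prod_congr rfl fun a _ => (hG.apply (i a) (j a)).symm]
  ring

lemma ContinuousAlternatingMap.comp_basisVec
    (ζ : EuclideanSpace ℝ (Fin d) [⋀^Fin k]→L[ℝ] ℂ) {n : ℕ}
    (c : Fin k → Fin n → ℝ) (v : Fin k → Fin n → EuclideanSpace ℝ (Fin d)) :
    ζ (fun a => ∑ p, c a p • v a p) =
      ∑ I : Fin k → Fin n, ((∏ a, c a (I a) : ℝ) : ℂ) * ζ (fun a => v a (I a)) := by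
  classical
  rw [ContinuousAlternatingMap.map_sum]
  refine Finset.sum_congr rfl fun I _ => ?_
  rw [ContinuousAlternatingMap.map_smul_univ, Complex.real_smul]

/-- Pulling back both forms under a linear map amounts to a congruence transformation of the
coefficient matrix. -/
lemma altInner_comp {n : ℕ} (N : Matrix (Fin n) (Fin n) ℝ) (M : Matrix (Fin d) (Fin n) ℝ)
    (A : EuclideanSpace ℝ (Fin n) →L[ℝ] EuclideanSpace ℝ (Fin d))
    (hA : ∀ i, A (basisVec i) = ∑ p, M p i • basisVec p)
    (ζ η : EuclideanSpace ℝ (Fin d) [⋀^Fin k]→L[ℝ] ℂ) :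
    altInner N (ζ.compContinuousLinearMap A) (η.compContinuousLinearMap A) =
      altInner (M * N * M.transpose) ζ η := by
  simp only [altInner, tensorPair]
  congr 1
  have e : ∀ (θ : EuclideanSpace ℝ (Fin d) [⋀^Fin k]→L[ℝ] ℂ) (i : Fin k → Fin n),
      θ.compContinuousLinearMap A (fun a => basisVec (i a)) =
        ∑ I : Fin k → Fin d, ((∏ a, M (I a) (i a) : ℝ) : ℂ) * θ (fun a => basisVec (I a)) := by
    intro θ i
    rw [ContinuousAlternatingMap.compContinuousLinearMap_apply,
      ← ContinuousAlternatingMap.comp_basisVec θ (fun a p => M p (i a)) (fun _ p => basisVec p)]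
    congr 1
    funext a
    exact hA (i a)
  have key : ∀ p q : Fin k → Fin d,
      (∏ a, (M * N * M.transpose) (p a) (q a) : ℝ) =
        ∑ i : Fin k → Fin n, ∑ j : Fin k → Fin n,
          (∏ a, N (i a) (j a)) * (∏ a, M (p a) (i a)) * ∏ a, M (q a) (j a) := by
    intro p q
    have h1 : ∀ a, (M * N * M.transpose) (p a) (q a) =
        ∑ x : Fin n × Fin n, N x.1 x.2 * M (p a) x.1 * M (q a) x.2 := by
      intro a
      rw [Fintype.sum_prod_type, Matrix.mul_apply, Finset.sum_comm]
      refine Finset.sum_congr rfl fun j _ => ?_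
      rw [Matrix.mul_apply, Finset.sum_mul]
      refine Finset.sum_congr rfl fun i _ => ?_
      rw [Matrix.transpose_apply]; ring
    simp_rw [h1]
    rw [Finset.prod_univ_sum]
    rw [← Finset.sum_product', Fintype.piFinset_univ]
    refine Fintype.sum_equiv (Equiv.arrowProdEquivProdArrow _ _ _) _ _ fun x => ?_
    simp [Equiv.arrowProdEquivProdArrow, Finset.prod_mul_distrib]
  simp_rw [key, e]
  push_cast
  simp_rw [map_sum, Finset.mul_sum, Finset.sum_mul]
  have swap : ∀ F : (Fin k → Fin n) → (Fin k → Fin n) → (Fin k → Fin d) → (Fin k → Fin d) → ℂ,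
      ∑ i, ∑ j, ∑ q, ∑ p, F i j p q = ∑ p, ∑ q, ∑ i, ∑ j, F i j p q := by
    intro F
    have : ∀ i, ∑ j, ∑ q, ∑ p, F i j p q = ∑ p, ∑ q, ∑ j, F i j p q := by
      intro i
      rw [Finset.sum_comm, Finset.sum_congr rfl fun q _ => Finset.sum_comm, Finset.sum_comm]
    simp_rw [this]
    rw [Finset.sum_comm, Finset.sum_congr rfl fun q _ => Finset.sum_comm]
  rw [swap]
  refine Finset.sum_congr rfl fun p _ => Finset.sum_congr rfl fun q _ =>
    Finset.sum_congr rfl fun i _ => Finset.sum_congr rfl fun j _ => ?_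
  simp only [map_mul, map_prod, Complex.conj_ofReal]
  ring

lemma altInner_one_self (ζ : EuclideanSpace ℝ (Fin d) [⋀^Fin k]→L[ℝ] ℂ) :
    altInner (1 : Matrix (Fin d) (Fin d) ℝ) ζ ζ =
      ((((k.factorial : ℝ))⁻¹ * ∑ i : Fin k → Fin d, ‖ζ (fun a => basisVec (i a))‖ ^ 2 : ℝ) : ℂ) := by
  simp only [altInner, tensorPair]
  rw [Complex.ofReal_mul, Complex.ofReal_inv, Complex.ofReal_natCast, Complex.ofReal_sum]
  congr 1
  refine Finset.sum_congr rfl fun i _ => ?_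
  rw [Finset.sum_eq_single i]
  · simp [Complex.mul_conj, Complex.normSq_eq_norm_sq]
  · intro j _ hj
    obtain ⟨a, ha⟩ := Function.ne_iff.mp hj
    have : (∏ a, (1 : Matrix (Fin d) (Fin d) ℝ) (i a) (j a)) = 0 :=
      Finset.prod_eq_zero (Finset.mem_univ a) (Matrix.one_apply_ne (Ne.symm ha))
    rw [this]; simp
  · simp

/-- The linear map of Euclidean spaces with a given matrix. -/
def matrixCLM {n : ℕ} (M : Matrix (Fin d) (Fin n) ℝ) :
    EuclideanSpace ℝ (Fin n) →L[ℝ] EuclideanSpace ℝ (Fin d) :=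
  LinearMap.toContinuousLinearMap (Matrix.toLpLin 2 2 M)

lemma matrixCLM_basisVec {n : ℕ} (M : Matrix (Fin d) (Fin n) ℝ) (i : Fin n) :
    matrixCLM M (basisVec i) = ∑ p, M p i • basisVec p := by
  ext q
  simp [matrixCLM, basisVec, Matrix.toLpLin_apply, Finset.sum_apply, Pi.single_apply]

open scoped MatrixOrder in
lemma exists_factor_inv {G : Matrix (Fin d) (Fin d) ℝ} (hG : G.PosDef) :
    ∃ B C : Matrix (Fin d) (Fin d) ℝ, B * C = 1 ∧ C * B = 1 ∧ G⁻¹ = B * 1 * B.transpose ∧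
      G = C.transpose * C := by
  obtain ⟨C, hC⟩ := CStarAlgebra.nonneg_iff_eq_star_mul_self.mp hG.posSemidef.nonneg
  have hC' : G = C.transpose * C := by
    rw [hC, Matrix.star_eq_conjTranspose, Matrix.conjTranspose_eq_transpose_of_trivial]
  have hdet : IsUnit C.det := by
    have h := hG.isUnit
    rw [Matrix.isUnit_iff_isUnit_det, hC', Matrix.det_mul] at h
    exact isUnit_of_mul_isUnit_right h
  refine ⟨C⁻¹, C, Matrix.nonsing_inv_mul _ hdet, Matrix.mul_nonsing_inv _ hdet, ?_, hC'⟩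
  rw [hC', Matrix.mul_inv_rev, mul_one, Matrix.transpose_nonsing_inv]

lemma altInner_self_real {G : Matrix (Fin d) (Fin d) ℝ} (hG : G.PosDef)
    (ζ : EuclideanSpace ℝ (Fin d) [⋀^Fin k]→L[ℝ] ℂ) :
    0 ≤ (altInner G⁻¹ ζ ζ).re := by
  obtain ⟨B, C, -, -, h, -⟩ := exists_factor_inv hG
  rw [h, ← altInner_comp _ B (matrixCLM B) (matrixCLM_basisVec B), altInner_one_self,
    Complex.ofReal_re]
  positivity

/-- Hadamard's inequality for alternating forms: values on tuples of vectors are controlled by the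
induced norm of the form and the lengths of the vectors. -/
lemma norm_apply_sq_le {G : Matrix (Fin d) (Fin d) ℝ} (hG : G.PosDef)
    (ζ : EuclideanSpace ℝ (Fin d) [⋀^Fin k]→L[ℝ] ℂ) (J : Fin k → Fin d) :
    ‖ζ (fun a => basisVec (J a))‖ ^ 2 ≤
      k.factorial * (altInner G⁻¹ ζ ζ).re * ∏ a, G (J a) (J a) := by
  obtain ⟨B, C, hBC, hCB, h, hG'⟩ := exists_factor_inv hG
  rw [h, ← altInner_comp _ B (matrixCLM B) (matrixCLM_basisVec B), altInner_one_self,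
    Complex.ofReal_re]
  have hk : (k.factorial : ℝ) ≠ 0 := by positivity
  rw [← mul_assoc, mul_inv_cancel₀ hk, one_mul]
  set θ := ζ.compContinuousLinearMap (matrixCLM B) with hθ
  have e1 : ζ (fun a => basisVec (J a)) =
      ∑ I : Fin k → Fin d, ((∏ a, C (I a) (J a) : ℝ) : ℂ) * θ (fun a => basisVec (I a)) := by
    rw [← ContinuousAlternatingMap.comp_basisVec θ (fun a p => C p (J a)) (fun _ p => basisVec p),
      hθ, ContinuousAlternatingMap.compContinuousLinearMap_apply]
    congr 1
    funext a
    simp only [Function.comp, map_sum, map_smul, matrixCLM_basisVec, Finset.smul_sum, smul_smul]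
    rw [Finset.sum_comm]
    have : ∀ q, ∑ p, (C p (J a) * B q p) • (basisVec q : EuclideanSpace ℝ (Fin d)) =
        (B * C) q (J a) • basisVec q := by
      intro q
      rw [← Finset.sum_smul, Matrix.mul_apply]
      simp_rw [mul_comm]
    simp_rw [this, hBC, Matrix.one_apply]
    simp
  have e2 : (∏ a, G (J a) (J a)) = ∑ I : Fin k → Fin d, (∏ a, C (I a) (J a)) ^ 2 := by
    have : ∀ a, G (J a) (J a) = ∑ p, C p (J a) ^ 2 := by
      intro a
      rw [hG', Matrix.mul_apply]
      refine Finset.sum_congr rfl fun p _ => ?_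
      rw [Matrix.transpose_apply]; ring
    simp_rw [this]
    rw [Finset.prod_univ_sum, Fintype.piFinset_univ]
    refine Finset.sum_congr rfl fun I _ => ?_
    rw [Finset.prod_pow]
  rw [e1, e2]
  calc _ ≤ (∑ I : Fin k → Fin d, |∏ a, C (I a) (J a)| * ‖θ (fun a => basisVec (I a))‖) ^ 2 := by
        gcongr
        refine (norm_sum_le _ _).trans (le_of_eq ?_)
        refine Finset.sum_congr rfl fun I _ => ?_
        rw [norm_mul, Complex.norm_real, Real.norm_eq_abs]
    _ ≤ (∑ I : Fin k → Fin d, |∏ a, C (I a) (J a)| ^ 2) *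
          ∑ I : Fin k → Fin d, ‖θ (fun a => basisVec (I a))‖ ^ 2 :=
        Finset.sum_mul_sq_le_sq_mul_sq _ _ _
    _ = _ := by simp_rw [sq_abs]; ring

lemma norm_altInner_le {G : Matrix (Fin d) (Fin d) ℝ} {K : ℝ} (hK : ∀ i j, |G i j| ≤ K)
    (ζ η : EuclideanSpace ℝ (Fin d) [⋀^Fin k]→L[ℝ] ℂ) :
    ‖altInner G ζ η‖ ≤ (∑ _i : Fin k → Fin d, ∑ _j : Fin k → Fin d, K ^ k) * (‖ζ‖ * ‖η‖) := by
  have hb : ∀ (θ : EuclideanSpace ℝ (Fin d) [⋀^Fin k]→L[ℝ] ℂ) (i : Fin k → Fin d),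
      ‖θ (fun a => basisVec (i a))‖ ≤ ‖θ‖ := by
    intro θ i
    simpa using θ.le_opNorm (fun a => basisVec (i a))
  have hk : ‖((k.factorial : ℂ))⁻¹‖ ≤ 1 := by
    rw [norm_inv, Complex.norm_natCast]
    exact inv_le_one_of_one_le₀ (by exact_mod_cast Nat.one_le_iff_ne_zero.mpr k.factorial_ne_zero)
  rw [altInner, norm_mul]
  refine (mul_le_of_le_one_left (norm_nonneg _) hk).trans ?_
  rw [tensorPair, Finset.sum_mul]
  refine (norm_sum_le _ _).trans (Finset.sum_le_sum fun i _ => ?_)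
  rw [Finset.sum_mul]
  refine (norm_sum_le _ _).trans (Finset.sum_le_sum fun j _ => ?_)
  rw [norm_mul, norm_mul, Complex.norm_real, RCLike.norm_conj, mul_assoc]
  have : ‖∏ a, G (i a) (j a)‖ ≤ K ^ k := by
    rw [norm_prod]
    calc _ ≤ ∏ _a : Fin k, K :=
          Finset.prod_le_prod (fun _ _ => norm_nonneg _) fun a _ => hK _ _
      _ = _ := by simp
  have hK0 : 0 ≤ K ^ k := (norm_nonneg _).trans this
  gcongr
  · exact hb _ _
  · exact hb _ _

lemma altInner_zero_left (G : Matrix (Fin d) (Fin d) ℝ)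
    (η : EuclideanSpace ℝ (Fin d) [⋀^Fin k]→L[ℝ] ℂ) : altInner G 0 η = 0 := by
  simp [altInner, tensorPair]

lemma tensorPair_succ (G : Matrix (Fin d) (Fin d) ℝ)
    (f g : (Fin (k + 1) → EuclideanSpace ℝ (Fin d)) → ℂ) :
    tensorPair G (k + 1) f g = ∑ i, ∑ j, (G i j : ℂ) *
      tensorPair G k (fun v => f (Matrix.vecCons (basisVec i) v))
        (fun v => g (Matrix.vecCons (basisVec j) v)) := by
  have e : ∀ F : (Fin (k + 1) → Fin d) → ℂ,
      ∑ I, F I = ∑ i, ∑ I : Fin k → Fin d, F (Matrix.vecCons i I) := by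
    intro F
    rw [← Fintype.sum_prod_type']
    exact (Fintype.sum_equiv (Fin.consEquiv fun _ => Fin d) _ _ fun x => rfl).symm
  have hv : ∀ (i : Fin d) (I : Fin k → Fin d),
      (fun a => basisVec (Matrix.vecCons i I a)) =
        Matrix.vecCons (basisVec i) fun a => basisVec (I a) := by
    intro i I
    funext a
    refine Fin.cases ?_ (fun a => ?_) a <;> simp
  simp only [tensorPair]
  rw [e]
  refine Finset.sum_congr rfl fun i _ => ?_
  simp_rw [e]
  rw [Finset.sum_comm]
  refine Finset.sum_congr rfl fun j _ => ?_
  rw [Finset.mul_sum]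
  refine Finset.sum_congr rfl fun I _ => ?_
  rw [Finset.mul_sum]
  refine Finset.sum_congr rfl fun J _ => ?_
  rw [hv, hv, Fin.prod_univ_succ]
  simp only [Matrix.cons_val_zero, Matrix.cons_val_succ]
  push_cast
  ring

lemma tensorPair_zero_left (G : Matrix (Fin d) (Fin d) ℝ)
    (g : (Fin k → EuclideanSpace ℝ (Fin d)) → ℂ) : tensorPair G k (fun _ => 0) g = 0 := by
  simp [tensorPair]

end AltInner

section Block

variable {m k : ℕ}

/-- The inclusion of Euclidean space as the hyperplane orthogonal to the first basis vector. -/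
def tailIncl (m : ℕ) : EuclideanSpace ℝ (Fin m) →L[ℝ] EuclideanSpace ℝ (Fin (m + 1)) :=
  LinearMap.toContinuousLinearMap
    { toFun := fun v => WithLp.toLp 2 (Fin.cons 0 v.ofLp : Fin (m + 1) → ℝ)
      map_add' := fun v w => by
        ext i; refine Fin.cases ?_ (fun i => ?_) i <;> simp
      map_smul' := fun c v => by
        ext i; refine Fin.cases ?_ (fun i => ?_) i <;> simp }

/-- The projection which forgets the first coordinate. -/
def tailProj (m : ℕ) : EuclideanSpace ℝ (Fin (m + 1)) →L[ℝ] EuclideanSpace ℝ (Fin m) :=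
  LinearMap.toContinuousLinearMap
    { toFun := fun v => WithLp.toLp 2 (fun i => v i.succ)
      map_add' := fun v w => by ext i; simp
      map_smul' := fun c v => by ext i; simp }

@[simp] lemma tailIncl_zero (v : EuclideanSpace ℝ (Fin m)) : tailIncl m v 0 = 0 := rfl
@[simp] lemma tailIncl_succ (v : EuclideanSpace ℝ (Fin m)) (i : Fin m) :
    tailIncl m v i.succ = v i := rfl
@[simp] lemma tailProj_apply (v : EuclideanSpace ℝ (Fin (m + 1))) (i : Fin m) :
    tailProj m v i = v i.succ := rfl

@[simp] lemma tailIncl_basisVec (i : Fin m) : tailIncl m (basisVec i) = basisVec i.succ := by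
  ext j
  refine Fin.cases ?_ (fun j => ?_) j
  · simp [basisVec, (Fin.succ_ne_zero i).symm]
  · simp [basisVec]

@[simp] lemma tailProj_tailIncl (v : EuclideanSpace ℝ (Fin m)) :
    tailProj m (tailIncl m v) = v := by
  ext i; simp

@[simp] lemma tailProj_basisVec_zero : tailProj m (basisVec 0) = 0 := by
  ext i; simp [basisVec]

lemma eq_add_tailIncl (v : EuclideanSpace ℝ (Fin (m + 1))) :
    v = v 0 • basisVec 0 + tailIncl m (tailProj m v) := by
  ext i
  refine Fin.cases ?_ (fun i => ?_) i <;> simp [basisVec]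

/-- The restriction of an alternating form to the hyperplane orthogonal to the first basis
vector. -/
def tangPart (ζ : EuclideanSpace ℝ (Fin (m + 1)) [⋀^Fin k]→L[ℝ] ℂ) :
    EuclideanSpace ℝ (Fin m) [⋀^Fin k]→L[ℝ] ℂ :=
  ζ.compContinuousLinearMap (tailIncl m)

/-- The contraction of an alternating form with the first basis vector, restricted to the
orthogonal hyperplane. -/
def normPart (ζ : EuclideanSpace ℝ (Fin (m + 1)) [⋀^Fin (k + 1)]→L[ℝ] ℂ) :
    EuclideanSpace ℝ (Fin m) [⋀^Fin k]→L[ℝ] ℂ :=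
  (ζ.curryLeft (basisVec 0)).compContinuousLinearMap (tailIncl m)

/-- The matrix `G` is block diagonal with blocks `b` and `N`. -/
structure IsBlock (G : Matrix (Fin (m + 1)) (Fin (m + 1)) ℝ) (b : ℝ)
    (N : Matrix (Fin m) (Fin m) ℝ) : Prop where
  zero_zero : G 0 0 = b
  zero_succ : ∀ i, G 0 (Fin.succ i) = 0
  succ_zero : ∀ i, G (Fin.succ i) 0 = 0
  succ_succ : ∀ i j, G (Fin.succ i) (Fin.succ j) = N i j

lemma tangPart_curryLeft (ζ : EuclideanSpace ℝ (Fin (m + 1)) [⋀^Fin (k + 1)]→L[ℝ] ℂ) (i : Fin m)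
    (v : Fin k → EuclideanSpace ℝ (Fin m)) :
    tangPart (ζ.curryLeft (basisVec i.succ)) v =
      tangPart ζ (Matrix.vecCons (basisVec i) v) := by
  simp only [tangPart, ContinuousAlternatingMap.compContinuousLinearMap_apply,
    ContinuousAlternatingMap.curryLeft_apply_apply]
  congr 1
  funext a
  refine Fin.cases ?_ (fun a => ?_) a <;> simp

lemma normPart_curryLeft (ζ : EuclideanSpace ℝ (Fin (m + 1)) [⋀^Fin (k + 2)]→L[ℝ] ℂ) (i : Fin m)
    (v : Fin k → EuclideanSpace ℝ (Fin m)) :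
    normPart (ζ.curryLeft (basisVec i.succ)) v =
      - normPart ζ (Matrix.vecCons (basisVec i) v) := by
  simp only [normPart, ContinuousAlternatingMap.compContinuousLinearMap_apply,
    ContinuousAlternatingMap.curryLeft_apply_apply]
  have := ζ.toAlternatingMap.map_swap (Matrix.vecCons (basisVec 0)
    (Matrix.vecCons (basisVec i.succ) (tailIncl m ∘ v))) (i := 0) (j := 1) (by simp)
  rw [ContinuousAlternatingMap.coe_toAlternatingMap] at this
  have e1 : Matrix.vecCons (basisVec i.succ) (Matrix.vecCons (basisVec 0) (tailIncl m ∘ v)) =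
      Matrix.vecCons (basisVec 0) (Matrix.vecCons (basisVec i.succ) (tailIncl m ∘ v)) ∘
        Equiv.swap (0 : Fin (k + 2)) 1 := by
    funext a
    refine Fin.cases ?_ (fun a => ?_) a
    · simp
    · refine Fin.cases ?_ (fun a => ?_) a
      · simp
      · have h0 : a.succ.succ ≠ 0 := Fin.succ_ne_zero _
        have h1 : a.succ.succ ≠ 1 := by
          rw [← Fin.succ_zero_eq_one]
          exact fun h => Fin.succ_ne_zero _ (Fin.succ_injective _ h)
        simp [Function.comp, Equiv.swap_apply_of_ne_of_ne h0 h1]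
  have e2 : tailIncl m ∘ Matrix.vecCons (basisVec i) v =
      Matrix.vecCons (basisVec i.succ) (tailIncl m ∘ v) := by
    funext a
    refine Fin.cases ?_ (fun a => ?_) a <;> simp
  rw [e2, ← this, ← e1]

lemma tensorPair_block_zero {G : Matrix (Fin (m + 1)) (Fin (m + 1)) ℝ}
    {N : Matrix (Fin m) (Fin m) ℝ}
    (ζ η : EuclideanSpace ℝ (Fin (m + 1)) [⋀^Fin 0]→L[ℝ] ℂ) :
    tensorPair G 0 ζ η = tensorPair N 0 (tangPart ζ) (tangPart η) := by
  have h : ∀ θ : EuclideanSpace ℝ (Fin (m + 1)) [⋀^Fin 0]→L[ℝ] ℂ,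
      ∀ v w, θ v = tangPart θ w := fun θ v w => by
    rw [tangPart, ContinuousAlternatingMap.compContinuousLinearMap_apply]
    congr 1
    exact Subsingleton.elim _ _
  simp only [tensorPair, Fintype.sum_unique, Finset.univ_eq_empty, Finset.prod_empty]
  rw [h ζ _ (fun a => basisVec ((default : Fin 0 → Fin m) a)),
    h η _ (fun a => basisVec ((default : Fin 0 → Fin m) a))]

lemma tensorPair_block {G : Matrix (Fin (m + 1)) (Fin (m + 1)) ℝ} {b : ℝ}
    {N : Matrix (Fin m) (Fin m) ℝ} (hG : IsBlock G b N) :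
    ∀ (k : ℕ) (ζ η : EuclideanSpace ℝ (Fin (m + 1)) [⋀^Fin (k + 1)]→L[ℝ] ℂ),
    tensorPair G (k + 1) ζ η = tensorPair N (k + 1) (tangPart ζ) (tangPart η) +
      (k + 1) * b * tensorPair N k (normPart ζ) (normPart η) := by
  have step : ∀ (k : ℕ) (ζ η : EuclideanSpace ℝ (Fin (m + 1)) [⋀^Fin (k + 1)]→L[ℝ] ℂ),
      tensorPair G (k + 1) ζ η =
        b * tensorPair G k (ζ.curryLeft (basisVec 0)) (η.curryLeft (basisVec 0)) +
        ∑ i : Fin m, ∑ j : Fin m, (N i j : ℂ) *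
          tensorPair G k (ζ.curryLeft (basisVec i.succ)) (η.curryLeft (basisVec j.succ)) := by
    intro k ζ η
    rw [tensorPair_succ, Fin.sum_univ_succ, Fin.sum_univ_succ]
    simp only [Fin.sum_univ_succ, hG.zero_zero, hG.zero_succ, hG.succ_zero, hG.succ_succ,
      Complex.ofReal_zero, zero_mul, Finset.sum_const_zero, add_zero, zero_add]
    rfl
  intro k
  induction k with
  | zero =>
    intro ζ η
    have e2 : ∀ i j : Fin m, (N i j : ℂ) * tensorPair G 0 (ζ.curryLeft (basisVec i.succ))
        (η.curryLeft (basisVec j.succ)) =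
        (N i j : ℂ) * tensorPair N 0 (fun v => tangPart ζ (Matrix.vecCons (basisVec i) v))
          (fun v => tangPart η (Matrix.vecCons (basisVec j) v)) := by
      intro i j
      rw [tensorPair_block_zero (N := N)]
      simp only [tensorPair, tangPart_curryLeft]
    rw [step, Finset.sum_congr rfl fun i _ => Finset.sum_congr rfl fun j _ => e2 i j,
      ← tensorPair_succ N (tangPart ζ) (tangPart η), tensorPair_block_zero (N := N)]
    have e4 : tangPart (ζ.curryLeft (basisVec 0)) = normPart ζ := rfl
    have e5 : tangPart (η.curryLeft (basisVec 0)) = normPart η := rfl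
    rw [e4, e5]
    push_cast
    ring
  | succ k ih =>
    intro ζ η
    have h0 : normPart (ζ.curryLeft (basisVec 0)) = 0 := by
      rw [normPart, ContinuousAlternatingMap.curryLeft_same]
      rfl
    have e0 : tensorPair N k (normPart (ζ.curryLeft (basisVec 0)))
        (normPart (η.curryLeft (basisVec 0))) = 0 := by
      rw [h0]; exact tensorPair_zero_left _ _
    have e1 : ∀ i j : Fin m, tensorPair N k (normPart (ζ.curryLeft (basisVec i.succ)))
        (normPart (η.curryLeft (basisVec j.succ))) =
        tensorPair N k (fun v => normPart ζ (Matrix.vecCons (basisVec i) v))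
          (fun v => normPart η (Matrix.vecCons (basisVec j) v)) := by
      intro i j
      simp only [tensorPair, normPart_curryLeft, map_neg, mul_neg, neg_mul, neg_neg]
    have e2 : ∀ i j : Fin m, tensorPair N (k + 1) (tangPart (ζ.curryLeft (basisVec i.succ)))
        (tangPart (η.curryLeft (basisVec j.succ))) =
        tensorPair N (k + 1) (fun v => tangPart ζ (Matrix.vecCons (basisVec i) v))
          (fun v => tangPart η (Matrix.vecCons (basisVec j) v)) := by
      intro i j
      simp only [tensorPair, tangPart_curryLeft]
    have e3 : ∀ i j : Fin m, (N i j : ℂ) * tensorPair G (k + 1) (ζ.curryLeft (basisVec i.succ))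
        (η.curryLeft (basisVec j.succ)) =
        (N i j : ℂ) * tensorPair N (k + 1) (fun v => tangPart ζ (Matrix.vecCons (basisVec i) v))
          (fun v => tangPart η (Matrix.vecCons (basisVec j) v)) +
        (k + 1) * b * ((N i j : ℂ) * tensorPair N k
          (fun v => normPart ζ (Matrix.vecCons (basisVec i) v))
          (fun v => normPart η (Matrix.vecCons (basisVec j) v))) := by
      intro i j
      rw [ih, e1, e2]
      ring
    rw [step, Finset.sum_congr rfl fun i _ => Finset.sum_congr rfl fun j _ => e3 i j]
    simp_rw [Finset.sum_add_distrib, ← Finset.mul_sum]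
    rw [← tensorPair_succ N (tangPart ζ) (tangPart η), ← tensorPair_succ N (normPart ζ) (normPart η),
      ih, e0]
    have e4 : tangPart (ζ.curryLeft (basisVec 0)) = normPart ζ := rfl
    have e5 : tangPart (η.curryLeft (basisVec 0)) = normPart η := rfl
    rw [e4, e5]
    push_cast
    ring

/-- The induced pairing of a block diagonal matrix splits into tangential and normal parts. -/
lemma altInner_block {G : Matrix (Fin (m + 1)) (Fin (m + 1)) ℝ} {b : ℝ}
    {N : Matrix (Fin m) (Fin m) ℝ} (hG : IsBlock G b N)
    (ζ η : EuclideanSpace ℝ (Fin (m + 1)) [⋀^Fin (k + 1)]→L[ℝ] ℂ) :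
    altInner G ζ η = altInner N (tangPart ζ) (tangPart η) +
      b * altInner N (normPart ζ) (normPart η) := by
  have h1 : ((k + 1 : ℕ) : ℂ) ≠ 0 := Nat.cast_ne_zero.mpr (Nat.succ_ne_zero k)
  have h2 : (k.factorial : ℂ) ≠ 0 := Nat.cast_ne_zero.mpr k.factorial_ne_zero
  rw [altInner, tensorPair_block hG, altInner, altInner, Nat.factorial_succ]
  push_cast at h1 ⊢
  field_simp

lemma altInner_block_zero {G : Matrix (Fin (m + 1)) (Fin (m + 1)) ℝ}
    {N : Matrix (Fin m) (Fin m) ℝ}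
    (ζ η : EuclideanSpace ℝ (Fin (m + 1)) [⋀^Fin 0]→L[ℝ] ℂ) :
    altInner G ζ η = altInner N (tangPart ζ) (tangPart η) := by
  rw [altInner, altInner, tensorPair_block_zero (N := N)]

end Block

section AltSmooth

variable {d k : ℕ}

lemma ContinuousAlternatingMap.apply_eq_sum_basisVec
    (ζ : EuclideanSpace ℝ (Fin d) [⋀^Fin k]→L[ℝ] ℂ) (v : Fin k → EuclideanSpace ℝ (Fin d)) :
    ζ v = ∑ I : Fin k → Fin d, ((∏ a, v a (I a) : ℝ) : ℂ) * ζ (fun a => basisVec (I a)) := by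
  rw [← ContinuousAlternatingMap.comp_basisVec ζ (fun a p => v a p) (fun _ p => basisVec p)]
  congr 1
  funext a
  ext q
  simp [basisVec, Finset.sum_apply, Pi.single_apply]

lemma ContinuousAlternatingMap.ext_basisVec
    {ζ η : EuclideanSpace ℝ (Fin d) [⋀^Fin k]→L[ℝ] ℂ}
    (h : ∀ I : Fin k → Fin d, ζ (fun a => basisVec (I a)) = η (fun a => basisVec (I a))) :
    ζ = η := by
  ext v
  rw [ζ.apply_eq_sum_basisVec, η.apply_eq_sum_basisVec]
  simp_rw [h]

/-- The components of an alternating form. -/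
def altComponents (d k : ℕ) :
    (EuclideanSpace ℝ (Fin d) [⋀^Fin k]→L[ℝ] ℂ) →ₗ[ℝ] ((Fin k → Fin d) → ℂ) where
  toFun ζ I := ζ (fun a => basisVec (I a))
  map_add' _ _ := rfl
  map_smul' _ _ := rfl

lemma exists_altComponents_leftInverse (d k : ℕ) :
    ∃ g : ((Fin k → Fin d) → ℂ) →L[ℝ] (EuclideanSpace ℝ (Fin d) [⋀^Fin k]→L[ℝ] ℂ),
      ∀ ζ, g (fun I => ζ (fun a => basisVec (I a))) = ζ := by
  obtain ⟨g, hg⟩ := (altComponents d k).exists_leftInverse_of_injective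
    (LinearMap.ker_eq_bot.mpr fun ζ η h =>
      ContinuousAlternatingMap.ext_basisVec fun I => congrFun h I)
  exact ⟨LinearMap.toContinuousLinearMap g, fun ζ => LinearMap.congr_fun hg ζ⟩

variable {F : Type*} [NormedAddCommGroup F] [NormedSpace ℝ F]

lemma contDiffOn_altMap_iff {n : WithTop ℕ∞}
    {f : F → EuclideanSpace ℝ (Fin d) [⋀^Fin k]→L[ℝ] ℂ} {s : Set F} :
    ContDiffOn ℝ n f s ↔
      ∀ I : Fin k → Fin d, ContDiffOn ℝ n (fun z => f z (fun a => basisVec (I a))) s := by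
  refine ⟨fun h I => ?_, fun h => ?_⟩
  · exact (ContinuousAlternatingMap.apply ℝ (EuclideanSpace ℝ (Fin d)) ℂ
      (fun a => basisVec (I a))).contDiff.comp_contDiffOn h
  · obtain ⟨g, hg⟩ := exists_altComponents_leftInverse d k
    refine (g.contDiff.comp_contDiffOn (contDiffOn_pi.mpr h)).congr fun z _ => ?_
    exact (hg (f z)).symm

lemma ContDiffOn.altMap_comp {n : WithTop ℕ∞} {d' : ℕ}
    {f : F → EuclideanSpace ℝ (Fin d) [⋀^Fin k]→L[ℝ] ℂ} {s : Set F}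
    {g : F → EuclideanSpace ℝ (Fin d') →L[ℝ] EuclideanSpace ℝ (Fin d)}
    (hf : ContDiffOn ℝ n f s) (hg : ContDiffOn ℝ n g s) :
    ContDiffOn ℝ n (fun z => (f z).compContinuousLinearMap (g z)) s := by
  rw [contDiffOn_altMap_iff]
  intro I
  simp only [ContinuousAlternatingMap.compContinuousLinearMap_apply]
  simp_rw [ContinuousAlternatingMap.apply_eq_sum_basisVec (f _) (_ ∘ _)]
  refine ContDiffOn.sum fun J _ => ContDiffOn.mul ?_ (contDiffOn_altMap_iff.mp hf J)
  refine Complex.ofRealCLM.contDiff.comp_contDiffOn (f := fun x => ∏ a,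
    (g x (basisVec (I a))).ofLp (J a)) (contDiffOn_prod fun a _ => ?_)
  exact (EuclideanSpace.proj (J a)).contDiff.comp_contDiffOn (hg.clm_apply contDiffOn_const)

end AltSmooth

section Param

variable {d : ℕ} {H : Type*} [TopologicalSpace H]
  {I : ModelWithCorners ℝ (EuclideanSpace ℝ (Fin d)) H}
  {M : Type*} [TopologicalSpace M] [ChartedSpace H M]

/-- The value of a form at a point, as an alternating form on the model space. -/
def formAt {k : ℕ} (ξ : FormField I M k) (x : M) : EuclideanSpace ℝ (Fin d) [⋀^Fin k]→L[ℝ] ℂ :=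
  ξ x

variable (I) in
/-- The derivative of a map from Euclidean space, as an endomorphism of the model space. -/
def modelDeriv (κ : EuclideanSpace ℝ (Fin d) → M) (z : EuclideanSpace ℝ (Fin d)) :
    EuclideanSpace ℝ (Fin d) →L[ℝ] EuclideanSpace ℝ (Fin d) :=
  (mfderiv 𝓘(ℝ, EuclideanSpace ℝ (Fin d)) I κ z :
      EuclideanSpace ℝ (Fin d) →L[ℝ] TangentSpace I (κ z))

variable (I) in
/-- The derivative of a chart, as an endomorphism of the model space. -/
def chartDeriv (c x : M) : EuclideanSpace ℝ (Fin d) →L[ℝ] EuclideanSpace ℝ (Fin d) :=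
  (mfderiv I 𝓘(ℝ, EuclideanSpace ℝ (Fin d)) (extChartAt I c) x :
      TangentSpace I x →L[ℝ] EuclideanSpace ℝ (Fin d))

/-- The pull-back of a form under a map from Euclidean space. -/
def pull {k : ℕ} (κ : EuclideanSpace ℝ (Fin d) → M) (ξ : FormField I M k)
    (z : EuclideanSpace ℝ (Fin d)) : EuclideanSpace ℝ (Fin d) [⋀^Fin k]→L[ℝ] ℂ :=
  (formAt ξ (κ z)).compContinuousLinearMap (modelDeriv I κ z)

/-- `κ` parametrises an open subset of the interior of `M` by the open set `U`. -/
structure IsParam (I : ModelWithCorners ℝ (EuclideanSpace ℝ (Fin d)) H)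
    (κ : EuclideanSpace ℝ (Fin d) → M) (U : Set (EuclideanSpace ℝ (Fin d))) : Prop where
  isOpen : IsOpen U
  smooth : ContMDiffOn 𝓘(ℝ, EuclideanSpace ℝ (Fin d)) I ∞ κ U
  mapsTo : MapsTo κ U (I.interior M)
  exists_inv : ∃ lam : M → EuclideanSpace ℝ (Fin d), ∀ z ∈ U, lam (κ z) = z ∧
    ContMDiffAt I 𝓘(ℝ, EuclideanSpace ℝ (Fin d)) ∞ lam (κ z)

/-- The interior of the domain of the inverse of a chart. -/
def chartDom (I : ModelWithCorners ℝ (EuclideanSpace ℝ (Fin d)) H) (c : M) :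
    Set (EuclideanSpace ℝ (Fin d)) :=
  interior (extChartAt I c).target

lemma two_le_infty : minSmoothness ℝ 2 ≤ (∞ : WithTop ℕ∞) := by
  simp only [minSmoothness_of_isRCLikeNormedField]
  exact ENat.LEInfty.out

lemma chartDom_subset (c : M) : chartDom I c ⊆ (extChartAt I c).target := interior_subset

lemma range_mem_nhds_of_mem_chartDom {c : M} {z : EuclideanSpace ℝ (Fin d)}
    (hz : z ∈ chartDom I c) : range I ∈ nhds z :=
  Filter.mem_of_superset (mem_interior_iff_mem_nhds.mp hz) (extChartAt_target_subset_range c)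

variable [IsManifold I ∞ M]

lemma mem_interior_iff_mem_chartDom {c : M} {x : M} (hx : x ∈ (extChartAt I c).source) :
    x ∈ I.interior M ↔ extChartAt I c x ∈ chartDom I c :=
  I.isInteriorPoint_iff_of_mem_atlas (n := ∞) (by simp) (chart_mem_atlas H c)
    (by rwa [extChartAt_source] at hx)

lemma symm_mem_interior_iff {c : M} {z : EuclideanSpace ℝ (Fin d)}
    (hz : z ∈ (extChartAt I c).target) :
    (extChartAt I c).symm z ∈ I.interior M ↔ z ∈ chartDom I c := by
  rw [mem_interior_iff_mem_chartDom ((extChartAt I c).map_target hz),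
    (extChartAt I c).right_inv hz]

lemma chartDom_eq (c : M) :
    (extChartAt I c).target ∩ (extChartAt I c).symm ⁻¹' (I.interior M) = chartDom I c := by
  ext z
  refine ⟨fun h => (symm_mem_interior_iff h.1).mp h.2, fun h => ⟨chartDom_subset c h, ?_⟩⟩
  exact (symm_mem_interior_iff (chartDom_subset c h)).mpr h

lemma isParam_chart (c : M) : IsParam I (extChartAt I c).symm (chartDom I c) where
  isOpen := isOpen_interior
  smooth := (contMDiffOn_extChartAt_symm c).mono (chartDom_subset c)
  mapsTo z hz := (symm_mem_interior_iff (chartDom_subset c hz)).mpr hz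
  exists_inv := ⟨extChartAt I c, fun z hz => ⟨(extChartAt I c).right_inv (chartDom_subset c hz),
    contMDiffAt_extChartAt' (by
      rw [← extChartAt_source I]; exact (extChartAt I c).map_target (chartDom_subset c hz))⟩⟩

omit [IsManifold I ∞ M] in
lemma inChart_eq_pull {k : ℕ} (ξ : FormField I M k) {c : M} {z : EuclideanSpace ℝ (Fin d)}
    (hz : z ∈ chartDom I c) : ξ.inChart c z = pull (extChartAt I c).symm ξ z := by
  rw [FormField.inChart, pull, mfderivWithin_of_mem_nhds (range_mem_nhds_of_mem_chartDom hz)]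
  rfl

lemma smoothOn_interior_iff {k : ℕ} {ξ : FormField I M k} :
    ξ.SmoothOn (I.interior M) ↔
      ∀ c : M, ContDiffOn ℝ ∞ (pull (extChartAt I c).symm ξ) (chartDom I c) := by
  refine forall_congr' fun c => ?_
  rw [chartDom_eq]
  exact contDiffOn_congr fun z hz => inChart_eq_pull ξ hz

namespace IsParam

variable {κ : EuclideanSpace ℝ (Fin d) → M} {U : Set (EuclideanSpace ℝ (Fin d))}

omit [IsManifold I ∞ M] in
lemma contMDiffAt (hκ : IsParam I κ U) {z : EuclideanSpace ℝ (Fin d)} (hz : z ∈ U) :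
    ContMDiffAt 𝓘(ℝ, EuclideanSpace ℝ (Fin d)) I ∞ κ z :=
  (hκ.smooth z hz).contMDiffAt (hκ.isOpen.mem_nhds hz)

omit [IsManifold I ∞ M] in
lemma mdifferentiableAt (hκ : IsParam I κ U) {z : EuclideanSpace ℝ (Fin d)} (hz : z ∈ U) :
    MDifferentiableAt 𝓘(ℝ, EuclideanSpace ℝ (Fin d)) I κ z :=
  (hκ.contMDiffAt hz).mdifferentiableAt (by simp)

omit [IsManifold I ∞ M] in
lemma injOn (hκ : IsParam I κ U) : InjOn κ U := by
  obtain ⟨lam, hl⟩ := hκ.exists_inv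
  intro z hz w hw h
  rw [← (hl z hz).1, h, (hl w hw).1]

omit [IsManifold I ∞ M] in
lemma hasMFDerivAt (hκ : IsParam I κ U) {z : EuclideanSpace ℝ (Fin d)} (hz : z ∈ U) :
    HasMFDerivAt 𝓘(ℝ, EuclideanSpace ℝ (Fin d)) I κ z (modelDeriv I κ z) :=
  (hκ.mdifferentiableAt hz).hasMFDerivAt

omit [IsManifold I ∞ M] in
lemma exists_deriv_inv (hκ : IsParam I κ U) {z : EuclideanSpace ℝ (Fin d)} (hz : z ∈ U) :
    ∃ L : EuclideanSpace ℝ (Fin d) →L[ℝ] EuclideanSpace ℝ (Fin d),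
      L.comp (modelDeriv I κ z) = ContinuousLinearMap.id ℝ _ := by
  obtain ⟨lam, hl⟩ := hκ.exists_inv
  obtain ⟨L, hL⟩ : ∃ L : EuclideanSpace ℝ (Fin d) →L[ℝ] EuclideanSpace ℝ (Fin d),
    HasMFDerivAt I 𝓘(ℝ, EuclideanSpace ℝ (Fin d)) lam (κ z) L := ⟨_, ((hl z hz).2.mdifferentiableAt (by simp)).hasMFDerivAt⟩
  have h1 : HasFDerivAt (lam ∘ κ) (L.comp (modelDeriv I κ z)) z :=
    (hL.comp z (hκ.hasMFDerivAt hz)).hasFDerivAt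
  have h2 : lam ∘ κ =ᶠ[nhds z] id := by
    filter_upwards [hκ.isOpen.mem_nhds hz] with w hw using (hl w hw).1
  exact ⟨L, h1.unique ((hasFDerivAt_id z).congr_of_eventuallyEq h2)⟩

omit [IsManifold I ∞ M] in
lemma modelDeriv_injective (hκ : IsParam I κ U) {z : EuclideanSpace ℝ (Fin d)} (hz : z ∈ U) :
    Function.Injective (modelDeriv I κ z) := by
  obtain ⟨L, hL⟩ := hκ.exists_deriv_inv hz
  exact Function.LeftInverse.injective (g := L) fun v => DFunLike.congr_fun hL v

omit [IsManifold I ∞ M] in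
lemma modelDeriv_surjective (hκ : IsParam I κ U) {z : EuclideanSpace ℝ (Fin d)} (hz : z ∈ U) :
    Function.Surjective (modelDeriv I κ z) :=
  LinearMap.surjective_of_injective
    (f := (modelDeriv I κ z).toLinearMap) (hκ.modelDeriv_injective hz)

/-- The expression of a parametrisation in a chart. -/
lemma contDiffAt_chart (hκ : IsParam I κ U) {z : EuclideanSpace ℝ (Fin d)} (hz : z ∈ U) {c : M}
    (hc : κ z ∈ (extChartAt I c).source) : ContDiffAt ℝ ∞ (extChartAt I c ∘ κ) z :=
  contMDiffAt_iff_contDiffAt.mp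
    ((contMDiffAt_extChartAt' (by rwa [extChartAt_source] at hc)).comp z (hκ.contMDiffAt hz))

lemma chart_mem (hκ : IsParam I κ U) {z : EuclideanSpace ℝ (Fin d)} (hz : z ∈ U) {c : M}
    (hc : κ z ∈ (extChartAt I c).source) : (extChartAt I c ∘ κ) z ∈ chartDom I c :=
  (mem_interior_iff_mem_chartDom hc).mp (hκ.mapsTo hz)

omit [IsManifold I ∞ M] in
lemma eventually_source (hκ : IsParam I κ U) {z : EuclideanSpace ℝ (Fin d)} (hz : z ∈ U) {c : M}
    (hc : κ z ∈ (extChartAt I c).source) :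
    ∀ᶠ w in nhds z, w ∈ U ∧ κ w ∈ (extChartAt I c).source :=
  (hκ.isOpen.eventually_mem hz).and ((hκ.contMDiffAt hz).continuousAt
    ((isOpen_extChartAt_source c).mem_nhds hc))

lemma fderiv_chart (hκ : IsParam I κ U) {z : EuclideanSpace ℝ (Fin d)} (hz : z ∈ U) {c : M}
    (hc : κ z ∈ (extChartAt I c).source) :
    fderiv ℝ (extChartAt I c ∘ κ) z = (chartDeriv I c (κ z)).comp (modelDeriv I κ z) := by
  have h0 : HasMFDerivAt I 𝓘(ℝ, EuclideanSpace ℝ (Fin d)) (extChartAt I c) (κ z)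
      (chartDeriv I c (κ z)) :=
    (mdifferentiableAt_extChartAt (by rwa [extChartAt_source] at hc)).hasMFDerivAt
  have h : HasFDerivAt (extChartAt I c ∘ κ) ((chartDeriv I c (κ z)).comp (modelDeriv I κ z)) z :=
    (h0.comp z (hκ.hasMFDerivAt hz)).hasFDerivAt
  exact h.fderiv

lemma modelDeriv_eq_comp (hκ : IsParam I κ U) {z : EuclideanSpace ℝ (Fin d)} (hz : z ∈ U) {c : M}
    (hc : κ z ∈ (extChartAt I c).source) :
    modelDeriv I κ z = (modelDeriv I (extChartAt I c).symm ((extChartAt I c ∘ κ) z)).comp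
        (fderiv ℝ (extChartAt I c ∘ κ) z) := by
  have h1 := ((isParam_chart (I := I) c).hasMFDerivAt (hκ.chart_mem hz hc)).comp z
    ((hκ.contDiffAt_chart hz hc).differentiableAt (by simp)).hasFDerivAt.hasMFDerivAt
  have h2 : (extChartAt I c).symm ∘ (extChartAt I c ∘ κ) =ᶠ[nhds z] κ := by
    filter_upwards [hκ.eventually_source hz hc] with w hw
    exact (extChartAt I c).left_inv hw.2
  exact (h1.congr_of_eventuallyEq h2.symm).mfderiv

lemma pull_eq_comp (hκ : IsParam I κ U) {z : EuclideanSpace ℝ (Fin d)} (hz : z ∈ U) {c : M}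
    (hc : κ z ∈ (extChartAt I c).source) {k : ℕ} (ξ : FormField I M k) :
    pull κ ξ z = (pull (extChartAt I c).symm ξ ((extChartAt I c ∘ κ) z)).compContinuousLinearMap
      (fderiv ℝ (extChartAt I c ∘ κ) z) := by
  have hx : (extChartAt I c).symm ((extChartAt I c ∘ κ) z) = κ z := (extChartAt I c).left_inv hc
  rw [pull, pull, hκ.modelDeriv_eq_comp hz hc, hx]
  rfl

lemma contDiffOn_pull (hκ : IsParam I κ U) {k : ℕ} {ξ : FormField I M k}
    (hξ : ξ.SmoothOn (I.interior M)) : ContDiffOn ℝ ∞ (pull κ ξ) U := by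
  intro z hz
  refine ContDiffAt.contDiffWithinAt ?_
  set c := κ z with hc
  have hcs : κ z ∈ (extChartAt I c).source := mem_extChartAt_source c
  set T := extChartAt I c ∘ κ with hT
  have hTd : ContDiffAt ℝ ∞ T z := hκ.contDiffAt_chart hz hcs
  obtain ⟨W, hW, hWo, hzW⟩ := eventually_nhds_iff.mp (hκ.eventually_source hz hcs)
  have hTW : ContDiffOn ℝ ∞ T W := fun w hw =>
    (hκ.contDiffAt_chart (hW w hw).1 (hW w hw).2).contDiffWithinAt
  have h1 : ContDiffOn ℝ ∞ (fun w => (pull (extChartAt I c).symm ξ (T w)).compContinuousLinearMap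
      (fderiv ℝ T w)) W := by
    refine ContDiffOn.altMap_comp ?_ (hTW.fderiv_of_isOpen hWo (by simp))
    exact (smoothOn_interior_iff.mp hξ c).comp hTW fun w hw =>
      hκ.chart_mem (hW w hw).1 (hW w hw).2
  refine (h1.contDiffAt (hWo.mem_nhds hzW)).congr_of_eventuallyEq ?_
  filter_upwards [hWo.mem_nhds hzW] with w hw
  exact hκ.pull_eq_comp (hW w hw).1 (hW w hw).2 ξ

/-- Pull-back under a parametrisation commutes with the exterior derivative. -/
lemma pull_extD (hκ : IsParam I κ U) {k : ℕ} {ξ : FormField I M k}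
    (hξ : ξ.SmoothOn (I.interior M)) {z : EuclideanSpace ℝ (Fin d)} (hz : z ∈ U) :
    pull κ ξ.extD z = extDeriv (pull κ ξ) z := by
  set c := κ z with hc
  have hcs : κ z ∈ (extChartAt I c).source := mem_extChartAt_source c
  have hmem : extChartAt I c (κ z) ∈ chartDom I c := hκ.chart_mem hz hcs
  have h1 : extDeriv (pull κ ξ) z =
      (extDeriv (pull (extChartAt I c).symm ξ) ((extChartAt I c ∘ κ) z)).compContinuousLinearMap
        (fderiv ℝ (extChartAt I c ∘ κ) z) := by
    rw [← extDeriv_pullback (r := ∞) _ (hκ.contDiffAt_chart hz hcs) two_le_infty]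
    · refine Filter.EventuallyEq.extDeriv_eq ?_
      filter_upwards [hκ.eventually_source hz hcs] with w hw
      exact hκ.pull_eq_comp hw.1 hw.2 ξ
    · exact (((smoothOn_interior_iff.mp hξ c).contDiffAt
        (isOpen_interior.mem_nhds hmem)).differentiableAt (by simp))
  have h2 : extDerivWithin (ξ.inChart c) (range I) (extChartAt I c (κ z)) =
      extDeriv (pull (extChartAt I c).symm ξ) (extChartAt I c (κ z)) := by
    rw [extDerivWithin, fderivWithin_of_mem_nhds (range_mem_nhds_of_mem_chartDom hmem)]
    rw [extDeriv]
    congr 1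
    refine Filter.EventuallyEq.fderiv_eq ?_
    filter_upwards [isOpen_interior.mem_nhds hmem] with w hw
    exact inChart_eq_pull ξ hw
  have h3 : formAt ξ.extD (κ z) = (extDerivWithin (ξ.inChart c) (range I)
      (extChartAt I c (κ z))).compContinuousLinearMap (chartDeriv I c (κ z)) := rfl
  rw [h1, hκ.fderiv_chart hz hcs, pull, h3, h2]
  rfl

end IsParam

end Param

section ExtDerivSmooth

variable {d k : ℕ}

lemma ContDiffOn.extDeriv {f : EuclideanSpace ℝ (Fin d) → EuclideanSpace ℝ (Fin d) [⋀^Fin k]→L[ℝ] ℂ}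
    {U : Set (EuclideanSpace ℝ (Fin d))} (hU : IsOpen U) (hf : ContDiffOn ℝ ∞ f U) :
    ContDiffOn ℝ ∞ (extDeriv f) U :=
  (ContinuousAlternatingMap.alternatizeUncurryFinCLM ℝ (EuclideanSpace ℝ (Fin d)) ℂ).contDiff.comp_contDiffOn
    (hf.fderiv_of_isOpen hU (by simp))

lemma extDeriv_const_smul' {f : EuclideanSpace ℝ (Fin d) → EuclideanSpace ℝ (Fin d) [⋀^Fin k]→L[ℝ] ℂ}
    {z : EuclideanSpace ℝ (Fin d)} (hf : DifferentiableAt ℝ f z) (c : ℂ) :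
    extDeriv (fun w => c • f w) z = c • extDeriv f z := by
  rw [extDeriv, fderiv_fun_const_smul hf, ContinuousAlternatingMap.alternatizeUncurryFin_smul]
  rfl

/-- The Leibniz rule for the product of a function and a form. -/
lemma extDeriv_fun_smul_form {f : EuclideanSpace ℝ (Fin d) → EuclideanSpace ℝ (Fin d) [⋀^Fin k]→L[ℝ] ℂ}
    {g : EuclideanSpace ℝ (Fin d) → ℝ}
    {z : EuclideanSpace ℝ (Fin d)} (hg : DifferentiableAt ℝ g z) (hf : DifferentiableAt ℝ f z) :
    extDeriv (fun w => g w • f w) z = g z • extDeriv f z +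
      ContinuousAlternatingMap.alternatizeUncurryFin ((fderiv ℝ g z).smulRight (f z)) := by
  rw [extDeriv, fderiv_fun_smul hg hf, ContinuousAlternatingMap.alternatizeUncurryFin_add,
    ContinuousAlternatingMap.alternatizeUncurryFin_smul]
  rfl

end ExtDerivSmooth

section FormOps

variable {d : ℕ} {H : Type*} [TopologicalSpace H]
  {I : ModelWithCorners ℝ (EuclideanSpace ℝ (Fin d)) H}
  {M : Type*} [TopologicalSpace M] [ChartedSpace H M]
  {κ : EuclideanSpace ℝ (Fin d) → M} {U : Set (EuclideanSpace ℝ (Fin d))} {k : ℕ}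

lemma pull_add (ξ η : FormField I M k) (z : EuclideanSpace ℝ (Fin d)) :
    pull κ (ξ + η) z = pull κ ξ z + pull κ η z := rfl

lemma pull_const_smul (a : ℂ) (ξ : FormField I M k) (z : EuclideanSpace ℝ (Fin d)) :
    pull κ (a • ξ) z = a • pull κ ξ z := rfl

lemma pull_zero (z : EuclideanSpace ℝ (Fin d)) : pull κ (0 : FormField I M k) z = 0 := rfl

lemma IsParam.eq_of_pull_eq (hκ : IsParam I κ U) {z : EuclideanSpace ℝ (Fin d)} (hz : z ∈ U)
    {ξ η : FormField I M k} (h : pull κ ξ z = pull κ η z) : ξ (κ z) = η (κ z) := by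
  have : formAt ξ (κ z) = formAt η (κ z) := by
    ext v
    choose w hw using fun a => hκ.modelDeriv_surjective hz (v a)
    have := DFunLike.congr_fun h w
    simp only [pull, ContinuousAlternatingMap.compContinuousLinearMap_apply] at this
    rwa [show (modelDeriv I κ z) ∘ w = v from funext hw] at this
  exact this

variable [IsManifold I ∞ M]

lemma exists_chart_eq {x : M} (hx : x ∈ I.interior M) :
    ∃ z ∈ chartDom I x, (extChartAt I x).symm z = x :=
  ⟨extChartAt I x x, (mem_interior_iff_mem_chartDom (mem_extChartAt_source x)).mp hx,
    extChartAt_to_inv x⟩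

lemma eq_of_forall_pull_eq {ξ η : FormField I M k}
    (h : ∀ c, ∀ z ∈ chartDom I c, pull (extChartAt I c).symm ξ z = pull (extChartAt I c).symm η z)
    {x : M} (hx : x ∈ I.interior M) : ξ x = η x := by
  obtain ⟨z, hz, hzx⟩ := exists_chart_eq hx
  have := (isParam_chart (I := I) x).eq_of_pull_eq hz (h x z hz)
  rwa [hzx] at this

namespace FormField.SmoothOn

variable {ξ η : FormField I M k}

lemma congr (hξ : ξ.SmoothOn (I.interior M)) (h : ∀ x ∈ I.interior M, η x = ξ x) :
    η.SmoothOn (I.interior M) := by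
  rw [smoothOn_interior_iff] at hξ ⊢
  refine fun c => (hξ c).congr fun z hz => ?_
  have := h _ ((isParam_chart (I := I) c).mapsTo hz)
  rw [pull, pull, formAt, formAt, this]

lemma add (hξ : ξ.SmoothOn (I.interior M)) (hη : η.SmoothOn (I.interior M)) :
    (ξ + η).SmoothOn (I.interior M) := by
  rw [smoothOn_interior_iff] at hξ hη ⊢
  exact fun c => (hξ c).add (hη c)

lemma zero : (0 : FormField I M k).SmoothOn (I.interior M) := by
  rw [smoothOn_interior_iff]
  exact fun c => contDiffOn_const (c := (0 : EuclideanSpace ℝ (Fin d) [⋀^Fin k]→L[ℝ] ℂ))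

lemma smul_fun {a : M → ℂ} (ha : ContMDiffOn I 𝓘(ℝ, ℂ) ∞ a (I.interior M))
    (hξ : ξ.SmoothOn (I.interior M)) :
    FormField.SmoothOn (I := I) (M := M) (k := k) (fun x => a x • ξ x) (I.interior M) := by
  rw [smoothOn_interior_iff] at hξ ⊢
  intro c
  have h1 : ContDiffOn ℝ ∞ (a ∘ (extChartAt I c).symm) (chartDom I c) :=
    contMDiffOn_iff_contDiffOn.mp
      (ha.comp (isParam_chart (I := I) c).smooth (isParam_chart (I := I) c).mapsTo)
  exact h1.smul (hξ c)

lemma const_smul (a : ℂ) (hξ : ξ.SmoothOn (I.interior M)) : (a • ξ).SmoothOn (I.interior M) :=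
  hξ.smul_fun contMDiffOn_const

lemma extD (hξ : ξ.SmoothOn (I.interior M)) : ξ.extD.SmoothOn (I.interior M) := by
  rw [smoothOn_interior_iff]
  refine fun c => (ContDiffOn.extDeriv isOpen_interior (smoothOn_interior_iff.mp hξ c)).congr
    fun z hz => ?_
  exact (isParam_chart c).pull_extD hξ hz

lemma differentiableAt_pull (hκ : IsParam I κ U) (hξ : ξ.SmoothOn (I.interior M))
    {z : EuclideanSpace ℝ (Fin d)} (hz : z ∈ U) : DifferentiableAt ℝ (pull κ ξ) z :=
  ((hκ.contDiffOn_pull hξ).contDiffAt (hκ.isOpen.mem_nhds hz)).differentiableAt (by simp)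

lemma extD_extD (hξ : ξ.SmoothOn (I.interior M)) {x : M} (hx : x ∈ I.interior M) :
    ξ.extD.extD x = 0 := by
  refine eq_of_forall_pull_eq (η := 0) (fun c z hz => ?_) hx
  have hκ := isParam_chart (I := I) c
  rw [hκ.pull_extD hξ.extD hz, pull_zero]
  have h : extDeriv (pull (extChartAt I c).symm ξ.extD) z =
      extDeriv (extDeriv (pull (extChartAt I c).symm ξ)) z := by
    refine Filter.EventuallyEq.extDeriv_eq ?_
    filter_upwards [hκ.isOpen.mem_nhds hz] with w hw using hκ.pull_extD hξ hw
  rw [h]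
  exact extDeriv_extDeriv_apply ((smoothOn_interior_iff.mp hξ c).contDiffAt
    (isOpen_interior.mem_nhds hz)) two_le_infty

lemma extD_add (hξ : ξ.SmoothOn (I.interior M)) (hη : η.SmoothOn (I.interior M)) {x : M}
    (hx : x ∈ I.interior M) : (ξ + η).extD x = ξ.extD x + η.extD x := by
  refine eq_of_forall_pull_eq (η := ξ.extD + η.extD) (fun c z hz => ?_) hx
  have hκ := isParam_chart (I := I) c
  rw [hκ.pull_extD (hξ.add hη) hz, pull_add, hκ.pull_extD hξ hz, hκ.pull_extD hη hz]
  exact extDeriv_add (hξ.differentiableAt_pull hκ hz) (hη.differentiableAt_pull hκ hz)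

lemma extD_const_smul (a : ℂ) (hξ : ξ.SmoothOn (I.interior M)) {x : M}
    (hx : x ∈ I.interior M) : (a • ξ).extD x = a • ξ.extD x := by
  refine eq_of_forall_pull_eq (η := a • ξ.extD) (fun c z hz => ?_) hx
  have hκ := isParam_chart (I := I) c
  rw [hκ.pull_extD (hξ.const_smul a) hz, pull_const_smul, hκ.pull_extD hξ hz]
  exact extDeriv_const_smul' (hξ.differentiableAt_pull hκ hz) a

end FormField.SmoothOn

omit [IsManifold I ∞ M] in
lemma FormField.extD_congr {ξ η : FormField I M k} {W : Set M} (hW : IsOpen W)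
    (h : ∀ x ∈ W, ξ x = η x) {x : M} (hx : x ∈ W) : ξ.extD x = η.extD x := by
  have key : extDerivWithin (ξ.inChart x) (range I) (extChartAt I x x) =
      extDerivWithin (η.inChart x) (range I) (extChartAt I x x) := by
    refine Filter.EventuallyEq.extDerivWithin_eq ?_ ?_
    · have h1 : Filter.Tendsto (extChartAt I x).symm (nhdsWithin (extChartAt I x x) (range I))
          (nhds x) := by
        have := (contMDiffWithinAt_extChartAt_symm_range_self (I := I) (n := ∞) x).continuousWithinAt
        rw [ContinuousWithinAt, extChartAt_to_inv] at this
        exact this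
      filter_upwards [h1 (hW.mem_nhds hx)] with z hz
      rw [FormField.inChart, FormField.inChart, h _ hz]
    · rw [FormField.inChart, FormField.inChart, extChartAt_to_inv, h x hx]
  rw [FormField.extD, FormField.extD, key]

end FormOps

section Gram

variable {d : ℕ}

/-- The matrix of a bilinear form in the standard basis. -/
def bilinMatrix (b : EuclideanSpace ℝ (Fin d) →L[ℝ] EuclideanSpace ℝ (Fin d) →L[ℝ] ℝ) :
    Matrix (Fin d) (Fin d) ℝ :=
  Matrix.of fun i j => b (basisVec i) (basisVec j)

/-- The matrix of a linear map in the standard basis. -/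
def mapMatrix (A : EuclideanSpace ℝ (Fin d) →L[ℝ] EuclideanSpace ℝ (Fin d)) :
    Matrix (Fin d) (Fin d) ℝ :=
  Matrix.of fun p i => A (basisVec i) p

lemma eq_sum_basisVec (v : EuclideanSpace ℝ (Fin d)) : v = ∑ p, v p • basisVec p := by
  ext q
  simp [basisVec, Finset.sum_apply, Pi.single_apply]

lemma apply_basisVec (A : EuclideanSpace ℝ (Fin d) →L[ℝ] EuclideanSpace ℝ (Fin d)) (i : Fin d) :
    A (basisVec i) = ∑ p, mapMatrix A p i • basisVec p :=
  eq_sum_basisVec _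

lemma mapMatrix_comp (A B : EuclideanSpace ℝ (Fin d) →L[ℝ] EuclideanSpace ℝ (Fin d)) :
    mapMatrix (A.comp B) = mapMatrix A * mapMatrix B := by
  ext p i
  rw [Matrix.mul_apply, mapMatrix, Matrix.of_apply, ContinuousLinearMap.comp_apply,
    apply_basisVec B, map_sum]
  simp [mapMatrix, mul_comm]

lemma mapMatrix_id : mapMatrix (ContinuousLinearMap.id ℝ (EuclideanSpace ℝ (Fin d))) = 1 := by
  ext p i
  simp [mapMatrix, Matrix.one_apply, basisVec]

lemma det_mapMatrix (A : EuclideanSpace ℝ (Fin d) →L[ℝ] EuclideanSpace ℝ (Fin d)) :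
    (mapMatrix A).det = A.det := by
  have h : mapMatrix A = LinearMap.toMatrix (EuclideanSpace.basisFun (Fin d) ℝ).toBasis
      (EuclideanSpace.basisFun (Fin d) ℝ).toBasis A.toLinearMap := by
    ext p i
    simp [mapMatrix, LinearMap.toMatrix_apply]
  rw [h, LinearMap.det_toMatrix]

lemma bilinMatrix_comp (b : EuclideanSpace ℝ (Fin d) →L[ℝ] EuclideanSpace ℝ (Fin d) →L[ℝ] ℝ)
    (A : EuclideanSpace ℝ (Fin d) →L[ℝ] EuclideanSpace ℝ (Fin d)) :
    (Matrix.of fun i j => b (A (basisVec i)) (A (basisVec j))) =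
      (mapMatrix A).transpose * bilinMatrix b * mapMatrix A := by
  ext i j
  rw [Matrix.of_apply, apply_basisVec A i, apply_basisVec A j, Matrix.mul_apply]
  simp only [map_sum, map_smul, sum_apply, smul_apply,
    Matrix.mul_apply, Matrix.transpose_apply, bilinMatrix, Matrix.of_apply, smul_eq_mul,
    Finset.mul_sum, Finset.sum_mul]
  refine Finset.sum_congr rfl fun p _ => Finset.sum_congr rfl fun q _ => ?_
  ring

lemma bilinMatrix_posDef {b : EuclideanSpace ℝ (Fin d) →L[ℝ] EuclideanSpace ℝ (Fin d) →L[ℝ] ℝ}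
    (hs : ∀ v w, b v w = b w v) (hp : ∀ v, v ≠ 0 → 0 < b v v) : (bilinMatrix b).PosDef := by
  rw [Matrix.posDef_iff_dotProduct_mulVec]
  refine ⟨?_, fun x hx => ?_⟩
  · ext i j
    simp [bilinMatrix, hs (basisVec i) (basisVec j)]
  · have h := hp (WithLp.toLp 2 x) (fun h0 : WithLp.toLp 2 x = 0 => hx (by simpa using congrArg WithLp.ofLp h0))
    rw [eq_sum_basisVec (WithLp.toLp 2 x)] at h
    simp only [map_sum, map_smul, sum_apply, smul_apply,
      smul_eq_mul, Finset.mul_sum] at h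
    simp only [dotProduct, Matrix.mulVec, bilinMatrix, Matrix.of_apply, Finset.mul_sum, star_trivial]
    refine h.trans_eq ?_
    refine Finset.sum_congr rfl fun p _ => Finset.sum_congr rfl fun q _ => ?_
    rw [hs]; ring

lemma bilinMatrix_comp_posDef
    {b : EuclideanSpace ℝ (Fin d) →L[ℝ] EuclideanSpace ℝ (Fin d) →L[ℝ] ℝ}
    (hs : ∀ v w, b v w = b w v) (hp : ∀ v, v ≠ 0 → 0 < b v v)
    {A : EuclideanSpace ℝ (Fin d) →L[ℝ] EuclideanSpace ℝ (Fin d)} (hA : Function.Injective A) :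
    (Matrix.of fun i j => b (A (basisVec i)) (A (basisVec j))).PosDef :=
  bilinMatrix_posDef (b := b.bilinearComp A A) (fun v w => hs (A v) (A w))
    (fun v hv => hp (A v) fun h0 => hv (hA (h0.trans (map_zero A).symm)))

variable {H : Type*} [TopologicalSpace H]
  {I : ModelWithCorners ℝ (EuclideanSpace ℝ (Fin d)) H}
  {M : Type*} [TopologicalSpace M] [ChartedSpace H M] [IsManifold I ∞ M]

/-- The metric at a point, as a bilinear form on the model space. -/
def metricAt (h : SmoothMetric I M) (x : M) :
    EuclideanSpace ℝ (Fin d) →L[ℝ] EuclideanSpace ℝ (Fin d) →L[ℝ] ℝ :=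
  h.inner x

lemma metricAt_symm (h : SmoothMetric I M) (x : M) (v w : EuclideanSpace ℝ (Fin d)) :
    metricAt h x v w = metricAt h x w v := h.symm x v w

lemma metricAt_pos (h : SmoothMetric I M) (x : M) (v : EuclideanSpace ℝ (Fin d)) (hv : v ≠ 0) :
    0 < metricAt h x v v := h.pos x v hv

lemma gram_posDef (h : SmoothMetric I M) (x : M) : (gram h x).PosDef :=
  bilinMatrix_posDef (metricAt_symm h x) (metricAt_pos h x)

/-- The Gram matrix of the metric in the coordinates given by `κ`. -/
def gramAlong (h : SmoothMetric I M) (κ : EuclideanSpace ℝ (Fin d) → M)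
    (z : EuclideanSpace ℝ (Fin d)) : Matrix (Fin d) (Fin d) ℝ :=
  Matrix.of fun i j =>
    metricAt h (κ z) (modelDeriv I κ z (basisVec i)) (modelDeriv I κ z (basisVec j))

lemma gramAlong_eq (h : SmoothMetric I M) (κ : EuclideanSpace ℝ (Fin d) → M)
    (z : EuclideanSpace ℝ (Fin d)) :
    gramAlong h κ z = (mapMatrix (modelDeriv I κ z)).transpose * gram h (κ z) *
      mapMatrix (modelDeriv I κ z) :=
  bilinMatrix_comp _ _

variable {κ : EuclideanSpace ℝ (Fin d) → M} {U : Set (EuclideanSpace ℝ (Fin d))} {k : ℕ}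

namespace IsParam

omit [IsManifold I ∞ M] in
lemma isUnit_mapMatrix (hκ : IsParam I κ U) {z : EuclideanSpace ℝ (Fin d)} (hz : z ∈ U) :
    IsUnit (mapMatrix (modelDeriv I κ z)).det := by
  obtain ⟨L, hL⟩ := hκ.exists_deriv_inv hz
  have : mapMatrix L * mapMatrix (modelDeriv I κ z) = 1 := by
    rw [← mapMatrix_comp, hL, mapMatrix_id]
  exact Matrix.isUnit_det_of_left_inverse this

lemma gramAlong_posDef (hκ : IsParam I κ U) (h : SmoothMetric I M)
    {z : EuclideanSpace ℝ (Fin d)} (hz : z ∈ U) : (gramAlong h κ z).PosDef :=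
  bilinMatrix_comp_posDef (metricAt_symm h (κ z)) (metricAt_pos h (κ z))
    (hκ.modelDeriv_injective hz)

lemma fiberInner_eq (hκ : IsParam I κ U) (h : SmoothMetric I M)
    {z : EuclideanSpace ℝ (Fin d)} (hz : z ∈ U) (ξ η : FormField I M k) :
    fiberInner h k (κ z) (ξ (κ z)) (η (κ z)) =
      altInner (gramAlong h κ z)⁻¹ (pull κ ξ z) (pull κ η z) := by
  refine Eq.trans ?_ (altInner_comp (gramAlong h κ z)⁻¹ _ _ (apply_basisVec (modelDeriv I κ z))
    (formAt ξ (κ z)) (formAt η (κ z))).symm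
  rw [gramAlong_eq, Matrix.mul_inv_rev, Matrix.mul_inv_rev]
  set A := mapMatrix (modelDeriv I κ z)
  have hA : IsUnit A.det := hκ.isUnit_mapMatrix hz
  have hA' : IsUnit A.transpose.det := by rwa [Matrix.det_transpose]
  have : A * (A⁻¹ * ((gram h (κ z))⁻¹ * A.transpose⁻¹)) * A.transpose = (gram h (κ z))⁻¹ := by
    rw [← mul_assoc, Matrix.mul_nonsing_inv _ hA, one_mul, mul_assoc,
      Matrix.nonsing_inv_mul _ hA', mul_one]
  rw [this]
  rfl

end IsParam

lemma contDiffOn_metric_apply (h : SmoothMetric I M) {s : Set (EuclideanSpace ℝ (Fin d))}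
    (hs : UniqueDiffOn ℝ s)
    (hκ : ContMDiffOn 𝓘(ℝ, EuclideanSpace ℝ (Fin d)) I ∞ κ s) (v w : EuclideanSpace ℝ (Fin d)) :
    ContDiffOn ℝ ∞ (fun z => h.inner (κ z)
      (mfderivWithin 𝓘(ℝ, EuclideanSpace ℝ (Fin d)) I κ s z v)
      (mfderivWithin 𝓘(ℝ, EuclideanSpace ℝ (Fin d)) I κ s z w)) s := by
  have hsec : ∀ u : EuclideanSpace ℝ (Fin d),
      ContMDiffOn 𝓘(ℝ, EuclideanSpace ℝ (Fin d)) I.tangent ∞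
        (fun z => Bundle.TotalSpace.mk' (EuclideanSpace ℝ (Fin d)) (E := TangentSpace I) (κ z)
          (mfderivWithin 𝓘(ℝ, EuclideanSpace ℝ (Fin d)) I κ s z u)) s := by
    intro u
    have h1 := hκ.contMDiffOn_tangentMapWithin (m := ∞) (by simp) hs.uniqueMDiffOn
    have h2 : ContMDiffOn 𝓘(ℝ, EuclideanSpace ℝ (Fin d))
        𝓘(ℝ, EuclideanSpace ℝ (Fin d)).tangent ∞
        (fun z => (⟨z, u⟩ : TangentBundle 𝓘(ℝ, EuclideanSpace ℝ (Fin d))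
          (EuclideanSpace ℝ (Fin d)))) s :=
      contMDiffOn_vectorSpace_iff_contDiffOn.mpr contDiffOn_const
    exact h1.comp h2 fun z hz => hz
  have h3 : ContMDiffOn 𝓘(ℝ, EuclideanSpace ℝ (Fin d)) _ ∞
      (fun z => Bundle.TotalSpace.mk' (EuclideanSpace ℝ (Fin d) →L[ℝ] EuclideanSpace ℝ (Fin d) →L[ℝ] ℝ)
        (E := fun x : M => TangentSpace I x →L[ℝ] TangentSpace I x →L[ℝ] ℝ)
        (κ z) (h.inner (κ z))) s := h.contMDiff.comp_contMDiffOn hκ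
  have h4 := ContMDiffOn.clm_bundle_apply₂ (F₁ := EuclideanSpace ℝ (Fin d))
    (F₂ := EuclideanSpace ℝ (Fin d)) (F₃ := ℝ) (E₃ := Bundle.Trivial M ℝ) h3 (hsec v) (hsec w)
  intro z hz
  have h5 := h4 z hz
  simp only [Bundle.contMDiffWithinAt_totalSpace] at h5
  exact contMDiffWithinAt_iff_contDiffWithinAt.mp h5.2

lemma IsParam.contDiffOn_gramAlong (hκ : IsParam I κ U) (h : SmoothMetric I M) (i j : Fin d) :
    ContDiffOn ℝ ∞ (fun z => gramAlong h κ z i j) U := by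
  refine (contDiffOn_metric_apply h hκ.isOpen.uniqueDiffOn hκ.smooth
    (basisVec i) (basisVec j)).congr fun z hz => ?_
  rw [mfderivWithin_of_isOpen hκ.isOpen hz]
  rfl

lemma contDiffOn_gramInChart (h : SmoothMetric I M) (c : M) (i j : Fin d) :
    ContDiffOn ℝ ∞ (fun z => gramInChart h c z i j) (extChartAt I c).target := by
  refine (contDiffOn_metric_apply h (uniqueDiffOn_extChartAt_target c)
    (contMDiffOn_extChartAt_symm c) (basisVec i) (basisVec j)).congr fun z hz => ?_
  have : mfderivWithin 𝓘(ℝ, EuclideanSpace ℝ (Fin d)) I (extChartAt I c).symm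
      (extChartAt I c).target z =
      mfderivWithin 𝓘(ℝ, EuclideanSpace ℝ (Fin d)) I (extChartAt I c).symm (range I) z :=
    mfderivWithin_congr_set (nhdsWithin_eq_iff_eventuallyEq.mp
      (nhdsWithin_extChartAt_target_eq_of_mem hz))
  rw [this]
  rfl

omit [IsManifold I ∞ M] in
lemma modelDeriv_chart {c : M} {z : EuclideanSpace ℝ (Fin d)} (hz : z ∈ chartDom I c) :
    modelDeriv I (extChartAt I c).symm z =
      (mfderivWithin 𝓘(ℝ, EuclideanSpace ℝ (Fin d)) I (extChartAt I c).symm (range I) z :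
        EuclideanSpace ℝ (Fin d) →L[ℝ] TangentSpace I ((extChartAt I c).symm z)) := by
  rw [mfderivWithin_of_mem_nhds (range_mem_nhds_of_mem_chartDom hz)]
  rfl

lemma gramInChart_eq (h : SmoothMetric I M) {c : M} {z : EuclideanSpace ℝ (Fin d)}
    (hz : z ∈ chartDom I c) : gramInChart h c z = gramAlong h (extChartAt I c).symm z := by
  ext i j
  simp only [gramInChart, gramAlong, Matrix.of_apply, modelDeriv_chart hz]
  rfl

lemma IsParam.gramAlong_eq_chart (hκ : IsParam I κ U) (h : SmoothMetric I M)
    {z : EuclideanSpace ℝ (Fin d)} (hz : z ∈ U) {c : M} (hc : κ z ∈ (extChartAt I c).source) :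
    gramAlong h κ z = (mapMatrix (fderiv ℝ (extChartAt I c ∘ κ) z)).transpose *
      gramAlong h (extChartAt I c).symm ((extChartAt I c ∘ κ) z) *
      mapMatrix (fderiv ℝ (extChartAt I c ∘ κ) z) := by
  have hx : (extChartAt I c).symm ((extChartAt I c ∘ κ) z) = κ z := (extChartAt I c).left_inv hc
  rw [gramAlong_eq, gramAlong_eq, hκ.modelDeriv_eq_comp hz hc, hx, mapMatrix_comp,
    Matrix.transpose_mul]
  simp only [mul_assoc]

end Gram

section AltInnerSmooth

variable {F : Type*} [NormedAddCommGroup F] [NormedSpace ℝ F] {d k : ℕ} {n : WithTop ℕ∞} {s : Set F}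

lemma ContDiffOn.matrix_det {G : F → Matrix (Fin d) (Fin d) ℝ}
    (hG : ∀ i j, ContDiffOn ℝ n (fun z => G z i j) s) : ContDiffOn ℝ n (fun z => (G z).det) s := by
  simp only [Matrix.det_apply]
  refine ContDiffOn.sum fun σ _ => ContDiffOn.const_smul _ ?_
  exact contDiffOn_prod fun i _ => hG _ _

lemma ContDiffOn.matrix_inv {G : F → Matrix (Fin d) (Fin d) ℝ}
    (hG : ∀ i j, ContDiffOn ℝ n (fun z => G z i j) s) (hdet : ∀ z ∈ s, (G z).det ≠ 0) (i j : Fin d) :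
    ContDiffOn ℝ n (fun z => (G z)⁻¹ i j) s := by
  simp only [Matrix.inv_def, Ring.inverse_eq_inv', Matrix.smul_apply, smul_eq_mul]
  refine ((ContDiffOn.matrix_det hG).inv hdet).mul ?_
  simp only [Matrix.adjugate_apply]
  refine ContDiffOn.matrix_det fun p q => ?_
  by_cases h : p = j
  · subst h; simp only [Matrix.updateRow_self]; exact contDiffOn_const
  · simp only [Matrix.updateRow_ne h]; exact hG p q

lemma ContDiffOn.altInner {G : F → Matrix (Fin d) (Fin d) ℝ}
    {f g : F → EuclideanSpace ℝ (Fin d) [⋀^Fin k]→L[ℝ] ℂ}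
    (hG : ∀ i j, ContDiffOn ℝ n (fun z => G z i j) s) (hf : ContDiffOn ℝ n f s)
    (hg : ContDiffOn ℝ n g s) : ContDiffOn ℝ n (fun z => altInner (G z) (f z) (g z)) s := by
  simp only [_root_.altInner, tensorPair]
  refine contDiffOn_const.mul (ContDiffOn.sum fun i _ => ContDiffOn.sum fun j _ => ?_)
  refine ContDiffOn.mul (ContDiffOn.mul ?_ (contDiffOn_altMap_iff.mp hf i)) ?_
  · exact Complex.ofRealCLM.contDiff.comp_contDiffOn (f := fun z => ∏ a, G z (i a) (j a))
      (contDiffOn_prod fun a _ => hG _ _)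
  · exact Complex.conjCLE.contDiff.comp_contDiffOn (contDiffOn_altMap_iff.mp hg j)

end AltInnerSmooth

section Volume

variable {d : ℕ} {H : Type*} [TopologicalSpace H]
  {I : ModelWithCorners ℝ (EuclideanSpace ℝ (Fin d)) H}
  {M : Type*} [TopologicalSpace M] [ChartedSpace H M] [IsManifold I ∞ M]
  {κ : EuclideanSpace ℝ (Fin d) → M} {U : Set (EuclideanSpace ℝ (Fin d))} {k : ℕ}

lemma isOpen_interior_manifold : IsOpen (I.interior M) := I.isOpen_interior (n := ∞) (by simp)

namespace IsParam

omit [IsManifold I ∞ M] in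
lemma mono (hκ : IsParam I κ U) {V : Set (EuclideanSpace ℝ (Fin d))} (hV : IsOpen V)
    (h : V ⊆ U) : IsParam I κ V where
  isOpen := hV
  smooth := hκ.smooth.mono h
  mapsTo := hκ.mapsTo.mono_left h
  exists_inv := by
    obtain ⟨lam, hl⟩ := hκ.exists_inv
    exact ⟨lam, fun z hz => hl z (h hz)⟩

lemma isUnit_fderiv_chart (hκ : IsParam I κ U) {z : EuclideanSpace ℝ (Fin d)} (hz : z ∈ U) {c : M}
    (hc : κ z ∈ (extChartAt I c).source) :
    IsUnit (mapMatrix (fderiv ℝ (extChartAt I c ∘ κ) z)).det := by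
  have h := hκ.isUnit_mapMatrix hz
  rw [hκ.modelDeriv_eq_comp hz hc, mapMatrix_comp, Matrix.det_mul] at h
  exact isUnit_of_mul_isUnit_right h

lemma map_nhds_eq (hκ : IsParam I κ U) {z : EuclideanSpace ℝ (Fin d)} (hz : z ∈ U) :
    Filter.map κ (nhds z) = nhds (κ z) := by
  set c := κ z with hc
  have hcs : κ z ∈ (extChartAt I c).source := mem_extChartAt_source c
  have hT := (hκ.contDiffAt_chart hz hcs).hasStrictFDerivAt (by simp)
  have hu := hκ.isUnit_fderiv_chart hz hcs
  rw [det_mapMatrix] at hu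
  have h1 : Filter.map (extChartAt I c ∘ κ) (nhds z) = nhds ((extChartAt I c ∘ κ) z) :=
    HasStrictFDerivAt.map_nhds_eq_of_equiv
      (f' := ContinuousLinearMap.toContinuousLinearEquivOfDetNeZero _ hu.ne_zero) hT
  have h2 : (extChartAt I c).symm ∘ (extChartAt I c ∘ κ) =ᶠ[nhds z] κ := by
    filter_upwards [hκ.eventually_source hz hcs] with w hw
    exact (extChartAt I c).left_inv hw.2
  rw [← Filter.map_congr h2, ← Filter.map_map, h1, Function.comp_apply, ← hc,
    ← map_extChartAt_symm_nhdsWithin_range (I := I) c, nhdsWithin_eq_nhds.mpr]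
  exact range_mem_nhds_of_mem_chartDom (hκ.chart_mem hz hcs)

lemma isOpen_image (hκ : IsParam I κ U) : IsOpen (κ '' U) := by
  rw [isOpen_iff_mem_nhds]
  rintro _ ⟨z, hz, rfl⟩
  rw [← hκ.map_nhds_eq hz]
  exact Filter.image_mem_map (hκ.isOpen.mem_nhds hz)

lemma continuousAt_of_comp (hκ : IsParam I κ U) {z : EuclideanSpace ℝ (Fin d)} (hz : z ∈ U)
    {Z : Type*} [TopologicalSpace Z] {f : M → Z} (h : ContinuousAt (f ∘ κ) z) :
    ContinuousAt f (κ z) := by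
  rw [ContinuousAt, ← hκ.map_nhds_eq hz]
  exact h

lemma contDiffOn_inv_gramAlong (hκ : IsParam I κ U) (h : SmoothMetric I M) (i j : Fin d) :
    ContDiffOn ℝ ∞ (fun z => (gramAlong h κ z)⁻¹ i j) U :=
  ContDiffOn.matrix_inv (hκ.contDiffOn_gramAlong h) (fun _ hz => (hκ.gramAlong_posDef h hz).det_pos.ne') i j

lemma contDiffOn_sqrt_det (hκ : IsParam I κ U) (h : SmoothMetric I M) :
    ContDiffOn ℝ ∞ (fun z => Real.sqrt (gramAlong h κ z).det) U :=
  (ContDiffOn.matrix_det (hκ.contDiffOn_gramAlong h)).sqrt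
    fun _ hz => (hκ.gramAlong_posDef h hz).det_pos.ne'

lemma contDiffOn_fiberInner (hκ : IsParam I κ U) (h : SmoothMetric I M) {ξ η : FormField I M k}
    (hξ : ξ.SmoothOn (I.interior M)) (hη : η.SmoothOn (I.interior M)) :
    ContDiffOn ℝ ∞ (fun z => fiberInner h k (κ z) (ξ (κ z)) (η (κ z))) U :=
  (ContDiffOn.altInner (hκ.contDiffOn_inv_gramAlong h) (hκ.contDiffOn_pull hξ)
    (hκ.contDiffOn_pull hη)).congr fun _ hz => hκ.fiberInner_eq h hz ξ η

end IsParam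

lemma continuousOn_fiberInner (h : SmoothMetric I M) {ξ η : FormField I M k}
    (hξ : ξ.SmoothOn (I.interior M)) (hη : η.SmoothOn (I.interior M)) :
    ContinuousOn (fun x => fiberInner h k x (ξ x) (η x)) (I.interior M) := by
  intro x hx
  obtain ⟨z, hz, hzx⟩ := exists_chart_eq hx
  have h1 := (isParam_chart (I := I) x).continuousAt_of_comp hz
    (f := fun x => fiberInner h k x (ξ x) (η x))
    (((isParam_chart (I := I) x).contDiffOn_fiberInner h hξ hη).continuousOn.continuousAt
      (isOpen_interior.mem_nhds hz))
  rw [hzx] at h1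
  exact h1.continuousWithinAt

variable [MeasurableSpace M] [BorelSpace M]

/-- The volume measure on the image of a parametrisation. -/
def paramMeasure (h : SmoothMetric I M) (κ : EuclideanSpace ℝ (Fin d) → M)
    (U : Set (EuclideanSpace ℝ (Fin d))) : Measure M :=
  Measure.map κ ((volume.restrict U).withDensity
    fun z => ENNReal.ofReal (Real.sqrt (gramAlong h κ z).det))

omit [IsManifold I ∞ M] in
lemma measurableSet_inter_preimage_of_continuousOn {f : EuclideanSpace ℝ (Fin d) → M}
    {S : Set (EuclideanSpace ℝ (Fin d))} (hS : MeasurableSet S) (hf : ContinuousOn f S) {A : Set M}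
    (hA : MeasurableSet A) : MeasurableSet (S ∩ f ⁻¹' A) := by
  have h1 := MeasurableSet.subtype_image hS
    ((continuousOn_iff_continuous_domRestrict.mp hf).measurable hA)
  convert h1 using 1
  ext z
  simp [and_comm]

lemma map_withDensity_apply {f : EuclideanSpace ℝ (Fin d) → M}
    {S : Set (EuclideanSpace ℝ (Fin d))} (hS : MeasurableSet S) (hf : ContinuousOn f S) {A : Set M}
    (hA : MeasurableSet A) (ρ : EuclideanSpace ℝ (Fin d) → ENNReal) :
    Measure.map f ((volume.restrict S).withDensity ρ) A = ∫⁻ z in S ∩ f ⁻¹' A, ρ z := by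
  have hm : AEMeasurable f (volume.restrict S) := hf.aemeasurable hS
  rw [Measure.map_apply_of_aemeasurable (hm.mono_ac (withDensity_absolutelyContinuous _ _)) hA,
    withDensity_apply₀ _ (hm.nullMeasurableSet_preimage hA),
    Measure.restrict_restrict₀ (hm.nullMeasurableSet_preimage hA), inter_comm]

lemma IsParam.measure_apply (hκ : IsParam I κ U) (h : SmoothMetric I M) {A : Set M}
    (hA : MeasurableSet A) : paramMeasure h κ U A =
      ∫⁻ z in U ∩ κ ⁻¹' A, ENNReal.ofReal (Real.sqrt (gramAlong h κ z).det) :=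
  map_withDensity_apply hκ.isOpen.measurableSet hκ.smooth.continuousOn hA _

/-- The volume measures of a parametrisation and of a chart agree on the overlap. -/
lemma IsParam.measure_eq_chart (hκ : IsParam I κ U) (h : SmoothMetric I M) {c : M} {A : Set M}
    (hA : MeasurableSet A) (hAU : A ⊆ κ '' U) (hAc : A ⊆ (extChartAt I c).source) :
    paramMeasure h κ U A = paramMeasure h (extChartAt I c).symm (chartDom I c) A := by
  rw [hκ.measure_apply h hA, (isParam_chart (I := I) c).measure_apply h hA]
  set S := U ∩ κ ⁻¹' A with hS
  have hSm : MeasurableSet S := measurableSet_inter_preimage_of_continuousOn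
    hκ.isOpen.measurableSet hκ.smooth.continuousOn hA
  set T := extChartAt I c ∘ κ with hT
  have himg : chartDom I c ∩ (extChartAt I c).symm ⁻¹' A = T '' S := by
    ext w
    constructor
    · rintro ⟨hw, hwA⟩
      obtain ⟨z, hz, hzw⟩ := hAU hwA
      refine ⟨z, ⟨hz, ?_⟩, ?_⟩
      · rw [mem_preimage, hzw]; exact hwA
      · rw [hT, Function.comp_apply, hzw, (extChartAt I c).right_inv (chartDom_subset c hw)]
    · rintro ⟨z, hz, rfl⟩
      refine ⟨hκ.chart_mem hz.1 (hAc hz.2), ?_⟩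
      rw [mem_preimage, hT, Function.comp_apply, (extChartAt I c).left_inv (hAc hz.2)]
      exact hz.2
  have hinj : InjOn T S := by
    intro z hz w hw hzw
    exact hκ.injOn hz.1 hw.1 ((extChartAt I c).injOn (hAc hz.2) (hAc hw.2) hzw)
  rw [himg, lintegral_image_eq_lintegral_abs_det_fderiv_mul volume hSm (f' := fderiv ℝ T)
    (fun z hz => ((hκ.contDiffAt_chart hz.1 (hAc hz.2)).differentiableAt
      (by simp)).hasFDerivAt.hasFDerivWithinAt) hinj]
  refine setLIntegral_congr_fun hSm fun z hz => ?_
  rw [← ENNReal.ofReal_mul (abs_nonneg _), hκ.gramAlong_eq_chart h hz.1 (hAc hz.2),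
    Matrix.det_mul, Matrix.det_mul, Matrix.det_transpose, ← det_mapMatrix]
  congr 1
  rw [show ∀ a b : ℝ, a * b * a = a ^ 2 * b by intros; ring, Real.sqrt_mul (sq_nonneg _),
    Real.sqrt_sq_eq_abs]

/-- The measure given by a chart in the definition of the Riemannian volume. -/
def chartMeasure (h : SmoothMetric I M) (c : M) : Measure M :=
  Measure.map (extChartAt I c).symm
    ((volume.restrict (extChartAt I c).target).withDensity
      fun z => ENNReal.ofReal (Real.sqrt (gramInChart h c z).det))

omit [BorelSpace M] in
lemma riemannianVolume_eq (h : SmoothMetric I M) : riemannianVolume h = ⨆ c, chartMeasure h c := rfl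

omit [IsManifold I ∞ M] [MeasurableSpace M] [BorelSpace M] in
lemma measurableSet_extChartAt_target (c : M) : MeasurableSet (extChartAt I c).target := by
  rw [extChartAt_target]
  exact (I.continuous_symm.isOpen_preimage _ (chartAt H c).open_target).measurableSet.inter
    I.isClosed_range.measurableSet

lemma chartMeasure_apply (h : SmoothMetric I M) (c : M) {A : Set M} (hA : MeasurableSet A)
    (hAi : A ⊆ I.interior M) :
    chartMeasure h c A = paramMeasure h (extChartAt I c).symm (chartDom I c) A := by
  rw [(isParam_chart (I := I) c).measure_apply h hA, chartMeasure,
    map_withDensity_apply (measurableSet_extChartAt_target c) (continuousOn_extChartAt_symm c) hA]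
  have : (extChartAt I c).target ∩ (extChartAt I c).symm ⁻¹' A =
      chartDom I c ∩ (extChartAt I c).symm ⁻¹' A := by
    rw [← chartDom_eq c]
    ext z
    exact ⟨fun hz => ⟨⟨hz.1, hAi hz.2⟩, hz.2⟩, fun hz => ⟨hz.1.1, hz.2⟩⟩
  rw [this]
  refine setLIntegral_congr_fun (measurableSet_inter_preimage_of_continuousOn
    isOpen_interior.measurableSet (isParam_chart (I := I) c).smooth.continuousOn hA) fun z hz => ?_
  simp only [gramInChart_eq h hz.1]

lemma chartMeasure_compl_source (h : SmoothMetric I M) (c : M) :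
    chartMeasure h c (extChartAt I c).sourceᶜ = 0 := by
  rw [chartMeasure, map_withDensity_apply (measurableSet_extChartAt_target c)
    (continuousOn_extChartAt_symm c) (isOpen_extChartAt_source c).measurableSet.compl]
  have : (extChartAt I c).target ∩ (extChartAt I c).symm ⁻¹' (extChartAt I c).sourceᶜ = ∅ := by
    ext z
    simp only [mem_inter_iff, mem_preimage, mem_compl_iff, mem_empty_iff_false, iff_false, not_and,
      not_not]
    exact fun hz => (extChartAt I c).map_target hz
  rw [this]; simp

lemma riemannianVolume_eq_chart (h : SmoothMetric I M) {c : M} {A : Set M} (hA : MeasurableSet A)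
    (hAi : A ⊆ I.interior M) (hAc : A ⊆ (extChartAt I c).source) :
    riemannianVolume h A = paramMeasure h (extChartAt I c).symm (chartDom I c) A := by
  refine le_antisymm ?_ ?_
  · set ν : Measure M := paramMeasure h (extChartAt I c).symm (chartDom I c) +
      (⊤ : ENNReal) • (Measure.count.restrict Aᶜ) with hν
    have hle : riemannianVolume h ≤ ν := by
      rw [riemannianVolume_eq]
      refine iSup_le fun c' => Measure.le_iff.mpr fun B hB => ?_
      by_cases hBA : B ⊆ A
      · have h1 : chartMeasure h c' B = chartMeasure h c' (B ∩ (extChartAt I c').source) := by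
          rw [← measure_inter_add_sdiff B (isOpen_extChartAt_source (I := I) c').measurableSet,
            measure_mono_null (s := B \ (extChartAt I c').source) (fun x hx => hx.2)
              (chartMeasure_compl_source h c'), add_zero]
        have hB' : MeasurableSet (B ∩ (extChartAt I c').source) :=
          hB.inter (isOpen_extChartAt_source (I := I) c').measurableSet
        have hBi : B ∩ (extChartAt I c').source ⊆ I.interior M :=
          inter_subset_left.trans (hBA.trans hAi)
        rw [h1, chartMeasure_apply h c' hB' hBi,
          (isParam_chart (I := I) c').measure_eq_chart h (c := c) hB' (fun x hx =>
            ⟨extChartAt I c' x, (mem_interior_iff_mem_chartDom hx.2).mp (hBi hx),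
              (extChartAt I c').left_inv hx.2⟩) (inter_subset_left.trans (hBA.trans hAc))]
        refine (measure_mono inter_subset_left).trans ?_
        rw [hν, Measure.add_apply]
        exact le_self_add
      · obtain ⟨x, hxB, hxA⟩ := not_subset.mp hBA
        have h1 : Measure.count.restrict Aᶜ B ≠ 0 := by
          rw [Measure.restrict_apply hB]
          intro h0
          have h2 := Measure.le_count_apply (s := B ∩ Aᶜ)
          rw [h0] at h2
          have h3 := (ENNReal.le_tsum (f := fun _ : ↥(B ∩ Aᶜ) => (1 : ENNReal))
            ⟨x, hxB, hxA⟩).trans h2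
          simp at h3
        rw [hν, Measure.add_apply, Measure.smul_apply, smul_eq_mul, ENNReal.top_mul h1, add_top]
        exact le_top
    refine (Measure.le_iff.mp hle A hA).trans ?_
    rw [hν, Measure.add_apply, Measure.smul_apply, Measure.restrict_apply hA]
    simp
  · rw [← chartMeasure_apply h c hA hAi, riemannianVolume_eq]
    exact Measure.le_iff.mp (le_iSup (chartMeasure h) c) A hA

/-- On the image of a parametrisation, the Riemannian volume is given by the Gram determinant. -/
lemma IsParam.restrict_riemannianVolume [CompactSpace M] (hκ : IsParam I κ U) (h : SmoothMetric I M) :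
    (riemannianVolume h).restrict (κ '' U) = paramMeasure h κ U := by
  obtain ⟨t, ht⟩ := isCompact_univ.elim_nhds_subcover (fun c : M => (extChartAt I c).source)
    fun c _ => extChartAt_source_mem_nhds c
  have hcov : ⋃ c : t, (extChartAt I (c : M)).source = univ := by
    refine eq_univ_of_univ_subset (ht.2.trans ?_)
    intro x hx
    simp only [mem_iUnion] at hx ⊢
    obtain ⟨c, hc, hx⟩ := hx
    exact ⟨⟨c, hc⟩, hx⟩
  have key := (Measure.restrict_iUnion_congr (μ := (riemannianVolume h).restrict (κ '' U))
    (ν := paramMeasure h κ U) (s := fun c : t => (extChartAt I (c : M)).source)).mpr fun c => by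
      ext A hA
      have hsm : MeasurableSet (extChartAt I (c : M)).source :=
        (isOpen_extChartAt_source (c : M)).measurableSet
      have hAm := hA.inter hsm
      rw [Measure.restrict_apply hA, Measure.restrict_apply hA, Measure.restrict_apply hAm]
      have hB : MeasurableSet (A ∩ (extChartAt I (c : M)).source ∩ κ '' U) :=
        hAm.inter hκ.isOpen_image.measurableSet
      rw [riemannianVolume_eq_chart h (c := c) hB (by
          rintro _ ⟨_, z, hz, rfl⟩; exact hκ.mapsTo hz) (fun x hx => hx.1.2),
        ← hκ.measure_eq_chart h (c := c) hB inter_subset_right (fun x hx => hx.1.2),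
        hκ.measure_apply h hB, hκ.measure_apply h hAm]
      congr 2
      ext z
      constructor
      · exact fun hz => ⟨hz.1, hz.2.1⟩
      · exact fun hz => ⟨hz.1, hz.2, z, hz.1, rfl⟩
  rwa [hcov, Measure.restrict_univ, Measure.restrict_univ] at key

section Integrals

variable [CompactSpace M]

omit [MeasurableSpace M] [BorelSpace M] [CompactSpace M] in
lemma IsParam.aemeasurable_density (hκ : IsParam I κ U) (h : SmoothMetric I M) :
    AEMeasurable (fun z => ENNReal.ofReal (Real.sqrt (gramAlong h κ z).det)) (volume.restrict U) :=
  ((hκ.contDiffOn_sqrt_det h).continuousOn.aemeasurable hκ.isOpen.measurableSet).ennreal_ofReal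

lemma IsParam.setLIntegral_eq (hκ : IsParam I κ U) (h : SmoothMetric I M) {f : M → ENNReal}
    (hf : ContinuousOn f (κ '' U)) :
    ∫⁻ x in κ '' U, f x ∂(riemannianVolume h) =
      ∫⁻ z in U, ENNReal.ofReal (Real.sqrt (gramAlong h κ z).det) * f (κ z) := by
  have hm := hκ.smooth.continuousOn.aemeasurable (μ := volume) hκ.isOpen.measurableSet
  have hfm : AEMeasurable f ((riemannianVolume h).restrict (κ '' U)) :=
    hf.aemeasurable hκ.isOpen_image.measurableSet
  rw [hκ.restrict_riemannianVolume] at hfm ⊢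
  rw [paramMeasure, lintegral_map' hfm (hm.mono_ac (withDensity_absolutelyContinuous _ _)),
    lintegral_withDensity_eq_lintegral_mul₀ (hκ.aemeasurable_density h)]
  · rfl
  · exact (hf.comp hκ.smooth.continuousOn (mapsTo_image κ U)).aemeasurable hκ.isOpen.measurableSet

lemma IsParam.setIntegral_eq (hκ : IsParam I κ U) (h : SmoothMetric I M) {f : M → ℂ}
    (hf : ContinuousOn f (κ '' U)) :
    ∫ x in κ '' U, f x ∂(riemannianVolume h) =
      ∫ z in U, (Real.sqrt (gramAlong h κ z).det : ℂ) * f (κ z) := by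
  have hm := hκ.smooth.continuousOn.aemeasurable (μ := volume) hκ.isOpen.measurableSet
  have hfm : AEStronglyMeasurable f ((riemannianVolume h).restrict (κ '' U)) :=
    hf.aestronglyMeasurable hκ.isOpen_image.measurableSet
  rw [hκ.restrict_riemannianVolume] at hfm ⊢
  rw [paramMeasure, integral_map (hm.mono_ac (withDensity_absolutelyContinuous _ _)) hfm,
    integral_withDensity_eq_integral_toReal_smul₀ (hκ.aemeasurable_density h)
      (Filter.Eventually.of_forall fun _ => ENNReal.ofReal_lt_top)]
  refine integral_congr_ae (Filter.Eventually.of_forall fun z => ?_)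
  simp only [ENNReal.toReal_ofReal (Real.sqrt_nonneg _), Complex.real_smul]

/-- A continuous function on the interior whose integral with respect to the Riemannian volume
vanishes is zero. -/
lemma eq_zero_of_lintegral_eq_zero (h : SmoothMetric I M) {f : M → ENNReal}
    (hf : ContinuousOn f (I.interior M)) (h0 : ∫⁻ x in I.interior M, f x ∂(riemannianVolume h) = 0)
    {x : M} (hx : x ∈ I.interior M) : f x = 0 := by
  obtain ⟨z, hz, hzx⟩ := exists_chart_eq hx
  have hκ := isParam_chart (I := I) x
  have h1 : ∫⁻ x in (extChartAt I x).symm '' (chartDom I x), f x ∂(riemannianVolume h) = 0 :=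
    le_antisymm ((lintegral_mono_set hκ.mapsTo.image_subset).trans h0.le) zero_le
  have hfc := hf.mono hκ.mapsTo.image_subset
  have hfκ : ContinuousOn (fun z => f ((extChartAt I x).symm z)) (chartDom I x) :=
    hfc.comp hκ.smooth.continuousOn (mapsTo_image _ _)
  have hae : AEMeasurable (fun z => ENNReal.ofReal (Real.sqrt (gramAlong h (extChartAt I x).symm z).det)
      * f ((extChartAt I x).symm z)) (volume.restrict (chartDom I x)) :=
    (hκ.aemeasurable_density h).mul (hfκ.aemeasurable hκ.isOpen.measurableSet)
  rw [hκ.setLIntegral_eq h hfc, lintegral_eq_zero_iff' hae] at h1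
  have h2 : (fun z => f ((extChartAt I x).symm z)) =ᵐ[volume.restrict (chartDom I x)] 0 := by
    filter_upwards [h1, ae_restrict_mem hκ.isOpen.measurableSet] with w hw hwU
    have : ENNReal.ofReal (Real.sqrt (gramAlong h (extChartAt I x).symm w).det) ≠ 0 := by
      rw [Ne, ENNReal.ofReal_eq_zero, not_le]
      exact Real.sqrt_pos.mpr (hκ.gramAlong_posDef h hwU).det_pos
    exact (mul_eq_zero.mp hw).resolve_left this
  have h3 := Measure.eqOn_open_of_ae_eq h2 hκ.isOpen hfκ continuousOn_const hz
  simp only [hzx] at h3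
  exact h3

/-- A function continuous at interior points is locally integrable there. -/
lemma exists_nhds_setLIntegral_lt_top (h : SmoothMetric I M) {f : M → ENNReal}
    (hf : ContinuousOn f (I.interior M)) (hft : ∀ x ∈ I.interior M, f x ≠ ⊤)
    {x : M} (hx : x ∈ I.interior M) :
    ∃ W ∈ nhds x, ∫⁻ x in W, f x ∂(riemannianVolume h) < ⊤ := by
  obtain ⟨z, hz, hzx⟩ := exists_chart_eq hx
  have hκ := isParam_chart (I := I) x
  obtain ⟨r, hr, hrU⟩ := Metric.nhds_basis_closedBall.mem_iff.mp (hκ.isOpen.mem_nhds hz)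
  set κ := (extChartAt I x).symm
  have hκ' := hκ.mono Metric.isOpen_ball (Metric.ball_subset_closedBall.trans hrU)
  refine ⟨κ '' Metric.ball z r, ?_, ?_⟩
  · rw [← hzx, ← hκ.map_nhds_eq hz]
    exact Filter.image_mem_map (Metric.ball_mem_nhds z hr)
  · rw [hκ'.setLIntegral_eq h (hf.mono hκ'.mapsTo.image_subset)]
    set g : EuclideanSpace ℝ (Fin d) → ENNReal := fun w =>
      ENNReal.ofReal (Real.sqrt (gramAlong h κ w).det) * f (κ w)
    have hg : ContinuousOn g (Metric.closedBall z r) := by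
      refine ContinuousOn.mono ?_ hrU
      intro w hw
      refine ENNReal.Tendsto.mul ?_ (Or.inr (hft _ (hκ.mapsTo hw))) ?_ (Or.inr ENNReal.ofReal_ne_top)
      · exact (ENNReal.continuous_ofReal.comp_continuousOn (hκ.contDiffOn_sqrt_det h).continuousOn) w hw
      · exact (hf.comp hκ.smooth.continuousOn hκ.mapsTo) w hw
    obtain ⟨w, hw, hmax⟩ := (isCompact_closedBall z r).exists_isMaxOn
      ⟨z, Metric.mem_closedBall_self hr.le⟩ hg
    have hgw : g w ≠ ⊤ := ENNReal.mul_ne_top ENNReal.ofReal_ne_top (hft _ (hκ.mapsTo (hrU hw)))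
    refine (setLIntegral_mono_ae' (g := fun _ => g w) Metric.isOpen_ball.measurableSet
      (Filter.Eventually.of_forall fun y hy =>
        hmax (Metric.ball_subset_closedBall hy))).trans_lt ?_
    rw [setLIntegral_const]
    exact ENNReal.mul_lt_top hgw.lt_top measure_ball_lt_top

end Integrals

end Volume

section Mixed

variable {d : ℕ} {H : Type*} [TopologicalSpace H]
  {I : ModelWithCorners ℝ (EuclideanSpace ℝ (Fin d)) H}
  {M : Type*} [TopologicalSpace M] [ChartedSpace H M] [IsManifold I ∞ M]

/-- The fibre inner product of two forms of mixed degree at a point. -/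
def mixedInner (h : SmoothMetric I M) (x : M) (ξ η : MixedForm I M) : ℂ :=
  ∑ k ∈ Finset.range (d + 1), fiberInner h k x (ξ k x) (η k x)

variable {h : SmoothMetric I M} {x : M} {ξ η θ ζ : MixedForm I M}

lemma fiberInner_eq_altInner (h : SmoothMetric I M) (x : M) {k : ℕ} (ξ η : FormField I M k) :
    fiberInner h k x (ξ x) (η x) = altInner (gram h x)⁻¹ (formAt ξ x) (formAt η x) := rfl

lemma gram_inv_isSymm (h : SmoothMetric I M) (x : M) : ((gram h x)⁻¹).IsSymm := by
  have h1 : (gram h x).IsSymm := by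
    ext i j
    exact metricAt_symm h x _ _
  rw [Matrix.IsSymm, Matrix.transpose_nonsing_inv, h1]

lemma conj_mixedInner (h : SmoothMetric I M) (x : M) (ξ η : MixedForm I M) :
    (starRingEnd ℂ) (mixedInner h x ξ η) = mixedInner h x η ξ := by
  simp only [mixedInner, map_sum, fiberInner_eq_altInner]
  exact Finset.sum_congr rfl fun k _ => altInner_conj_symm (gram_inv_isSymm h x) _ _

lemma mixedInner_left (ζ : MixedForm I M) {a b : ℂ} (hξ : ∀ k, ξ k x = a • η k x + b • θ k x) :
    mixedInner h x ξ ζ = a * mixedInner h x η ζ + b * mixedInner h x θ ζ := by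
  simp only [mixedInner, Finset.mul_sum, ← Finset.sum_add_distrib, fiberInner_eq_altInner]
  refine Finset.sum_congr rfl fun k _ => ?_
  have : formAt (ξ k) x = a • formAt (η k) x + b • formAt (θ k) x := hξ k
  rw [this, altInner_add_left, altInner_smul_left, altInner_smul_left]

lemma mixedInner_right (ζ : MixedForm I M) {a b : ℂ} (hξ : ∀ k, ξ k x = a • η k x + b • θ k x) :
    mixedInner h x ζ ξ = (starRingEnd ℂ) a * mixedInner h x ζ η +
      (starRingEnd ℂ) b * mixedInner h x ζ θ := by
  rw [← conj_mixedInner, mixedInner_left ζ hξ, map_add, map_mul, map_mul, conj_mixedInner,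
    conj_mixedInner]

lemma mixedInner_smul_left (ζ : MixedForm I M) {a : ℂ} (hξ : ∀ k, ξ k x = a • η k x) :
    mixedInner h x ξ ζ = a * mixedInner h x η ζ := by
  rw [mixedInner_left (η := η) (θ := η) (a := a) (b := 0) ζ fun k => (hξ k).trans
    (by
      have : a • formAt (η k) x = a • formAt (η k) x + (0 : ℂ) • formAt (η k) x := by
        ext v; simp
      exact this),
    zero_mul, add_zero]

lemma mixedInner_smul_right (ζ : MixedForm I M) {a : ℂ} (hξ : ∀ k, ξ k x = a • η k x) :
    mixedInner h x ζ ξ = (starRingEnd ℂ) a * mixedInner h x ζ η := by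
  rw [← conj_mixedInner, mixedInner_smul_left ζ hξ, map_mul, conj_mixedInner]

lemma mixedInner_self (h : SmoothMetric I M) (x : M) (ξ : MixedForm I M) :
    mixedInner h x ξ ξ = (fiberNormSq h ξ x : ℂ) := by
  have h1 : fiberNormSq h ξ x = (mixedInner h x ξ ξ).re := by
    rw [fiberNormSq, mixedInner, Complex.re_sum]
  rw [h1]
  exact (Complex.conj_eq_iff_re.mp (conj_mixedInner h x ξ ξ)).symm

lemma re_fiberInner_self_nonneg (h : SmoothMetric I M) (x : M) {k : ℕ} (ξ : FormField I M k) :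
    0 ≤ (fiberInner h k x (ξ x) (ξ x)).re :=
  altInner_self_real (gram_posDef h x) _

lemma fiberNormSq_nonneg (h : SmoothMetric I M) (ξ : MixedForm I M) (x : M) :
    0 ≤ fiberNormSq h ξ x :=
  Finset.sum_nonneg fun k _ => re_fiberInner_self_nonneg h x (ξ k)

lemma fiberNormSq_smul {a : ℂ} (hξ : ∀ k, ξ k x = a • η k x) :
    fiberNormSq h ξ x = ‖a‖ ^ 2 * fiberNormSq h η x := by
  have h1 := mixedInner_self h x ξ
  rw [mixedInner_smul_left ξ hξ, mixedInner_smul_right η hξ, mixedInner_self, ← mul_assoc,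
    Complex.mul_conj, Complex.normSq_eq_norm_sq] at h1
  exact_mod_cast h1.symm

lemma fiberNormSq_lin {a b : ℂ} (hξ : ∀ k, ξ k x = a • η k x + b • θ k x) :
    fiberNormSq h ξ x = ‖a‖ ^ 2 * fiberNormSq h η x + ‖b‖ ^ 2 * fiberNormSq h θ x +
      2 * (a * (starRingEnd ℂ) b * mixedInner h x η θ).re := by
  have h1 := mixedInner_self h x ξ
  rw [mixedInner_left ξ hξ, mixedInner_right η hξ, mixedInner_right θ hξ, mixedInner_self,
    mixedInner_self, ← conj_mixedInner h x η θ] at h1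
  have h2 := congrArg Complex.re h1
  rw [Complex.ofReal_re] at h2
  rw [← h2, ← Complex.normSq_eq_norm_sq, ← Complex.normSq_eq_norm_sq]
  simp only [Complex.add_re, Complex.mul_re, Complex.conj_re, Complex.conj_im, Complex.ofReal_re,
    Complex.ofReal_im, Complex.add_im, Complex.mul_im, Complex.normSq_apply]
  ring

lemma norm_mixedInner_le (h : SmoothMetric I M) (x : M) (ξ η : MixedForm I M) {t : ℝ} (ht : 0 < t) :
    2 * ‖mixedInner h x ξ η‖ ≤ t * fiberNormSq h ξ x + t⁻¹ * fiberNormSq h η x := by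
  set p := mixedInner h x ξ η with hp
  by_cases hp0 : p = 0
  · rw [hp0, norm_zero, mul_zero]
    have h1 := fiberNormSq_nonneg h ξ x
    have h2 := fiberNormSq_nonneg h η x
    positivity
  have hn : ‖p‖ ≠ 0 := norm_ne_zero_iff.mpr hp0
  have hs : (0 : ℝ) < Real.sqrt t := Real.sqrt_pos.mpr ht
  set c : ℂ := p / (‖p‖ : ℂ) with hc
  set a : ℂ := (Real.sqrt t : ℂ) with ha
  set b : ℂ := -(c * (Real.sqrt t : ℂ)⁻¹) with hb
  have key := fiberNormSq_lin (h := h) (x := x) (ξ := fun k x => a • ξ k x + b • η k x) (η := ξ)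
    (θ := η) (a := a) (b := b) fun k => rfl
  have hc1 : ‖c‖ = 1 := by
    rw [hc, norm_div, Complex.norm_real, norm_norm, div_self hn]
  have ha2 : ‖a‖ ^ 2 = t := by
    rw [ha, Complex.norm_real, Real.norm_of_nonneg hs.le, Real.sq_sqrt ht.le]
  have hb2 : ‖b‖ ^ 2 = t⁻¹ := by
    rw [hb, norm_neg, norm_mul, hc1, one_mul, norm_inv, Complex.norm_real,
      Real.norm_of_nonneg hs.le, inv_pow, Real.sq_sqrt ht.le]
  have hab : a * (starRingEnd ℂ) b * p = ((-‖p‖ : ℝ) : ℂ) := by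
    have h1 : (starRingEnd ℂ) c * p = (‖p‖ : ℂ) := by
      rw [hc, map_div₀, Complex.conj_ofReal, div_mul_eq_mul_div, mul_comm, Complex.mul_conj,
        Complex.normSq_eq_norm_sq, Complex.ofReal_pow, sq,
        mul_div_assoc, div_self (Complex.ofReal_ne_zero.mpr hn), mul_one]
    rw [hb, map_neg, map_mul, map_inv₀, Complex.conj_ofReal, ha, Complex.ofReal_neg, ← h1]
    have : (Real.sqrt t : ℂ) ≠ 0 := Complex.ofReal_ne_zero.mpr hs.ne'
    field_simp
  rw [ha2, hb2, hab, Complex.ofReal_re] at key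
  have := fiberNormSq_nonneg h (fun k x => a • ξ k x + b • η k x) x
  linarith

lemma fiberNormSq_lin_le {a b : ℂ} (hξ : ∀ k, ξ k x = a • η k x + b • θ k x) :
    fiberNormSq h ξ x ≤ 2 * (‖a‖ ^ 2 * fiberNormSq h η x) + 2 * (‖b‖ ^ 2 * fiberNormSq h θ x) := by
  have h1 := fiberNormSq_lin (h := h) hξ
  have h2 := fiberNormSq_lin (h := h) (x := x) (ξ := fun k x => a • η k x + (-b) • θ k x) (η := η)
    (θ := θ) (a := a) (b := -b) fun k => rfl
  have h3 := fiberNormSq_nonneg h (fun k x => a • η k x + (-b) • θ k x) x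
  rw [norm_neg, map_neg, mul_neg, neg_mul, Complex.neg_re] at h2
  linarith

lemma formAt_eq_zero_of_lt {k : ℕ} (hk : d < k) (ζ : EuclideanSpace ℝ (Fin d) [⋀^Fin k]→L[ℝ] ℂ) :
    ζ = 0 := by
  refine ContinuousAlternatingMap.ext_basisVec fun J => ?_
  have : ¬ Function.Injective J := fun hJ => by
    have := Fintype.card_le_of_injective J hJ
    simp only [Fintype.card_fin] at this
    omega
  obtain ⟨a, b, hab, hne⟩ := Function.not_injective_iff.mp this
  exact ζ.map_eq_zero_of_eq _ (congrArg basisVec hab) hne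

lemma eq_zero_of_fiberNormSq_eq_zero (h0 : fiberNormSq h ξ x = 0) (k : ℕ) : ξ k x = 0 := by
  by_cases hk : d < k
  · exact formAt_eq_zero_of_lt hk (formAt (ξ k) x)
  · have h1 := (Finset.sum_eq_zero_iff_of_nonneg fun k _ =>
      re_fiberInner_self_nonneg h x (ξ k)).mp h0 k (Finset.mem_range.mpr (by omega))
    rw [fiberInner_eq_altInner] at h1
    refine ContinuousAlternatingMap.ext_basisVec (ζ := formAt (ξ k) x) (η := 0) fun J => ?_
    have h2 := norm_apply_sq_le (gram_posDef h x) (formAt (ξ k) x) J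
    rw [h1, mul_zero, zero_mul] at h2
    exact norm_eq_zero.mp (pow_eq_zero_iff two_ne_zero |>.mp (le_antisymm h2 (sq_nonneg _)))

lemma continuousOn_mixedInner (h : SmoothMetric I M) (hξ : ξ.SmoothOn (I.interior M))
    (hη : η.SmoothOn (I.interior M)) :
    ContinuousOn (fun x => mixedInner h x ξ η) (I.interior M) :=
  continuousOn_finsetSum _ fun k _ => continuousOn_fiberInner h (hξ k) (hη k)

lemma continuousOn_fiberNormSq (h : SmoothMetric I M) (hξ : ξ.SmoothOn (I.interior M)) :
    ContinuousOn (fun x => fiberNormSq h ξ x) (I.interior M) :=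
  (Complex.continuous_re.comp_continuousOn (continuousOn_mixedInner h hξ hξ)).congr fun x _ => by
    simp [mixedInner_self]

lemma MixedForm.SmoothOn.extD (hξ : ξ.SmoothOn (I.interior M)) :
    MixedForm.SmoothOn ξ.extD (I.interior M) := by
  intro k
  cases k with
  | zero => exact FormField.SmoothOn.zero
  | succ k => exact (hξ k).extD

omit [IsManifold I ∞ M] in
lemma MixedForm.extD_congr {W : Set M} (hW : IsOpen W) (h : ∀ k, ∀ x ∈ W, ξ k x = η k x) (k : ℕ)
    {x : M} (hx : x ∈ W) : ξ.extD k x = η.extD k x := by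
  cases k with
  | zero => rfl
  | succ k => exact FormField.extD_congr hW (h k) hx

lemma MixedForm.extD_zero (k : ℕ) {x : M} (hx : x ∈ I.interior M) :
    MixedForm.extD (0 : MixedForm I M) k x = 0 := by
  cases k with
  | zero => rfl
  | succ k =>
    refine eq_of_forall_pull_eq (ξ := FormField.extD (0 : FormField I M k)) (η := 0)
      (fun c z hz => ?_) hx
    rw [(isParam_chart (I := I) c).pull_extD FormField.SmoothOn.zero hz, pull_zero]
    have : pull (extChartAt I c).symm (0 : FormField I M k) = fun _ => 0 := rfl
    rw [this, extDeriv, fderiv_fun_const]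
    ext v; simp [ContinuousAlternatingMap.alternatizeUncurryFin_apply]

lemma MixedForm.SmoothOn.extD_extD (hξ : ξ.SmoothOn (I.interior M)) (k : ℕ) {x : M}
    (hx : x ∈ I.interior M) : ξ.extD.extD k x = 0 := by
  match k with
  | 0 => rfl
  | 1 => exact MixedForm.extD_zero 1 hx
  | k + 2 => exact (hξ k).extD_extD hx

lemma MixedForm.SmoothOn.extD_lin (hη : η.SmoothOn (I.interior M)) (hθ : θ.SmoothOn (I.interior M))
    {a b : ℂ} (hξ : ∀ k, ∀ x ∈ I.interior M, ξ k x = a • η k x + b • θ k x) (k : ℕ) {x : M}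
    (hx : x ∈ I.interior M) : ξ.extD k x = a • η.extD k x + b • θ.extD k x := by
  rw [MixedForm.extD_congr (η := fun k => a • η k + b • θ k) isOpen_interior_manifold hξ k hx]
  cases k with
  | zero =>
    have : (0 : EuclideanSpace ℝ (Fin d) [⋀^Fin 0]→L[ℝ] ℂ) = a • 0 + b • 0 := by
      ext v; simp
    exact this
  | succ k =>
    refine (((hη k).const_smul a).extD_add ((hθ k).const_smul b) hx).trans ?_
    rw [(hη k).extD_const_smul a hx, (hθ k).extD_const_smul b hx]
    rfl

variable [MeasurableSpace M] [BorelSpace M] [CompactSpace M]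

lemma setLIntegral_lt_top_of_isCompact (h : SmoothMetric I M) {f : M → ENNReal}
    (hf : ContinuousOn f (I.interior M)) (hft : ∀ x ∈ I.interior M, f x ≠ ⊤) {K : Set M}
    (hK : IsCompact K) (hKi : K ⊆ I.interior M) : ∫⁻ x in K, f x ∂(riemannianVolume h) < ⊤ := by
  refine hK.induction_on (p := fun s => ∫⁻ x in s, f x ∂(riemannianVolume h) < ⊤) (by simp)
    (fun s t hst ht => (lintegral_mono_set hst).trans_lt ht)
    (fun s t hs ht => (lintegral_union_le f s t).trans_lt (ENNReal.add_lt_top.mpr ⟨hs, ht⟩))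
    fun x hx => ?_
  obtain ⟨W, hW, h1⟩ := exists_nhds_setLIntegral_lt_top h hf hft (hKi hx)
  exact ⟨W, mem_nhdsWithin_of_mem_nhds hW, h1⟩

omit [BorelSpace M] in
lemma setLIntegral_lt_top_of_locally (h : SmoothMetric I M) {f : M → ENNReal} {S : Set M}
    (hloc : ∀ x, ∃ W ∈ nhds x, ∫⁻ x in W ∩ S, f x ∂(riemannianVolume h) < ⊤) :
    ∫⁻ x in S, f x ∂(riemannianVolume h) < ⊤ := by
  have := isCompact_univ.induction_on
    (p := fun s : Set M => ∫⁻ x in s ∩ S, f x ∂(riemannianVolume h) < ⊤) (by simp)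
    (fun s t hst ht => (lintegral_mono_set (inter_subset_inter_left _ hst)).trans_lt ht)
    (fun s t hs ht => by
      rw [union_inter_distrib_right]
      exact (lintegral_union_le f _ _).trans_lt (ENNReal.add_lt_top.mpr ⟨hs, ht⟩))
    fun x _ => by
      obtain ⟨W, hW, h1⟩ := hloc x
      exact ⟨W, mem_nhdsWithin_of_mem_nhds hW, h1⟩
  rwa [univ_inter] at this

variable [T2Space M]

lemma integrableOn_of_isCompact (h : SmoothMetric I M) {f : M → ℂ}
    (hf : ContinuousOn f (I.interior M)) {K : Set M} (hK : IsCompact K) (hKi : K ⊆ I.interior M)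
    (hfK : ∀ x ∈ I.interior M, x ∉ K → f x = 0) : IntegrableOn f (I.interior M) (riemannianVolume h) := by
  refine ⟨hf.aestronglyMeasurable isOpen_interior_manifold.measurableSet, ?_⟩
  have h1 := setLIntegral_lt_top_of_isCompact h (f := fun x => ‖f x‖ₑ)
    (continuous_enorm.comp_continuousOn hf) (fun x _ => by simp) hK hKi
  refine lt_of_le_of_lt ?_ h1
  rw [← lintegral_indicator hK.measurableSet]
  refine le_trans ?_ (setLIntegral_le_lintegral (I.interior M) _)
  refine setLIntegral_mono_ae' isOpen_interior_manifold.measurableSet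
    (Filter.Eventually.of_forall fun x hxi => ?_)
  by_cases hx : x ∈ K
  · rw [indicator_of_mem hx]
  · rw [indicator_of_notMem hx, hfK x hxi hx, enorm_zero]

lemma integral_mixedInner_eq {h : SmoothMetric I M} {ξ p φ : MixedForm I M}
    (hξ : ξ.SmoothOn (I.interior M)) (hp : ξ.IsCodifferential h p)
    (hφ : φ.SmoothOn (I.interior M)) {K : Set M} (hK : IsCompact K) (hKi : K ⊆ I.interior M)
    (hφK : ∀ k x, x ∉ K → φ k x = 0) :
    ∫ x in I.interior M, mixedInner h x φ p ∂(riemannianVolume h) =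
      ∫ x in I.interior M, mixedInner h x φ.extD ξ ∂(riemannianVolume h) := by
  have hdφK : ∀ k x, x ∉ K → x ∈ I.interior M → φ.extD k x = 0 := by
    intro k x hx hxi
    rw [MixedForm.extD_congr (η := 0) hK.isClosed.isOpen_compl (fun k x hx => hφK k x hx) k hx]
    exact MixedForm.extD_zero k hxi
  have hpair : ∀ (k : ℕ) (x : M) (ζ θ : FormField I M k), ζ x = 0 → fiberInner h k x (ζ x) (θ x) = 0 := by
    intro k x ζ θ h0
    rw [fiberInner_eq_altInner, show formAt ζ x = 0 from h0, altInner_zero_left]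
  have hI1 : ∀ k, IntegrableOn (fun x => fiberInner h k x (φ k x) (p k x)) (I.interior M)
      (riemannianVolume h) := fun k =>
    integrableOn_of_isCompact h (continuousOn_fiberInner h (hφ k) (hp k).1) hK hKi
      fun x _ hx => hpair k x _ _ (hφK k x hx)
  have hI2 : ∀ k, IntegrableOn (fun x => fiberInner h k x (φ.extD k x) (ξ k x)) (I.interior M)
      (riemannianVolume h) := fun k =>
    integrableOn_of_isCompact h (continuousOn_fiberInner h (hφ.extD k) (hξ k)) hK hKi
      fun x hxi hx => hpair k x _ _ (hdφK k x hx hxi)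
  simp only [mixedInner]
  rw [integral_finsetSum _ fun k _ => hI1 k, integral_finsetSum _ fun k _ => hI2 k,
    Finset.sum_range_succ, Finset.sum_range_succ']
  congr 1
  · exact Finset.sum_congr rfl fun k _ => (hp k).2 (φ k) (hφ k) ⟨K, hK, hKi, hφK k⟩
  · rw [(hp d).2 (φ d) (hφ d) ⟨K, hK, hKi, hφK d⟩]
    have h1 : ∀ x, fiberInner h (d + 1) x ((φ d).extD x) (ξ (d + 1) x) = 0 := fun x =>
      hpair (d + 1) x _ _ (formAt_eq_zero_of_lt (Nat.lt_succ_self d) (formAt (φ d).extD x))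
    have h2 : ∀ x, fiberInner h 0 x (φ.extD 0 x) (ξ 0 x) = 0 := fun x => hpair 0 x _ _ rfl
    simp only [h1, h2]

end Mixed

section TestForm

variable {d : ℕ} {H : Type*} [TopologicalSpace H]
  {I : ModelWithCorners ℝ (EuclideanSpace ℝ (Fin d)) H}
  {M : Type*} [TopologicalSpace M] [ChartedSpace H M] [IsManifold I ∞ M]
  {κ : EuclideanSpace ℝ (Fin d) → M} {U : Set (EuclideanSpace ℝ (Fin d))} {k : ℕ}

/-- The exterior product of the `i`-th coordinate differential with a constant form. -/
def coordWedge (i : Fin d) (e : EuclideanSpace ℝ (Fin d) [⋀^Fin k]→L[ℝ] ℂ) :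
    EuclideanSpace ℝ (Fin d) [⋀^Fin (k + 1)]→L[ℝ] ℂ :=
  ContinuousAlternatingMap.alternatizeUncurryFin
    ((EuclideanSpace.proj i : EuclideanSpace ℝ (Fin d) →L[ℝ] ℝ).smulRight e)

lemma extDeriv_smul_const {g : EuclideanSpace ℝ (Fin d) → ℝ} {z : EuclideanSpace ℝ (Fin d)}
    (hg : DifferentiableAt ℝ g z) (e : EuclideanSpace ℝ (Fin d) [⋀^Fin k]→L[ℝ] ℂ) :
    extDeriv (fun w => g w • e) z =
      ∑ i, ((fderiv ℝ g z (basisVec i) : ℝ) : ℂ) • coordWedge i e := by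
  rw [extDeriv_fun_smul_form hg (differentiableAt_const e)]
  have h1 : extDeriv (fun _ : EuclideanSpace ℝ (Fin d) => e) z = 0 := by
    rw [extDeriv, fderiv_fun_const]
    ext v; simp [ContinuousAlternatingMap.alternatizeUncurryFin_apply]
  ext v
  have h2 : ∀ j, fderiv ℝ g z (v j) = ∑ i, v j i * fderiv ℝ g z (basisVec i) := fun j => by
    conv_lhs => rw [eq_sum_basisVec (v j)]
    simp only [map_sum, map_smul, smul_eq_mul]
  rw [h1]
  simp only [coordWedge, ContinuousAlternatingMap.smul_apply, smul_zero, zero_add, ContinuousAlternatingMap.sum_apply,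
    ContinuousAlternatingMap.alternatizeUncurryFin_apply, ContinuousLinearMap.smulRight_apply,
    PiLp.proj_apply, h2, Finset.smul_sum]
  rw [Finset.sum_comm]
  refine Finset.sum_congr rfl fun j _ => ?_
  simp only [Complex.real_smul, Complex.ofReal_sum, Complex.ofReal_mul, Finset.sum_mul,
    Finset.smul_sum, smul_eq_mul, zsmul_eq_mul]
  exact Finset.sum_congr rfl fun i _ => by ring

variable [T2Space M]

/-- A compactly supported function times a constant form, in the coordinates of a parametrisation,
extends to a smooth form. -/
lemma IsParam.exists_testForm (hκ : IsParam I κ U)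
    (e : EuclideanSpace ℝ (Fin d) [⋀^Fin k]→L[ℝ] ℂ) {g : EuclideanSpace ℝ (Fin d) → ℝ}
    (hg : ContDiff ℝ ∞ g) (hgc : HasCompactSupport g) (hgU : tsupport g ⊆ U) :
    ∃ φ : FormField I M k, φ.SmoothOn (I.interior M) ∧
      (∀ x, x ∉ κ '' tsupport g → φ x = 0) ∧ ∀ z ∈ U, pull κ φ z = g z • e := by
  classical
  obtain ⟨lam, hl⟩ := hκ.exists_inv
  set L : M → EuclideanSpace ℝ (Fin d) →L[ℝ] EuclideanSpace ℝ (Fin d) := fun x =>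
    (mfderiv I 𝓘(ℝ, EuclideanSpace ℝ (Fin d)) lam x : TangentSpace I x →L[ℝ] _) with hL
  set φ' : M → EuclideanSpace ℝ (Fin d) [⋀^Fin k]→L[ℝ] ℂ := fun x =>
    if x ∈ κ '' tsupport g then g (lam x) • e.compContinuousLinearMap (L x) else 0 with hφ'
  obtain ⟨φ, hφ⟩ : ∃ φ : FormField I M k, ∀ x, formAt φ x = φ' x := ⟨φ', fun _ => rfl⟩
  have hout : ∀ x, x ∉ κ '' tsupport g → formAt φ x = 0 := fun x hx => (hφ x).trans (if_neg hx)
  have hpull : ∀ z ∈ U, pull κ φ z = g z • e := by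
    intro z hz
    by_cases hzg : z ∈ tsupport g
    · have h1 : formAt φ (κ z) = g z • e.compContinuousLinearMap (L (κ z)) := by
        rw [hφ, hφ']
        simp only
        rw [if_pos (mem_image_of_mem κ hzg), (hl z hz).1]
      have h2 : (L (κ z)).comp (modelDeriv I κ z) = ContinuousLinearMap.id ℝ _ := by
        have h3 : HasMFDerivAt I 𝓘(ℝ, EuclideanSpace ℝ (Fin d)) lam (κ z) (L (κ z)) :=
          ((hl z hz).2.mdifferentiableAt (by simp)).hasMFDerivAt
        have h4 : HasFDerivAt (lam ∘ κ) ((L (κ z)).comp (modelDeriv I κ z)) z :=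
          (h3.comp z (hκ.hasMFDerivAt hz)).hasFDerivAt
        have h5 : lam ∘ κ =ᶠ[nhds z] id := by
          filter_upwards [hκ.isOpen.mem_nhds hz] with w hw using (hl w hw).1
        exact h4.unique ((hasFDerivAt_id z).congr_of_eventuallyEq h5)
      rw [pull, h1]
      ext v
      have h6 : ∀ w, L (κ z) (modelDeriv I κ z w) = w := fun w => DFunLike.congr_fun h2 w
      simp [Function.comp_def, h6]
    · have h1 : κ z ∉ κ '' tsupport g := by
        rintro ⟨w, hw, hwz⟩
        exact hzg (hκ.injOn (hgU hw) hz hwz ▸ hw)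
      rw [pull, show formAt φ (κ z) = 0 from hout _ h1,
        image_eq_zero_of_notMem_tsupport hzg]
      ext v; simp
  refine ⟨φ, ?_, hout, hpull⟩
  rw [smoothOn_interior_iff]
  intro c w hw
  refine ContDiffAt.contDiffWithinAt ?_
  set κ' := (extChartAt I c).symm
  have hκ' := isParam_chart (I := I) c
  by_cases hwU : κ' w ∈ κ '' U
  · have hnear : ∀ᶠ y in nhds w, y ∈ chartDom I c ∧ κ' y ∈ κ '' U :=
      (hκ'.isOpen.eventually_mem hw).and
        ((hκ'.contMDiffAt hw).continuousAt (hκ.isOpen_image.mem_nhds hwU))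
    obtain ⟨W, hW, hWo, hwW⟩ := eventually_nhds_iff.mp hnear
    set T := lam ∘ κ' with hT
    have hTd : ContDiffOn ℝ ∞ T W := by
      intro y hy
      obtain ⟨z, hz, hzy⟩ := (hW y hy).2
      have h1 : ContMDiffAt I 𝓘(ℝ, EuclideanSpace ℝ (Fin d)) ∞ lam (κ' y) := hzy ▸ (hl z hz).2
      exact (contMDiffAt_iff_contDiffAt.mp
        (h1.comp y (hκ'.contMDiffAt (hW y hy).1))).contDiffWithinAt
    have hTU : ∀ y ∈ W, T y ∈ U ∧ κ (T y) = κ' y := by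
      intro y hy
      obtain ⟨z, hz, hzy⟩ := (hW y hy).2
      rw [hT, Function.comp_apply, ← hzy, (hl z hz).1]
      exact ⟨hz, rfl⟩
    have hform : ∀ y ∈ W, pull κ' φ y =
        (g (T y) • e).compContinuousLinearMap (fderiv ℝ T y) := by
      intro y hy
      have h1 : HasMFDerivAt 𝓘(ℝ, EuclideanSpace ℝ (Fin d)) I (κ ∘ T) y
          ((modelDeriv I κ (T y)).comp (fderiv ℝ T y)) :=
        (hκ.hasMFDerivAt (hTU y hy).1).comp y
          ((hTd.contDiffAt (hWo.mem_nhds hy)).differentiableAt (by simp)).hasFDerivAt.hasMFDerivAt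
      have h2 : κ' =ᶠ[nhds y] κ ∘ T := by
        filter_upwards [hWo.mem_nhds hy] with y' hy' using (hTU y' hy').2.symm
      have h3 : modelDeriv I κ' y = (modelDeriv I κ (T y)).comp (fderiv ℝ T y) :=
        hasMFDerivAt_unique (hκ'.hasMFDerivAt (hW y hy).1) (h1.congr_of_eventuallyEq h2)
      rw [← hpull _ (hTU y hy).1, pull, pull, h3, (hTU y hy).2]
      rfl
    refine ContDiffAt.congr_of_eventuallyEq (f := fun y =>
      (g (T y) • e).compContinuousLinearMap (fderiv ℝ T y)) ?_
      (Filter.eventuallyEq_of_mem (hWo.mem_nhds hwW) hform)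
    refine ContDiffOn.contDiffAt (s := W) ?_ (hWo.mem_nhds hwW)
    exact ContDiffOn.altMap_comp ((hg.comp_contDiffOn hTd).smul contDiffOn_const)
      (hTd.fderiv_of_isOpen hWo (by simp))
  · have hcl : IsClosed (κ '' tsupport g) :=
      (hgc.isCompact.image_of_continuousOn (hκ.smooth.continuousOn.mono hgU)).isClosed
    have hnot : κ' w ∈ (κ '' tsupport g)ᶜ := fun hmem => hwU (image_mono hgU hmem)
    have hnear : ∀ᶠ y in nhds w, κ' y ∈ (κ '' tsupport g)ᶜ :=
      (hκ'.contMDiffAt hw).continuousAt (hcl.isOpen_compl.mem_nhds hnot)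
    refine (contDiffAt_const (c := (0 : EuclideanSpace ℝ (Fin d) [⋀^Fin k]→L[ℝ] ℂ))).congr_of_eventuallyEq ?_
    filter_upwards [hnear] with y hy
    rw [pull, show formAt φ (κ' y) = 0 from hout _ hy]
    rfl

end TestForm

section Codifferential

lemma integral_smul_fderiv {d : ℕ} {U : Set (EuclideanSpace ℝ (Fin d))} (hU : IsOpen U)
    {Y : EuclideanSpace ℝ (Fin d) → ℂ} (hY : ContDiffOn ℝ ∞ Y U)
    {g : EuclideanSpace ℝ (Fin d) → ℝ} (hg : ContDiff ℝ ∞ g) (hgc : HasCompactSupport g)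
    (hgU : tsupport g ⊆ U) (v : EuclideanSpace ℝ (Fin d)) :
    IntegrableOn (fun z => g z • fderiv ℝ Y z v) U ∧ IntegrableOn (fun z => fderiv ℝ g z v • Y z) U ∧
    ∫ z in U, g z • fderiv ℝ Y z v = - ∫ z in U, fderiv ℝ g z v • Y z := by
  have hint : ∀ {a : EuclideanSpace ℝ (Fin d) → ℝ} {b : EuclideanSpace ℝ (Fin d) → ℂ},
      Continuous a → Function.support a ⊆ tsupport g → ContinuousOn b U →
      Integrable (fun z => a z • b z) := by
    intro a b ha hs hb
    have h1 : IntegrableOn (fun z => a z • b z) (tsupport g) :=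
      (ha.continuousOn.smul (hb.mono hgU)).integrableOn_compact hgc.isCompact
    refine (integrableOn_iff_integrable_of_support_subset fun z hz => hs ?_).mp h1
    exact fun h0 => hz (by simp only [h0, zero_smul])
  have hY' : ContinuousOn (fun z => fderiv ℝ Y z v) U :=
    ((hY.continuousOn_fderiv_of_isOpen hU (by simp)).clm_apply continuousOn_const)
  have hg' : Continuous fun z => fderiv ℝ g z v :=
    (hg.continuous_fderiv (by simp)).clm_apply continuous_const
  have hs' : Function.support (fun z => fderiv ℝ g z v) ⊆ tsupport g := by
    intro z hz
    by_contra h0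
    refine hz ?_
    have : g =ᶠ[nhds z] fun _ => 0 := notMem_tsupport_iff_eventuallyEq.mp h0
    simp [this.fderiv_eq]
  have i1 := hint hg.continuous (subset_tsupport g) hY'
  have i2 := hint hg' hs' hY.continuousOn
  have i3 := hint hg.continuous (subset_tsupport g) hY.continuousOn
  refine ⟨i1.integrableOn, i2.integrableOn, ?_⟩
  have key := integral_bilinear_hasFDerivAt_right_eq_neg_left_of_integrable (μ := volume)
    (f := g) (f' := fderiv ℝ g) (g := Y) (g' := fderiv ℝ Y) (v := v)
    (B := ContinuousLinearMap.lsmul ℝ ℝ) i2 i1 i3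
    (fun z _ => (hg.differentiable (by simp) z).hasFDerivAt)
    (fun z hz => ((hY.contDiffAt (hU.mem_nhds (hgU hz))).differentiableAt (by simp)).hasFDerivAt)
  simp only [ContinuousLinearMap.lsmul_apply] at key
  rw [setIntegral_eq_integral_of_forall_compl_eq_zero, setIntegral_eq_integral_of_forall_compl_eq_zero,
    key]
  · intro z hz
    have : fderiv ℝ g z v = 0 := by
      by_contra h0; exact hz (hgU (hs' h0))
    rw [this, zero_smul]
  · intro z hz
    rw [image_eq_zero_of_notMem_tsupport fun h0 => hz (hgU h0), zero_smul]

variable {d : ℕ} {H : Type*} [TopologicalSpace H]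
  {I : ModelWithCorners ℝ (EuclideanSpace ℝ (Fin d)) H}
  {M : Type*} [TopologicalSpace M] [ChartedSpace H M] [IsManifold I ∞ M]
  {κ : EuclideanSpace ℝ (Fin d) → M} {U : Set (EuclideanSpace ℝ (Fin d))} {k : ℕ}

/-- The density of the volume times the pairing with a constant form, in coordinates. -/
def weightedPairing (h : SmoothMetric I M) (κ : EuclideanSpace ℝ (Fin d) → M)
    (e : EuclideanSpace ℝ (Fin d) [⋀^Fin k]→L[ℝ] ℂ) (ξ : FormField I M k)
    (z : EuclideanSpace ℝ (Fin d)) : ℂ :=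
  (Real.sqrt (gramAlong h κ z).det : ℂ) * altInner (gramAlong h κ z)⁻¹ e (pull κ ξ z)

lemma IsParam.contDiffOn_weightedPairing (hκ : IsParam I κ U) (h : SmoothMetric I M)
    (e : EuclideanSpace ℝ (Fin d) [⋀^Fin k]→L[ℝ] ℂ) {ξ : FormField I M k}
    (hξ : ξ.SmoothOn (I.interior M)) : ContDiffOn ℝ ∞ (weightedPairing h κ e ξ) U :=
  (Complex.ofRealCLM.contDiff.comp_contDiffOn (hκ.contDiffOn_sqrt_det h)).mul
    (ContDiffOn.altInner (hκ.contDiffOn_inv_gramAlong h) contDiffOn_const (hκ.contDiffOn_pull hξ))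

variable [MeasurableSpace M] [BorelSpace M] [CompactSpace M] [T2Space M]

/-- The divergence formula for the codifferential in local coordinates. -/
lemma IsParam.weightedPairing_codifferential (hκ : IsParam I κ U) {h : SmoothMetric I M}
    {ξ : FormField I M (k + 1)} {η : FormField I M k} (hξ : ξ.SmoothOn (I.interior M))
    (hη : IsCodifferential h ξ η) (e : EuclideanSpace ℝ (Fin d) [⋀^Fin k]→L[ℝ] ℂ)
    {z : EuclideanSpace ℝ (Fin d)} (hz : z ∈ U) :
    weightedPairing h κ e η z =
      -∑ i, fderiv ℝ (weightedPairing h κ (coordWedge i e) ξ) z (basisVec i) := by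
  set Y : Fin d → EuclideanSpace ℝ (Fin d) → ℂ := fun i => weightedPairing h κ (coordWedge i e) ξ
  have hY : ∀ i, ContDiffOn ℝ ∞ (Y i) U := fun i => hκ.contDiffOn_weightedPairing h _ hξ
  have hP := hκ.contDiffOn_weightedPairing h e hη.1
  set D : EuclideanSpace ℝ (Fin d) → ℂ := fun w =>
    weightedPairing h κ e η w + ∑ i, fderiv ℝ (Y i) w (basisVec i) with hD
  have hDc : ContinuousOn D U := hP.continuousOn.add (continuousOn_finsetSum _ fun i _ =>
    ((hY i).continuousOn_fderiv_of_isOpen hκ.isOpen (by simp)).clm_apply continuousOn_const)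
  have hae : ∀ᵐ w, w ∈ U → D w = 0 := by
    refine hκ.isOpen.ae_eq_zero_of_integral_contDiff_smul_eq_zero
      (hDc.locallyIntegrableOn hκ.isOpen.measurableSet) fun g hg hgc hgU => ?_
    obtain ⟨φ, hφ, hφ0, hφp⟩ := hκ.exists_testForm e hg hgc hgU
    have hKc : IsCompact (κ '' tsupport g) :=
      hgc.isCompact.image_of_continuousOn (hκ.smooth.continuousOn.mono hgU)
    have hKi : κ '' tsupport g ⊆ I.interior M := (image_mono hgU).trans hκ.mapsTo.image_subset
    have hweak := hη.2 φ hφ ⟨_, hKc, hKi, hφ0⟩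
    have hred : ∀ {l : ℕ} (ζ θ : FormField I M l), ζ.SmoothOn (I.interior M) →
        θ.SmoothOn (I.interior M) → (∀ x, x ∉ κ '' tsupport g → x ∈ I.interior M → ζ x = 0) →
        ∫ x in I.interior M, fiberInner h l x (ζ x) (θ x) ∂(riemannianVolume h) =
        ∫ w in U, (Real.sqrt (gramAlong h κ w).det : ℂ) *
          altInner (gramAlong h κ w)⁻¹ (pull κ ζ w) (pull κ θ w) := by
      intro l ζ θ hζ hθ h0
      rw [setIntegral_eq_of_subset_of_forall_sdiff_eq_zero
        isOpen_interior_manifold.measurableSet hκ.mapsTo.image_subset, hκ.setIntegral_eq h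
        ((continuousOn_fiberInner h hζ hθ).mono hκ.mapsTo.image_subset)]
      · refine setIntegral_congr_fun hκ.isOpen.measurableSet fun w hw => ?_
        simp only [hκ.fiberInner_eq h hw]
      · intro x hx
        rw [fiberInner_eq_altInner, show formAt ζ x = 0 from
          h0 x (fun hm => hx.2 (image_mono hgU hm)) hx.1, altInner_zero_left]
    have hdφ : ∀ x, x ∉ κ '' tsupport g → x ∈ I.interior M → φ.extD x = 0 := by
      intro x hx hxi
      rw [FormField.extD_congr (η := 0) hKc.isClosed.isOpen_compl (fun x hx => hφ0 x hx) hx]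
      exact MixedForm.extD_zero (k + 1) hxi
    rw [hred φ η hφ hη.1 fun x hx _ => hφ0 x hx, hred φ.extD ξ hφ.extD hξ hdφ] at hweak
    have e1 : ∫ w in U, g w • weightedPairing h κ e η w = ∫ w in U,
        (Real.sqrt (gramAlong h κ w).det : ℂ) *
          altInner (gramAlong h κ w)⁻¹ (pull κ φ w) (pull κ η w) := by
      refine setIntegral_congr_fun hκ.isOpen.measurableSet fun w hw => ?_
      have : (g w • e : EuclideanSpace ℝ (Fin d) [⋀^Fin k]→L[ℝ] ℂ) = (g w : ℂ) • e := by ext v; simp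
      simp only [hφp w hw, this, altInner_smul_left, weightedPairing, Complex.real_smul]
      ring
    have e2 : ∫ w in U, (Real.sqrt (gramAlong h κ w).det : ℂ) *
          altInner (gramAlong h κ w)⁻¹ (pull κ φ.extD w) (pull κ ξ w) =
        ∫ w in U, ∑ i, fderiv ℝ g w (basisVec i) • Y i w := by
      refine setIntegral_congr_fun hκ.isOpen.measurableSet fun w hw => ?_
      have h1 : pull κ φ.extD w =
          ∑ i, ((fderiv ℝ g w (basisVec i) : ℝ) : ℂ) • coordWedge i e := by
        rw [hκ.pull_extD hφ hw, ← extDeriv_smul_const (hg.differentiable (by simp) w)]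
        refine Filter.EventuallyEq.extDeriv_eq ?_
        filter_upwards [hκ.isOpen.mem_nhds hw] with y hy using hφp y hy
      have h2 : ∀ (s : Finset (Fin d)) (a : Fin d → ℂ), altInner (gramAlong h κ w)⁻¹
          (∑ i ∈ s, a i • coordWedge i e) (pull κ ξ w) =
          ∑ i ∈ s, a i * altInner (gramAlong h κ w)⁻¹ (coordWedge i e) (pull κ ξ w) := by
        intro s a
        induction s using Finset.cons_induction with
        | empty => simp [altInner_zero_left]
        | cons i s hi ih =>
          rw [Finset.sum_cons, Finset.sum_cons, altInner_add_left, altInner_smul_left, ih]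
      simp only [h1, h2, Finset.mul_sum, Y, weightedPairing, Complex.real_smul]
      exact Finset.sum_congr rfl fun i _ => by ring
    have hIBP := fun i => integral_smul_fderiv hκ.isOpen (hY i) hg hgc hgU (basisVec i)
    have i0 : IntegrableOn (fun w => g w • weightedPairing h κ e η w) U := by
      have h1 : IntegrableOn (fun w => g w • weightedPairing h κ e η w) (tsupport g) :=
        (hg.continuous.continuousOn.smul (hP.continuousOn.mono hgU)).integrableOn_compact hgc.isCompact
      exact ((integrableOn_iff_integrable_of_support_subset fun w hw => subset_tsupport g
        fun h0 => hw (by simp only [h0, zero_smul])).mp h1).integrableOn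
    rw [← setIntegral_eq_integral_of_forall_compl_eq_zero (s := U) fun w hw => by
      rw [image_eq_zero_of_notMem_tsupport fun h0 => hw (hgU h0), zero_smul]]
    simp only [hD, smul_add, Finset.smul_sum]
    rw [integral_add i0 (integrable_finsetSum _ fun i _ => (hIBP i).1), integral_finsetSum _
      fun i _ => (hIBP i).1, e1, hweak, e2, integral_finsetSum _ fun i _ => (hIBP i).2.1,
      ← Finset.sum_add_distrib]
    exact Finset.sum_eq_zero fun i _ => by rw [(hIBP i).2.2, add_neg_cancel]
  have h3 : EqOn D (fun _ => 0) U := Measure.eqOn_open_of_ae_eq (μ := volume)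
    ((ae_restrict_iff' hκ.isOpen.measurableSet).mpr hae) hκ.isOpen hDc continuousOn_const
  exact eq_neg_of_add_eq_zero_left (h3 hz)

end Codifferential

section BlockInverse

variable {m : ℕ}

lemma IsBlock.det_eq {G : Matrix (Fin (m + 1)) (Fin (m + 1)) ℝ} {b : ℝ}
    {N : Matrix (Fin m) (Fin m) ℝ} (hG : IsBlock G b N) : G.det = b * N.det := by
  rw [Matrix.det_succ_row_zero, Fin.sum_univ_succ]
  have h1 : G.submatrix Fin.succ Fin.succ = N := by
    ext i j
    simp [hG.succ_succ]
  simp [hG.zero_zero, hG.zero_succ, h1]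

lemma IsBlock.inv {G : Matrix (Fin (m + 1)) (Fin (m + 1)) ℝ} {b : ℝ}
    {N : Matrix (Fin m) (Fin m) ℝ} (hG : IsBlock G b N) (hb : b ≠ 0) (hN : N.det ≠ 0) :
    IsBlock G⁻¹ b⁻¹ N⁻¹ := by
  set G' : Matrix (Fin (m + 1)) (Fin (m + 1)) ℝ :=
    Matrix.of (Fin.cons (Fin.cons b⁻¹ fun _ => 0) fun i => Fin.cons 0 fun j => N⁻¹ i j) with hG'
  have hNN : ∀ i j, ∑ p, N i p * N⁻¹ p j = (1 : Matrix (Fin m) (Fin m) ℝ) i j := fun i j => by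
    rw [← Matrix.mul_apply, Matrix.mul_nonsing_inv _ (isUnit_iff_ne_zero.mpr hN)]
  have h1 : G * G' = 1 := by
    ext i j
    rw [Matrix.mul_apply, Fin.sum_univ_succ]
    refine Fin.cases ?_ (fun i => ?_) i <;> refine Fin.cases ?_ (fun j => ?_) j
    · simp [hG', hG.zero_zero, hG.zero_succ, hb]
    · simp [hG', hG.zero_succ, (Fin.succ_ne_zero j).symm]
    · simp [hG', hG.succ_zero]
    · simp [hG', hG.succ_zero, hG.succ_succ, hNN, Matrix.one_apply]
  rw [Matrix.inv_eq_right_inv h1]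
  exact ⟨by simp [hG'], fun i => by simp [hG'], fun i => by simp [hG'], fun i j => by simp [hG']⟩

end BlockInverse

namespace StaticGeometry

variable {m : ℕ}
  {X : Type*} [TopologicalSpace X] [ChartedSpace (EuclideanHalfSpace (m + 1)) X]
  [IsManifold (𝓡∂ (m + 1)) ∞ X]
  {Y : Type*} [TopologicalSpace Y] [ChartedSpace (EuclideanSpace ℝ (Fin m)) Y]
  [IsManifold (𝓡 m) ∞ Y] (S : StaticGeometry m X Y) (c : Y)

/-- The point of the boundary with given tangential coordinates. -/
def collarPoint (z : EuclideanSpace ℝ (Fin (m + 1))) : Y := (extChartAt (𝓡 m) c).symm (tailProj m z)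

/-- The collar in the coordinates of a chart of the boundary. -/
def collarMap (z : EuclideanSpace ℝ (Fin (m + 1))) : X := S.Φ (z 0, collarPoint c z)

/-- The domain of the collar coordinates. -/
def collarDom : Set (EuclideanSpace ℝ (Fin (m + 1))) :=
  {z | z 0 ∈ Ioo 0 S.ε ∧ tailProj m z ∈ (extChartAt (𝓡 m) c).target}

/-- The domain of the collar coordinates, with the boundary. -/
def collarDomClosed : Set (EuclideanSpace ℝ (Fin (m + 1))) :=
  {z | z 0 ∈ Ico 0 S.ε ∧ tailProj m z ∈ (extChartAt (𝓡 m) c).target}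

/-- The collar coordinates of a point. -/
def collarInv (x : X) : EuclideanSpace ℝ (Fin (m + 1)) :=
  (S.Ψ x).1 • basisVec 0 + tailIncl m (extChartAt (𝓡 m) c (S.Ψ x).2)

variable {c} {z : EuclideanSpace ℝ (Fin (m + 1))}

lemma collarDom_subset : S.collarDom c ⊆ S.collarDomClosed c :=
  fun _ hz => ⟨Ioo_subset_Ico_self hz.1, hz.2⟩

omit [IsManifold (𝓡 m) ∞ Y] [IsManifold (𝓡∂ (m + 1)) ∞ X] in
lemma continuous_coord {n : ℕ} (i : Fin n) :
    Continuous fun z : EuclideanSpace ℝ (Fin n) => z i :=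
  (EuclideanSpace.proj (𝕜 := ℝ) i).continuous

lemma isOpen_collarDom : IsOpen (S.collarDom c) :=
  (isOpen_Ioo.preimage (continuous_coord 0)).inter
    ((isOpen_extChartAt_target c).preimage (tailProj m).continuous)

lemma contMDiffOn_collarPair :
    ContMDiffOn 𝓘(ℝ, EuclideanSpace ℝ (Fin (m + 1))) (𝓘(ℝ, ℝ).prod (𝓡 m)) ∞
      (fun z : EuclideanSpace ℝ (Fin (m + 1)) => (z 0, collarPoint c z))
      {z | tailProj m z ∈ (extChartAt (𝓡 m) c).target} := by
  refine ContMDiffOn.prodMk ?_ ?_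
  · exact (EuclideanSpace.proj (𝕜 := ℝ) (0 : Fin (m + 1))).contDiff.contMDiff.contMDiffOn
  · exact (contMDiffOn_extChartAt_symm c).comp (tailProj m).contDiff.contMDiff.contMDiffOn
      fun _ hz => hz

lemma contMDiffOn_collarMap :
    ContMDiffOn 𝓘(ℝ, EuclideanSpace ℝ (Fin (m + 1))) (𝓡∂ (m + 1)) ∞ (S.collarMap c)
      (S.collarDomClosed c) :=
  S.Φ_smooth.comp ((contMDiffOn_collarPair (c := c)).mono fun _ hz => hz.2)
    fun _ hz => ⟨hz.1, mem_univ _⟩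

lemma α_collarMap (hz : z ∈ S.collarDomClosed c) : S.α (S.collarMap c z) = z 0 :=
  S.α_collar _ hz.1 _

lemma mem_interior_iff_α {x : X} : x ∈ (𝓡∂ (m + 1)).interior X ↔ 0 < S.α x := by
  refine ⟨S.α_pos x, fun h => ?_⟩
  by_contra hx
  rw [← mem_compl_iff, ModelWithCorners.compl_interior] at hx
  exact h.ne' (S.α_boundary x hx)

lemma collarMap_mem_interior (hz : z ∈ S.collarDom c) :
    S.collarMap c z ∈ (𝓡∂ (m + 1)).interior X := by
  rw [S.mem_interior_iff_α, S.α_collarMap (S.collarDom_subset hz)]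
  exact hz.1.1

lemma collarInv_collarMap (hz : z ∈ S.collarDomClosed c) :
    S.collarInv c (S.collarMap c z) = z := by
  rw [collarInv, collarMap, S.Ψ_left_inv _ ⟨hz.1, mem_univ _⟩]
  simp only [collarPoint]
  rw [(extChartAt (𝓡 m) c).right_inv hz.2, ← eq_add_tailIncl]

lemma contMDiffAt_collarInv (hz : z ∈ S.collarDomClosed c) :
    ContMDiffAt (𝓡∂ (m + 1)) 𝓘(ℝ, EuclideanSpace ℝ (Fin (m + 1))) ∞ (S.collarInv c)
      (S.collarMap c z) := by
  have h1 : ContMDiffAt (𝓡∂ (m + 1)) (𝓘(ℝ, ℝ).prod (𝓡 m)) ∞ S.Ψ (S.collarMap c z) :=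
    S.Ψ_smooth.contMDiffAt (S.Φ_open.mem_nhds ⟨_, ⟨hz.1, mem_univ _⟩, rfl⟩)
  have h2 : (S.Ψ (S.collarMap c z)).2 = collarPoint c z := by
    rw [collarMap, S.Ψ_left_inv _ ⟨hz.1, mem_univ _⟩]
  have h3 : ContMDiffAt (𝓡 m) 𝓘(ℝ, EuclideanSpace ℝ (Fin m)) ∞ (extChartAt (𝓡 m) c)
      (S.Ψ (S.collarMap c z)).2 := by
    refine contMDiffAt_extChartAt' ?_
    rw [h2, ← extChartAt_source (𝓡 m)]
    exact (extChartAt (𝓡 m) c).map_target hz.2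
  have h4 : ContMDiffAt (𝓡∂ (m + 1)) 𝓘(ℝ, EuclideanSpace ℝ (Fin m)) ∞
      (fun x => extChartAt (𝓡 m) c (S.Ψ x).2) (S.collarMap c z) :=
    ContMDiffAt.comp (g := extChartAt (𝓡 m) c) (f := fun x => (S.Ψ x).2) _ h3 h1.snd
  have h5 : ContMDiffAt (𝓡∂ (m + 1)) 𝓘(ℝ, EuclideanSpace ℝ (Fin (m + 1))) ∞
      (fun x => tailIncl m (extChartAt (𝓡 m) c (S.Ψ x).2)) (S.collarMap c z) :=
    (tailIncl m).contDiff.contMDiff.contMDiffAt.comp _ h4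
  exact (h1.fst.smul contMDiffAt_const).add h5

lemma isParam_collarMap : IsParam (𝓡∂ (m + 1)) (S.collarMap c) (S.collarDom c) where
  isOpen := S.isOpen_collarDom
  smooth := S.contMDiffOn_collarMap.mono S.collarDom_subset
  mapsTo _ hz := S.collarMap_mem_interior hz
  exists_inv := ⟨S.collarInv c, fun _ hz => ⟨S.collarInv_collarMap (S.collarDom_subset hz),
    S.contMDiffAt_collarInv (S.collarDom_subset hz)⟩⟩

lemma mdifferentiableAt_Φ (hz : z ∈ S.collarDom c) :
    MDifferentiableAt (𝓘(ℝ, ℝ).prod (𝓡 m)) (𝓡∂ (m + 1)) S.Φ (z 0, collarPoint c z) :=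
  (S.Φ_smooth.contMDiffAt (prod_mem_nhds (Ico_mem_nhds hz.1.1 hz.1.2)
    Filter.univ_mem)).mdifferentiableAt (by simp)

/-- The radial derivative of the collar, as an element of the model space. -/
lemma modelDeriv_collarMap_zero (hz : z ∈ S.collarDom c) :
    modelDeriv (𝓡∂ (m + 1)) (S.collarMap c) z (basisVec 0) =
      collarRadial (m := m) (𝓡∂ (m + 1)) S.Φ (z 0) (collarPoint c z) := by
  have hγ : HasFDerivAt (fun t : ℝ => t • basisVec (d := m + 1) 0 + tailIncl m (tailProj m z))
      ((ContinuousLinearMap.id ℝ ℝ).smulRight (basisVec 0)) (z 0) :=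
    ((ContinuousLinearMap.id ℝ ℝ).smulRight (basisVec 0)).hasFDerivAt.add_const _
  have hz' : z 0 • basisVec 0 + tailIncl m (tailProj m z) = z := (eq_add_tailIncl z).symm
  have h1 := S.isParam_collarMap.hasMFDerivAt hz
  have h2 : HasMFDerivAt 𝓘(ℝ, ℝ) (𝓡∂ (m + 1))
      (S.collarMap c ∘ fun t : ℝ => t • basisVec (d := m + 1) 0 + tailIncl m (tailProj m z)) (z 0)
      ((modelDeriv (𝓡∂ (m + 1)) (S.collarMap c) z).comp
        ((ContinuousLinearMap.id ℝ ℝ).smulRight (basisVec 0))) :=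
    HasMFDerivAt.comp (z 0) (by rw [hz']; exact h1) hγ.hasMFDerivAt
  have h3 : (S.collarMap c ∘ fun t : ℝ => t • basisVec (d := m + 1) 0 + tailIncl m (tailProj m z)) =
      fun t => S.Φ (t, collarPoint c z) := by
    funext t
    simp [collarMap, collarPoint]
  rw [h3] at h2
  have h4 : (mfderiv 𝓘(ℝ, ℝ) (𝓡∂ (m + 1)) (fun t => S.Φ (t, collarPoint c z)) (z 0) :
      ℝ →L[ℝ] EuclideanSpace ℝ (Fin (m + 1))) = _ := h2.mfderiv
  have h5 := DFunLike.congr_fun h4 (1 : ℝ)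
  refine Eq.trans ?_ h5.symm
  exact congrArg (modelDeriv (𝓡∂ (m + 1)) (S.collarMap c) z) (one_smul ℝ (basisVec 0)).symm

/-- The differential of the inverse of a chart of the boundary. -/
def chartFrame (c : Y) (w : EuclideanSpace ℝ (Fin m)) :
    EuclideanSpace ℝ (Fin m) →L[ℝ] TangentSpace (𝓡 m) ((extChartAt (𝓡 m) c).symm w) :=
  mfderivWithin 𝓘(ℝ, EuclideanSpace ℝ (Fin m)) (𝓡 m) (extChartAt (𝓡 m) c).symm (range (𝓡 m)) w

lemma modelDeriv_collarMap_tail (hz : z ∈ S.collarDom c) (v : EuclideanSpace ℝ (Fin m)) :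
    modelDeriv (𝓡∂ (m + 1)) (S.collarMap c) z (tailIncl m v) =
      collarTangential (m := m) (𝓡∂ (m + 1)) S.Φ (z 0) (collarPoint c z)
        (chartFrame c (tailProj m z) v) := by
  set w := tailProj m z with hw
  have hγ : HasFDerivAt (fun w' => z 0 • basisVec (d := m + 1) 0 + tailIncl m w') (tailIncl m) w :=
    (tailIncl m).hasFDerivAt.const_add _
  have hz' : z 0 • basisVec 0 + tailIncl m w = z := (eq_add_tailIncl z).symm
  have h2 : HasMFDerivAt 𝓘(ℝ, EuclideanSpace ℝ (Fin m)) (𝓡∂ (m + 1))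
      (S.collarMap c ∘ fun w' => z 0 • basisVec (d := m + 1) 0 + tailIncl m w') w
      ((modelDeriv (𝓡∂ (m + 1)) (S.collarMap c) z).comp (tailIncl m)) :=
    HasMFDerivAt.comp w (by rw [hz']; exact S.isParam_collarMap.hasMFDerivAt hz) hγ.hasMFDerivAt
  have h3 : (S.collarMap c ∘ fun w' => z 0 • basisVec (d := m + 1) 0 + tailIncl m w') =
      (fun y => S.Φ (z 0, y)) ∘ (extChartAt (𝓡 m) c).symm := by
    funext w'
    simp [collarMap, collarPoint]
  have h4 : MDifferentiableAt (𝓡 m) (𝓡∂ (m + 1)) (fun y => S.Φ (z 0, y))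
      ((extChartAt (𝓡 m) c).symm w) :=
    (S.mdifferentiableAt_Φ hz).comp _
      (mdifferentiableAt_const.prodMk mdifferentiableAt_id)
  have h5 : HasMFDerivAt 𝓘(ℝ, EuclideanSpace ℝ (Fin m)) (𝓡 m) (extChartAt (𝓡 m) c).symm w
      (chartFrame c w) := by
    have h6 : MDifferentiableAt 𝓘(ℝ, EuclideanSpace ℝ (Fin m)) (𝓡 m) (extChartAt (𝓡 m) c).symm w :=
      ((contMDiffOn_extChartAt_symm (n := ∞) c).contMDiffAt
        ((isOpen_extChartAt_target c).mem_nhds hz.2)).mdifferentiableAt (by simp)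
    have h7 := h6.hasMFDerivAt
    rw [chartFrame, mfderivWithin_of_mem_nhds (by simp)]
    exact h7
  rw [h3] at h2
  have h8 := hasMFDerivAt_unique h2 (h4.hasMFDerivAt.comp w h5)
  exact DFunLike.congr_fun h8 v

lemma tangPart_pull_collarMap (hz : z ∈ S.collarDom c) (ξ : MixedForm (𝓡∂ (m + 1)) X) (k : ℕ) :
    tangPart (pull (S.collarMap c) (ξ k) z) =
      FormField.inChart (S.collarT ξ (z 0) k) c (tailProj m z) := by
  ext v
  refine congrArg (formAt (ξ k) (S.collarMap c z)) ?_
  funext a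
  exact S.modelDeriv_collarMap_tail hz (v a)

lemma normPart_pull_collarMap (hz : z ∈ S.collarDom c) (ξ : MixedForm (𝓡∂ (m + 1)) X) (k : ℕ) :
    normPart (pull (S.collarMap c) (ξ (k + 1)) z) =
      FormField.inChart (S.collarN ξ (z 0) k) c (tailProj m z) := by
  ext v
  refine congrArg (formAt (ξ (k + 1)) (S.collarMap c z)) ?_
  funext a
  refine Fin.cases ?_ (fun a => ?_) a
  · exact S.modelDeriv_collarMap_zero hz
  · exact S.modelDeriv_collarMap_tail hz (v a)

/-- The matrix of `k(μ, y, dy)` in a chart of the boundary. -/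
def kMatrix (c : Y) (z : EuclideanSpace ℝ (Fin (m + 1))) : Matrix (Fin m) (Fin m) ℝ :=
  Matrix.of fun i j => S.k (z 0 ^ 2) (collarPoint c z) (chartFrame c (tailProj m z) (basisVec i))
    (chartFrame c (tailProj m z) (basisVec j))

/-- The function `β̃(α², y)` in collar coordinates. -/
def betaFun (c : Y) (z : EuclideanSpace ℝ (Fin (m + 1))) : ℝ := S.βt (z 0 ^ 2, collarPoint c z)

lemma sq_mem_Ico {s r : ℝ} (hs : s ∈ Ico 0 r) : s ^ 2 ∈ Ico 0 (r ^ 2) :=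
  ⟨sq_nonneg s, by have := hs.1; have := hs.2; gcongr⟩

lemma betaFun_pos (hz : z ∈ S.collarDomClosed c) : 0 < S.betaFun c z :=
  S.βt_pos _ ⟨sq_mem_Ico hz.1, mem_univ _⟩

lemma isBlock_gramAlong (hz : z ∈ S.collarDom c) :
    IsBlock (gramAlong S.h (S.collarMap c) z) (S.betaFun c z ^ 2) (S.kMatrix c z) := by
  have ht : ∀ i : Fin m, basisVec (d := m + 1) i.succ = tailIncl m (basisVec i) := fun i => by
    ext j
    refine Fin.cases ?_ (fun j => ?_) j <;> simp [basisVec]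
  refine ⟨?_, fun i => ?_, fun i => ?_, fun i j => ?_⟩
  · rw [gramAlong, Matrix.of_apply, S.modelDeriv_collarMap_zero hz]
    exact S.h_radial _ hz.1 _
  · rw [gramAlong, Matrix.of_apply, S.modelDeriv_collarMap_zero hz, ht,
      S.modelDeriv_collarMap_tail hz]
    exact S.h_mixed _ hz.1 _ _
  · rw [gramAlong, Matrix.of_apply, metricAt_symm, S.modelDeriv_collarMap_zero hz, ht,
      S.modelDeriv_collarMap_tail hz]
    exact S.h_mixed _ hz.1 _ _
  · rw [gramAlong, Matrix.of_apply, ht, ht, S.modelDeriv_collarMap_tail hz,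
      S.modelDeriv_collarMap_tail hz]
    exact S.h_tangential _ hz.1 _ _ _

/-- The coordinates `(α², y)` as functions of `(α, y)`. -/
def sqCoords (z : EuclideanSpace ℝ (Fin (m + 1))) : ℝ × EuclideanSpace ℝ (Fin m) :=
  (z 0 ^ 2, tailProj m z)

omit [IsManifold (𝓡 m) ∞ Y] [IsManifold (𝓡∂ (m + 1)) ∞ X] in
lemma contDiff_coord {n : ℕ} (i : Fin n) :
    ContDiff ℝ ∞ fun z : EuclideanSpace ℝ (Fin n) => z i :=
  (EuclideanSpace.proj (𝕜 := ℝ) i).contDiff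

lemma contDiff_sqCoords : ContDiff ℝ ∞ (sqCoords (m := m)) :=
  ((contDiff_coord 0).pow 2).prodMk (tailProj m).contDiff

lemma mapsTo_sqCoords : MapsTo sqCoords (S.collarDomClosed c)
    (Ico 0 (S.ε ^ 2) ×ˢ (extChartAt (𝓡 m) c).target) :=
  fun _ hz => ⟨sq_mem_Ico hz.1, hz.2⟩

lemma contDiffOn_kMatrix (i j : Fin m) :
    ContDiffOn ℝ ∞ (fun z => S.kMatrix c z i j) (S.collarDomClosed c) :=
  (S.k_smooth c (basisVec i) (basisVec j)).comp contDiff_sqCoords.contDiffOn S.mapsTo_sqCoords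

lemma contDiffOn_betaFun : ContDiffOn ℝ ∞ (S.betaFun c) (S.collarDomClosed c) := by
  refine contMDiffOn_iff_contDiffOn.mp (S.βt_smooth.comp (s := S.collarDomClosed c)
    (f := fun z => (z 0 ^ 2, collarPoint c z)) ?_ fun z hz => ⟨sq_mem_Ico hz.1, mem_univ _⟩)
  refine ContMDiffOn.prodMk ?_ ?_
  · exact ((contDiff_coord 0).pow 2).contMDiff.contMDiffOn
  · exact ((contMDiffOn_extChartAt_symm c).comp (tailProj m).contDiff.contMDiff.contMDiffOn
      fun _ hz => hz.2)

lemma det_gramInChart_pos {d : ℕ} {H : Type*} [TopologicalSpace H]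
    {I : ModelWithCorners ℝ (EuclideanSpace ℝ (Fin d)) H}
    {M : Type*} [TopologicalSpace M] [ChartedSpace H M] [IsManifold I ∞ M] (h : SmoothMetric I M)
    {c : M} {z : EuclideanSpace ℝ (Fin d)} (hz : z ∈ (extChartAt I c).target) :
    0 < (gramInChart h c z).det := by
  have hD := isInvertible_mfderivWithin_extChartAt_symm (I := I) hz
  set D : EuclideanSpace ℝ (Fin d) →L[ℝ] EuclideanSpace ℝ (Fin d) :=
    (mfderivWithin 𝓘(ℝ, EuclideanSpace ℝ (Fin d)) I (extChartAt I c).symm (range I) z :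
      EuclideanSpace ℝ (Fin d) →L[ℝ] TangentSpace I ((extChartAt I c).symm z)) with hDef
  have hinj : Function.Injective D := hD.injective
  exact (bilinMatrix_comp_posDef (metricAt_symm h _) (metricAt_pos h _) hinj).det_pos

lemma neBot_nhdsWithin_collarDom (hz : z ∈ S.collarDomClosed c) (hz0 : z 0 = 0) :
    (nhdsWithin z (S.collarDom c)).NeBot := by
  rw [← mem_closure_iff_nhdsWithin_neBot]
  have h1 : Filter.Tendsto (fun t : ℝ => z + t • basisVec 0) (nhdsWithin 0 (Ioi 0)) (nhds z) := by
    have : Continuous fun t : ℝ => z + t • basisVec (d := m + 1) 0 := by fun_prop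
    have h2 := this.tendsto 0
    rw [zero_smul, add_zero] at h2
    exact h2.mono_left nhdsWithin_le_nhds
  refine mem_closure_of_tendsto h1 ?_
  filter_upwards [Ioo_mem_nhdsGT S.ε_pos] with t ht
  refine ⟨?_, ?_⟩
  · simpa [basisVec, hz0] using ht
  · simpa using hz.2

/-- The family `k(μ, y, dy)` is nondegenerate up to `μ = 0`. -/
lemma det_kMatrix_pos (hz : z ∈ S.collarDomClosed c) : 0 < (S.kMatrix c z).det := by
  rcases hz.1.1.eq_or_lt with hz0 | hz0
  swap
  · have hz' : z ∈ S.collarDom c := ⟨⟨hz0, hz.1.2⟩, hz.2⟩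
    have h1 := (S.isParam_collarMap.gramAlong_posDef S.h hz').det_pos
    rw [(S.isBlock_gramAlong hz').det_eq] at h1
    exact (pos_iff_pos_of_mul_pos h1).mp (pow_pos (S.betaFun_pos hz) 2)
  set I := 𝓡∂ (m + 1)
  set κ := S.collarMap c
  set x₀ := κ z with hx₀
  set T := extChartAt I x₀ ∘ κ with hT
  set v₀ := extChartAt I x₀ x₀ with hv₀
  set R : EuclideanSpace ℝ (Fin (m + 1)) → EuclideanSpace ℝ (Fin (m + 1)) :=
    S.collarInv c ∘ (extChartAt I x₀).symm with hR
  have hne := S.neBot_nhdsWithin_collarDom hz hz0.symm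
  set l := nhdsWithin z (S.collarDom c) with hl
  have hκc : Filter.Tendsto κ l (nhds x₀) :=
    ((S.contMDiffOn_collarMap.continuousOn z hz).mono S.collarDom_subset)
  have hTc : Filter.Tendsto T l (nhds v₀) := (continuousAt_extChartAt (I := I) x₀).tendsto.comp hκc
  have hsrc : ∀ᶠ w in l, w ∈ S.collarDom c ∧ κ w ∈ (extChartAt I x₀).source :=
    eventually_mem_nhdsWithin.and (hκc.eventually (extChartAt_source_mem_nhds x₀))
  have hTr : Filter.Tendsto T l (nhdsWithin v₀ (range I)) := by
    refine tendsto_nhdsWithin_iff.mpr ⟨hTc, ?_⟩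
    filter_upwards [hsrc] with w hw
    exact extChartAt_target_subset_range x₀ ((extChartAt I x₀).map_source hw.2)
  have hRs : ContDiffWithinAt ℝ ∞ R (range I) v₀ := by
    have h1 : ContMDiffWithinAt 𝓘(ℝ, EuclideanSpace ℝ (Fin (m + 1))) I ∞ (extChartAt I x₀).symm
        (range I) v₀ := contMDiffWithinAt_extChartAt_symm_range x₀ (mem_extChartAt_target x₀)
    have h2 : ContMDiffAt I 𝓘(ℝ, EuclideanSpace ℝ (Fin (m + 1))) ∞ (S.collarInv c)
        ((extChartAt I x₀).symm v₀) := by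
      rw [hv₀, extChartAt_to_inv]
      exact S.contMDiffAt_collarInv hz
    exact contMDiffWithinAt_iff_contDiffWithinAt.mp (h2.comp_contMDiffWithinAt _ h1)
  have hRd : Filter.Tendsto (fun w => (mapMatrix (fderivWithin ℝ R (range I) (T w))).det) l
      (nhds (mapMatrix (fderivWithin ℝ R (range I) v₀)).det) := by
    have h1 : ContinuousWithinAt (fderivWithin ℝ R (range I)) (range I) v₀ :=
      (hRs.fderivWithin_right (m := ∞) I.uniqueDiffOn (by simp)
        (mem_range_self _)).continuousWithinAt
    have h2 : Continuous fun A : EuclideanSpace ℝ (Fin (m + 1)) →L[ℝ]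
        EuclideanSpace ℝ (Fin (m + 1)) => (mapMatrix A).det := by
      refine Continuous.matrix_det (continuous_matrix fun i j => ?_)
      simp only [mapMatrix, Matrix.of_apply]
      exact (continuous_coord i).comp (continuous_id.clm_apply continuous_const)
    exact (h2.tendsto _).comp (h1.tendsto.comp hTr)
  have hGd : Filter.Tendsto (fun w => (gramInChart S.h x₀ (T w)).det) l
      (nhds (gramInChart S.h x₀ v₀).det) := by
    have h1 : ContinuousWithinAt (fun v => (gramInChart S.h x₀ v).det) (extChartAt I x₀).target v₀ :=
      (ContDiffOn.matrix_det (contDiffOn_gramInChart S.h x₀)).continuousOn v₀ (mem_extChartAt_target x₀)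
    refine h1.tendsto.comp (tendsto_nhdsWithin_iff.mpr ⟨hTc, ?_⟩)
    filter_upwards [hsrc] with w hw
    exact (extChartAt I x₀).map_source hw.2
  have hKd : Filter.Tendsto (fun w => S.betaFun c w ^ 2 * (S.kMatrix c w).det) l
      (nhds (S.betaFun c z ^ 2 * (S.kMatrix c z).det)) :=
    (((S.contDiffOn_betaFun.continuousOn.pow 2).mul
      (ContDiffOn.matrix_det S.contDiffOn_kMatrix).continuousOn) z hz).mono S.collarDom_subset
  have heq : ∀ᶠ w in l, S.betaFun c w ^ 2 * (S.kMatrix c w).det *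
      (mapMatrix (fderivWithin ℝ R (range I) (T w))).det ^ 2 = (gramInChart S.h x₀ (T w)).det := by
    filter_upwards [hsrc] with w hw
    have hTw := S.isParam_collarMap.chart_mem hw.1 hw.2
    have h1 := S.isParam_collarMap.gramAlong_eq_chart S.h hw.1 hw.2
    have h2 : (fderivWithin ℝ R (range I) (T w)).comp (fderiv ℝ T w) =
        ContinuousLinearMap.id ℝ _ := by
      rw [fderivWithin_of_mem_nhds (range_mem_nhds_of_mem_chartDom hTw)]
      have h3 : R ∘ T =ᶠ[nhds w] id := by
        filter_upwards [S.isParam_collarMap.eventually_source hw.1 hw.2] with y hy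
        change S.collarInv c ((extChartAt I x₀).symm (extChartAt I x₀ (κ y))) = y
        rw [(extChartAt I x₀).left_inv hy.2]
        exact S.collarInv_collarMap (S.collarDom_subset hy.1)
      have h4 : DifferentiableAt ℝ R (T w) := by
        have h5 : ContMDiffAt I 𝓘(ℝ, EuclideanSpace ℝ (Fin (m + 1))) ∞ (S.collarInv c)
            ((extChartAt I x₀).symm (T w)) := by
          rw [show (extChartAt I x₀).symm (T w) = κ w from (extChartAt I x₀).left_inv hw.2]
          exact S.contMDiffAt_collarInv (S.collarDom_subset hw.1)
        exact (contMDiffAt_iff_contDiffAt.mp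
          (h5.comp _ ((isParam_chart (I := I) x₀).contMDiffAt hTw))).differentiableAt (by simp)
      exact (h4.hasFDerivAt.comp w ((S.isParam_collarMap.contDiffAt_chart hw.1
        hw.2).differentiableAt (by simp)).hasFDerivAt).unique
        ((hasFDerivAt_id w).congr_of_eventuallyEq h3)
    have h3 := congrArg (fun A => (mapMatrix A).det) h2
    simp only [mapMatrix_comp, Matrix.det_mul, mapMatrix_id, Matrix.det_one] at h3
    rw [← (S.isBlock_gramAlong hw.1).det_eq, h1, Matrix.det_mul, Matrix.det_mul,
      Matrix.det_transpose, gramInChart_eq S.h hTw]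
    linear_combination (gramAlong S.h (extChartAt I x₀).symm (T w)).det *
      ((mapMatrix (fderivWithin ℝ R (range I) (T w))).det * (mapMatrix (fderiv ℝ T w)).det + 1) * h3
  have hlim := tendsto_nhds_unique ((hKd.mul (hRd.pow 2)).congr' heq) hGd
  have hpos := det_gramInChart_pos S.h (mem_extChartAt_target (I := I) x₀)
  rw [← hv₀, ← hlim] at hpos
  have h6 := pos_of_mul_pos_left hpos (sq_nonneg _)
  exact pos_of_mul_pos_right h6 (sq_nonneg _)

end StaticGeometry

section Phased

open Asymptotics Filter

variable {m : ℕ}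

/-- The set `U` lies in the half-space where the first coordinate is positive, and is contained in a
compact subset of the set `K` on which functions are required to be smooth. -/
structure IsPatch (K U : Set (EuclideanSpace ℝ (Fin (m + 1)))) : Prop where
  isOpen : IsOpen U
  pos : ∀ z ∈ U, 0 < z 0
  exists_compact : ∃ K₀, IsCompact K₀ ∧ U ⊆ K₀ ∧ K₀ ⊆ K
  uniqueDiffOn : UniqueDiffOn ℝ K

variable {K U : Set (EuclideanSpace ℝ (Fin (m + 1)))}
  {V : Type*} [NormedAddCommGroup V] [NormedSpace ℝ V]

omit [NormedSpace ℝ V] in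
lemma isBigO_one_of_continuousOn {F : EuclideanSpace ℝ (Fin (m + 1)) → V} {K₀ : Set _}
    (hK : IsCompact K₀) (hU : U ⊆ K₀) (hF : ContinuousOn F K₀) :
    F =O[𝓟 U] fun _ => (1 : ℝ) := by
  obtain ⟨C, hC⟩ := hK.exists_bound_of_continuousOn hF
  refine IsBigO.of_bound C ?_
  rw [eventually_principal]
  intro z hz
  simpa using hC z (hU hz)

namespace IsPatch

lemma mem_nhds (hU : IsPatch K U) {z} (hz : z ∈ U) : K ∈ nhds z := by
  obtain ⟨K₀, -, h1, h2⟩ := hU.exists_compact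
  exact mem_of_superset (hU.isOpen.mem_nhds hz) (h1.trans h2)

lemma subset (hU : IsPatch K U) : U ⊆ K := fun _ hz => mem_of_mem_nhds (hU.mem_nhds hz)

omit [NormedSpace ℝ V] in
lemma isBigO_one (hU : IsPatch K U) {F : EuclideanSpace ℝ (Fin (m + 1)) → V}
    (hF : ContinuousOn F K) : F =O[𝓟 U] fun _ => (1 : ℝ) := by
  obtain ⟨K₀, h0, h1, h2⟩ := hU.exists_compact
  exact isBigO_one_of_continuousOn h0 h1 (hF.mono h2)

lemma differentiableAt (hU : IsPatch K U) {F : EuclideanSpace ℝ (Fin (m + 1)) → V}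
    (hF : ContDiffOn ℝ ∞ F K) {z} (hz : z ∈ U) : DifferentiableAt ℝ F z :=
  (hF.contDiffAt (hU.mem_nhds hz)).differentiableAt (by simp)

lemma fderiv_isBigO_one (hU : IsPatch K U) {F : EuclideanSpace ℝ (Fin (m + 1)) → V}
    (hF : ContDiffOn ℝ ∞ F K) : (fderiv ℝ F) =O[𝓟 U] fun _ => (1 : ℝ) := by
  refine (hU.isBigO_one (hF.continuousOn_fderivWithin hU.uniqueDiffOn (by simp))).congr' ?_
    EventuallyEq.rfl
  rw [EventuallyEq, eventually_principal]
  exact fun z hz => fderivWithin_of_mem_nhds (hU.mem_nhds hz)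

lemma phase_isBigO (hU : IsPatch K U) (a : ℂ) :
    (fun z : EuclideanSpace ℝ (Fin (m + 1)) => (z 0 : ℂ) ^ a) =O[𝓟 U] fun z => z 0 ^ a.re := by
  refine IsBigO.of_bound 1 ?_
  rw [eventually_principal]
  intro z hz
  rw [Complex.norm_cpow_eq_rpow_re_of_pos (hU.pos z hz), one_mul]
  exact Real.le_norm_self _

end IsPatch

lemma hasFDerivAt_phase {z : EuclideanSpace ℝ (Fin (m + 1))} (hz : 0 < z 0) (a : ℂ) :
    HasFDerivAt (fun z : EuclideanSpace ℝ (Fin (m + 1)) => (z 0 : ℂ) ^ a)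
      ((EuclideanSpace.proj (𝕜 := ℝ) (0 : Fin (m + 1))).smulRight (a * (z 0 : ℂ)⁻¹ * (z 0 : ℂ) ^ a))
      z := by
  have hne : (z 0 : ℂ) ≠ 0 := Complex.ofReal_ne_zero.mpr hz.ne'
  have h1 : HasDerivAt (fun w : ℂ => w ^ a) (a * (z 0 : ℂ) ^ (a - 1)) (z 0 : ℂ) := by
    simpa using (hasDerivAt_id (z 0 : ℂ)).cpow_const (c := a) (Complex.ofReal_mem_slitPlane.mpr hz)
  have h2 := h1.comp_ofReal
  have h3 : a * (z 0 : ℂ) ^ (a - 1) = a * (z 0 : ℂ)⁻¹ * (z 0 : ℂ) ^ a := by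
    rw [Complex.cpow_sub _ _ hne, Complex.cpow_one]
    field_simp
  rw [h3] at h2
  exact h2.hasFDerivAt.comp z (EuclideanSpace.proj (𝕜 := ℝ) (0 : Fin (m + 1))).hasFDerivAt

variable [NormedSpace ℂ V] [IsScalarTower ℝ ℂ V]

/-- `f` is the product of the complex power `z₀ ^ a` and of a function that is smooth on `K`. -/
def Phased (K U : Set (EuclideanSpace ℝ (Fin (m + 1)))) (a : ℂ)
    (f : EuclideanSpace ℝ (Fin (m + 1)) → V) : Prop :=
  ∃ F : EuclideanSpace ℝ (Fin (m + 1)) → V, ContDiffOn ℝ ∞ F K ∧ ∀ z ∈ U, f z = (z 0 : ℂ) ^ a • F z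

namespace Phased

variable {a : ℂ} {f g : EuclideanSpace ℝ (Fin (m + 1)) → V}

omit [IsScalarTower ℝ ℂ V] in
lemma add (hf : Phased K U a f) (hg : Phased K U a g) : Phased K U a fun z => f z + g z := by
  obtain ⟨F, hF, h1⟩ := hf
  obtain ⟨G, hG, h2⟩ := hg
  exact ⟨fun z => F z + G z, hF.add hG, fun z hz => by simp only [h1 z hz, h2 z hz, smul_add]⟩

lemma smul (hf : Phased K U a f) {b : EuclideanSpace ℝ (Fin (m + 1)) → ℂ}
    (hb : ContDiffOn ℝ ∞ b K) : Phased K U a fun z => b z • f z := by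
  obtain ⟨F, hF, h1⟩ := hf
  exact ⟨fun z => b z • F z, hb.smul hF, fun z hz => by simp only [h1 z hz]; rw [smul_comm]⟩

/-- Pairing with a constant form, with coefficients that are smooth on `K`. -/
lemma pairing {n k : ℕ}
    {f : EuclideanSpace ℝ (Fin (m + 1)) → EuclideanSpace ℝ (Fin n) [⋀^Fin k]→L[ℝ] ℂ}
    (hf : Phased K U a f) (hpos : ∀ z ∈ U, 0 < z 0)
    {ρ : EuclideanSpace ℝ (Fin (m + 1)) → ℝ} (hρ : ContDiffOn ℝ ∞ ρ K)
    {G : EuclideanSpace ℝ (Fin (m + 1)) → Matrix (Fin n) (Fin n) ℝ}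
    (hG : ∀ i j, ContDiffOn ℝ ∞ (fun z => G z i j) K)
    (e : EuclideanSpace ℝ (Fin n) [⋀^Fin k]→L[ℝ] ℂ) :
    Phased K U ((starRingEnd ℂ) a) fun z => (ρ z : ℂ) * altInner (G z) e (f z) := by
  obtain ⟨F, hF, h1⟩ := hf
  refine ⟨fun z => (ρ z : ℂ) * altInner (G z) e (F z),
    (Complex.ofRealCLM.contDiff.comp_contDiffOn hρ).mul (ContDiffOn.altInner hG contDiffOn_const hF),
    fun z hz => ?_⟩
  simp only [h1 z hz]
  rw [altInner_smul_right, Complex.cpow_conj _ _ (by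
    rw [Complex.arg_ofReal_of_nonneg (hpos z hz).le]; exact Real.pi_pos.ne), Complex.conj_ofReal,
    smul_eq_mul]
  ring

omit [IsScalarTower ℝ ℂ V] in
lemma isBigO (hf : Phased K U a f) (hU : IsPatch K U) : f =O[𝓟 U] fun z => z 0 ^ a.re := by
  obtain ⟨F, hF, h1⟩ := hf
  have h2 := (hU.phase_isBigO a).smul (hU.isBigO_one hF.continuousOn)
  refine (h2.congr' ?_ ?_)
  · rw [EventuallyEq, eventually_principal]
    exact fun z hz => (h1 z hz).symm
  · simp

lemma hasFDerivAt {F : EuclideanSpace ℝ (Fin (m + 1)) → V} (hU : IsPatch K U)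
    (hF : ContDiffOn ℝ ∞ F K) (h1 : ∀ z ∈ U, f z = (z 0 : ℂ) ^ a • F z) {z} (hz : z ∈ U) :
    HasFDerivAt f ((z 0 : ℂ) ^ a • fderiv ℝ F z +
      ((EuclideanSpace.proj (𝕜 := ℝ) (0 : Fin (m + 1))).smulRight
        (a * (z 0 : ℂ)⁻¹ * (z 0 : ℂ) ^ a)).smulRight (F z)) z := by
  refine ((hasFDerivAt_phase (hU.pos z hz) a).smul (hU.differentiableAt hF hz).hasFDerivAt).congr_of_eventuallyEq ?_
  filter_upwards [hU.isOpen.mem_nhds hz] with w hw using h1 w hw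

lemma differentiableAt (hf : Phased K U a f) (hU : IsPatch K U) {z} (hz : z ∈ U) :
    DifferentiableAt ℝ f z := by
  obtain ⟨F, hF, h1⟩ := hf
  exact (hasFDerivAt hU hF h1 hz).differentiableAt

lemma fderiv_tail_isBigO (hf : Phased K U a f) (hU : IsPatch K U) :
    (fun z => (fderiv ℝ f z).comp (tailIncl m)) =O[𝓟 U] fun z => z 0 ^ a.re := by
  obtain ⟨F, hF, h1⟩ := hf
  have h2 : (fun z => (fderiv ℝ F z).comp (tailIncl m)) =O[𝓟 U] fun _ => (1 : ℝ) :=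
    (((ContinuousLinearMap.compL ℝ (EuclideanSpace ℝ (Fin m)) (EuclideanSpace ℝ (Fin (m + 1)))
      V).flip (tailIncl m)).isBigO_comp _ _).trans (hU.fderiv_isBigO_one hF)
  refine ((hU.phase_isBigO a).smul h2).congr' ?_ (by simp)
  rw [EventuallyEq, eventually_principal]
  intro z hz
  rw [(hasFDerivAt hU hF h1 hz).fderiv]
  ext v
  simp

lemma fderiv_zero_isBigO (hf : Phased K U a f) (hU : IsPatch K U) :
    (fun z => fderiv ℝ f z (basisVec 0) - (a * (z 0 : ℂ)⁻¹) • f z) =O[𝓟 U]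
      fun z => z 0 ^ a.re := by
  obtain ⟨F, hF, h1⟩ := hf
  have h2 : (fun z => fderiv ℝ F z (basisVec 0)) =O[𝓟 U] fun _ => (1 : ℝ) :=
    ((ContinuousLinearMap.apply ℝ V (basisVec (d := m + 1) 0)).isBigO_comp _ _).trans
      (hU.fderiv_isBigO_one hF)
  refine ((hU.phase_isBigO a).smul h2).congr' ?_ (by simp)
  rw [EventuallyEq, eventually_principal]
  intro z hz
  rw [(hasFDerivAt hU hF h1 hz).fderiv, h1 z hz]
  simp [basisVec, smul_smul]

lemma smul_fderiv_zero_isBigO (hf : Phased K U a f) (hU : IsPatch K U)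
    (hr : (fun z : EuclideanSpace ℝ (Fin (m + 1)) => (z 0 : ℂ)) =O[𝓟 U] fun _ => (1 : ℝ)) :
    (fun z => (z 0 : ℂ) • fderiv ℝ f z (basisVec 0)) =O[𝓟 U] fun z => z 0 ^ a.re := by
  have h1 : (fun z => (z 0 : ℂ) • (fderiv ℝ f z (basisVec 0) - (a * (z 0 : ℂ)⁻¹) • f z)) =O[𝓟 U]
      fun z => z 0 ^ a.re := (hr.smul (hf.fderiv_zero_isBigO hU)).congr_right (by simp)
  have h2 : (fun z => a • f z) =O[𝓟 U] fun z => z 0 ^ a.re := (hf.isBigO hU).const_smul_left a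
  refine (h1.add h2).congr' ?_ EventuallyEq.rfl
  rw [EventuallyEq, eventually_principal]
  intro z hz
  have : (z 0 : ℂ) ≠ 0 := Complex.ofReal_ne_zero.mpr (hU.pos z hz).ne'
  rw [smul_sub, smul_smul, mul_left_comm, mul_inv_cancel₀ this, mul_one, sub_add_cancel]

end Phased

end Phased

section PartsOfDerivative

variable {m k : ℕ}

/-- `tangPart` as a continuous linear map. -/
def tangCLM (m k : ℕ) : (EuclideanSpace ℝ (Fin (m + 1)) [⋀^Fin k]→L[ℝ] ℂ) →L[ℝ]
    (EuclideanSpace ℝ (Fin m) [⋀^Fin k]→L[ℝ] ℂ) :=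
  ContinuousAlternatingMap.compContinuousLinearMapCLM (tailIncl m)

/-- `normPart` as a continuous linear map. -/
def normCLM (m k : ℕ) : (EuclideanSpace ℝ (Fin (m + 1)) [⋀^Fin (k + 1)]→L[ℝ] ℂ) →L[ℝ]
    (EuclideanSpace ℝ (Fin m) [⋀^Fin k]→L[ℝ] ℂ) :=
  (ContinuousAlternatingMap.compContinuousLinearMapCLM (tailIncl m)).comp
    ((ContinuousLinearMap.apply ℝ _ (basisVec (d := m + 1) 0)).comp
      (ContinuousAlternatingMap.curryLeftLI (n := k) (𝕜 := ℝ)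
        (E := EuclideanSpace ℝ (Fin (m + 1))) (F := ℂ)).toContinuousLinearMap)

lemma tangCLM_apply (ζ : EuclideanSpace ℝ (Fin (m + 1)) [⋀^Fin k]→L[ℝ] ℂ) :
    tangCLM m k ζ = tangPart ζ := rfl

lemma normCLM_apply (ζ : EuclideanSpace ℝ (Fin (m + 1)) [⋀^Fin (k + 1)]→L[ℝ] ℂ) :
    normCLM m k ζ = normPart ζ := rfl

lemma tangPart_add (ζ η : EuclideanSpace ℝ (Fin (m + 1)) [⋀^Fin k]→L[ℝ] ℂ) :
    tangPart (ζ + η) = tangPart ζ + tangPart η := rfl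

lemma normPart_add (ζ η : EuclideanSpace ℝ (Fin (m + 1)) [⋀^Fin (k + 1)]→L[ℝ] ℂ) :
    normPart (ζ + η) = normPart ζ + normPart η := rfl

lemma tangPart_smul (c : ℂ) (ζ : EuclideanSpace ℝ (Fin (m + 1)) [⋀^Fin k]→L[ℝ] ℂ) :
    tangPart (c • ζ) = c • tangPart ζ := rfl

lemma normPart_smul (c : ℂ) (ζ : EuclideanSpace ℝ (Fin (m + 1)) [⋀^Fin (k + 1)]→L[ℝ] ℂ) :
    normPart (c • ζ) = c • normPart ζ := rfl

lemma tangPart_apply (ζ : EuclideanSpace ℝ (Fin (m + 1)) [⋀^Fin k]→L[ℝ] ℂ)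
    (v : Fin k → EuclideanSpace ℝ (Fin m)) : tangPart ζ v = ζ (fun a => tailIncl m (v a)) := rfl

lemma normPart_apply (ζ : EuclideanSpace ℝ (Fin (m + 1)) [⋀^Fin (k + 1)]→L[ℝ] ℂ)
    (v : Fin k → EuclideanSpace ℝ (Fin m)) :
    normPart ζ v = ζ (Matrix.vecCons (basisVec 0) fun a => tailIncl m (v a)) := rfl

lemma tangPart_alternatize (L : EuclideanSpace ℝ (Fin (m + 1)) →L[ℝ]
      EuclideanSpace ℝ (Fin (m + 1)) [⋀^Fin k]→L[ℝ] ℂ) :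
    tangPart (ContinuousAlternatingMap.alternatizeUncurryFin L) =
      ContinuousAlternatingMap.alternatizeUncurryFin (((tangCLM m k).comp L).comp (tailIncl m)) := by
  ext v
  simp only [tangPart_apply, ContinuousAlternatingMap.alternatizeUncurryFin_apply]
  rfl

lemma normPart_alternatize_zero (L : EuclideanSpace ℝ (Fin (m + 1)) →L[ℝ]
      EuclideanSpace ℝ (Fin (m + 1)) [⋀^Fin 0]→L[ℝ] ℂ) :
    normPart (ContinuousAlternatingMap.alternatizeUncurryFin L) = tangPart (L (basisVec 0)) := by
  ext v
  simp only [normPart_apply, tangPart_apply, ContinuousAlternatingMap.alternatizeUncurryFin_apply]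
  simp

lemma normPart_alternatize_succ (L : EuclideanSpace ℝ (Fin (m + 1)) →L[ℝ]
      EuclideanSpace ℝ (Fin (m + 1)) [⋀^Fin (k + 1)]→L[ℝ] ℂ) :
    normPart (ContinuousAlternatingMap.alternatizeUncurryFin L) = tangPart (L (basisVec 0)) -
      ContinuousAlternatingMap.alternatizeUncurryFin (((normCLM m k).comp L).comp (tailIncl m)) := by
  ext v
  simp only [normPart_apply, tangPart_apply, ContinuousAlternatingMap.alternatizeUncurryFin_apply,
    ContinuousAlternatingMap.sub_apply]
  rw [Fin.sum_univ_succ, sub_eq_add_neg, ← Finset.sum_neg_distrib]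
  congr 1
  · simp only [Fin.val_zero, pow_zero, one_smul]
    rfl
  · refine Finset.sum_congr rfl fun i _ => ?_
    rw [Fin.val_succ, pow_succ, mul_neg_one, neg_smul]
    congr 2
    simp only [ContinuousLinearMap.comp_apply, normCLM_apply, normPart_apply]
    congr 1
    funext a
    refine Fin.cases ?_ (fun a => ?_) a
    · simp [Fin.removeNth]
    · simp [Fin.removeNth]

variable {f : EuclideanSpace ℝ (Fin (m + 1)) → EuclideanSpace ℝ (Fin (m + 1)) [⋀^Fin k]→L[ℝ] ℂ}
  {z : EuclideanSpace ℝ (Fin (m + 1))}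

lemma fderiv_tangPart (hf : DifferentiableAt ℝ f z) :
    fderiv ℝ (fun w => tangPart (f w)) z = (tangCLM m k).comp (fderiv ℝ f z) :=
  ((tangCLM m k).hasFDerivAt.comp z hf.hasFDerivAt).fderiv

lemma fderiv_normPart
    {f : EuclideanSpace ℝ (Fin (m + 1)) → EuclideanSpace ℝ (Fin (m + 1)) [⋀^Fin (k + 1)]→L[ℝ] ℂ}
    (hf : DifferentiableAt ℝ f z) :
    fderiv ℝ (fun w => normPart (f w)) z = (normCLM m k).comp (fderiv ℝ f z) :=
  ((normCLM m k).hasFDerivAt.comp z hf.hasFDerivAt).fderiv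

lemma tangPart_extDeriv (hf : DifferentiableAt ℝ f z) :
    tangPart (extDeriv f z) = ContinuousAlternatingMap.alternatizeUncurryFin
      ((fderiv ℝ (fun w => tangPart (f w)) z).comp (tailIncl m)) := by
  rw [extDeriv, tangPart_alternatize, fderiv_tangPart hf]

lemma normPart_extDeriv_zero
    {f : EuclideanSpace ℝ (Fin (m + 1)) → EuclideanSpace ℝ (Fin (m + 1)) [⋀^Fin 0]→L[ℝ] ℂ}
    (hf : DifferentiableAt ℝ f z) :
    normPart (extDeriv f z) = fderiv ℝ (fun w => tangPart (f w)) z (basisVec 0) := by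
  rw [extDeriv, normPart_alternatize_zero, fderiv_tangPart hf]
  rfl

lemma normPart_extDeriv_succ
    {f : EuclideanSpace ℝ (Fin (m + 1)) → EuclideanSpace ℝ (Fin (m + 1)) [⋀^Fin (k + 1)]→L[ℝ] ℂ}
    (hf : DifferentiableAt ℝ f z) :
    normPart (extDeriv f z) = fderiv ℝ (fun w => tangPart (f w)) z (basisVec 0) -
      ContinuousAlternatingMap.alternatizeUncurryFin
        ((fderiv ℝ (fun w => normPart (f w)) z).comp (tailIncl m)) := by
  rw [extDeriv, normPart_alternatize_succ, fderiv_tangPart hf, fderiv_normPart hf]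
  rfl

lemma hasFDerivAt_coord_smul {V : Type*} [NormedAddCommGroup V] [NormedSpace ℝ V] [NormedSpace ℂ V]
    [IsScalarTower ℝ ℂ V] {f : EuclideanSpace ℝ (Fin (m + 1)) → V} (hf : DifferentiableAt ℝ f z) :
    HasFDerivAt (fun w : EuclideanSpace ℝ (Fin (m + 1)) => (w 0 : ℂ) • f w)
      ((z 0 : ℂ) • fderiv ℝ f z +
        (Complex.ofRealCLM.comp (EuclideanSpace.proj (𝕜 := ℝ) (0 : Fin (m + 1)))).smulRight (f z)) z :=
  (Complex.ofRealCLM.comp (EuclideanSpace.proj (𝕜 := ℝ) (0 : Fin (m + 1)))).hasFDerivAt.smul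
    hf.hasFDerivAt

lemma fderiv_coord_smul_tail {V : Type*} [NormedAddCommGroup V] [NormedSpace ℝ V] [NormedSpace ℂ V]
    [IsScalarTower ℝ ℂ V] {f : EuclideanSpace ℝ (Fin (m + 1)) → V} (hf : DifferentiableAt ℝ f z) :
    (fderiv ℝ (fun w : EuclideanSpace ℝ (Fin (m + 1)) => (w 0 : ℂ) • f w) z).comp (tailIncl m) =
      (z 0 : ℂ) • (fderiv ℝ f z).comp (tailIncl m) := by
  rw [(hasFDerivAt_coord_smul hf).fderiv]
  ext v
  change (z 0 : ℂ) • fderiv ℝ f z (tailIncl m v) + ((tailIncl m v 0 : ℝ) : ℂ) • f z =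
    (z 0 : ℂ) • fderiv ℝ f z (tailIncl m v)
  rw [tailIncl_zero, Complex.ofReal_zero, zero_smul, add_zero]

end PartsOfDerivative

section Conormal

open Asymptotics Filter

variable {m : ℕ}

/-- A family of alternating forms of all degrees on Euclidean space. -/
abbrev CoordForms (m : ℕ) : Type :=
  (k : ℕ) → EuclideanSpace ℝ (Fin (m + 1)) →
    EuclideanSpace ℝ (Fin (m + 1)) [⋀^Fin k]→L[ℝ] ℂ

/-- The behaviour near the boundary `z₀ = 0` of the coordinate expressions of a pair of forms in the
space `C^∞_(σ)`. -/
structure ConormalPair (K U : Set (EuclideanSpace ℝ (Fin (m + 1)))) (a : ℂ) (b : ℝ)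
    (ξ η : CoordForms m) : Prop where
  diff_left : ∀ k, ∀ z ∈ U, DifferentiableAt ℝ (ξ k) z
  diff_right : ∀ k, ∀ z ∈ U, DifferentiableAt ℝ (η k) z
  tang_left : ∀ k, Phased K U a fun z => tangPart (ξ k z)
  norm_left : ∀ k, Phased K U a fun z => (z 0 : ℂ) • normPart (ξ (k + 1) z)
  tang_right : ∀ k, Phased K U a fun z => (z 0 : ℂ) • tangPart (η k z)
  norm_right : ∀ k, Phased K U a fun z => normPart (η (k + 1) z)
  cancel : ∀ k, Phased K U a fun z => (z 0 : ℂ)⁻¹ • ((z 0 : ℂ) • normPart (ξ (k + 1) z) -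
    (b : ℂ) • (z 0 : ℂ) • tangPart (η k z))

/-- The exterior derivative of a family of forms of all degrees. -/
def CoordForms.d (ξ : CoordForms m) : CoordForms m
  | 0 => 0
  | k + 1 => extDeriv (ξ k)

/-- Multiplication by the first coordinate. -/
def CoordForms.mulCoord (ξ : CoordForms m) : CoordForms m := fun k z => (z 0 : ℂ) • ξ k z

variable {K U : Set (EuclideanSpace ℝ (Fin (m + 1)))} {a : ℂ} {b : ℝ} {ξ η : CoordForms m}

lemma IsPatch.coord_isBigO (hU : IsPatch K U) :
    (fun z : EuclideanSpace ℝ (Fin (m + 1)) => (z 0 : ℂ)) =O[𝓟 U] fun _ => (1 : ℝ) :=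
  hU.isBigO_one (Complex.continuous_ofReal.comp (StaticGeometry.continuous_coord 0)).continuousOn

lemma isBigO_alternatize {k : ℕ} {g : EuclideanSpace ℝ (Fin (m + 1)) → ℝ}
    {f : EuclideanSpace ℝ (Fin (m + 1)) →
      EuclideanSpace ℝ (Fin m) →L[ℝ] EuclideanSpace ℝ (Fin m) [⋀^Fin k]→L[ℝ] ℂ}
    (hf : f =O[𝓟 U] g) :
    (fun z => ContinuousAlternatingMap.alternatizeUncurryFin (f z)) =O[𝓟 U] g := by
  obtain ⟨C, hC⟩ := hf.bound
  refine IsBigO.of_bound ((k + 1) * C) (hC.mono fun z hz => ?_)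
  refine (ContinuousAlternatingMap.norm_alternatizeUncurryFin_le (f z)).trans ?_
  rw [mul_assoc]
  exact mul_le_mul_of_nonneg_left hz (by positivity)

lemma isBigO_congr_on {V : Type*} [NormedAddCommGroup V] {g : EuclideanSpace ℝ (Fin (m + 1)) → ℝ}
    {f f' : EuclideanSpace ℝ (Fin (m + 1)) → V} (hf : f =O[𝓟 U] g) (h : ∀ z ∈ U, f' z = f z) :
    f' =O[𝓟 U] g :=
  hf.congr' (by rw [EventuallyEq, eventually_principal]; exact fun z hz => (h z hz).symm)
    EventuallyEq.rfl

namespace ConormalPair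

variable (h : ConormalPair K U a b ξ η) (hU : IsPatch K U)
include h hU

lemma tangPart_d_left (k : ℕ) :
    (fun z => tangPart (ξ.d k z)) =O[𝓟 U] fun z => z 0 ^ a.re := by
  cases k with
  | zero => exact (isBigO_zero _ _).congr_left fun _ => rfl
  | succ k =>
    refine isBigO_congr_on (isBigO_alternatize ((h.tang_left k).fderiv_tail_isBigO hU))
      fun z hz => ?_
    exact tangPart_extDeriv (h.diff_left k z hz)

lemma normPart_d_left (k : ℕ) :
    (fun z => (z 0 : ℂ) • normPart (ξ.d (k + 1) z)) =O[𝓟 U] fun z => z 0 ^ a.re := by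
  have h1 := (h.tang_left k).smul_fderiv_zero_isBigO hU hU.coord_isBigO
  cases k with
  | zero =>
    refine isBigO_congr_on h1 fun z hz => ?_
    rw [CoordForms.d, normPart_extDeriv_zero (h.diff_left 0 z hz)]
  | succ k =>
    refine isBigO_congr_on (h1.sub (isBigO_alternatize ((h.norm_left k).fderiv_tail_isBigO hU)))
      fun z hz => ?_
    have hs : (fderiv ℝ (fun w => (w 0 : ℂ) • normPart (ξ (k + 1) w)) z).comp (tailIncl m) =
        (z 0 : ℂ) • (fderiv ℝ (fun w => normPart (ξ (k + 1) w)) z).comp (tailIncl m) :=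
      fderiv_coord_smul_tail
        (((normCLM m k).differentiableAt (x := ξ (k + 1) z)).comp z (h.diff_left (k + 1) z hz))
    rw [CoordForms.d, normPart_extDeriv_succ (h.diff_left (k + 1) z hz), hs,
      ContinuousAlternatingMap.alternatizeUncurryFin_smul, smul_sub]

omit hU in
lemma diff_mulCoord (k : ℕ) {z} (hz : z ∈ U) : DifferentiableAt ℝ (η.mulCoord k) z :=
  (hasFDerivAt_coord_smul (h.diff_right k z hz)).differentiableAt

lemma tangPart_combination (c : ℂ) (k : ℕ) :
    (fun z => tangPart (c • ξ k z - η.mulCoord.d k z)) =O[𝓟 U] fun z => z 0 ^ a.re := by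
  have h1 : (fun z => c • tangPart (ξ k z)) =O[𝓟 U] fun z => z 0 ^ a.re :=
    ((h.tang_left k).isBigO hU).const_smul_left c
  cases k with
  | zero =>
    refine isBigO_congr_on h1 fun z _ => ?_
    rw [CoordForms.d, Pi.zero_apply, sub_zero, tangPart_smul]
  | succ k =>
    refine isBigO_congr_on (h1.sub (isBigO_alternatize ((h.tang_right k).fderiv_tail_isBigO hU)))
      fun z hz => ?_
    rw [← tangCLM_apply, map_sub, tangCLM_apply, tangCLM_apply, tangPart_smul, CoordForms.d,
      tangPart_extDeriv (h.diff_mulCoord k hz)]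
    rfl

lemma normPart_combination {c : ℂ} (hc : a = c * b) (k : ℕ) :
    (fun z => normPart (c • ξ (k + 1) z - η.mulCoord.d (k + 1) z)) =O[𝓟 U]
      fun z => z 0 ^ a.re := by
  have h1 : (fun z => c • normPart (ξ (k + 1) z) -
      fderiv ℝ (fun w => tangPart (η.mulCoord k w)) z (basisVec 0)) =O[𝓟 U]
      fun z => z 0 ^ a.re := by
    have h2 := (((h.cancel k).isBigO hU).const_smul_left c).sub
      ((h.tang_right k).fderiv_zero_isBigO hU)
    refine isBigO_congr_on h2 fun z hz => ?_
    have hz0 : (z 0 : ℂ) ≠ 0 := Complex.ofReal_ne_zero.mpr (hU.pos z hz).ne'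
    have e1 : (z 0 : ℂ)⁻¹ • ((z 0 : ℂ) • normPart (ξ (k + 1) z) -
        (b : ℂ) • (z 0 : ℂ) • tangPart (η k z)) = normPart (ξ (k + 1) z) - (b : ℂ) • tangPart (η k z) := by
      rw [smul_sub, smul_smul, inv_mul_cancel₀ hz0, one_smul, smul_comm (b : ℂ), smul_smul,
        inv_mul_cancel₀ hz0, one_smul]
    rw [Pi.smul_apply, e1, hc, smul_smul, mul_assoc, inv_mul_cancel₀ hz0, mul_one, smul_sub, smul_smul]
    change _ = c • normPart (ξ (k + 1) z) - (c * (b : ℂ)) • tangPart (η k z) -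
      (fderiv ℝ (fun w => tangPart (η.mulCoord k w)) z (basisVec 0) - (c * (b : ℂ)) • tangPart (η k z))
    abel
  cases k with
  | zero =>
    refine isBigO_congr_on h1 fun z hz => ?_
    rw [← normCLM_apply, map_sub, normCLM_apply, normCLM_apply, normPart_smul, CoordForms.d,
      normPart_extDeriv_zero (h.diff_mulCoord 0 hz)]
  | succ k =>
    have hs : ∀ z ∈ U, (fderiv ℝ (fun w => normPart (η.mulCoord (k + 1) w)) z).comp (tailIncl m) =
        (z 0 : ℂ) • (fderiv ℝ (fun w => normPart (η (k + 1) w)) z).comp (tailIncl m) := fun z hz =>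
      fderiv_coord_smul_tail
        (((normCLM m k).differentiableAt (x := η (k + 1) z)).comp z (h.diff_right (k + 1) z hz))
    have h3 : (fun z => (z 0 : ℂ) •
        (fderiv ℝ (fun w => normPart (η (k + 1) w)) z).comp (tailIncl m)) =O[𝓟 U]
        fun z => z 0 ^ a.re :=
      (hU.coord_isBigO.smul ((h.norm_right k).fderiv_tail_isBigO hU)).congr_right (by simp)
    refine isBigO_congr_on (h1.add (isBigO_alternatize h3)) fun z hz => ?_
    rw [← normCLM_apply, map_sub, normCLM_apply, normCLM_apply, normPart_smul, CoordForms.d,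
      normPart_extDeriv_succ (h.diff_mulCoord (k + 1) hz), hs z hz]
    abel

end ConormalPair

end Conormal

section BlockPairing

open Asymptotics Filter

variable {m k : ℕ}

lemma tangPart_coordWedge_zero (e : EuclideanSpace ℝ (Fin (m + 1)) [⋀^Fin k]→L[ℝ] ℂ) :
    tangPart (coordWedge 0 e) = 0 := by
  ext v
  simp [coordWedge, tangPart_apply, ContinuousAlternatingMap.alternatizeUncurryFin_apply]

lemma normPart_coordWedge_zero (e : EuclideanSpace ℝ (Fin (m + 1)) [⋀^Fin k]→L[ℝ] ℂ) :
    normPart (coordWedge 0 e) = tangPart e := by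
  ext v
  rw [normPart_apply, coordWedge, ContinuousAlternatingMap.alternatizeUncurryFin_apply,
    Fin.sum_univ_succ]
  simp [basisVec, tangPart_apply]

/-- The pairing of forms, decomposed into tangential and normal parts, with weights `ρ`, `ρ'`. -/
def blockPairing (ρ ρ' : EuclideanSpace ℝ (Fin (m + 1)) → ℝ)
    (G : EuclideanSpace ℝ (Fin (m + 1)) → Matrix (Fin m) (Fin m) ℝ) : (k : ℕ) →
    (EuclideanSpace ℝ (Fin (m + 1)) [⋀^Fin k]→L[ℝ] ℂ) →
    (EuclideanSpace ℝ (Fin (m + 1)) → EuclideanSpace ℝ (Fin (m + 1)) [⋀^Fin k]→L[ℝ] ℂ) →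
    EuclideanSpace ℝ (Fin (m + 1)) → ℂ
  | 0, e, ζ, z => ρ z * altInner (G z) (tangPart e) (tangPart (ζ z))
  | _ + 1, e, ζ, z => ρ z * altInner (G z) (tangPart e) (tangPart (ζ z)) +
      ρ' z * altInner (G z) (normPart e) (normPart (ζ z))

variable {K U : Set (EuclideanSpace ℝ (Fin (m + 1)))} {a : ℂ} {b : ℝ} {ξ η : CoordForms m}
  {ρ ρ' : EuclideanSpace ℝ (Fin (m + 1)) → ℝ}
  {G : EuclideanSpace ℝ (Fin (m + 1)) → Matrix (Fin m) (Fin m) ℝ}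

lemma blockPairing_lin (e : EuclideanSpace ℝ (Fin (m + 1)) [⋀^Fin k]→L[ℝ] ℂ)
    (ζ θ : EuclideanSpace ℝ (Fin (m + 1)) → EuclideanSpace ℝ (Fin (m + 1)) [⋀^Fin k]→L[ℝ] ℂ)
    (c c' : ℂ) (z : EuclideanSpace ℝ (Fin (m + 1))) :
    blockPairing ρ ρ' G k e (fun z => c • ζ z + c' • θ z) z =
      (starRingEnd ℂ) c * blockPairing ρ ρ' G k e ζ z +
        (starRingEnd ℂ) c' * blockPairing ρ ρ' G k e θ z := by
  cases k with
  | zero =>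
    simp only [blockPairing, tangPart_add, tangPart_smul, altInner_add_right, altInner_smul_right]
    ring
  | succ k =>
    simp only [blockPairing, tangPart_add, tangPart_smul, normPart_add, normPart_smul,
      altInner_add_right, altInner_smul_right]
    ring

lemma isBigO_tail_sum {f : Fin m → EuclideanSpace ℝ (Fin (m + 1)) → ℂ} (hU : IsPatch K U)
    (hf : ∀ i, Phased K U a (f i)) :
    (fun z => ∑ i, fderiv ℝ (f i) z (basisVec i.succ)) =O[𝓟 U] fun z => z 0 ^ a.re := by
  have ht : ∀ i : Fin m, basisVec (d := m + 1) i.succ = tailIncl m (basisVec i) := fun i => by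
    ext j
    refine Fin.cases ?_ (fun j => ?_) j <;> simp [basisVec]
  refine IsBigO.fun_sum fun i _ => ?_
  rw [ht]
  exact ((ContinuousLinearMap.apply ℝ ℂ (basisVec i)).isBigO_comp
    (fun z => (fderiv ℝ (f i) z).comp (tailIncl m)) (𝓟 U)).trans ((hf i).fderiv_tail_isBigO hU)

lemma phased_blockPairing_succ (hpos : ∀ z ∈ U, 0 < z 0) (hρ : ContDiffOn ℝ ∞ ρ K)
    (hρ' : ContDiffOn ℝ ∞ ρ' K) (hG : ∀ i j, ContDiffOn ℝ ∞ (fun z => G z i j) K)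
    {ζ : EuclideanSpace ℝ (Fin (m + 1)) → EuclideanSpace ℝ (Fin (m + 1)) [⋀^Fin (k + 1)]→L[ℝ] ℂ}
    (hT : Phased K U a fun z => tangPart (ζ z)) (hN : Phased K U a fun z => normPart (ζ z))
    (e : EuclideanSpace ℝ (Fin (m + 1)) [⋀^Fin (k + 1)]→L[ℝ] ℂ) :
    Phased K U ((starRingEnd ℂ) a) (blockPairing ρ ρ' G (k + 1) e ζ) :=
  (hT.pairing hpos hρ hG _).add (hN.pairing hpos hρ' hG _)

lemma blockPairing_coordWedge_zero
    (e : EuclideanSpace ℝ (Fin (m + 1)) [⋀^Fin k]→L[ℝ] ℂ)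
    (ζ : EuclideanSpace ℝ (Fin (m + 1)) → EuclideanSpace ℝ (Fin (m + 1)) [⋀^Fin (k + 1)]→L[ℝ] ℂ)
    (z : EuclideanSpace ℝ (Fin (m + 1))) :
    blockPairing ρ ρ' G (k + 1) (coordWedge 0 e) ζ z =
      ρ' z * altInner (G z) (tangPart e) (normPart (ζ z)) := by
  rw [blockPairing, tangPart_coordWedge_zero, normPart_coordWedge_zero, altInner_zero_left,
    mul_zero, zero_add]

lemma conj_re_eq (a : ℂ) : ((starRingEnd ℂ) a).re = a.re := Complex.conj_re a

lemma contDiffOn_coord_ofReal {n : ℕ} (i : Fin n) (K : Set (EuclideanSpace ℝ (Fin n))) :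
    ContDiffOn ℝ ∞ (fun z : EuclideanSpace ℝ (Fin n) => (z i : ℂ)) K :=
  (Complex.ofRealCLM.contDiff.comp (StaticGeometry.contDiff_coord i)).contDiffOn

namespace ConormalPair

variable (h : ConormalPair K U a b ξ η) (hU : IsPatch K U) (hρ : ContDiffOn ℝ ∞ ρ K)
  (hρ' : ContDiffOn ℝ ∞ ρ' K) (hG : ∀ i j, ContDiffOn ℝ ∞ (fun z => G z i j) K)
include h hU hρ hρ' hG

/-- The cancellation of the leading terms in `-δ(α u_T) + iσ u_N`. -/
lemma blockPairing_left_isBigO (e : EuclideanSpace ℝ (Fin (m + 1)) [⋀^Fin k]→L[ℝ] ℂ) {c : ℂ}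
    (hc : a = c * b)
    (hb : (fun z => (z 0)⁻¹ * (b ^ 2 * ρ' z - ρ z)) =O[𝓟 U] fun _ => (1 : ℝ))
    {p : EuclideanSpace ℝ (Fin (m + 1)) → EuclideanSpace ℝ (Fin (m + 1)) [⋀^Fin k]→L[ℝ] ℂ}
    (hp : ∀ z ∈ U, blockPairing ρ ρ' G k e p z =
      -∑ i, fderiv ℝ (blockPairing ρ ρ' G (k + 1) (coordWedge i e) (ξ.mulCoord (k + 1))) z
        (basisVec i)) :
    blockPairing ρ ρ' G k e (fun z => (-1 : ℂ) • p z + (-c) • η k z) =O[𝓟 U]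
      fun z => z 0 ^ a.re := by
  have hN : Phased K U a fun z => normPart (ξ.mulCoord (k + 1) z) := h.norm_left k
  have hph : ∀ e' : EuclideanSpace ℝ (Fin (m + 1)) [⋀^Fin (k + 1)]→L[ℝ] ℂ,
      Phased K U ((starRingEnd ℂ) a) (blockPairing ρ ρ' G (k + 1) e' (ξ.mulCoord (k + 1))) :=
    phased_blockPairing_succ hU.pos hρ hρ' hG
      ((h.tang_left (k + 1)).smul (contDiffOn_coord_ofReal 0 K)) hN
  have h1 := isBigO_tail_sum hU fun i : Fin m => hph (coordWedge i.succ e)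
  have h0 := (hph (coordWedge 0 e)).fderiv_zero_isBigO hU
  rw [conj_re_eq] at h0 h1
  have hC := (((h.cancel k).pairing hU.pos hρ' hG (tangPart e)).isBigO hU).const_mul_left
    ((starRingEnd ℂ) c * b)
  have hone : ContDiffOn ℝ ∞ (fun _ : EuclideanSpace ℝ (Fin (m + 1)) => (1 : ℝ)) K :=
    contDiffOn_const
  have hA := (((h.tang_right k).pairing hU.pos hone hG (tangPart e)).isBigO hU).const_mul_left
    ((starRingEnd ℂ) c)
  rw [conj_re_eq] at hC hA
  have hbC : (fun z => (((z 0)⁻¹ * (b ^ 2 * ρ' z - ρ z) : ℝ) : ℂ)) =O[𝓟 U] fun _ => (1 : ℝ) :=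
    (hb.norm_left.congr_left fun z => (Complex.norm_real _).symm).of_norm_left
  have hA' := (hbC.mul hA).congr_right fun z => one_mul (z 0 ^ a.re)
  have hEta : (fun z => (starRingEnd ℂ) (-c) * (blockPairing ρ ρ' G k e (η k) z -
      ρ z * altInner (G z) (tangPart e) (tangPart (η k z)))) =O[𝓟 U] fun z => z 0 ^ a.re := by
    cases k with
    | zero => simpa [blockPairing] using isBigO_zero _ _
    | succ k =>
      have h3 := (((h.norm_right k).pairing hU.pos hρ' hG (normPart e)).isBigO hU).const_mul_left
        ((starRingEnd ℂ) (-c))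
      rw [conj_re_eq] at h3
      refine h3.congr_left fun z => ?_
      rw [blockPairing, add_sub_cancel_left]
  refine isBigO_congr_on ((((h1.add h0).add hC).add hA').add hEta) fun z hz => ?_
  have hz0 : (z 0 : ℂ) ≠ 0 := Complex.ofReal_ne_zero.mpr (hU.pos z hz).ne'
  set C := (z 0 : ℂ)⁻¹ • ((z 0 : ℂ) • normPart (ξ (k + 1) z) -
    (b : ℂ) • (z 0 : ℂ) • tangPart (η k z)) with hCdef
  have hB : normPart (ξ.mulCoord (k + 1) z) =
      (z 0 : ℂ) • C + (b : ℂ) • (z 0 : ℂ) • tangPart (η k z) := by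
    rw [hCdef, smul_smul (z 0 : ℂ) (z 0 : ℂ)⁻¹, mul_inv_cancel₀ hz0, one_smul, sub_add_cancel]
    rfl
  clear_value C
  rw [blockPairing_lin, hp z hz, Fin.sum_univ_succ, blockPairing_coordWedge_zero, hB]
  simp only [altInner_add_right, altInner_smul_right, hc]
  simp only [map_neg, map_one, map_mul, Complex.conj_ofReal, Complex.ofReal_mul, Complex.ofReal_sub,
    Complex.ofReal_inv, Complex.ofReal_pow, Complex.ofReal_one, smul_eq_mul]
  field_simp
  ring

lemma blockPairing_right_isBigO (e : EuclideanSpace ℝ (Fin (m + 1)) [⋀^Fin k]→L[ℝ] ℂ)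
    {q : EuclideanSpace ℝ (Fin (m + 1)) → EuclideanSpace ℝ (Fin (m + 1)) [⋀^Fin k]→L[ℝ] ℂ}
    (hq : ∀ z ∈ U, blockPairing ρ ρ' G k e q z =
      -∑ i, fderiv ℝ (blockPairing ρ ρ' G (k + 1) (coordWedge i e) (η (k + 1))) z (basisVec i)) :
    (fun z => (z 0 : ℂ) * blockPairing ρ ρ' G k e q z) =O[𝓟 U] fun z => z 0 ^ a.re := by
  have hS : ∀ e' : EuclideanSpace ℝ (Fin (m + 1)) [⋀^Fin (k + 1)]→L[ℝ] ℂ,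
      Phased K U ((starRingEnd ℂ) a) (blockPairing ρ ρ' G (k + 1) e' (η.mulCoord (k + 1))) :=
    phased_blockPairing_succ hU.pos hρ hρ' hG (h.tang_right (k + 1))
      ((h.norm_right k).smul (contDiffOn_coord_ofReal 0 K))
  have h1 := isBigO_tail_sum hU fun i : Fin m => hS (coordWedge i.succ e)
  have h0 := ((h.norm_right k).pairing hU.pos hρ' hG (tangPart e)).smul_fderiv_zero_isBigO hU
    hU.coord_isBigO
  rw [conj_re_eq] at h0 h1
  refine isBigO_congr_on (h1.neg_left.sub h0) fun z hz => ?_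
  have hcoord : ∀ (e' : EuclideanSpace ℝ (Fin (m + 1)) [⋀^Fin (k + 1)]→L[ℝ] ℂ)
      (w : EuclideanSpace ℝ (Fin (m + 1))), blockPairing ρ ρ' G (k + 1) e' (η.mulCoord (k + 1)) w =
      (w 0 : ℂ) • blockPairing ρ ρ' G (k + 1) e' (η (k + 1)) w := fun e' w => by
    simp only [CoordForms.mulCoord, blockPairing, tangPart_smul, normPart_smul, altInner_smul_right,
      Complex.conj_ofReal, smul_eq_mul]
    ring
  have hdiff : ∀ e', DifferentiableAt ℝ (blockPairing ρ ρ' G (k + 1) e' (η (k + 1))) z := by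
    intro e'
    have hinv : DifferentiableAt ℝ (fun w : EuclideanSpace ℝ (Fin (m + 1)) => (w 0)⁻¹) z :=
      ((StaticGeometry.contDiff_coord 0).differentiable (by simp) z).inv (hU.pos z hz).ne'
    refine (hinv.smul ((hS e').differentiableAt hU hz)).congr_of_eventuallyEq ?_
    filter_upwards [hU.isOpen.mem_nhds hz] with w hw
    have hw0 : (w 0 : ℂ) ≠ 0 := Complex.ofReal_ne_zero.mpr (hU.pos w hw).ne'
    rw [Pi.smul_apply', hcoord, Complex.real_smul, smul_eq_mul, Complex.ofReal_inv, ← mul_assoc,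
      inv_mul_cancel₀ hw0, one_mul]
  have htail : ∀ i : Fin m,
      fderiv ℝ (blockPairing ρ ρ' G (k + 1) (coordWedge i.succ e) (η.mulCoord (k + 1))) z
        (basisVec i.succ) =
      (z 0 : ℂ) * fderiv ℝ (blockPairing ρ ρ' G (k + 1) (coordWedge i.succ e) (η (k + 1))) z
        (basisVec i.succ) := by
    intro i
    rw [funext (hcoord _), (hasFDerivAt_coord_smul (hdiff _)).fderiv]
    simp [basisVec]
  have hfun : blockPairing ρ ρ' G (k + 1) (coordWedge 0 e) (η (k + 1)) =
      fun z => (ρ' z : ℂ) * altInner (G z) (tangPart e) (normPart (η (k + 1) z)) :=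
    funext fun z => blockPairing_coordWedge_zero e _ z
  rw [hq z hz, Fin.sum_univ_succ, hfun]
  simp only [htail, ← Finset.mul_sum, smul_eq_mul]
  ring

end ConormalPair

end BlockPairing

section PairingBounds

open Asymptotics Filter

variable {d k : ℕ} {E : Type*} {U : Set E}

lemma isBigO_altInner {G : E → Matrix (Fin d) (Fin d) ℝ} {C : ℝ}
    (hG : ∀ z ∈ U, ∀ i j, |G z i j| ≤ C)
    {f f' : E → EuclideanSpace ℝ (Fin d) [⋀^Fin k]→L[ℝ] ℂ} {g g' : E → ℝ}
    (hf : f =O[𝓟 U] g) (hf' : f' =O[𝓟 U] g') :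
    (fun z => altInner (G z) (f z) (f' z)) =O[𝓟 U] fun z => g z * g' z := by
  have h1 := hf.norm_left.mul hf'.norm_left
  refine IsBigO.trans (IsBigO.of_bound (∑ _i : Fin k → Fin d, ∑ _j : Fin k → Fin d, C ^ k) ?_) h1
  rw [eventually_principal]
  intro z hz
  rw [norm_mul, norm_norm, norm_norm]
  exact norm_altInner_le (hG z hz) _ _

/-- A form whose pairings with all constant forms are bounded is bounded. -/
lemma isBigO_altInner_self {G : E → Matrix (Fin d) (Fin d) ℝ} {C : ℝ}
    (hpos : ∀ z ∈ U, (G z).PosDef) (hG : ∀ z ∈ U, ∀ i j, |G z i j| ≤ C)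
    {ζ : E → EuclideanSpace ℝ (Fin d) [⋀^Fin k]→L[ℝ] ℂ} {g : E → ℝ}
    (hζ : ∀ e, (fun z => altInner (G z)⁻¹ e (ζ z)) =O[𝓟 U] g) :
    (fun z => (altInner (G z)⁻¹ (ζ z) (ζ z)).re) =O[𝓟 U] fun z => g z * g z := by
  obtain ⟨L, hL⟩ := exists_altComponents_leftInverse d k
  set N : E → ℝ := fun z => (altInner (G z)⁻¹ (ζ z) (ζ z)).re with hN
  have hN0 : ∀ z ∈ U, 0 ≤ N z := fun z hz => altInner_self_real (hpos z hz) _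
  set n : E → ℝ := fun z => Real.sqrt (N z) with hn
  have hnn : ∀ z ∈ U, n z ^ 2 = N z := fun z hz => Real.sq_sqrt (hN0 z hz)
  have hcomp : ∀ J : Fin k → Fin d, (fun z => ζ z (fun a => basisVec (J a))) =O[𝓟 U] n := by
    intro J
    refine IsBigO.of_pow two_ne_zero ?_
    refine IsBigO.of_bound (k.factorial * C ^ k) ?_
    rw [eventually_principal]
    intro z hz
    simp only [Pi.pow_apply]
    rw [norm_pow, hnn z hz, Real.norm_of_nonneg (hN0 z hz)]
    have h2 : ∏ a, G z (J a) (J a) ≤ C ^ k := by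
      calc ∏ a, G z (J a) (J a) ≤ ∏ _a : Fin k, C := Finset.prod_le_prod
            (fun a _ => (hpos z hz).diag_pos.le)
            (fun a _ => (le_abs_self _).trans (hG z hz _ _))
        _ = C ^ k := by simp
    refine (norm_apply_sq_le (hpos z hz) (ζ z) J).trans ?_
    rw [mul_right_comm]
    have := hN0 z hz
    gcongr
  have hexp : ∀ z, ζ z = ∑ J : Fin k → Fin d,
      (((ζ z (fun a => basisVec (J a))).re : ℂ) • L (Pi.single J 1) +
        ((ζ z (fun a => basisVec (J a))).im : ℂ) • L (Pi.single J Complex.I)) := by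
    intro z
    conv_lhs => rw [← hL (ζ z)]
    have h1 : (fun J : Fin k → Fin d => ζ z (fun a => basisVec (J a))) =
        ∑ J : Fin k → Fin d, ((ζ z (fun a => basisVec (J a))).re • (Pi.single J 1 : (Fin k → Fin d) → ℂ) +
          (ζ z (fun a => basisVec (J a))).im • (Pi.single J Complex.I : (Fin k → Fin d) → ℂ)) := by
      funext J'
      rw [Finset.sum_apply, Finset.sum_eq_single J']
      · simp
      · intro J _ hJ
        simp [hJ.symm]
      · simp
    rw [h1, map_sum]
    refine Finset.sum_congr rfl fun J _ => ?_
    rw [map_add, map_smul, map_smul]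
    rfl
  have hself : (fun z => altInner (G z)⁻¹ (ζ z) (ζ z)) =O[𝓟 U] fun z => n z * g z := by
    have h1 : ∀ z, altInner (G z)⁻¹ (ζ z) (ζ z) = ∑ J : Fin k → Fin d,
        (((ζ z (fun a => basisVec (J a))).re : ℂ) * altInner (G z)⁻¹ (L (Pi.single J 1)) (ζ z) +
        ((ζ z (fun a => basisVec (J a))).im : ℂ) *
          altInner (G z)⁻¹ (L (Pi.single J Complex.I)) (ζ z)) := by
      intro z
      have hs : ∀ (s : Finset (Fin k → Fin d))
          (f : (Fin k → Fin d) → EuclideanSpace ℝ (Fin d) [⋀^Fin k]→L[ℝ] ℂ),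
          altInner (G z)⁻¹ (∑ J ∈ s, f J) (ζ z) = ∑ J ∈ s, altInner (G z)⁻¹ (f J) (ζ z) := by
        intro s f
        induction s using Finset.cons_induction with
        | empty => simp [altInner_zero_left]
        | cons J s hJ ih => rw [Finset.sum_cons, altInner_add_left, ih, Finset.sum_cons]
      refine (congrArg (fun θ => altInner (G z)⁻¹ θ (ζ z)) (hexp z)).trans ?_
      simp only [hs, altInner_add_left, altInner_smul_left]
    simp only [h1]
    refine IsBigO.fun_sum fun J _ => ?_
    have hre : (fun z => ((ζ z (fun a => basisVec (J a))).re : ℂ)) =O[𝓟 U] n :=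
      (IsBigO.of_bound 1 (Eventually.of_forall fun z => by
        rw [one_mul, Complex.norm_real]; exact Complex.abs_re_le_norm _)).trans (hcomp J)
    have him : (fun z => ((ζ z (fun a => basisVec (J a))).im : ℂ)) =O[𝓟 U] n :=
      (IsBigO.of_bound 1 (Eventually.of_forall fun z => by
        rw [one_mul, Complex.norm_real]; exact Complex.abs_im_le_norm _)).trans (hcomp J)
    exact (hre.mul (hζ _)).add (him.mul (hζ _))
  obtain ⟨c, hc, hb⟩ := hself.exists_pos
  have hng : n =O[𝓟 U] g := by
    refine IsBigO.of_bound c ?_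
    rw [isBigOWith_iff, eventually_principal] at hb
    rw [eventually_principal]
    intro z hz
    have h1 := hb z hz
    have h2 : N z ≤ c * ‖n z * g z‖ := (Complex.re_le_norm _).trans h1
    rw [← hnn z hz, norm_mul, Real.norm_of_nonneg (Real.sqrt_nonneg _)] at h2
    rw [Real.norm_of_nonneg (Real.sqrt_nonneg _)]
    rcases (Real.sqrt_nonneg (N z)).eq_or_lt with h0 | h0
    · rw [← h0]; positivity
    · refine le_of_mul_le_mul_left ?_ h0
      change n z * n z ≤ n z * _
      nlinarith
  refine (hng.mul hng).congr' ?_ EventuallyEq.rfl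
  rw [EventuallyEq, eventually_principal]
  intro z hz
  change n z * n z = N z
  rw [← sq, hnn z hz]

end PairingBounds

namespace StaticGeometry

open Asymptotics Filter

variable {m : ℕ}
  {X : Type*} [TopologicalSpace X] [ChartedSpace (EuclideanHalfSpace (m + 1)) X]
  [IsManifold (𝓡∂ (m + 1)) ∞ X]
  {Y : Type*} [TopologicalSpace Y] [ChartedSpace (EuclideanSpace ℝ (Fin m)) Y]
  [IsManifold (𝓡 m) ∞ Y] (S : StaticGeometry m X Y) (c : Y)

/-- A radius such that the ball around `c` in a chart of the boundary, and the collar up to that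
height, are well inside the domain of the collar coordinates, and `β` is constant on the ball. -/
structure IsPatchRadius (r : ℝ) : Prop where
  pos : 0 < r
  lt : r < S.ε
  subset : Metric.closedBall (extChartAt (𝓡 m) c c) r ⊆ (extChartAt (𝓡 m) c).target
  const : ∀ w ∈ Metric.closedBall (extChartAt (𝓡 m) c c) r,
    S.βt (0, (extChartAt (𝓡 m) c).symm w) = S.βt (0, c)

lemma exists_isPatchRadius : ∃ r, S.IsPatchRadius c r := by
  have h1 : ∀ᶠ w in nhds (extChartAt (𝓡 m) c c), w ∈ (extChartAt (𝓡 m) c).target ∧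
      S.βt (0, (extChartAt (𝓡 m) c).symm w) = S.βt (0, c) := by
    have h0 : ∀ᶠ w in nhds (extChartAt (𝓡 m) c c), w ∈ (extChartAt (𝓡 m) c).target :=
      extChartAt_target_mem_nhds c
    refine h0.and ?_
    have h2 : ContinuousAt (extChartAt (𝓡 m) c).symm (extChartAt (𝓡 m) c c) :=
      continuousAt_extChartAt_symm c
    have h3 : ∀ᶠ y in nhds c, S.βt (0, y) = S.βt (0, c) := S.βt_zero.eventually_eq c
    rw [ContinuousAt, extChartAt_to_inv] at h2
    exact h2.eventually h3
  obtain ⟨r, hr, h⟩ := Metric.eventually_nhds_iff_ball.mp h1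
  have hr' : 0 < min (r / 2) (S.ε / 2) := by have := S.ε_pos; positivity
  have hsub : Metric.closedBall (extChartAt (𝓡 m) c c) (min (r / 2) (S.ε / 2)) ⊆
      Metric.ball (extChartAt (𝓡 m) c c) r :=
    Metric.closedBall_subset_ball ((min_le_left _ _).trans_lt (half_lt_self hr))
  exact ⟨_, hr', (min_le_right _ _).trans_lt (half_lt_self S.ε_pos), fun w hw => (h w (hsub hw)).1,
    fun w hw => (h w (hsub hw)).2⟩

omit [IsManifold (𝓡 m) ∞ Y] in
/-- The patch of collar coordinates of given radius. -/
def collarPatch (r : ℝ) : Set (EuclideanSpace ℝ (Fin (m + 1))) :=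
  {z | z 0 ∈ Ioo 0 r ∧ tailProj m z ∈ Metric.ball (extChartAt (𝓡 m) c c) r}

/-- A compact neighbourhood of the patch. -/
def collarPatchClosed (r : ℝ) : Set (EuclideanSpace ℝ (Fin (m + 1))) :=
  {z | z 0 ∈ Icc 0 r ∧ tailProj m z ∈ Metric.closedBall (extChartAt (𝓡 m) c c) r}

variable {c} {r : ℝ}

omit [IsManifold (𝓡 m) ∞ Y] in
lemma collarPatch_subset_closed : collarPatch (m := m) c r ⊆ collarPatchClosed c r := fun _ hz =>
  ⟨Ioo_subset_Icc_self hz.1, Metric.ball_subset_closedBall hz.2⟩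

omit [IsManifold (𝓡 m) ∞ Y] in
lemma isCompact_collarPatchClosed : IsCompact (collarPatchClosed (m := m) c r) := by
  have h1 : Continuous fun p : ℝ × EuclideanSpace ℝ (Fin m) =>
      p.1 • basisVec (d := m + 1) 0 + tailIncl m p.2 := by fun_prop
  have h2 := (isCompact_Icc (a := (0 : ℝ)) (b := r)).prod
    (isCompact_closedBall (extChartAt (𝓡 m) c c) r)
  refine (h2.image h1).of_isClosed_subset ?_ fun z hz => ⟨(z 0, tailProj m z), ⟨hz.1, hz.2⟩,
    (eq_add_tailIncl z).symm⟩
  exact (isClosed_Icc.preimage (continuous_coord 0)).inter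
    (Metric.isClosed_closedBall.preimage (tailProj m).continuous)

omit [IsManifold (𝓡 m) ∞ Y] in
lemma convex_collarPatchClosed : Convex ℝ (collarPatchClosed (m := m) c r) :=
  ((convex_Icc (0 : ℝ) r).linear_preimage
    (EuclideanSpace.proj (𝕜 := ℝ) (0 : Fin (m + 1))).toLinearMap).inter
    ((convex_closedBall (extChartAt (𝓡 m) c c) r).linear_preimage (tailProj m).toLinearMap)

variable {S} (hr : S.IsPatchRadius c r)
include hr

namespace IsPatchRadius

lemma closed_subset : collarPatchClosed c r ⊆ S.collarDomClosed c := fun _ hz =>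
  ⟨⟨hz.1.1, hz.1.2.trans_lt hr.lt⟩, hr.subset hz.2⟩

lemma patch_subset : collarPatch c r ⊆ S.collarDom c := fun _ hz =>
  ⟨⟨hz.1.1, hz.1.2.trans hr.lt⟩, hr.subset (Metric.ball_subset_closedBall hz.2)⟩

lemma isPatch : IsPatch (S.collarDomClosed c) (collarPatch c r) where
  isOpen := (isOpen_Ioo.preimage (continuous_coord 0)).inter
    (Metric.isOpen_ball.preimage (tailProj m).continuous)
  pos _ hz := hz.1.1
  exists_compact := ⟨_, isCompact_collarPatchClosed, collarPatch_subset_closed, hr.closed_subset⟩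
  uniqueDiffOn := by
    have h1 : S.collarDomClosed c = range (𝓡∂ (m + 1)) ∩
        {z | z 0 < S.ε ∧ tailProj m z ∈ (extChartAt (𝓡 m) c).target} := by
      rw [range_modelWithCornersEuclideanHalfSpace]
      ext z
      exact ⟨fun h => ⟨h.1.1, h.1.2, h.2⟩, fun h => ⟨⟨h.1, h.2.1⟩, h.2.2⟩⟩
    rw [h1]
    exact (𝓡∂ (m + 1)).uniqueDiffOn.inter ((isOpen_Iio.preimage (continuous_coord 0)).inter
      ((isOpen_extChartAt_target c).preimage (tailProj m).continuous))

lemma phase_eq (σ : ℂ) {z : EuclideanSpace ℝ (Fin (m + 1))} (hz : z ∈ collarPatch c r) :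
    S.phase σ (z 0) (collarPoint c z) = (z 0 : ℂ) ^ (-(Complex.I * (S.βt (0, c) : ℂ) * σ)) := by
  rw [phase, collarPoint, hr.const _ (Metric.ball_subset_closedBall hz.2)]

omit hr in
lemma _root_.SmoothFormFamily.contDiffOn_inChart {v : ℝ → MixedForm (𝓡 m) Y}
    (hv : SmoothFormFamily (S.ε ^ 2) v) (k : ℕ) :
    ContDiffOn ℝ ∞ (fun z : EuclideanSpace ℝ (Fin (m + 1)) =>
      (v (z 0 ^ 2) k).inChart c (tailProj m z)) (S.collarDomClosed c) :=
  (hv k c).comp contDiff_sqCoords.contDiffOn S.mapsTo_sqCoords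

/-- The coordinate expressions of an element of `C^∞_(σ)` near the boundary. -/
lemma conormalPair {σ : ℂ} {u : S.Form} (hu : u ∈ S.asymptoticSpace σ) :
    ConormalPair (S.collarDomClosed c) (collarPatch c r) (-(Complex.I * (S.βt (0, c) : ℂ) * σ))
      (S.βt (0, c)) (fun k => pull (S.collarMap c) (u.1 k)) (fun k => pull (S.collarMap c) (u.2 k)) := by
  obtain ⟨hu1, hu2, vTT, vTN, vNT, vNN, hTT, hTN, hNT, hNN, hu⟩ := hu
  have hs : ∀ z ∈ collarPatch (m := m) c r, z 0 ∈ Ioo 0 S.ε := fun z hz => (hr.patch_subset hz).1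
  have hsne : ∀ z ∈ collarPatch (m := m) c r, (z 0 : ℂ) ≠ 0 := fun z hz =>
    Complex.ofReal_ne_zero.mpr hz.1.1.ne'
  have e1 : ∀ k, ∀ z ∈ collarPatch (m := m) c r, tangPart (pull (S.collarMap c) (u.1 k) z) =
      (z 0 : ℂ) ^ (-(Complex.I * (S.βt (0, c) : ℂ) * σ)) •
        (vTT (z 0 ^ 2) k).inChart c (tailProj m z) := by
    intro k z hz
    rw [S.tangPart_pull_collarMap (hr.patch_subset hz), ← hr.phase_eq σ hz, FormField.inChart,
      (hu (z 0) (hs z hz) k _).1]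
    rfl
  have e2 : ∀ k, ∀ z ∈ collarPatch (m := m) c r, normPart (pull (S.collarMap c) (u.1 (k + 1)) z) =
      (z 0 : ℂ) ^ (-(Complex.I * (S.βt (0, c) : ℂ) * σ)) •
        ((z 0 : ℂ) • (vTN (z 0 ^ 2) k).inChart c (tailProj m z) +
          ((S.βt (0, c) : ℂ) * (z 0 : ℂ)⁻¹) • (vNT (z 0 ^ 2) k).inChart c (tailProj m z)) := by
    intro k z hz
    rw [S.normPart_pull_collarMap (hr.patch_subset hz), ← hr.phase_eq σ hz, FormField.inChart,
      (hu (z 0) (hs z hz) k _).2.1, ← hr.const _ (Metric.ball_subset_closedBall hz.2)]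
    rfl
  have e3 : ∀ k, ∀ z ∈ collarPatch (m := m) c r, tangPart (pull (S.collarMap c) (u.2 k) z) =
      (z 0 : ℂ) ^ (-(Complex.I * (S.βt (0, c) : ℂ) * σ)) •
        (z 0 : ℂ)⁻¹ • (vNT (z 0 ^ 2) k).inChart c (tailProj m z) := by
    intro k z hz
    rw [S.tangPart_pull_collarMap (hr.patch_subset hz), ← hr.phase_eq σ hz, FormField.inChart,
      (hu (z 0) (hs z hz) k _).2.2.1]
    rfl
  have e4 : ∀ k, ∀ z ∈ collarPatch (m := m) c r, normPart (pull (S.collarMap c) (u.2 (k + 1)) z) =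
      (z 0 : ℂ) ^ (-(Complex.I * (S.βt (0, c) : ℂ) * σ)) •
        (vNN (z 0 ^ 2) k).inChart c (tailProj m z) := by
    intro k z hz
    rw [S.normPart_pull_collarMap (hr.patch_subset hz), ← hr.phase_eq σ hz, FormField.inChart,
      (hu (z 0) (hs z hz) k _).2.2.2]
    rfl
  have hz2 : ContDiffOn ℝ ∞ (fun z : EuclideanSpace ℝ (Fin (m + 1)) => (z 0 : ℂ))
      (S.collarDomClosed c) := contDiffOn_coord_ofReal 0 _
  refine ⟨fun k z hz => FormField.SmoothOn.differentiableAt_pull S.isParam_collarMap (hu1 k) (hr.patch_subset hz),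
    fun k z hz => FormField.SmoothOn.differentiableAt_pull S.isParam_collarMap (hu2 k) (hr.patch_subset hz),
    fun k => ⟨_, hTT.contDiffOn_inChart k, e1 k⟩, fun k => ?_, fun k => ?_,
    fun k => ⟨_, hNN.contDiffOn_inChart k, e4 k⟩, fun k => ?_⟩
  · refine ⟨fun z => ((z 0 : ℂ) * (z 0 : ℂ)) • (vTN (z 0 ^ 2) k).inChart c (tailProj m z) +
      (S.βt (0, c) : ℂ) • (vNT (z 0 ^ 2) k).inChart c (tailProj m z),
      ((hz2.mul hz2).smul (hTN.contDiffOn_inChart k)).add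
        ((hNT.contDiffOn_inChart k).const_smul _), fun z hz => ?_⟩
    simp only [e2 k z hz]
    rw [smul_comm, smul_add, smul_smul, smul_smul, mul_left_comm,
      mul_inv_cancel₀ (hsne z hz), mul_one]
  · refine ⟨_, hNT.contDiffOn_inChart k, fun z hz => ?_⟩
    simp only [e3 k z hz]
    rw [smul_comm, smul_smul (z 0 : ℂ), mul_inv_cancel₀ (hsne z hz), one_smul]
  · refine ⟨fun z => (z 0 : ℂ) • (vTN (z 0 ^ 2) k).inChart c (tailProj m z),
      hz2.smul (hTN.contDiffOn_inChart k), fun z hz => ?_⟩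
    simp only [e2 k z hz, e3 k z hz]
    generalize (vTN (z 0 ^ 2) k).inChart c (tailProj m z) = A
    generalize (vNT (z 0 ^ 2) k).inChart c (tailProj m z) = B
    have := hsne z hz
    simp only [smul_add, smul_sub, smul_smul]
    have h1 : (z 0 : ℂ)⁻¹ * ((z 0 : ℂ) * ((z 0 : ℂ) ^ (-(Complex.I * (S.βt (0, c) : ℂ) * σ)) *
        ((S.βt (0, c) : ℂ) * (z 0 : ℂ)⁻¹))) = (z 0 : ℂ)⁻¹ * ((S.βt (0, c) : ℂ) * ((z 0 : ℂ) *
          ((z 0 : ℂ) ^ (-(Complex.I * (S.βt (0, c) : ℂ) * σ)) * (z 0 : ℂ)⁻¹))) := by ring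
    rw [h1, add_sub_cancel_right, ← mul_assoc, inv_mul_cancel₀ this, one_mul]

end IsPatchRadius

end StaticGeometry

namespace StaticGeometry

open Asymptotics Filter

variable {m : ℕ}
  {X : Type*} [TopologicalSpace X] [ChartedSpace (EuclideanHalfSpace (m + 1)) X]
  [IsManifold (𝓡∂ (m + 1)) ∞ X]
  {Y : Type*} [TopologicalSpace Y] [ChartedSpace (EuclideanSpace ℝ (Fin m)) Y]
  [IsManifold (𝓡 m) ∞ Y] (S : StaticGeometry m X Y) (c : Y)

/-- The inverse of the matrix of `k(μ, y, dy)` in collar coordinates. -/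
def kInv (z : EuclideanSpace ℝ (Fin (m + 1))) : Matrix (Fin m) (Fin m) ℝ := (S.kMatrix c z)⁻¹

/-- The volume density in collar coordinates. -/
def density (z : EuclideanSpace ℝ (Fin (m + 1))) : ℝ :=
  S.betaFun c z * Real.sqrt (S.kMatrix c z).det

/-- The volume density in collar coordinates, divided by `β̃²`. -/
def normDensity (z : EuclideanSpace ℝ (Fin (m + 1))) : ℝ :=
  Real.sqrt (S.kMatrix c z).det / S.betaFun c z

variable {c}

lemma contDiffOn_kInv (i j : Fin m) :
    ContDiffOn ℝ ∞ (fun z => S.kInv c z i j) (S.collarDomClosed c) :=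
  ContDiffOn.matrix_inv S.contDiffOn_kMatrix (fun _ hz => (S.det_kMatrix_pos hz).ne') i j

lemma contDiffOn_sqrt_det_kMatrix :
    ContDiffOn ℝ ∞ (fun z => Real.sqrt (S.kMatrix c z).det) (S.collarDomClosed c) :=
  (ContDiffOn.matrix_det S.contDiffOn_kMatrix).sqrt fun _ hz => (S.det_kMatrix_pos hz).ne'

lemma contDiffOn_density : ContDiffOn ℝ ∞ (S.density c) (S.collarDomClosed c) :=
  S.contDiffOn_betaFun.mul S.contDiffOn_sqrt_det_kMatrix

lemma contDiffOn_normDensity : ContDiffOn ℝ ∞ (S.normDensity c) (S.collarDomClosed c) :=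
  S.contDiffOn_sqrt_det_kMatrix.div S.contDiffOn_betaFun fun _ hz => (S.betaFun_pos hz).ne'

variable {z : EuclideanSpace ℝ (Fin (m + 1))} {k : ℕ}

lemma isBlock_inv_gramAlong (hz : z ∈ S.collarDom c) :
    IsBlock (gramAlong S.h (S.collarMap c) z)⁻¹ (S.betaFun c z ^ 2)⁻¹ (S.kInv c z) :=
  (S.isBlock_gramAlong hz).inv (pow_pos (S.betaFun_pos (S.collarDom_subset hz)) 2).ne'
    (S.det_kMatrix_pos (S.collarDom_subset hz)).ne'

lemma sqrt_det_gramAlong (hz : z ∈ S.collarDom c) :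
    Real.sqrt (gramAlong S.h (S.collarMap c) z).det = S.density c z := by
  rw [(S.isBlock_gramAlong hz).det_eq, Real.sqrt_mul (sq_nonneg _),
    Real.sqrt_sq (S.betaFun_pos (S.collarDom_subset hz)).le, density]

lemma weightedPairing_collarMap (hz : z ∈ S.collarDom c)
    (e : EuclideanSpace ℝ (Fin (m + 1)) [⋀^Fin k]→L[ℝ] ℂ) (ξ : FormField (𝓡∂ (m + 1)) X k) :
    weightedPairing S.h (S.collarMap c) e ξ z =
      blockPairing (S.density c) (S.normDensity c) (S.kInv c) k e (pull (S.collarMap c) ξ) z := by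
  have hb := (S.betaFun_pos (S.collarDom_subset hz)).ne'
  rw [weightedPairing, S.sqrt_det_gramAlong hz]
  cases k with
  | zero => rw [altInner_block_zero (N := S.kInv c z), blockPairing]
  | succ k =>
    rw [altInner_block (S.isBlock_inv_gramAlong hz), blockPairing, mul_add, ← mul_assoc]
    congr 2
    rw [← Complex.ofReal_mul, density, normDensity]
    congr 1
    field_simp

/-- The fibre inner product in collar coordinates, in terms of tangential and normal parts. -/
lemma fiberInner_collarMap_zero (hz : z ∈ S.collarDom c) (ξ η : FormField (𝓡∂ (m + 1)) X 0) :
    fiberInner S.h 0 (S.collarMap c z) (ξ (S.collarMap c z)) (η (S.collarMap c z)) =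
      altInner (S.kInv c z) (tangPart (pull (S.collarMap c) ξ z))
        (tangPart (pull (S.collarMap c) η z)) := by
  rw [S.isParam_collarMap.fiberInner_eq S.h hz, altInner_block_zero (N := S.kInv c z)]

lemma fiberInner_collarMap_succ (hz : z ∈ S.collarDom c) (ξ η : FormField (𝓡∂ (m + 1)) X (k + 1)) :
    fiberInner S.h (k + 1) (S.collarMap c z) (ξ (S.collarMap c z)) (η (S.collarMap c z)) =
      altInner (S.kInv c z) (tangPart (pull (S.collarMap c) ξ z))
        (tangPart (pull (S.collarMap c) η z)) + (((S.betaFun c z ^ 2)⁻¹ : ℝ) : ℂ) *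
      altInner (S.kInv c z) (normPart (pull (S.collarMap c) ξ z))
        (normPart (pull (S.collarMap c) η z)) := by
  rw [S.isParam_collarMap.fiberInner_eq S.h hz, altInner_block (S.isBlock_inv_gramAlong hz)]

variable {S} {r : ℝ} (hr : S.IsPatchRadius c r)
include hr

namespace IsPatchRadius

lemma exists_bound {n : ℕ} {G : EuclideanSpace ℝ (Fin (m + 1)) → Matrix (Fin n) (Fin n) ℝ}
    (hG : ∀ i j, ContinuousOn (fun z => G z i j) (S.collarDomClosed c)) :
    ∃ C, ∀ z ∈ collarPatch c r, ∀ i j, |G z i j| ≤ C := by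
  have h1 : ∀ p : Fin n × Fin n, ∃ C, ∀ z ∈ collarPatch c r, |G z p.1 p.2| ≤ C := fun p => by
    obtain ⟨C, hC⟩ := isCompact_collarPatchClosed.exists_bound_of_continuousOn
      ((hG p.1 p.2).mono hr.closed_subset)
    exact ⟨C, fun z hz => hC z (collarPatch_subset_closed hz)⟩
  choose C hC using h1
  refine ⟨∑ p, |C p|, fun z hz i j => (hC (i, j) z hz).trans ((le_abs_self _).trans ?_)⟩
  exact Finset.single_le_sum (f := fun p => |C p|) (fun p _ => abs_nonneg _)
    (Finset.mem_univ (i, j))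

lemma mixedInner_isBigO_of_parts {ξ η : MixedForm (𝓡∂ (m + 1)) X}
    {f : EuclideanSpace ℝ (Fin (m + 1)) → ℝ}
    (hT : ∀ k, (fun z => altInner (S.kInv c z) (tangPart (pull (S.collarMap c) (ξ k) z))
      (tangPart (pull (S.collarMap c) (η k) z))) =O[𝓟 (collarPatch c r)] f)
    (hN : ∀ k, (fun z => altInner (S.kInv c z) (normPart (pull (S.collarMap c) (ξ (k + 1)) z))
      (normPart (pull (S.collarMap c) (η (k + 1)) z))) =O[𝓟 (collarPatch c r)] f) :
    (fun z => mixedInner S.h (S.collarMap c z) ξ η) =O[𝓟 (collarPatch c r)] f := by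
  simp only [mixedInner]
  refine IsBigO.fun_sum fun k _ => ?_
  cases k with
  | zero =>
    exact isBigO_congr_on (hT 0) fun z hz => S.fiberInner_collarMap_zero (hr.patch_subset hz) _ _
  | succ k =>
    have hb : (fun z => (((S.betaFun c z ^ 2)⁻¹ : ℝ) : ℂ)) =O[𝓟 (collarPatch c r)]
        fun _ => (1 : ℝ) := hr.isPatch.isBigO_one (Complex.continuous_ofReal.comp_continuousOn
      ((S.contDiffOn_betaFun.continuousOn.pow 2).inv₀ fun z hz => (pow_pos (S.betaFun_pos hz) 2).ne'))
    have h1 := (hb.mul (hN k)).congr_right fun z => one_mul (f z)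
    exact isBigO_congr_on ((hT (k + 1)).add h1) fun z hz =>
      S.fiberInner_collarMap_succ (hr.patch_subset hz) _ _

lemma fiberNormSq_isBigO_of_parts {ξ : MixedForm (𝓡∂ (m + 1)) X}
    {g : EuclideanSpace ℝ (Fin (m + 1)) → ℝ}
    (hT : ∀ k, (fun z => tangPart (pull (S.collarMap c) (ξ k) z)) =O[𝓟 (collarPatch c r)] g)
    (hN : ∀ k, (fun z => normPart (pull (S.collarMap c) (ξ (k + 1)) z)) =O[𝓟 (collarPatch c r)] g) :
    (fun z => fiberNormSq S.h ξ (S.collarMap c z)) =O[𝓟 (collarPatch c r)] fun z => g z * g z := by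
  obtain ⟨C, hC⟩ := hr.exists_bound fun i j => (S.contDiffOn_kInv i j).continuousOn
  have h1 := hr.mixedInner_isBigO_of_parts (fun k => isBigO_altInner hC (hT k) (hT k))
    fun k => isBigO_altInner hC (hN k) (hN k)
  simp only [mixedInner_self] at h1
  exact (h1.norm_left.congr_left fun z => Complex.norm_real _).of_norm_left

lemma fiberNormSq_isBigO_of_pairing {ζ : MixedForm (𝓡∂ (m + 1)) X}
    {g : EuclideanSpace ℝ (Fin (m + 1)) → ℝ}
    (h : ∀ k e, (fun z => weightedPairing S.h (S.collarMap c) e (ζ k) z) =O[𝓟 (collarPatch c r)] g) :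
    (fun z => fiberNormSq S.h ζ (S.collarMap c z)) =O[𝓟 (collarPatch c r)] fun z => g z * g z := by
  obtain ⟨C, hC⟩ : ∃ C, ∀ z ∈ collarPatch c r, ∀ i j, |gramAlong S.h (S.collarMap c) z i j| ≤ C := by
    obtain ⟨C, hC⟩ := hr.exists_bound fun i j => (S.contDiffOn_kMatrix i j).continuousOn
    obtain ⟨B, hB⟩ := isCompact_collarPatchClosed.exists_bound_of_continuousOn
      ((S.contDiffOn_betaFun.continuousOn.pow 2).mono hr.closed_subset)
    refine ⟨max (max C B) 0, fun z hz i j => ?_⟩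
    have hbl := S.isBlock_gramAlong (hr.patch_subset hz)
    refine Fin.cases ?_ (fun i => ?_) i <;> refine Fin.cases ?_ (fun j => ?_) j
    · rw [hbl.zero_zero]
      exact (hB z (collarPatch_subset_closed hz)).trans ((le_max_right _ _).trans (le_max_left _ _))
    · rw [hbl.zero_succ, abs_zero]; exact le_max_right _ _
    · rw [hbl.succ_zero, abs_zero]; exact le_max_right _ _
    · rw [hbl.succ_succ]
      exact (hC z hz i j).trans ((le_max_left _ _).trans (le_max_left _ _))
  have hρ : (fun z => (((S.density c z)⁻¹ : ℝ) : ℂ)) =O[𝓟 (collarPatch c r)] fun _ => (1 : ℝ) :=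
    hr.isPatch.isBigO_one (Complex.continuous_ofReal.comp_continuousOn
      (S.contDiffOn_density.continuousOn.inv₀ fun z hz =>
        (mul_pos (S.betaFun_pos hz) (Real.sqrt_pos.mpr (S.det_kMatrix_pos hz))).ne'))
  have h1 : ∀ k, (fun z => (altInner (gramAlong S.h (S.collarMap c) z)⁻¹
      (pull (S.collarMap c) (ζ k) z) (pull (S.collarMap c) (ζ k) z)).re) =O[𝓟 (collarPatch c r)]
      fun z => g z * g z := by
    intro k
    refine isBigO_altInner_self
      (fun z hz => S.isParam_collarMap.gramAlong_posDef S.h (hr.patch_subset hz)) hC fun e => ?_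
    refine isBigO_congr_on ((hρ.mul (h k e)).congr_right fun z => one_mul (g z)) fun z hz => ?_
    have hd : S.density c z ≠ 0 := (mul_pos (S.betaFun_pos (hr.isPatch.subset hz))
      (Real.sqrt_pos.mpr (S.det_kMatrix_pos (hr.isPatch.subset hz)))).ne'
    rw [weightedPairing, S.sqrt_det_gramAlong (hr.patch_subset hz), ← mul_assoc,
      ← Complex.ofReal_mul, inv_mul_cancel₀ hd, Complex.ofReal_one, one_mul]
  refine isBigO_congr_on (IsBigO.fun_sum (s := Finset.range (m + 1 + 1)) fun k _ => h1 k) fun z hz => ?_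
  rw [fiberNormSq]
  refine Finset.sum_congr rfl fun k _ => ?_
  rw [S.isParam_collarMap.fiberInner_eq S.h (hr.patch_subset hz)]

/-- `β̃(α², y)² - β(y)²` vanishes at the boundary. -/
lemma beta_sq_sub_isBigO : (fun z : EuclideanSpace ℝ (Fin (m + 1)) =>
    (z 0)⁻¹ * (S.βt (0, c) ^ 2 * S.normDensity c z - S.density c z)) =O[𝓟 (collarPatch c r)]
    fun _ => (1 : ℝ) := by
  have hsm : ContDiffOn ℝ ∞ (fun z => S.betaFun c z ^ 2) (S.collarDomClosed c) :=
    S.contDiffOn_betaFun.pow 2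
  obtain ⟨C, hC⟩ := isCompact_collarPatchClosed.exists_bound_of_continuousOn
    ((hsm.continuousOn_fderivWithin hr.isPatch.uniqueDiffOn (by simp)).mono hr.closed_subset)
  have h1 : (fun z : EuclideanSpace ℝ (Fin (m + 1)) =>
      (z 0)⁻¹ * (S.βt (0, c) ^ 2 - S.betaFun c z ^ 2)) =O[𝓟 (collarPatch c r)]
      fun _ => (1 : ℝ) := by
    refine IsBigO.of_bound C ?_
    rw [eventually_principal]
    intro z hz
    set z' := tailIncl m (tailProj m z) with hz'
    have hz'0 : z' 0 = 0 := rfl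
    have hz't : tailProj m z' = tailProj m z := by simp [hz']
    have hmem : z' ∈ collarPatchClosed c r := by
      refine ⟨?_, ?_⟩
      · rw [hz'0]; exact ⟨le_rfl, hr.pos.le⟩
      · rw [hz't]; exact Metric.ball_subset_closedBall hz.2
    have h2 := Convex.norm_image_sub_le_of_norm_hasFDerivWithin_le
      (f := fun z => S.betaFun c z ^ 2) (f' := fderivWithin ℝ (fun z => S.betaFun c z ^ 2)
        (S.collarDomClosed c)) (C := C) (s := collarPatchClosed c r)
      (fun w hw => ((hsm.differentiableOn (by simp) w (hr.closed_subset hw)).hasFDerivWithinAt).mono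
        hr.closed_subset) hC convex_collarPatchClosed (collarPatch_subset_closed hz) hmem
    have h3 : S.betaFun c z' = S.βt (0, c) := by
      rw [betaFun, collarPoint, hz't, hz'0, zero_pow two_ne_zero,
        hr.const _ (Metric.ball_subset_closedBall hz.2)]
    have h4 : ‖z' - z‖ = z 0 := by
      have : z' - z = -(z 0 • basisVec 0) := by
        conv_lhs => rw [eq_add_tailIncl z]
        simp [hz']
      rw [this, norm_neg, norm_smul, Real.norm_of_nonneg hz.1.1.le]
      simp [basisVec]
    rw [h3, h4] at h2
    rw [norm_mul, norm_inv, Real.norm_of_nonneg hz.1.1.le, norm_one, mul_one,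
      inv_mul_le_iff₀ hz.1.1, mul_comm]
    exact h2
  have h2 : S.normDensity c =O[𝓟 (collarPatch c r)] fun _ => (1 : ℝ) :=
    hr.isPatch.isBigO_one S.contDiffOn_normDensity.continuousOn
  refine isBigO_congr_on ((h1.mul h2).congr_right fun z => one_mul _) fun z hz => ?_
  have hb := (S.betaFun_pos (hr.isPatch.subset hz)).ne'
  rw [density, normDensity]
  field_simp

end IsPatchRadius

end StaticGeometry

section PullMixed

variable {m : ℕ} {H : Type*} [TopologicalSpace H]
  {I : ModelWithCorners ℝ (EuclideanSpace ℝ (Fin (m + 1))) H}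
  {M : Type*} [TopologicalSpace M] [ChartedSpace H M] [IsManifold I ∞ M]
  {κ : EuclideanSpace ℝ (Fin (m + 1)) → M} {U : Set (EuclideanSpace ℝ (Fin (m + 1)))}

lemma CoordForms.d_congr {ξ η : CoordForms m} (hU : IsOpen U) (h : ∀ k, ∀ z ∈ U, ξ k z = η k z)
    (k : ℕ) {z} (hz : z ∈ U) : ξ.d k z = η.d k z := by
  cases k with
  | zero => rfl
  | succ k =>
    have h1 : ξ k =ᶠ[nhds z] η k := by
      filter_upwards [hU.mem_nhds hz] with w hw using h k w hw
    rw [CoordForms.d, CoordForms.d, extDeriv, extDeriv, h1.fderiv_eq]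

lemma IsParam.pull_mixed_extD (hκ : IsParam I κ U) {ξ : MixedForm I M}
    (hξ : ξ.SmoothOn (I.interior M)) (k : ℕ) {z} (hz : z ∈ U) :
    pull κ (ξ.extD k) z = CoordForms.d (fun k => pull κ (ξ k)) k z := by
  cases k with
  | zero => rfl
  | succ k => exact hκ.pull_extD (hξ k) hz

end PullMixed

namespace StaticGeometry

open Asymptotics Filter

variable {m : ℕ}
  {X : Type*} [TopologicalSpace X] [ChartedSpace (EuclideanHalfSpace (m + 1)) X]
  [IsManifold (𝓡∂ (m + 1)) ∞ X]
  {Y : Type*} [TopologicalSpace Y] [ChartedSpace (EuclideanSpace ℝ (Fin m)) Y]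
  [IsManifold (𝓡 m) ∞ Y] (S : StaticGeometry m X Y) {c : Y}

/-- Multiplication of a form by the boundary defining function. -/
def mulα (ξ : MixedForm (𝓡∂ (m + 1)) X) : MixedForm (𝓡∂ (m + 1)) X :=
  ξ.mulFun fun x => (S.α x : ℂ)

lemma contMDiff_α_ofReal : ContMDiff (𝓡∂ (m + 1)) 𝓘(ℝ, ℂ) ∞ fun x => (S.α x : ℂ) :=
  Complex.ofRealCLM.contDiff.contMDiff.comp S.α_smooth

lemma smoothOn_mulα {ξ : MixedForm (𝓡∂ (m + 1)) X} (hξ : ξ.SmoothOn ((𝓡∂ (m + 1)).interior X)) :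
    MixedForm.SmoothOn (S.mulα ξ) ((𝓡∂ (m + 1)).interior X) := fun k =>
  (hξ k).smul_fun S.contMDiff_α_ofReal.contMDiffOn

/-- The exterior product of `dα` with a form. -/
def dαWedge (φ : MixedForm (𝓡∂ (m + 1)) X) : MixedForm (𝓡∂ (m + 1)) X := fun k x =>
  (S.mulα φ).extD k x - (S.α x : ℂ) • φ.extD k x

lemma pull_mulα (ξ : MixedForm (𝓡∂ (m + 1)) X) (k : ℕ) {z : EuclideanSpace ℝ (Fin (m + 1))}
    (hz : z ∈ S.collarDom c) :
    pull (S.collarMap c) (S.mulα ξ k) z = (z 0 : ℂ) • pull (S.collarMap c) (ξ k) z := by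
  rw [← S.α_collarMap (S.collarDom_subset hz)]
  rfl

lemma pull_extD_mulα {ξ : MixedForm (𝓡∂ (m + 1)) X} (hξ : ξ.SmoothOn ((𝓡∂ (m + 1)).interior X))
    (k : ℕ) {z : EuclideanSpace ℝ (Fin (m + 1))} (hz : z ∈ S.collarDom c) :
    pull (S.collarMap c) ((S.mulα ξ).extD k) z =
      (CoordForms.mulCoord fun k => pull (S.collarMap c) (ξ k)).d k z := by
  rw [S.isParam_collarMap.pull_mixed_extD (S.smoothOn_mulα hξ) k hz]
  exact CoordForms.d_congr S.isOpen_collarDom (fun k w hw => S.pull_mulα ξ k hw) k hz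

lemma pull_dαWedge_zero (φ : MixedForm (𝓡∂ (m + 1)) X) {z : EuclideanSpace ℝ (Fin (m + 1))} :
    pull (S.collarMap c) (S.dαWedge φ 0) z = 0 := by
  have h1 : pull (S.collarMap c) (S.dαWedge φ 0) z =
      (0 : EuclideanSpace ℝ (Fin (m + 1)) [⋀^Fin 0]→L[ℝ] ℂ) -
        (S.α (S.collarMap c z) : ℂ) • (0 : EuclideanSpace ℝ (Fin (m + 1)) [⋀^Fin 0]→L[ℝ] ℂ) := rfl
  rw [h1]
  ext v
  simp

lemma pull_dαWedge_succ {φ : MixedForm (𝓡∂ (m + 1)) X} (hφ : φ.SmoothOn ((𝓡∂ (m + 1)).interior X))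
    (k : ℕ) {z : EuclideanSpace ℝ (Fin (m + 1))} (hz : z ∈ S.collarDom c) :
    pull (S.collarMap c) (S.dαWedge φ (k + 1)) z =
      coordWedge 0 (pull (S.collarMap c) (φ k) z) := by
  have h1 : pull (S.collarMap c) (S.dαWedge φ (k + 1)) z =
      pull (S.collarMap c) ((S.mulα φ).extD (k + 1)) z -
        (S.α (S.collarMap c z) : ℂ) • pull (S.collarMap c) (φ.extD (k + 1)) z := rfl
  have hd := (hφ k).differentiableAt_pull S.isParam_collarMap hz
  have h2 := extDeriv_fun_smul_form ((contDiff_coord (0 : Fin (m + 1))).differentiable (by simp) z) hd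
  have h3 : fderiv ℝ (fun z : EuclideanSpace ℝ (Fin (m + 1)) => z 0) z = EuclideanSpace.proj 0 :=
    (EuclideanSpace.proj (𝕜 := ℝ) (0 : Fin (m + 1))).fderiv
  rw [h3] at h2
  rw [h1, S.pull_extD_mulα hφ _ hz, S.α_collarMap (S.collarDom_subset hz),
    S.isParam_collarMap.pull_mixed_extD hφ _ hz]
  refine (sub_eq_iff_eq_add').mpr ?_
  exact h2

/-- `α δ̂(σ)u` and `α d̂(σ)u` in the interior. -/
lemma mulα_dHat (σ : ℂ) (u : S.Form) (k : ℕ) {x : X} (hx : x ∈ (𝓡∂ (m + 1)).interior X) :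
    S.mulα (S.dHat σ u).2 k x =
      (-(Complex.I * σ)) • u.1 k x + (-1 : ℂ) • (S.mulα u.2).extD k x := by
  have h0 : (S.α x : ℂ) ≠ 0 := Complex.ofReal_ne_zero.mpr (S.α_pos x hx).ne'
  have h1 : S.mulα (S.dHat σ u).2 k x = (S.α x : ℂ) • ((-(Complex.I * σ * (S.α x : ℂ)⁻¹)) • u.1 k x +
      (-(S.α x : ℂ)⁻¹) • (S.mulα u.2).extD k x) := rfl
  rw [h1]
  ext v
  change (S.α x : ℂ) * ((-(Complex.I * σ * (S.α x : ℂ)⁻¹)) * u.1 k x v +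
      (-(S.α x : ℂ)⁻¹) * (S.mulα u.2).extD k x v) =
    (-(Complex.I * σ)) * u.1 k x v + (-1 : ℂ) * (S.mulα u.2).extD k x v
  field_simp

lemma mulα_eq_of_eq {σ : ℂ} {u w : S.Form} {p : MixedForm (𝓡∂ (m + 1)) X} (k : ℕ) {x : X}
    (hx : x ∈ (𝓡∂ (m + 1)).interior X)
    (h : w.1 k x = -((S.α x : ℂ)⁻¹ • p k x) + (Complex.I * σ * (S.α x : ℂ)⁻¹) • u.2 k x) :
    S.mulα w.1 k x = (-1 : ℂ) • p k x + (-(-(Complex.I * σ))) • u.2 k x := by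
  have h0 : (S.α x : ℂ) ≠ 0 := Complex.ofReal_ne_zero.mpr (S.α_pos x hx).ne'
  have h1 : S.mulα w.1 k x = (S.α x : ℂ) • w.1 k x := rfl
  rw [h1, h]
  ext v
  change (S.α x : ℂ) * (-((S.α x : ℂ)⁻¹ * p k x v) + (Complex.I * σ * (S.α x : ℂ)⁻¹) * u.2 k x v) =
    (-1 : ℂ) * p k x v + (-(-(Complex.I * σ))) * u.2 k x v
  field_simp

lemma eq_of_isDeltaHat {σ : ℂ} {u w : S.Form} {p : MixedForm (𝓡∂ (m + 1)) X} (k : ℕ) {x : X}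
    (hx : x ∈ (𝓡∂ (m + 1)).interior X)
    (h : w.1 k x = -((S.α x : ℂ)⁻¹ • p k x) + (Complex.I * σ * (S.α x : ℂ)⁻¹) • u.2 k x) :
    p k x = (-(S.α x : ℂ)) • w.1 k x + (Complex.I * σ) • u.2 k x := by
  have h0 : (S.α x : ℂ) ≠ 0 := Complex.ofReal_ne_zero.mpr (S.α_pos x hx).ne'
  rw [h]
  ext v
  change p k x v = (-(S.α x : ℂ)) * (-((S.α x : ℂ)⁻¹ * p k x v) +
    (Complex.I * σ * (S.α x : ℂ)⁻¹) * u.2 k x v) + (Complex.I * σ) * u.2 k x v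
  field_simp
  ring

lemma fiberNormSq_mulα (v : MixedForm (𝓡∂ (m + 1)) X) (x : X) :
    fiberNormSq S.h (S.mulα v) x = S.α x ^ 2 * fiberNormSq S.h v x := by
  rw [fiberNormSq_smul (η := v) (a := (S.α x : ℂ)) fun k => rfl, Complex.norm_real,
    Real.norm_eq_abs, sq_abs]

/-- The decay rate near a boundary point. -/
lemma phase_exponent_re (σ : ℂ) :
    (-(Complex.I * (S.βt (0, c) : ℂ) * σ)).re = S.βt (0, c) * σ.im := by
  simp

variable {S} {r : ℝ} (hr : S.IsPatchRadius c r)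
include hr

namespace IsPatchRadius

lemma mulCoord_isBigO {V : Type*} [NormedAddCommGroup V] [NormedSpace ℂ V]
    {f : EuclideanSpace ℝ (Fin (m + 1)) → V} {g : EuclideanSpace ℝ (Fin (m + 1)) → ℝ}
    (hf : f =O[𝓟 (collarPatch c r)] g) :
    (fun z => (z 0 : ℂ) • f z) =O[𝓟 (collarPatch c r)] g :=
  (hr.isPatch.coord_isBigO.smul hf).congr_right fun z => one_mul (g z)

variable {σ : ℂ} {u w : S.Form} (hu : u ∈ S.asymptoticSpace σ)
include hu

lemma tangPart_left : ∀ k, (fun z => tangPart (pull (S.collarMap c) (u.1 k) z))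
    =O[𝓟 (collarPatch c r)] fun z => z 0 ^ (-(Complex.I * (S.βt (0, c) : ℂ) * σ)).re := fun k =>
  ((hr.conormalPair hu).tang_left k).isBigO hr.isPatch

lemma tangPart_mulα_left : ∀ k, (fun z => tangPart (pull (S.collarMap c) (S.mulα u.1 k) z))
    =O[𝓟 (collarPatch c r)] fun z => z 0 ^ (-(Complex.I * (S.βt (0, c) : ℂ) * σ)).re := fun k =>
  isBigO_congr_on (hr.mulCoord_isBigO (hr.tangPart_left hu k)) fun z hz => by
    rw [S.pull_mulα _ _ (hr.patch_subset hz), tangPart_smul]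

lemma normPart_mulα_left : ∀ k, (fun z => normPart (pull (S.collarMap c) (S.mulα u.1 (k + 1)) z))
    =O[𝓟 (collarPatch c r)] fun z => z 0 ^ (-(Complex.I * (S.βt (0, c) : ℂ) * σ)).re := fun k =>
  isBigO_congr_on (((hr.conormalPair hu).norm_left k).isBigO hr.isPatch) fun z hz => by
    rw [S.pull_mulα _ _ (hr.patch_subset hz), normPart_smul]

lemma tangPart_mulα_right : ∀ k, (fun z => tangPart (pull (S.collarMap c) (S.mulα u.2 k) z))
    =O[𝓟 (collarPatch c r)] fun z => z 0 ^ (-(Complex.I * (S.βt (0, c) : ℂ) * σ)).re := fun k =>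
  isBigO_congr_on (((hr.conormalPair hu).tang_right k).isBigO hr.isPatch) fun z hz => by
    rw [S.pull_mulα _ _ (hr.patch_subset hz), tangPart_smul]

lemma normPart_right : ∀ k, (fun z => normPart (pull (S.collarMap c) (u.2 (k + 1)) z))
    =O[𝓟 (collarPatch c r)] fun z => z 0 ^ (-(Complex.I * (S.βt (0, c) : ℂ) * σ)).re := fun k =>
  ((hr.conormalPair hu).norm_right k).isBigO hr.isPatch

lemma normPart_mulα_right : ∀ k, (fun z => normPart (pull (S.collarMap c) (S.mulα u.2 (k + 1)) z))
    =O[𝓟 (collarPatch c r)] fun z => z 0 ^ (-(Complex.I * (S.βt (0, c) : ℂ) * σ)).re := fun k =>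
  isBigO_congr_on (hr.mulCoord_isBigO (hr.normPart_right hu k)) fun z hz => by
    rw [S.pull_mulα _ _ (hr.patch_subset hz), normPart_smul]

lemma tangPart_d : ∀ k, (fun z => tangPart (pull (S.collarMap c) ((S.dHat σ u).1 k) z))
    =O[𝓟 (collarPatch c r)] fun z => z 0 ^ (-(Complex.I * (S.βt (0, c) : ℂ) * σ)).re := fun k =>
  isBigO_congr_on ((hr.conormalPair hu).tangPart_d_left hr.isPatch k) fun z hz => by
    rw [dHat, S.isParam_collarMap.pull_mixed_extD hu.1 k (hr.patch_subset hz)]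

lemma tangPart_mulα_d : ∀ k, (fun z => tangPart (pull (S.collarMap c) (S.mulα (S.dHat σ u).1 k) z))
    =O[𝓟 (collarPatch c r)] fun z => z 0 ^ (-(Complex.I * (S.βt (0, c) : ℂ) * σ)).re := fun k =>
  isBigO_congr_on (hr.mulCoord_isBigO (hr.tangPart_d hu k)) fun z hz => by
    rw [S.pull_mulα _ _ (hr.patch_subset hz), tangPart_smul]

lemma normPart_mulα_d : ∀ k,
    (fun z => normPart (pull (S.collarMap c) (S.mulα (S.dHat σ u).1 (k + 1)) z))
    =O[𝓟 (collarPatch c r)] fun z => z 0 ^ (-(Complex.I * (S.βt (0, c) : ℂ) * σ)).re := fun k =>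
  isBigO_congr_on ((hr.conormalPair hu).normPart_d_left hr.isPatch k) fun z hz => by
    rw [S.pull_mulα _ _ (hr.patch_subset hz), normPart_smul, dHat,
      S.isParam_collarMap.pull_mixed_extD hu.1 (k + 1) (hr.patch_subset hz)]

omit hr in
lemma pull_mulα_dHat (k : ℕ) {z : EuclideanSpace ℝ (Fin (m + 1))} (hz : z ∈ S.collarDom c) :
    pull (S.collarMap c) (S.mulα (S.dHat σ u).2 k) z =
      (-(Complex.I * σ)) • pull (S.collarMap c) (u.1 k) z -
        (CoordForms.mulCoord fun k => pull (S.collarMap c) (u.2 k)).d k z := by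
  rw [← S.pull_extD_mulα hu.2.1 k hz, sub_eq_add_neg,
    ← neg_one_smul ℂ (pull (S.collarMap c) ((S.mulα u.2).extD k) z)]
  change (formAt (S.mulα (S.dHat σ u).2 k) (S.collarMap c z)).compContinuousLinearMap _ = _
  rw [show formAt (S.mulα (S.dHat σ u).2 k) (S.collarMap c z) =
    (-(Complex.I * σ)) • formAt (u.1 k) (S.collarMap c z) +
      (-1 : ℂ) • formAt ((S.mulα u.2).extD k) (S.collarMap c z) from
    S.mulα_dHat σ u k (S.collarMap_mem_interior hz)]
  rfl

lemma tangPart_mulα_dHat : ∀ k,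
    (fun z => tangPart (pull (S.collarMap c) (S.mulα (S.dHat σ u).2 k) z))
    =O[𝓟 (collarPatch c r)] fun z => z 0 ^ (-(Complex.I * (S.βt (0, c) : ℂ) * σ)).re := fun k =>
  isBigO_congr_on ((hr.conormalPair hu).tangPart_combination hr.isPatch _ k) fun z hz => by
    rw [pull_mulα_dHat hu k (hr.patch_subset hz)]

lemma normPart_mulα_dHat : ∀ k,
    (fun z => normPart (pull (S.collarMap c) (S.mulα (S.dHat σ u).2 (k + 1)) z))
    =O[𝓟 (collarPatch c r)] fun z => z 0 ^ (-(Complex.I * (S.βt (0, c) : ℂ) * σ)).re := fun k =>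
  isBigO_congr_on ((hr.conormalPair hu).normPart_combination hr.isPatch
    (c := -(Complex.I * σ)) (by ring) k) fun z hz => by
    rw [pull_mulα_dHat hu (k + 1) (hr.patch_subset hz)]

variable [T2Space X] [CompactSpace X] [MeasurableSpace X] [BorelSpace X]

lemma pairing_mulα_left {p : MixedForm (𝓡∂ (m + 1)) X}
    (hp : (u.1.mulFun fun x => (S.α x : ℂ)).IsCodifferential S.h p)
    (hw : ∀ x ∈ (𝓡∂ (m + 1)).interior X, ∀ k : ℕ,
      w.1 k x = -((S.α x : ℂ)⁻¹ • p k x) + (Complex.I * σ * (S.α x : ℂ)⁻¹) • u.2 k x)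
    (k : ℕ) (e : EuclideanSpace ℝ (Fin (m + 1)) [⋀^Fin k]→L[ℝ] ℂ) :
    (fun z => weightedPairing S.h (S.collarMap c) e (S.mulα w.1 k) z) =O[𝓟 (collarPatch c r)]
      fun z => z 0 ^ (-(Complex.I * (S.βt (0, c) : ℂ) * σ)).re := by
  have h1 := (hr.conormalPair hu).blockPairing_left_isBigO hr.isPatch S.contDiffOn_density
    S.contDiffOn_normDensity S.contDiffOn_kInv e (c := -(Complex.I * σ)) (by ring)
    hr.beta_sq_sub_isBigO (p := pull (S.collarMap c) (p k)) fun z hz => by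
      have hz' := hr.patch_subset hz
      rw [← S.weightedPairing_collarMap hz',
        S.isParam_collarMap.weightedPairing_codifferential (S.smoothOn_mulα hu.1 (k + 1)) (hp k) e hz']
      congr 1
      refine Finset.sum_congr rfl fun i _ => ?_
      congr 1
      refine Filter.EventuallyEq.fderiv_eq ?_
      filter_upwards [S.isOpen_collarDom.mem_nhds hz'] with y hy
      rw [S.weightedPairing_collarMap hy]
      have h2 := S.pull_mulα u.1 (k + 1) hy
      simp only [blockPairing, CoordForms.mulCoord, h2]
  refine isBigO_congr_on h1 fun z hz => ?_
  have hz' := hr.patch_subset hz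
  rw [S.weightedPairing_collarMap hz']
  have h3 : pull (S.collarMap c) (S.mulα w.1 k) z = (-1 : ℂ) • pull (S.collarMap c) (p k) z +
      (-(-(Complex.I * σ))) • pull (S.collarMap c) (u.2 k) z := by
    change (formAt (S.mulα w.1 k) (S.collarMap c z)).compContinuousLinearMap _ = _
    rw [show formAt (S.mulα w.1 k) (S.collarMap c z) =
      (-1 : ℂ) • formAt (p k) (S.collarMap c z) +
        (-(-(Complex.I * σ))) • formAt (u.2 k) (S.collarMap c z) from
      S.mulα_eq_of_eq k (S.collarMap_mem_interior hz') (hw _ (S.collarMap_mem_interior hz') k)]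
    rfl
  cases k <;> simp only [blockPairing, h3]

lemma pairing_mulα_right {q : MixedForm (𝓡∂ (m + 1)) X} (hq : u.2.IsCodifferential S.h q)
    (hw : ∀ x ∈ (𝓡∂ (m + 1)).interior X, ∀ k : ℕ, w.2 k x = q k x)
    (k : ℕ) (e : EuclideanSpace ℝ (Fin (m + 1)) [⋀^Fin k]→L[ℝ] ℂ) :
    (fun z => weightedPairing S.h (S.collarMap c) e (S.mulα w.2 k) z) =O[𝓟 (collarPatch c r)]
      fun z => z 0 ^ (-(Complex.I * (S.βt (0, c) : ℂ) * σ)).re := by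
  have h1 := (hr.conormalPair hu).blockPairing_right_isBigO hr.isPatch S.contDiffOn_density
    S.contDiffOn_normDensity S.contDiffOn_kInv e (q := pull (S.collarMap c) (q k)) fun z hz => by
      have hz' := hr.patch_subset hz
      rw [← S.weightedPairing_collarMap hz',
        S.isParam_collarMap.weightedPairing_codifferential (hu.2.1 (k + 1)) (hq k) e hz']
      congr 1
      refine Finset.sum_congr rfl fun i _ => ?_
      congr 1
      refine Filter.EventuallyEq.fderiv_eq ?_
      filter_upwards [S.isOpen_collarDom.mem_nhds hz'] with y hy
      rw [S.weightedPairing_collarMap hy]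
  refine isBigO_congr_on h1 fun z hz => ?_
  have hz' := hr.patch_subset hz
  have h3 : pull (S.collarMap c) (S.mulα w.2 k) z = (z 0 : ℂ) • pull (S.collarMap c) (q k) z := by
    rw [S.pull_mulα _ _ hz']
    congr 1
    exact congrArg (fun θ : EuclideanSpace ℝ (Fin (m + 1)) [⋀^Fin k]→L[ℝ] ℂ =>
      θ.compContinuousLinearMap (modelDeriv (𝓡∂ (m + 1)) (S.collarMap c) z))
      (hw _ (S.collarMap_mem_interior hz') k)
  rw [← S.weightedPairing_collarMap hz', weightedPairing, weightedPairing, h3, altInner_smul_right,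
    Complex.conj_ofReal]
  ring

end IsPatchRadius

end StaticGeometry

section PowerIntegral

variable {m : ℕ}

lemma setLIntegral_rpow_lt_top {γ : ℝ} (hγ : 0 < γ) (r : ℝ) :
    ∫⁻ s in Ioo 0 r, ENNReal.ofReal (s ^ (γ - 1)) < ⊤ := by
  rcases le_or_gt r 0 with hr | hr
  · simp [Ioo_eq_empty_of_le hr]
  have h1 := intervalIntegral.intervalIntegrable_rpow' (a := 0) (b := r) (r := γ - 1) (by linarith)
  rw [intervalIntegrable_iff_integrableOn_Ioo_of_le hr.le] at h1
  refine lt_of_le_of_lt (lintegral_mono fun s => ?_) h1.2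
  exact Real.ofReal_le_enorm _

/-- A negative power of the first coordinate is integrable over bounded sets in the half-space. -/
lemma setLIntegral_coord_rpow_lt_top {γ : ℝ} (hγ : 0 < γ) {r R : ℝ}
    {V : Set (EuclideanSpace ℝ (Fin (m + 1)))}
    (hV : ∀ z ∈ V, z 0 ∈ Ioo 0 r ∧ ∀ i : Fin m, |z i.succ| ≤ R) :
    ∫⁻ z in V, ENNReal.ofReal (z 0 ^ (γ - 1)) < ⊤ := by
  have hφ : MeasurePreserving (fun z : EuclideanSpace ℝ (Fin (m + 1)) =>
      MeasurableEquiv.piFinSuccAbove (fun _ => ℝ) 0 z.ofLp) volume (volume.prod volume) :=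
    (volume_preserving_piFinSuccAbove (fun _ : Fin (m + 1) => ℝ) 0).comp
      (PiLp.volume_preserving_ofLp (Fin (m + 1)))
  set B : Set (Fin m → ℝ) := Set.pi univ fun _ => Icc (-R) R with hB
  have hBm : MeasurableSet B := MeasurableSet.univ_pi fun _ => measurableSet_Icc
  have hBf : volume B < ⊤ := (isCompact_univ_pi fun _ => isCompact_Icc).measure_lt_top
  have hF : Measurable fun s : ℝ => ENNReal.ofReal (s ^ (γ - 1)) :=
    (measurable_id.pow_const _).ennreal_ofReal
  have h1 := hφ.setLIntegral_comp_preimage (measurableSet_Ioo.prod hBm : MeasurableSet (Ioo 0 r ×ˢ B))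
    (f := fun p => ENNReal.ofReal (p.1 ^ (γ - 1))) (hF.comp measurable_fst)
  have h2 : ∫⁻ p in Ioo 0 r ×ˢ B, ENNReal.ofReal (p.1 ^ (γ - 1)) ∂(volume.prod volume) < ⊤ := by
    rw [← Measure.prod_restrict]
    have h3 := lintegral_prod_mul (μ := volume.restrict (Ioo 0 r)) (ν := volume.restrict B)
      (f := fun s : ℝ => ENNReal.ofReal (s ^ (γ - 1))) (g := fun _ => 1) hF.aemeasurable
      aemeasurable_const
    simp only [mul_one, lintegral_const, Measure.restrict_apply MeasurableSet.univ, univ_inter,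
      one_mul] at h3
    rw [h3]
    exact ENNReal.mul_lt_top (setLIntegral_rpow_lt_top hγ r) hBf
  rw [← h1] at h2
  refine lt_of_le_of_lt (lintegral_mono_set fun z hz => ?_) h2
  refine ⟨(hV z hz).1, fun i _ => ?_⟩
  exact abs_le.mp ((hV z hz).2 i)

end PowerIntegral

namespace StaticGeometry

open Asymptotics Filter

variable {m : ℕ}
  {X : Type*} [TopologicalSpace X] [ChartedSpace (EuclideanHalfSpace (m + 1)) X]
  [IsManifold (𝓡∂ (m + 1)) ∞ X]
  {Y : Type*} [TopologicalSpace Y] [ChartedSpace (EuclideanSpace ℝ (Fin m)) Y]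
  [IsManifold (𝓡 m) ∞ Y] (S : StaticGeometry m X Y) {c : Y} {r : ℝ}

/-- Functions that are bounded near the boundary by an integrable power of `α`. -/
def BoundaryDominated {V : Type*} [NormedAddCommGroup V] (f : X → V) : Prop :=
  ∀ (c : Y) (r : ℝ), S.IsPatchRadius c r → ∃ γ : ℝ, 0 < γ ∧
    (fun z => f (S.collarMap c z)) =O[𝓟 (collarPatch c r)] fun z => z 0 ^ (γ - 1)

/-- A neighbourhood of a boundary point whose interior part is covered by a patch. -/
lemma exists_nhds_subset_image (hr : S.IsPatchRadius c r) :
    ∃ W ∈ nhds (S.Φ (0, c)), W ∩ (𝓡∂ (m + 1)).interior X ⊆ S.collarMap c '' collarPatch c r := by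
  have hmem : ((0 : ℝ), c) ∈ Ico 0 S.ε ×ˢ (univ : Set Y) := ⟨⟨le_rfl, S.ε_pos⟩, mem_univ _⟩
  have hnh : S.Φ '' (Ico 0 S.ε ×ˢ univ) ∈ nhds (S.Φ (0, c)) := S.Φ_open.mem_nhds ⟨_, hmem, rfl⟩
  have hΨ : ContinuousAt S.Ψ (S.Φ (0, c)) := (S.Ψ_smooth.contMDiffAt hnh).continuousAt
  have hball : (extChartAt (𝓡 m) c).source ∩ (extChartAt (𝓡 m) c) ⁻¹'
      (Metric.ball (extChartAt (𝓡 m) c c) r) ∈ nhds c :=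
    inter_mem (extChartAt_source_mem_nhds c)
      ((continuousAt_extChartAt c).preimage_mem_nhds (Metric.ball_mem_nhds _ hr.pos))
  have h1 : Iio r ×ˢ ((extChartAt (𝓡 m) c).source ∩ (extChartAt (𝓡 m) c) ⁻¹'
      (Metric.ball (extChartAt (𝓡 m) c c) r)) ∈ nhds (S.Ψ (S.Φ (0, c))) := by
    rw [S.Ψ_left_inv _ hmem]
    exact prod_mem_nhds (Iio_mem_nhds hr.pos) hball
  refine ⟨_, inter_mem hnh (hΨ.preimage_mem_nhds h1), ?_⟩
  rintro x ⟨⟨⟨⟨s, y⟩, hs, rfl⟩, hx⟩, hxi⟩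
  rw [mem_preimage, S.Ψ_left_inv _ hs] at hx
  rw [S.mem_interior_iff_α, S.α_collar s hs.1 y] at hxi
  refine ⟨s • basisVec 0 + tailIncl m (extChartAt (𝓡 m) c y), ⟨?_, ?_⟩, ?_⟩
  · simpa [basisVec] using ⟨hxi, hx.1⟩
  · simpa using hx.2.2
  · have h2 : (extChartAt (𝓡 m) c).symm (extChartAt (𝓡 m) c y) = y :=
      (extChartAt (𝓡 m) c).left_inv hx.2.1
    rw [collarMap, collarPoint, map_add, map_smul, tailProj_basisVec_zero, smul_zero, zero_add,
      tailProj_tailIncl, h2]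
    simp [basisVec]

variable [T2Space X] [CompactSpace X] [MeasurableSpace X] [BorelSpace X]

omit [T2Space X] in
/-- Continuous functions that are bounded near the boundary by an integrable power of `α` are
integrable. -/
lemma integrableOn_of_boundaryDominated {V : Type*} [NormedAddCommGroup V]
    [SecondCountableTopologyEither X V] {f : X → V}
    (hf : ContinuousOn f ((𝓡∂ (m + 1)).interior X)) (hd : S.BoundaryDominated f) :
    IntegrableOn f ((𝓡∂ (m + 1)).interior X) (riemannianVolume S.h) := by
  have hfe : ContinuousOn (fun x => ‖f x‖ₑ) ((𝓡∂ (m + 1)).interior X) :=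
    continuous_enorm.comp_continuousOn hf
  refine ⟨hf.aestronglyMeasurable isOpen_interior_manifold.measurableSet, ?_⟩
  refine setLIntegral_lt_top_of_locally S.h fun x => ?_
  by_cases hx : x ∈ (𝓡∂ (m + 1)).interior X
  · obtain ⟨W, hW, h1⟩ := exists_nhds_setLIntegral_lt_top S.h hfe (fun _ _ => by simp) hx
    exact ⟨W, hW, (lintegral_mono_set inter_subset_left).trans_lt h1⟩
  have hxb : x ∈ (𝓡∂ (m + 1)).boundary X := by
    rwa [← mem_compl_iff, ModelWithCorners.compl_interior] at hx
  obtain ⟨⟨s, c⟩, hs, rfl⟩ := S.Φ_boundary hxb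
  have hs0 : s = 0 := by rw [← S.α_collar s hs.1 c]; exact S.α_boundary _ hxb
  subst hs0
  obtain ⟨r, hr⟩ := S.exists_isPatchRadius c
  obtain ⟨W, hW, hWsub⟩ := S.exists_nhds_subset_image hr
  refine ⟨W, hW, (lintegral_mono_set hWsub).trans_lt ?_⟩
  obtain ⟨γ, hγ, hO⟩ := hd c r hr
  have hpar := S.isParam_collarMap.mono hr.isPatch.isOpen hr.patch_subset
  have hsub : S.collarMap c '' collarPatch c r ⊆ (𝓡∂ (m + 1)).interior X := by
    rintro _ ⟨z, hz, rfl⟩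
    exact S.collarMap_mem_interior (hr.patch_subset hz)
  rw [hpar.setLIntegral_eq S.h (hfe.mono hsub)]
  have hρ : S.density c =O[𝓟 (collarPatch c r)] fun _ => (1 : ℝ) :=
    hr.isPatch.isBigO_one S.contDiffOn_density.continuousOn
  obtain ⟨C, hC⟩ := ((hρ.mul hO.norm_left).congr_right fun z => one_mul _).bound
  rw [eventually_principal] at hC
  have hle : ∀ z ∈ collarPatch c r,
      ENNReal.ofReal (Real.sqrt (gramAlong S.h (S.collarMap c) z).det) * ‖f (S.collarMap c z)‖ₑ ≤
        ENNReal.ofReal C * ENNReal.ofReal (z 0 ^ (γ - 1)) := by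
    intro z hz
    have h1 := hC z hz
    have hp : 0 ≤ z 0 ^ (γ - 1) := Real.rpow_nonneg hz.1.1.le _
    have hd0 : 0 ≤ S.density c z := by
      rw [← S.sqrt_det_gramAlong (hr.patch_subset hz)]; exact Real.sqrt_nonneg _
    rw [norm_mul, norm_norm, Real.norm_of_nonneg hd0, Real.norm_of_nonneg hp] at h1
    rw [S.sqrt_det_gramAlong (hr.patch_subset hz), ← ofReal_norm,
      ← ENNReal.ofReal_mul hd0, ← ENNReal.ofReal_mul' hp]
    exact ENNReal.ofReal_le_ofReal h1
  refine (setLIntegral_mono' hr.isPatch.isOpen.measurableSet hle).trans_lt ?_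
  rw [lintegral_const_mul' _ _ ENNReal.ofReal_ne_top]
  refine ENNReal.mul_lt_top ENNReal.ofReal_lt_top (setLIntegral_coord_rpow_lt_top hγ (r := r)
    (R := ‖extChartAt (𝓡 m) c c‖ + r) fun z hz => ⟨hz.1, fun i => ?_⟩)
  have h1 : |z i.succ| ≤ ‖tailProj m z‖ := PiLp.norm_apply_le (tailProj m z) i
  have h2 : ‖tailProj m z - extChartAt (𝓡 m) c c‖ < r := by
    rw [← dist_eq_norm]; exact hz.2
  have h3 := norm_sub_norm_le (tailProj m z) (extChartAt (𝓡 m) c c)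
  linarith

end StaticGeometry

section MixedSmooth

variable {d : ℕ} {H : Type*} [TopologicalSpace H]
  {I : ModelWithCorners ℝ (EuclideanSpace ℝ (Fin d)) H}
  {M : Type*} [TopologicalSpace M] [ChartedSpace H M] [IsManifold I ∞ M]

lemma MixedForm.SmoothOn.lin {ξ η θ : MixedForm I M} (hη : η.SmoothOn (I.interior M))
    (hθ : θ.SmoothOn (I.interior M)) {a b : ℂ}
    (hξ : ∀ k, ∀ x ∈ I.interior M, ξ k x = a • η k x + b • θ k x) :
    ξ.SmoothOn (I.interior M) := fun k =>
  (((hη k).const_smul a).add ((hθ k).const_smul b)).congr (hξ k)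

end MixedSmooth

namespace StaticGeometry

open Asymptotics Filter

variable {m : ℕ}
  {X : Type*} [TopologicalSpace X] [ChartedSpace (EuclideanHalfSpace (m + 1)) X]
  [IsManifold (𝓡∂ (m + 1)) ∞ X]
  {Y : Type*} [TopologicalSpace Y] [ChartedSpace (EuclideanSpace ℝ (Fin m)) Y]
  [IsManifold (𝓡 m) ∞ Y] (S : StaticGeometry m X Y) {c : Y} {r : ℝ}

lemma contMDiffOn_inv_α :
    ContMDiffOn (𝓡∂ (m + 1)) 𝓘(ℝ, ℂ) ∞ (fun x => (S.α x : ℂ)⁻¹) ((𝓡∂ (m + 1)).interior X) := by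
  have h1 : ContMDiffOn (𝓡∂ (m + 1)) 𝓘(ℝ, ℝ) ∞ (fun x => (S.α x)⁻¹) ((𝓡∂ (m + 1)).interior X) :=
    S.α_smooth.contMDiffOn.inv₀ fun x hx => (S.α_pos x hx).ne'
  have h2 := Complex.ofRealCLM.contDiff.contMDiff.comp_contMDiffOn (n := ∞) h1
  refine h2.congr fun x _ => ?_
  simp

lemma smoothOn_of_mulα {ξ : MixedForm (𝓡∂ (m + 1)) X}
    (hξ : MixedForm.SmoothOn (S.mulα ξ) ((𝓡∂ (m + 1)).interior X)) :
    ξ.SmoothOn ((𝓡∂ (m + 1)).interior X) := fun k => by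
  refine ((hξ k).smul_fun S.contMDiffOn_inv_α).congr fun x hx => ?_
  have h0 : (S.α x : ℂ) ≠ 0 := Complex.ofReal_ne_zero.mpr (S.α_pos x hx).ne'
  ext v
  change ξ k x v = (S.α x : ℂ)⁻¹ * ((S.α x : ℂ) * ξ k x v)
  rw [← mul_assoc, inv_mul_cancel₀ h0, one_mul]

lemma smoothOn_dαWedge {φ : MixedForm (𝓡∂ (m + 1)) X}
    (hφ : φ.SmoothOn ((𝓡∂ (m + 1)).interior X)) :
    MixedForm.SmoothOn (S.dαWedge φ) ((𝓡∂ (m + 1)).interior X) := by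
  intro k
  refine (((S.smoothOn_mulα hφ).extD k).add
    ((((hφ.extD k).smul_fun S.contMDiff_α_ofReal.contMDiffOn)).const_smul (-1))).congr fun x _ => ?_
  ext v
  change (S.mulα φ).extD k x v - (S.α x : ℂ) * φ.extD k x v =
    (S.mulα φ).extD k x v + (-1 : ℂ) * ((S.α x : ℂ) * φ.extD k x v)
  ring

variable {σ : ℂ} {u w : S.Form} (hu : u ∈ S.asymptoticSpace σ)

section
include hu

lemma smoothOn_dHat_left : MixedForm.SmoothOn (S.dHat σ u).1 ((𝓡∂ (m + 1)).interior X) :=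
  hu.1.extD

lemma smoothOn_dHat_right : MixedForm.SmoothOn (S.dHat σ u).2 ((𝓡∂ (m + 1)).interior X) :=
  S.smoothOn_of_mulα (hu.1.lin (S.smoothOn_mulα hu.2.1).extD fun k _ hx => S.mulα_dHat σ u k hx)

variable [MeasurableSpace X]

lemma smoothOn_deltaHat_left (hw : S.IsDeltaHat σ u w) :
    w.1.SmoothOn ((𝓡∂ (m + 1)).interior X) := by
  obtain ⟨p, q, hp, hq, h⟩ := hw
  exact S.smoothOn_of_mulα (MixedForm.SmoothOn.lin (fun k => (hp k).1) hu.2.1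
    fun k x hx => S.mulα_eq_of_eq k hx (h x hx k).1)

omit hu in
lemma smoothOn_deltaHat_right (hw : S.IsDeltaHat σ u w) :
    w.2.SmoothOn ((𝓡∂ (m + 1)).interior X) := by
  obtain ⟨p, q, hp, hq, h⟩ := hw
  exact fun k => (hq k).1.congr fun x hx => (h x hx k).2

end

lemma rpow_mul_rpow_mul_inv {s g : ℝ} (hs : 0 < s) : s⁻¹ * (s ^ g * s ^ g) = s ^ (2 * g - 1) := by
  rw [Real.rpow_sub_one hs.ne', two_mul, Real.rpow_add hs, div_eq_inv_mul]

/-- Bounds near the boundary by the square of the leading behaviour of the elements of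
`C^∞_(σ)`. -/
def SquareBound {V : Type*} [NormedAddCommGroup V] (σ : ℂ) (f : X → V) : Prop :=
  ∀ (c : Y) (r : ℝ), S.IsPatchRadius c r →
    (fun z => f (S.collarMap c z)) =O[𝓟 (collarPatch c r)]
      fun z => z 0 ^ (-(Complex.I * (S.βt (0, c) : ℂ) * σ)).re *
        z 0 ^ (-(Complex.I * (S.βt (0, c) : ℂ) * σ)).re

lemma SquareBound.boundaryDominated {S : StaticGeometry m X Y} {V : Type*} [NormedAddCommGroup V]
    [NormedSpace ℝ V] (hσ : 0 < σ.im) {f : X → V}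
    (hf : S.SquareBound σ f) : S.BoundaryDominated fun x => (S.α x)⁻¹ • f x := by
  intro c r hr
  have hβ : 0 < S.βt (0, c) := S.βt_pos _ ⟨⟨le_rfl, pow_pos S.ε_pos 2⟩, mem_univ _⟩
  refine ⟨2 * (-(Complex.I * (S.βt (0, c) : ℂ) * σ)).re, ?_, ?_⟩
  · rw [S.phase_exponent_re]; positivity
  · have h1 := (isBigO_refl (fun z : EuclideanSpace ℝ (Fin (m + 1)) => (z 0)⁻¹)
      (𝓟 (collarPatch c r))).smul (hf c r hr)
    refine h1.congr' ?_ ?_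
    · rw [EventuallyEq, eventually_principal]
      intro z hz
      simp only
      rw [S.α_collarMap (hr.isPatch.subset hz)]
    · rw [EventuallyEq, eventually_principal]
      intro z hz
      exact rpow_mul_rpow_mul_inv hz.1.1

lemma boundaryDominated_normSq (hσ : 0 < σ.im) {v : MixedForm (𝓡∂ (m + 1)) X}
    (hv : S.SquareBound σ fun x => fiberNormSq S.h (S.mulα v) x) :
    S.BoundaryDominated fun x => S.α x * fiberNormSq S.h v x := by
  intro c r hr
  obtain ⟨γ, hγ, h⟩ := hv.boundaryDominated hσ c r hr
  refine ⟨γ, hγ, isBigO_congr_on h fun z hz => ?_⟩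
  have h0 : S.α (S.collarMap c z) ≠ 0 := by
    rw [S.α_collarMap (hr.isPatch.subset hz)]; exact hz.1.1.ne'
  simp only [fiberNormSq_mulα, smul_eq_mul]
  field_simp

lemma squareBound_dαWedge {φ η : MixedForm (𝓡∂ (m + 1)) X}
    (hφ : φ.SmoothOn ((𝓡∂ (m + 1)).interior X))
    (hT : ∀ (c : Y) (r : ℝ), S.IsPatchRadius c r → ∀ k,
      (fun z => tangPart (pull (S.collarMap c) (φ k) z)) =O[𝓟 (collarPatch c r)]
        fun z => z 0 ^ (-(Complex.I * (S.βt (0, c) : ℂ) * σ)).re)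
    (hN : ∀ (c : Y) (r : ℝ), S.IsPatchRadius c r → ∀ k,
      (fun z => normPart (pull (S.collarMap c) (η (k + 1)) z)) =O[𝓟 (collarPatch c r)]
        fun z => z 0 ^ (-(Complex.I * (S.βt (0, c) : ℂ) * σ)).re) :
    S.SquareBound σ fun x => mixedInner S.h x (S.dαWedge φ) η := by
  intro c r hr
  obtain ⟨C, hC⟩ := hr.exists_bound fun i j => (S.contDiffOn_kInv i j).continuousOn
  refine hr.mixedInner_isBigO_of_parts (fun k => ?_) fun k => ?_
  · refine isBigO_congr_on (isBigO_zero _ _) (f := fun _ => (0 : ℂ)) fun z hz => ?_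
    have h1 : tangPart (pull (S.collarMap c) (S.dαWedge φ k) z) = 0 := by
      cases k with
      | zero => rw [S.pull_dαWedge_zero]; rfl
      | succ k => rw [S.pull_dαWedge_succ hφ k (hr.patch_subset hz), tangPart_coordWedge_zero]
    rw [h1, altInner_zero_left]
  · refine isBigO_congr_on (isBigO_altInner hC (hT c r hr k) (hN c r hr k)) fun z hz => ?_
    rw [S.pull_dαWedge_succ hφ k (hr.patch_subset hz), normPart_coordWedge_zero]

section
include hu

lemma squareBound_left : S.SquareBound σ fun x => fiberNormSq S.h (S.mulα u.1) x := fun _ _ hr =>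
  hr.fiberNormSq_isBigO_of_parts (hr.tangPart_mulα_left hu) (hr.normPart_mulα_left hu)

lemma squareBound_right : S.SquareBound σ fun x => fiberNormSq S.h (S.mulα u.2) x := fun _ _ hr =>
  hr.fiberNormSq_isBigO_of_parts (hr.tangPart_mulα_right hu) (hr.normPart_mulα_right hu)

lemma squareBound_dHat_left : S.SquareBound σ fun x => fiberNormSq S.h (S.mulα (S.dHat σ u).1) x :=
  fun _ _ hr => hr.fiberNormSq_isBigO_of_parts (hr.tangPart_mulα_d hu) (hr.normPart_mulα_d hu)

lemma squareBound_dHat_right : S.SquareBound σ fun x => fiberNormSq S.h (S.mulα (S.dHat σ u).2) x :=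
  fun _ _ hr => hr.fiberNormSq_isBigO_of_parts (hr.tangPart_mulα_dHat hu)
    (hr.normPart_mulα_dHat hu)

variable [T2Space X] [CompactSpace X] [MeasurableSpace X] [BorelSpace X]

lemma squareBound_deltaHat (hw : S.IsDeltaHat σ u w) :
    (S.SquareBound σ fun x => fiberNormSq S.h (S.mulα w.1) x) ∧
      S.SquareBound σ fun x => fiberNormSq S.h (S.mulα w.2) x := by
  obtain ⟨p, q, hp, hq, h⟩ := hw
  exact ⟨fun c r hr => hr.fiberNormSq_isBigO_of_pairing fun k e =>
      hr.pairing_mulα_left hu hp (fun x hx k => (h x hx k).1) k e,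
    fun c r hr => hr.fiberNormSq_isBigO_of_pairing fun k e =>
      hr.pairing_mulα_right hu hq (fun x hx k => (h x hx k).2) k e⟩

end

variable [T2Space X] [CompactSpace X] [MeasurableSpace X] [BorelSpace X]

lemma integrableOn_normSq (hσ : 0 < σ.im) {v : MixedForm (𝓡∂ (m + 1)) X}
    (hv : v.SmoothOn ((𝓡∂ (m + 1)).interior X))
    (hb : S.SquareBound σ fun x => fiberNormSq S.h (S.mulα v) x) :
    IntegrableOn (fun x => S.α x * fiberNormSq S.h v x) ((𝓡∂ (m + 1)).interior X)
      (riemannianVolume S.h) :=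
  S.integrableOn_of_boundaryDominated
    (S.α_smooth.continuous.continuousOn.mul (continuousOn_fiberNormSq S.h hv))
    (S.boundaryDominated_normSq hσ hb)

lemma integrableOn_dαWedge (hσ : 0 < σ.im) {φ η : MixedForm (𝓡∂ (m + 1)) X}
    (hφ : φ.SmoothOn ((𝓡∂ (m + 1)).interior X)) (hη : η.SmoothOn ((𝓡∂ (m + 1)).interior X))
    (hb : S.SquareBound σ fun x => mixedInner S.h x (S.dαWedge φ) η) :
    IntegrableOn (fun x => (S.α x)⁻¹ • mixedInner S.h x (S.dαWedge φ) η)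
      ((𝓡∂ (m + 1)).interior X) (riemannianVolume S.h) := by
  refine S.integrableOn_of_boundaryDominated ?_ (hb.boundaryDominated hσ)
  exact (S.α_smooth.continuous.continuousOn.inv₀ fun x hx => (S.α_pos x hx).ne').smul
    (continuousOn_mixedInner S.h (S.smoothOn_dαWedge hφ) hη)

end StaticGeometry

section Cutoff

open Filter

lemma deriv_smoothTransition_eq_zero {t : ℝ} (ht : t < 0 ∨ 1 < t) :
    deriv Real.smoothTransition t = 0 := by
  rcases ht with ht | ht
  · have h1 : Real.smoothTransition =ᶠ[nhds t] fun _ => 0 := by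
      filter_upwards [Iio_mem_nhds ht] with s hs using Real.smoothTransition.zero_of_nonpos hs.le
    rw [h1.deriv_eq, deriv_const]
  · have h1 : Real.smoothTransition =ᶠ[nhds t] fun _ => 1 := by
      filter_upwards [Ioi_mem_nhds ht] with s hs using Real.smoothTransition.one_of_one_le hs.le
    rw [h1.deriv_eq, deriv_const]

/-- Logarithmic cutoffs near zero. -/
def cutoff (n : ℕ) (s : ℝ) : ℝ := Real.smoothTransition (n * s - 1)

lemma contDiff_cutoff (n : ℕ) : ContDiff ℝ ∞ (cutoff n) :=
  Real.smoothTransition.contDiff.comp ((contDiff_const.mul contDiff_id).sub contDiff_const)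

lemma abs_cutoff_le (n : ℕ) (s : ℝ) : |cutoff n s| ≤ 1 := by
  rw [cutoff, abs_of_nonneg (Real.smoothTransition.nonneg _)]
  exact Real.smoothTransition.le_one _

lemma deriv_cutoff (n : ℕ) (s : ℝ) :
    deriv (cutoff n) s = deriv Real.smoothTransition (n * s - 1) * n := by
  have h1 : HasDerivAt (fun s : ℝ => (n : ℝ) * s - 1) n s := by
    simpa using ((hasDerivAt_id s).const_mul (n : ℝ)).sub_const 1
  have h2 : DifferentiableAt ℝ Real.smoothTransition (n * s - 1) :=
    (Real.smoothTransition.contDiff (n := 1)).differentiable (by simp) _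
  exact (h2.hasDerivAt.comp s h1).deriv

lemma exists_abs_deriv_cutoff_le :
    ∃ C : ℝ, ∀ (n : ℕ) (s : ℝ), 0 < s → |deriv (cutoff n) s| ≤ C * s⁻¹ := by
  have hc : Continuous fun t : ℝ => deriv Real.smoothTransition (t - 1) * t :=
    ((Real.smoothTransition.contDiff.continuous_deriv (n := 1) le_rfl).comp
      (continuous_id.sub continuous_const)).mul continuous_id
  obtain ⟨C, hC⟩ := (isCompact_Icc (a := (1 : ℝ)) (b := 2)).exists_bound_of_continuousOn
    hc.continuousOn
  refine ⟨C, fun n s hs => ?_⟩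
  rw [← div_eq_mul_inv, le_div_iff₀ hs, deriv_cutoff, ← abs_of_pos hs, ← abs_mul, abs_of_pos hs,
    mul_assoc]
  by_cases ht : (n : ℝ) * s ∈ Icc (1 : ℝ) 2
  · exact hC _ ht
  · have h0 : 0 ≤ C := (norm_nonneg _).trans (hC 1 ⟨le_rfl, one_le_two⟩)
    rw [deriv_smoothTransition_eq_zero, zero_mul, abs_zero]
    · exact h0
    · rw [mem_Icc, not_and_or, not_le, not_le] at ht
      rcases ht with ht | ht
      · left; linarith
      · right; linarith

lemma cutoff_eq_zero {n : ℕ} {s : ℝ} (hs : s < (n + 1 : ℝ)⁻¹) : cutoff n s = 0 := by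
  refine Real.smoothTransition.zero_of_nonpos ?_
  have hn : (0 : ℝ) ≤ n := n.cast_nonneg
  have hn' : (0 : ℝ) < n + 1 := by linarith
  rcases le_or_gt s 0 with h0 | h0
  · nlinarith
  · have h1 : s * (n + 1) < 1 := by
      rwa [← one_div, lt_div_iff₀ hn'] at hs
    nlinarith

lemma eventually_cutoff {s : ℝ} (hs : 0 < s) :
    ∀ᶠ n : ℕ in atTop, cutoff n s = 1 ∧ deriv (cutoff n) s = 0 := by
  filter_upwards [(tendsto_natCast_atTop_atTop (R := ℝ)).eventually_gt_atTop (2 / s)] with n hn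
  rw [div_lt_iff₀ hs] at hn
  exact ⟨Real.smoothTransition.one_of_one_le (by linarith),
    by rw [deriv_cutoff, deriv_smoothTransition_eq_zero (Or.inr (by linarith)), zero_mul]⟩

end Cutoff

namespace StaticGeometry

open Asymptotics Filter

variable {m : ℕ}
  {X : Type*} [TopologicalSpace X] [ChartedSpace (EuclideanHalfSpace (m + 1)) X]
  [IsManifold (𝓡∂ (m + 1)) ∞ X]
  {Y : Type*} [TopologicalSpace Y] [ChartedSpace (EuclideanSpace ℝ (Fin m)) Y]
  [IsManifold (𝓡 m) ∞ Y] (S : StaticGeometry m X Y)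

/-- The product of a form and a function of `α`. -/
def mulFunα (g : ℝ → ℝ) (φ : MixedForm (𝓡∂ (m + 1)) X) : MixedForm (𝓡∂ (m + 1)) X :=
  φ.mulFun fun x => (g (S.α x) : ℂ)

variable {φ : MixedForm (𝓡∂ (m + 1)) X}

lemma smoothOn_mulFunα {g : ℝ → ℝ} (hg : ContDiff ℝ ∞ g)
    (hφ : φ.SmoothOn ((𝓡∂ (m + 1)).interior X)) :
    MixedForm.SmoothOn (S.mulFunα g φ) ((𝓡∂ (m + 1)).interior X) := fun k =>
  (hφ k).smul_fun (Complex.ofRealCLM.contDiff.contMDiff.comp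
    (hg.contMDiff.comp S.α_smooth)).contMDiffOn

/-- The product rule for `d(g(α) φ)`. -/
lemma extD_mulFunα {g : ℝ → ℝ} (hg : ContDiff ℝ ∞ g) (hφ : φ.SmoothOn ((𝓡∂ (m + 1)).interior X))
    (k : ℕ) {x : X} (hx : x ∈ (𝓡∂ (m + 1)).interior X) :
    (S.mulFunα g φ).extD k x =
      (g (S.α x) : ℂ) • φ.extD k x + ((deriv g (S.α x) : ℝ) : ℂ) • S.dαWedge φ k x := by
  cases k with
  | zero =>
    have : (0 : EuclideanSpace ℝ (Fin (m + 1)) [⋀^Fin 0]→L[ℝ] ℂ) =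
        (g (S.α x) : ℂ) • 0 + ((deriv g (S.α x) : ℝ) : ℂ) • (0 - (S.α x : ℂ) • 0) := by
      ext v; simp
    exact this
  | succ k =>
    refine eq_of_forall_pull_eq (ξ := (S.mulFunα g φ).extD (k + 1))
      (η := fun x => (g (S.α x) : ℂ) • φ.extD (k + 1) x +
        ((deriv g (S.α x) : ℝ) : ℂ) • S.dαWedge φ (k + 1) x) (fun c z hz => ?_) hx
    set κ := (extChartAt (𝓡∂ (m + 1)) c).symm with hκ
    have hpar := isParam_chart (I := 𝓡∂ (m + 1)) c
    have hf : DifferentiableAt ℝ (pull κ (φ k)) z := (hφ k).differentiableAt_pull hpar hz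
    have ha : DifferentiableAt ℝ (fun y => S.α (κ y)) z :=
      ((contMDiffAt_iff_contDiffAt.mp ((S.α_smooth _).comp z (hpar.contMDiffAt hz)))).differentiableAt
        (by simp)
    have hga : HasFDerivAt (fun y => g (S.α (κ y)))
        (deriv g (S.α (κ z)) • fderiv ℝ (fun y => S.α (κ y)) z) z :=
      ((hg.differentiable (by simp) _).hasDerivAt).comp_hasFDerivAt z ha.hasFDerivAt
    have h1 : pull κ ((S.mulFunα g φ).extD (k + 1)) z =
        extDeriv (fun y => g (S.α (κ y)) • pull κ (φ k) y) z :=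
      hpar.pull_mixed_extD (S.smoothOn_mulFunα hg hφ) (k + 1) hz
    have h2 : pull κ ((S.mulα φ).extD (k + 1)) z =
        extDeriv (fun y => S.α (κ y) • pull κ (φ k) y) z :=
      hpar.pull_mixed_extD (S.smoothOn_mulα hφ) (k + 1) hz
    have h3 : pull κ (φ.extD (k + 1)) z = extDeriv (pull κ (φ k)) z :=
      hpar.pull_mixed_extD hφ (k + 1) hz
    rw [h1, extDeriv_fun_smul_form hga.differentiableAt hf, hga.fderiv]
    rw [extDeriv_fun_smul_form ha hf] at h2
    change _ = (g (S.α (κ z)) : ℂ) • pull κ (φ.extD (k + 1)) z + ((deriv g (S.α (κ z)) : ℝ) : ℂ) •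
      (pull κ ((S.mulα φ).extD (k + 1)) z - (S.α (κ z) : ℂ) • pull κ (φ.extD (k + 1)) z)
    rw [h2, h3]
    congr 1
    have h4 : S.α (κ z) • extDeriv (pull κ (φ k)) z = (S.α (κ z) : ℂ) • extDeriv (pull κ (φ k)) z := rfl
    rw [h4, add_sub_cancel_left]
    ext v
    simp only [ContinuousAlternatingMap.alternatizeUncurryFin_apply,
      ContinuousAlternatingMap.smul_apply, ContinuousLinearMap.smulRight_apply,
      smul_apply, Finset.smul_sum]
    refine Finset.sum_congr rfl fun i _ => ?_
    simp only [smul_eq_mul, Complex.real_smul, Complex.ofReal_mul, zsmul_eq_mul]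
    ring

variable [T2Space X] [CompactSpace X] [MeasurableSpace X] [BorelSpace X]

omit [T2Space X] [MeasurableSpace X] [BorelSpace X] in
lemma isCompact_le_α (δ : ℝ) : IsCompact {x | δ ≤ S.α x} :=
  (isClosed_le continuous_const S.α_smooth.continuous).isCompact

omit [T2Space X] [CompactSpace X] in
lemma tendsto_integral_cutoff {f : X → ℂ}
    (hf : IntegrableOn f ((𝓡∂ (m + 1)).interior X) (riemannianVolume S.h)) :
    Tendsto (fun n => ∫ x in (𝓡∂ (m + 1)).interior X, (cutoff n (S.α x) : ℂ) * f x
      ∂(riemannianVolume S.h)) atTop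
      (nhds (∫ x in (𝓡∂ (m + 1)).interior X, f x ∂(riemannianVolume S.h))) := by
  refine tendsto_integral_of_dominated_convergence (fun x => ‖f x‖) (fun n => ?_) hf.norm
    (fun n => Eventually.of_forall fun x => ?_) ?_
  · exact ((Complex.continuous_ofReal.comp ((contDiff_cutoff n).continuous.comp
      S.α_smooth.continuous)).aestronglyMeasurable).mul hf.aestronglyMeasurable
  · rw [norm_mul, Complex.norm_real]
    exact mul_le_of_le_one_left (norm_nonneg _) (abs_cutoff_le n _)
  · filter_upwards [ae_restrict_mem isOpen_interior_manifold.measurableSet] with x hx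
    refine tendsto_const_nhds.congr' ?_
    filter_upwards [eventually_cutoff (S.α_pos x hx)] with n hn
    rw [hn.1, Complex.ofReal_one, one_mul]

lemma integrable_cutoff_mul (n : ℕ) {f : X → ℂ} (hf : ContinuousOn f ((𝓡∂ (m + 1)).interior X)) :
    IntegrableOn (fun x => (cutoff n (S.α x) : ℂ) * f x) ((𝓡∂ (m + 1)).interior X)
      (riemannianVolume S.h) := by
  have hδ : (0 : ℝ) < (n + 1 : ℝ)⁻¹ := by positivity
  refine integrableOn_of_isCompact S.h (K := {x | (n + 1 : ℝ)⁻¹ ≤ S.α x}) ?_ (S.isCompact_le_α _)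
    (fun x hx => S.mem_interior_iff_α.mpr (hδ.trans_le hx)) fun x _ hx => ?_
  · exact (Complex.continuous_ofReal.comp ((contDiff_cutoff n).continuous.comp
      S.α_smooth.continuous)).continuousOn.mul hf
  · rw [cutoff_eq_zero (not_le.mp hx), Complex.ofReal_zero, zero_mul]

/-- Green's formula, up to boundary terms that vanish in the limit. -/
lemma tendsto_green {ξ p : MixedForm (𝓡∂ (m + 1)) X} (hφ : φ.SmoothOn ((𝓡∂ (m + 1)).interior X))
    (hξ : ξ.SmoothOn ((𝓡∂ (m + 1)).interior X)) (hp : ξ.IsCodifferential S.h p)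
    (hint : IntegrableOn (fun x => (S.α x)⁻¹ • mixedInner S.h x (S.dαWedge φ) ξ)
      ((𝓡∂ (m + 1)).interior X) (riemannianVolume S.h)) :
    Tendsto (fun n => (∫ x in (𝓡∂ (m + 1)).interior X, (cutoff n (S.α x) : ℂ) *
        mixedInner S.h x φ p ∂(riemannianVolume S.h)) -
      ∫ x in (𝓡∂ (m + 1)).interior X, (cutoff n (S.α x) : ℂ) *
        mixedInner S.h x φ.extD ξ ∂(riemannianVolume S.h)) atTop (nhds 0) := by
  set ν := (riemannianVolume S.h).restrict ((𝓡∂ (m + 1)).interior X) with hν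
  have hdφ : MixedForm.SmoothOn (S.dαWedge φ) ((𝓡∂ (m + 1)).interior X) := S.smoothOn_dαWedge hφ
  obtain ⟨C, hC⟩ := exists_abs_deriv_cutoff_le
  have hcut' : ∀ n, Continuous (fun x => ((deriv (cutoff n) (S.α x) : ℝ) : ℂ)) :=
    fun n => Complex.continuous_ofReal.comp (((contDiff_cutoff n).continuous_deriv (by simp)).comp
      S.α_smooth.continuous)
  have heq : ∀ n : ℕ, (∫ x, (cutoff n (S.α x) : ℂ) * mixedInner S.h x φ p ∂ν) -
      ∫ x, (cutoff n (S.α x) : ℂ) * mixedInner S.h x φ.extD ξ ∂ν =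
      ∫ x, ((deriv (cutoff n) (S.α x) : ℝ) : ℂ) * mixedInner S.h x (S.dαWedge φ) ξ ∂ν := by
    intro n
    set K := {x | (n + 1 : ℝ)⁻¹ ≤ S.α x} with hK
    have hKc : IsCompact K := S.isCompact_le_α _
    have hδ : (0 : ℝ) < (n + 1 : ℝ)⁻¹ := by positivity
    have hKi : K ⊆ (𝓡∂ (m + 1)).interior X := fun x hx =>
      S.mem_interior_iff_α.mpr (hδ.trans_le hx)
    have hφK : ∀ k x, x ∉ K → S.mulFunα (cutoff n) φ k x = 0 := by
      intro k x hx
      have h1 : S.mulFunα (cutoff n) φ k x = (cutoff n (S.α x) : ℂ) • φ k x := rfl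
      rw [h1, cutoff_eq_zero (not_le.mp hx)]
      ext v
      simp
    have h1 := integral_mixedInner_eq hξ hp (S.smoothOn_mulFunα (contDiff_cutoff n) hφ) hKc hKi hφK
    have h2 : ∀ x, mixedInner S.h x (S.mulFunα (cutoff n) φ) p =
        (cutoff n (S.α x) : ℂ) * mixedInner S.h x φ p := fun x =>
      mixedInner_smul_left p fun k => rfl
    have h3 : ∀ x ∈ (𝓡∂ (m + 1)).interior X, mixedInner S.h x (S.mulFunα (cutoff n) φ).extD ξ =
        (cutoff n (S.α x) : ℂ) * mixedInner S.h x φ.extD ξ +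
          ((deriv (cutoff n) (S.α x) : ℝ) : ℂ) * mixedInner S.h x (S.dαWedge φ) ξ := fun x hx =>
      mixedInner_left ξ fun k => S.extD_mulFunα (contDiff_cutoff n) hφ k hx
    have hI1 : Integrable (fun x => (cutoff n (S.α x) : ℂ) * mixedInner S.h x φ.extD ξ) ν :=
      S.integrable_cutoff_mul n (continuousOn_mixedInner S.h hφ.extD hξ)
    have hI2 : Integrable
        (fun x => ((deriv (cutoff n) (S.α x) : ℝ) : ℂ) * mixedInner S.h x (S.dαWedge φ) ξ) ν :=
      integrableOn_of_isCompact S.h ((hcut' n).continuousOn.mul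
        (continuousOn_mixedInner S.h hdφ hξ)) hKc hKi fun x _ hx => by
          have h4 : cutoff n =ᶠ[nhds (S.α x)] fun _ => 0 := by
            filter_upwards [Iio_mem_nhds (not_le.mp hx)] with s hs using cutoff_eq_zero hs
          rw [h4.deriv_eq, deriv_const, Complex.ofReal_zero, zero_mul]
    simp only [h2] at h1
    rw [setIntegral_congr_fun isOpen_interior_manifold.measurableSet h3, integral_add hI1 hI2] at h1
    rw [h1, add_sub_cancel_left]
  simp only [heq]
  have hlim := tendsto_integral_of_dominated_convergence (μ := ν) (f := fun _ => (0 : ℂ))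
    (F := fun n x => ((deriv (cutoff n) (S.α x) : ℝ) : ℂ) * mixedInner S.h x (S.dαWedge φ) ξ)
    (fun x => C * ‖(S.α x)⁻¹ • mixedInner S.h x (S.dαWedge φ) ξ‖)
    (fun n => ?_) (hint.norm.const_mul C) (fun n => ?_) ?_
  · simpa using hlim
  · exact (hcut' n).aestronglyMeasurable.mul ((continuousOn_mixedInner S.h hdφ hξ).aestronglyMeasurable
      isOpen_interior_manifold.measurableSet)
  · filter_upwards [ae_restrict_mem isOpen_interior_manifold.measurableSet] with x hx
    have h0 := S.α_pos x hx
    rw [norm_mul, Complex.norm_real, norm_smul, norm_inv, Real.norm_of_nonneg h0.le, ← mul_assoc]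
    exact mul_le_mul_of_nonneg_right (hC n _ h0) (norm_nonneg _)
  · filter_upwards [ae_restrict_mem isOpen_interior_manifold.measurableSet] with x hx
    refine tendsto_const_nhds.congr' ?_
    filter_upwards [eventually_cutoff (S.α_pos x hx)] with n hn
    rw [hn.2, Complex.ofReal_zero, zero_mul]

end StaticGeometry

namespace StaticGeometry

open Filter

variable {m : ℕ}
  {X : Type*} [TopologicalSpace X] [ChartedSpace (EuclideanHalfSpace (m + 1)) X]
  [IsManifold (𝓡∂ (m + 1)) ∞ X] [MeasurableSpace X]
  {Y : Type*} [TopologicalSpace Y] [ChartedSpace (EuclideanSpace ℝ (Fin m)) Y]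
  [IsManifold (𝓡 m) ∞ Y] (S : StaticGeometry m X Y)

/-- The measure `|dh|` on the interior. -/
abbrev intVol : Measure X := (riemannianVolume S.h).restrict ((𝓡∂ (m + 1)).interior X)

/-- The inner product of `L²(α|dh|; H)`. -/
def ip (ξ η : MixedForm (𝓡∂ (m + 1)) X) : ℂ := ∫ x, (S.α x : ℂ) * mixedInner S.h x ξ η ∂S.intVol

/-- The squared norm of `L²(α|dh|; H)`. -/
def nsq (ξ : MixedForm (𝓡∂ (m + 1)) X) : ℝ := ∫ x, S.α x * fiberNormSq S.h ξ x ∂S.intVol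

/-- Smooth forms on the interior that are square integrable. -/
structure IsL2 (ξ : MixedForm (𝓡∂ (m + 1)) X) : Prop where
  smooth : ξ.SmoothOn ((𝓡∂ (m + 1)).interior X)
  integrable : Integrable (fun x => S.α x * fiberNormSq S.h ξ x) S.intVol

variable {S} {ξ η θ ζ : MixedForm (𝓡∂ (m + 1)) X} {a b : ℂ}

omit [MeasurableSpace X] in
lemma α_nonneg (S : StaticGeometry m X Y) (x : X) : 0 ≤ S.α x := by
  by_cases hx : x ∈ (𝓡∂ (m + 1)).interior X
  · exact (S.α_pos x hx).le
  · rw [← mem_compl_iff, ModelWithCorners.compl_interior] at hx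
    exact (S.α_boundary x hx).ge

lemma nsq_nonneg (ξ : MixedForm (𝓡∂ (m + 1)) X) : 0 ≤ S.nsq ξ :=
  integral_nonneg fun x => mul_nonneg (S.α_nonneg x) (fiberNormSq_nonneg S.h ξ x)

lemma ip_self (ξ : MixedForm (𝓡∂ (m + 1)) X) : S.ip ξ ξ = S.nsq ξ := by
  rw [ip, nsq, ← integral_complex_ofReal]
  simp only [mixedInner_self, Complex.ofReal_mul]

omit [MeasurableSpace X] in
lemma norm_α_mixedInner_le (S : StaticGeometry m X Y) (x : X) (ξ η : MixedForm (𝓡∂ (m + 1)) X)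
    {t : ℝ} (ht : 0 < t) : 2 * ‖(S.α x : ℂ) * mixedInner S.h x ξ η‖ ≤
      t * (S.α x * fiberNormSq S.h ξ x) + t⁻¹ * (S.α x * fiberNormSq S.h η x) := by
  rw [norm_mul, Complex.norm_real, Real.norm_of_nonneg (S.α_nonneg x)]
  have := mul_le_mul_of_nonneg_left (norm_mixedInner_le S.h x ξ η ht) (S.α_nonneg x)
  linarith

lemma ae_intVol {P : X → Prop} (S : StaticGeometry m X Y) [BorelSpace X]
    (h : ∀ x ∈ (𝓡∂ (m + 1)).interior X, P x) : ∀ᵐ x ∂S.intVol, P x :=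
  (ae_restrict_mem isOpen_interior_manifold.measurableSet).mono h

section Borel

variable [BorelSpace X]

lemma IsL2.integrable_ip (hξ : S.IsL2 ξ) (hη : S.IsL2 η) :
    Integrable (fun x => (S.α x : ℂ) * mixedInner S.h x ξ η) S.intVol := by
  refine ((hξ.integrable.add hη.integrable).const_mul (2⁻¹ : ℝ)).mono' ?_
    (Eventually.of_forall fun x => ?_)
  · exact ((Complex.continuous_ofReal.comp S.α_smooth.continuous).continuousOn.mul
      (continuousOn_mixedInner S.h hξ.smooth hη.smooth)).aestronglyMeasurable
        isOpen_interior_manifold.measurableSet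
  · have := S.norm_α_mixedInner_le x ξ η one_pos
    simp only [Pi.add_apply]
    rw [inv_one] at this
    linarith

lemma two_norm_ip_le (hξ : S.IsL2 ξ) (hη : S.IsL2 η) {t : ℝ} (ht : 0 < t) :
    2 * ‖S.ip ξ η‖ ≤ t * S.nsq ξ + t⁻¹ * S.nsq η := by
  calc 2 * ‖S.ip ξ η‖ ≤ 2 * ∫ x, ‖(S.α x : ℂ) * mixedInner S.h x ξ η‖ ∂S.intVol := by
        gcongr; exact norm_integral_le_integral_norm _
    _ = ∫ x, 2 * ‖(S.α x : ℂ) * mixedInner S.h x ξ η‖ ∂S.intVol := (integral_const_mul _ _).symm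
    _ ≤ ∫ x, (t * (S.α x * fiberNormSq S.h ξ x) + t⁻¹ * (S.α x * fiberNormSq S.h η x)) ∂S.intVol :=
        integral_mono ((hξ.integrable_ip hη).norm.const_mul 2)
          ((hξ.integrable.const_mul t).add (hη.integrable.const_mul t⁻¹))
          fun x => S.norm_α_mixedInner_le x ξ η ht
    _ = t * S.nsq ξ + t⁻¹ * S.nsq η := by
        rw [integral_add (hξ.integrable.const_mul t) (hη.integrable.const_mul t⁻¹),
          integral_const_mul, integral_const_mul]
        rfl

omit [BorelSpace X] [MeasurableSpace X] in
lemma α_fiberNormSq_lin_le {x : X} (hx : ∀ k, ξ k x = a • η k x + b • θ k x) :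
    S.α x * fiberNormSq S.h ξ x ≤ 2 * ‖a‖ ^ 2 * (S.α x * fiberNormSq S.h η x) +
      2 * ‖b‖ ^ 2 * (S.α x * fiberNormSq S.h θ x) := by
  have := mul_le_mul_of_nonneg_left (fiberNormSq_lin_le (h := S.h) hx) (S.α_nonneg x)
  linarith

lemma IsL2.lin (hη : S.IsL2 η) (hθ : S.IsL2 θ)
    (hξ : ∀ k, ∀ x ∈ (𝓡∂ (m + 1)).interior X, ξ k x = a • η k x + b • θ k x) : S.IsL2 ξ := by
  have hs := hη.smooth.lin hθ.smooth hξ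
  refine ⟨hs, ((hη.integrable.const_mul (2 * ‖a‖ ^ 2)).add
    (hθ.integrable.const_mul (2 * ‖b‖ ^ 2))).mono' ?_ ?_⟩
  · exact (S.α_smooth.continuous.continuousOn.mul
      (continuousOn_fiberNormSq S.h hs)).aestronglyMeasurable isOpen_interior_manifold.measurableSet
  · refine S.ae_intVol fun x hx => ?_
    rw [Real.norm_of_nonneg (mul_nonneg (S.α_nonneg x) (fiberNormSq_nonneg S.h ξ x))]
    exact α_fiberNormSq_lin_le fun k => hξ k x hx

lemma nsq_lin_le (hη : S.IsL2 η) (hθ : S.IsL2 θ)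
    (hξ : ∀ k, ∀ x ∈ (𝓡∂ (m + 1)).interior X, ξ k x = a • η k x + b • θ k x) :
    S.nsq ξ ≤ 2 * ‖a‖ ^ 2 * S.nsq η + 2 * ‖b‖ ^ 2 * S.nsq θ := by
  have h1 := hη.integrable.const_mul (2 * ‖a‖ ^ 2)
  have h2 := hθ.integrable.const_mul (2 * ‖b‖ ^ 2)
  have := integral_mono_ae (hη.lin hθ hξ).integrable (h1.add h2)
    (S.ae_intVol fun x hx => α_fiberNormSq_lin_le fun k => hξ k x hx)
  rw [integral_add' h1 h2, integral_const_mul, integral_const_mul] at this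
  exact this

lemma ip_lin_right (hζ : S.IsL2 ζ) (hη : S.IsL2 η) (hθ : S.IsL2 θ)
    (hξ : ∀ k, ∀ x ∈ (𝓡∂ (m + 1)).interior X, ξ k x = a • η k x + b • θ k x) :
    S.ip ζ ξ = (starRingEnd ℂ) a * S.ip ζ η + (starRingEnd ℂ) b * S.ip ζ θ := by
  have h1 := (hζ.integrable_ip hη).const_mul ((starRingEnd ℂ) a)
  have h2 := (hζ.integrable_ip hθ).const_mul ((starRingEnd ℂ) b)
  rw [ip, ip, ip, ← integral_const_mul, ← integral_const_mul, ← integral_add h1 h2]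
  refine integral_congr_ae (S.ae_intVol fun x hx => ?_)
  simp only
  rw [mixedInner_right ζ fun k => hξ k x hx]
  ring

lemma IsL2.mulα (hξ : S.IsL2 ξ) {A : ℝ} (hA : ∀ x, S.α x ≤ A) : S.IsL2 (S.mulα ξ) := by
  refine ⟨S.smoothOn_mulα hξ.smooth, (hξ.integrable.const_mul (A ^ 2)).mono' ?_
    (Eventually.of_forall fun x => ?_)⟩
  · exact (S.α_smooth.continuous.continuousOn.mul (continuousOn_fiberNormSq S.h
      (S.smoothOn_mulα hξ.smooth))).aestronglyMeasurable isOpen_interior_manifold.measurableSet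
  · have h0 := S.α_nonneg x
    have h1 := fiberNormSq_nonneg S.h ξ x
    rw [Real.norm_of_nonneg (mul_nonneg h0 (fiberNormSq_nonneg S.h _ x)), fiberNormSq_mulα,
      mul_left_comm]
    have := hA x
    gcongr

lemma nsq_mulα_le (hξ : S.IsL2 ξ) {A : ℝ} (hA : ∀ x, S.α x ≤ A) :
    S.nsq (S.mulα ξ) ≤ A ^ 2 * S.nsq ξ := by
  rw [nsq, nsq, ← integral_const_mul]
  refine integral_mono (hξ.mulα hA).integrable (hξ.integrable.const_mul _) fun x => ?_
  have h0 := S.α_nonneg x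
  have h1 := fiberNormSq_nonneg S.h ξ x
  simp only
  rw [fiberNormSq_mulα, mul_left_comm]
  have := hA x
  gcongr

end Borel

lemma L2norm_eq {v : S.Form} (h1 : S.IsL2 v.1) (h2 : S.IsL2 v.2) :
    S.L2norm v = ENNReal.ofReal (Real.sqrt (S.nsq v.1 + S.nsq v.2)) := by
  have hI : Integrable (fun x => S.α x * fiberNormSq S.h v.1 x + S.α x * fiberNormSq S.h v.2 x)
      S.intVol := h1.integrable.add h2.integrable
  rw [L2norm, Real.sqrt_eq_rpow, ← ENNReal.ofReal_rpow_of_nonneg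
    (add_nonneg (nsq_nonneg _) (nsq_nonneg _)) (by norm_num), nsq, nsq,
    ← integral_add h1.integrable h2.integrable, ofReal_integral_eq_lintegral_ofReal hI]
  · simp only [mul_add]
  · exact Eventually.of_forall fun x => add_nonneg
      (mul_nonneg (S.α_nonneg x) (fiberNormSq_nonneg S.h _ x))
      (mul_nonneg (S.α_nonneg x) (fiberNormSq_nonneg S.h _ x))

section Energy

variable [T2Space X] [CompactSpace X] [BorelSpace X] {σ : ℂ} {u w : S.Form} (hσ : 0 < σ.im)
  (hu : u ∈ S.asymptoticSpace σ)
include hσ hu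

lemma isL2_left : S.IsL2 u.1 := ⟨hu.1, S.integrableOn_normSq hσ hu.1 (S.squareBound_left hu)⟩

lemma isL2_right : S.IsL2 u.2 := ⟨hu.2.1, S.integrableOn_normSq hσ hu.2.1 (S.squareBound_right hu)⟩

lemma isL2_dHat_left : S.IsL2 (S.dHat σ u).1 :=
  ⟨S.smoothOn_dHat_left hu,
    S.integrableOn_normSq hσ (S.smoothOn_dHat_left hu) (S.squareBound_dHat_left hu)⟩

lemma isL2_dHat_right : S.IsL2 (S.dHat σ u).2 :=
  ⟨S.smoothOn_dHat_right hu,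
    S.integrableOn_normSq hσ (S.smoothOn_dHat_right hu) (S.squareBound_dHat_right hu)⟩

lemma isL2_deltaHat_left (hw : S.IsDeltaHat σ u w) : S.IsL2 w.1 :=
  ⟨S.smoothOn_deltaHat_left hu hw,
    S.integrableOn_normSq hσ (S.smoothOn_deltaHat_left hu hw) (S.squareBound_deltaHat hu hw).1⟩

lemma isL2_deltaHat_right (hw : S.IsDeltaHat σ u w) : S.IsL2 w.2 :=
  ⟨S.smoothOn_deltaHat_right hw,
    S.integrableOn_normSq hσ (S.smoothOn_deltaHat_right hw) (S.squareBound_deltaHat hu hw).2⟩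

omit hσ [MeasurableSpace X] [T2Space X] [CompactSpace X] [BorelSpace X] in
lemma extD_dHat_left (k : ℕ) {x : X} (hx : x ∈ (𝓡∂ (m + 1)).interior X) :
    (S.dHat σ u).1.extD k x = 0 := hu.1.extD_extD k hx

omit hσ [MeasurableSpace X] [T2Space X] [CompactSpace X] [BorelSpace X] in
lemma extD_mulα_dHat (k : ℕ) {x : X} (hx : x ∈ (𝓡∂ (m + 1)).interior X) :
    (S.mulα (S.dHat σ u).2).extD k x = (-(Complex.I * σ)) • (S.dHat σ u).1 k x := by
  have h1 := MixedForm.SmoothOn.extD_lin hu.1 (S.smoothOn_mulα hu.2.1).extD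
    (fun k x hx => S.mulα_dHat σ u k hx) k hx
  rw [h1, (S.smoothOn_mulα hu.2.1).extD_extD k hx]
  ext v
  change (-(Complex.I * σ)) * u.1.extD k x v + (-1 : ℂ) * 0 = (-(Complex.I * σ)) * u.1.extD k x v
  ring

/-- The orthogonality relation between `d̂(σ)u` and `δ̂(σ)u`. -/
lemma conj_mul_ip_eq (hw : S.IsDeltaHat σ u w) :
    (starRingEnd ℂ) σ * S.ip (S.dHat σ u).2 w.2 = σ * S.ip (S.dHat σ u).1 w.1 := by
  have hw' := hw
  obtain ⟨p, q, hp, hq, h⟩ := hw'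
  have hd1 := S.smoothOn_dHat_left hu
  have hd2 := S.smoothOn_dHat_right hu
  have hw1 := S.smoothOn_deltaHat_left hu hw
  have g1 := S.tendsto_green (S.smoothOn_mulα hd2) hu.2.1 hq
    (S.integrableOn_dαWedge hσ (S.smoothOn_mulα hd2) hu.2.1
      (S.squareBound_dαWedge (S.smoothOn_mulα hd2) (fun c r hr => hr.tangPart_mulα_dHat hu)
        fun c r hr => hr.normPart_right hu))
  have g2 := S.tendsto_green hd1 (S.smoothOn_mulα hu.1) hp
    (S.integrableOn_dαWedge hσ hd1 (S.smoothOn_mulα hu.1)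
      (S.squareBound_dαWedge hd1 (fun c r hr => hr.tangPart_d hu)
        fun c r hr => hr.normPart_mulα_left hu))
  set Xn : ℕ → ℂ := fun n => ∫ x, (cutoff n (S.α x) : ℂ) *
    mixedInner S.h x (S.dHat σ u).1 u.2 ∂S.intVol with hXn
  set An : ℕ → ℂ := fun n => ∫ x, (cutoff n (S.α x) : ℂ) * ((S.α x : ℂ) *
    mixedInner S.h x (S.dHat σ u).2 w.2) ∂S.intVol with hAn
  set Bn : ℕ → ℂ := fun n => ∫ x, (cutoff n (S.α x) : ℂ) * ((S.α x : ℂ) *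
    mixedInner S.h x (S.dHat σ u).1 w.1) ∂S.intVol with hBn
  have e1 : ∀ n : ℕ, ∫ x in (𝓡∂ (m + 1)).interior X, (cutoff n (S.α x) : ℂ) *
      mixedInner S.h x (S.mulα (S.dHat σ u).2) q ∂(riemannianVolume S.h) = An n := fun n => by
    refine integral_congr_ae (S.ae_intVol fun x hx => ?_)
    simp only
    rw [mixedInner_smul_left (η := (S.dHat σ u).2) (a := (S.α x : ℂ)) q fun k => rfl]
    congr 2
    exact Finset.sum_congr rfl fun k _ => congrArg (fiberInner S.h k x _) (h x hx k).2.symm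
  have e2 : ∀ n : ℕ, ∫ x in (𝓡∂ (m + 1)).interior X, (cutoff n (S.α x) : ℂ) *
      mixedInner S.h x (S.mulα (S.dHat σ u).2).extD u.2 ∂(riemannianVolume S.h) =
        -(Complex.I * σ) * Xn n := fun n => by
    rw [hXn, ← integral_const_mul]
    refine integral_congr_ae (S.ae_intVol fun x hx => ?_)
    simp only
    rw [mixedInner_smul_left u.2 fun k => extD_mulα_dHat hu k hx]
    ring
  have e3 : ∀ n : ℕ, ∫ x in (𝓡∂ (m + 1)).interior X, (cutoff n (S.α x) : ℂ) *
      mixedInner S.h x (S.dHat σ u).1 p ∂(riemannianVolume S.h) =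
        -Bn n + (starRingEnd ℂ) (Complex.I * σ) * Xn n := fun n => by
    have hI1 : Integrable (fun x => -((cutoff n (S.α x) : ℂ) * ((S.α x : ℂ) *
        mixedInner S.h x (S.dHat σ u).1 w.1))) S.intVol := (S.integrable_cutoff_mul n ((Complex.continuous_ofReal.comp
      S.α_smooth.continuous).continuousOn.mul (continuousOn_mixedInner S.h hd1 hw1))).neg
    have hI2 : Integrable (fun x => (starRingEnd ℂ) (Complex.I * σ) * ((cutoff n (S.α x) : ℂ) *
        mixedInner S.h x (S.dHat σ u).1 u.2)) S.intVol :=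
      (S.integrable_cutoff_mul n (continuousOn_mixedInner S.h hd1 hu.2.1)).const_mul _
    rw [hXn, hBn, ← integral_const_mul, ← integral_neg, ← integral_add hI1 hI2]
    refine integral_congr_ae (S.ae_intVol fun x hx => ?_)
    simp only
    rw [mixedInner_right (S.dHat σ u).1 fun k => S.eq_of_isDeltaHat k hx (h x hx k).1]
    simp only [map_neg, Complex.conj_ofReal]
    ring
  have e4 : ∀ n : ℕ, ∫ x in (𝓡∂ (m + 1)).interior X, (cutoff n (S.α x) : ℂ) *
      mixedInner S.h x (S.dHat σ u).1.extD (S.mulα u.1) ∂(riemannianVolume S.h) = 0 := fun n => by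
    refine integral_eq_zero_of_ae (S.ae_intVol fun x hx => ?_)
    have h0 : ∀ k, (S.dHat σ u).1.extD k x = (0 : ℂ) • (S.dHat σ u).1 k x := fun k => by
      rw [extD_dHat_left hu k hx]
      ext v
      change (0 : ℂ) = 0 * _
      rw [zero_mul]
    simp only [Pi.zero_apply]
    rw [mixedInner_smul_left _ h0, zero_mul, mul_zero]
  simp only [e1, e2] at g1
  simp only [e3, e4] at g2
  have hA : Tendsto An atTop (nhds (S.ip (S.dHat σ u).2 w.2)) := S.tendsto_integral_cutoff
    ((isL2_dHat_right hσ hu).integrable_ip (isL2_deltaHat_right hσ hu hw))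
  have hB : Tendsto Bn atTop (nhds (S.ip (S.dHat σ u).1 w.1)) := S.tendsto_integral_cutoff
    ((isL2_dHat_left hσ hu).integrable_ip (isL2_deltaHat_left hσ hu hw))
  have l1 := (g1.const_mul ((starRingEnd ℂ) σ)).add (g2.const_mul σ)
  have l2 := (hA.const_mul ((starRingEnd ℂ) σ)).sub (hB.const_mul σ)
  rw [mul_zero, mul_zero, add_zero] at l1
  have l3 : Tendsto (fun n => (starRingEnd ℂ) σ * An n - σ * Bn n) atTop (nhds 0) := by
    refine l1.congr fun n => ?_
    rw [map_mul, Complex.conj_I]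
    ring
  exact sub_eq_zero.mp (tendsto_nhds_unique l2 l3)

/-- The energy identity. -/
lemma energy_identity (hw : S.IsDeltaHat σ u w) {A : ℝ} (hA : ∀ x, S.α x ≤ A) :
    Complex.I * σ * S.nsq u.1 + (starRingEnd ℂ) (Complex.I * σ) * S.nsq u.2 =
      S.ip (S.mulα u.2) w.1 - S.ip (S.mulα (S.dHat σ u).2) u.1 := by
  have hw' := hw
  obtain ⟨p, q, hp, hq, h⟩ := hw'
  have hα1 := S.smoothOn_mulα hu.1
  have hα2 := S.smoothOn_mulα hu.2.1
  have hL1 := isL2_left hσ hu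
  have hL2 := isL2_right hσ hu
  have hLw := isL2_deltaHat_left hσ hu hw
  have hLd := isL2_dHat_right hσ hu
  have g := S.tendsto_green hα2 hα1 hp (S.integrableOn_dαWedge hσ hα2 hα1
      (S.squareBound_dαWedge hα2 (fun c r hr => hr.tangPart_mulα_right hu)
        fun c r hr => hr.normPart_mulα_left hu))
  have i1 := (hL2.mulα hA).integrable_ip hLw
  have i1' : Integrable (fun x => -((S.α x : ℂ) * mixedInner S.h x (S.mulα u.2) w.1)) S.intVol :=
    i1.neg
  have i2 := (hL2.integrable_ip hL2).const_mul ((starRingEnd ℂ) (Complex.I * σ))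
  have i3 := (hL1.integrable_ip hL1).const_mul (-(Complex.I * σ))
  have i4 := (hLd.mulα hA).integrable_ip hL1
  have e1 : ∀ x ∈ (𝓡∂ (m + 1)).interior X, mixedInner S.h x (S.mulα u.2) p =
      -((S.α x : ℂ) * mixedInner S.h x (S.mulα u.2) w.1) +
        (starRingEnd ℂ) (Complex.I * σ) * ((S.α x : ℂ) * mixedInner S.h x u.2 u.2) := fun x hx => by
    rw [mixedInner_right (S.mulα u.2) fun k => S.eq_of_isDeltaHat k hx (h x hx k).1,
      mixedInner_smul_left (ξ := S.mulα u.2) (η := u.2) (a := (S.α x : ℂ)) u.2 fun k => rfl]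
    simp only [map_neg, Complex.conj_ofReal]
    ring
  have e2 : ∀ x ∈ (𝓡∂ (m + 1)).interior X, mixedInner S.h x (S.mulα u.2).extD (S.mulα u.1) =
      -(Complex.I * σ) * ((S.α x : ℂ) * mixedInner S.h x u.1 u.1) -
        (S.α x : ℂ) * mixedInner S.h x (S.mulα (S.dHat σ u).2) u.1 := fun x hx => by
    have h1 : ∀ k, (S.mulα u.2).extD k x = (-(Complex.I * σ)) • u.1 k x +
        (-1 : ℂ) • S.mulα (S.dHat σ u).2 k x := fun k => by
      rw [S.mulα_dHat σ u k hx]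
      ext v
      change (S.mulα u.2).extD k x v = (-(Complex.I * σ)) * u.1 k x v + (-1 : ℂ) *
        ((-(Complex.I * σ)) * u.1 k x v + (-1 : ℂ) * (S.mulα u.2).extD k x v)
      ring
    rw [mixedInner_smul_right (ξ := S.mulα u.1) (η := u.1) (a := (S.α x : ℂ)) _ fun k => rfl,
      mixedInner_left u.1 h1]
    simp only [Complex.conj_ofReal]
    ring
  have t1 := S.tendsto_integral_cutoff (f := fun x => mixedInner S.h x (S.mulα u.2) p)
    ((i1'.add i2).congr (S.ae_intVol fun x hx => (e1 x hx).symm))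
  have t2 := S.tendsto_integral_cutoff (f := fun x => mixedInner S.h x (S.mulα u.2).extD (S.mulα u.1))
    ((i3.sub i4).congr (S.ae_intVol fun x hx => (e2 x hx).symm))
  have key := tendsto_nhds_unique (t1.sub t2) g
  have v1 : ∫ x in (𝓡∂ (m + 1)).interior X, mixedInner S.h x (S.mulα u.2) p ∂(riemannianVolume S.h) =
      -S.ip (S.mulα u.2) w.1 + (starRingEnd ℂ) (Complex.I * σ) * S.nsq u.2 := by
    rw [integral_congr_ae (S.ae_intVol e1), integral_add i1' i2, integral_neg,
      integral_const_mul, ← ip_self]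
    rfl
  have v2 : ∫ x in (𝓡∂ (m + 1)).interior X, mixedInner S.h x (S.mulα u.2).extD (S.mulα u.1)
      ∂(riemannianVolume S.h) =
      -(Complex.I * σ) * S.nsq u.1 - S.ip (S.mulα (S.dHat σ u).2) u.1 := by
    rw [integral_congr_ae (S.ae_intVol e2), integral_sub i3 i4, integral_const_mul, ← ip_self]
    rfl
  rw [v1, v2] at key
  linear_combination key

end Energy

end StaticGeometry

namespace StaticGeometry

variable {m : ℕ}
  {X : Type*} [TopologicalSpace X] [ChartedSpace (EuclideanHalfSpace (m + 1)) X]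
  [IsManifold (𝓡∂ (m + 1)) ∞ X] [MeasurableSpace X]
  {Y : Type*} [TopologicalSpace Y] [ChartedSpace (EuclideanSpace ℝ (Fin m)) Y]
  [IsManifold (𝓡 m) ∞ Y] {S : StaticGeometry m X Y} [T2Space X] [CompactSpace X] [BorelSpace X]

omit [MeasurableSpace X] [T2Space X] [BorelSpace X] in
lemma exists_α_le (S : StaticGeometry m X Y) : ∃ A : ℝ, 0 < A ∧ ∀ x, S.α x ≤ A := by
  obtain ⟨B, hB⟩ := isCompact_univ.exists_bound_of_continuousOn S.α_smooth.continuous.continuousOn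
  exact ⟨|B| + 1, by positivity, fun x =>
    ((le_abs_self _).trans (hB x (mem_univ x))).trans ((le_abs_self B).trans (by linarith))⟩

variable {σ : ℂ} {u w : S.Form} (hσ : 0 < σ.im) (hu : u ∈ S.asymptoticSpace σ)
  (hw : S.IsDeltaHat σ u w)
include hσ hu hw

lemma isL2_add_left : S.IsL2 (S.dHat σ u + w).1 :=
  (isL2_dHat_left hσ hu).lin (a := 1) (b := 1) (isL2_deltaHat_left hσ hu hw) fun k x _ => by
    ext v
    change (S.dHat σ u).1 k x v + w.1 k x v = 1 * (S.dHat σ u).1 k x v + 1 * w.1 k x v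
    ring

lemma isL2_add_right : S.IsL2 (S.dHat σ u + w).2 :=
  (isL2_dHat_right hσ hu).lin (a := 1) (b := 1) (isL2_deltaHat_right hσ hu hw) fun k x _ => by
    ext v
    change (S.dHat σ u).2 k x v + w.2 k x v = 1 * (S.dHat σ u).2 k x v + 1 * w.2 k x v
    ring

omit hσ hu hw [T2Space X] [CompactSpace X] [BorelSpace X] [MeasurableSpace X] in
lemma deltaHat_left_eq (σ : ℂ) (u w : S.Form) (k : ℕ) (x : X) :
    w.1 k x = (1 : ℂ) • (S.dHat σ u + w).1 k x + (-1 : ℂ) • (S.dHat σ u).1 k x := by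
  ext v
  change w.1 k x v = 1 * ((S.dHat σ u).1 k x v + w.1 k x v) + -1 * (S.dHat σ u).1 k x v
  ring

omit hσ hu hw [T2Space X] [CompactSpace X] [BorelSpace X] [MeasurableSpace X] in
lemma deltaHat_right_eq (σ : ℂ) (u w : S.Form) (k : ℕ) (x : X) :
    w.2 k x = (1 : ℂ) • (S.dHat σ u + w).2 k x + (-1 : ℂ) • (S.dHat σ u).2 k x := by
  ext v
  change w.2 k x v = 1 * ((S.dHat σ u).2 k x v + w.2 k x v) + -1 * (S.dHat σ u).2 k x v
  ring

/-- The estimate of `d̂(σ)u` by `(d̂(σ) + δ̂(σ))u`. -/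
lemma sq_mul_nsq_dHat_le :
    σ.im ^ 2 * (S.nsq (S.dHat σ u).1 + S.nsq (S.dHat σ u).2) ≤
      ‖σ‖ ^ 2 * (S.nsq (S.dHat σ u + w).1 + S.nsq (S.dHat σ u + w).2) := by
  have hd1 := isL2_dHat_left hσ hu
  have hd2 := isL2_dHat_right hσ hu
  have hf1 := isL2_add_left hσ hu hw
  have hf2 := isL2_add_right hσ hu hw
  have hn : 0 < ‖σ‖ := hσ.trans_le ((le_abs_self _).trans (Complex.abs_im_le_norm σ))
  have h := conj_mul_ip_eq hσ hu hw
  rw [ip_lin_right hd2 hf2 hd2 fun k x _ => deltaHat_right_eq σ u w k x,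
    ip_lin_right hd1 hf1 hd1 fun k x _ => deltaHat_left_eq σ u w k x, ip_self, ip_self] at h
  simp only [map_neg, map_one, one_mul, neg_mul] at h
  have ht : 0 < σ.im / ‖σ‖ := div_pos hσ hn
  have q1 := two_norm_ip_le hd1 hf1 ht
  have q2 := two_norm_ip_le hd2 hf2 ht
  generalize S.ip (S.dHat σ u).1 (S.dHat σ u + w).1 = Q1 at *
  generalize S.ip (S.dHat σ u).2 (S.dHat σ u + w).2 = Q2 at *
  generalize S.nsq (S.dHat σ u).1 = W1 at *
  generalize S.nsq (S.dHat σ u).2 = W2 at *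
  generalize S.nsq (S.dHat σ u + w).1 = F1 at *
  generalize S.nsq (S.dHat σ u + w).2 = F2 at *
  have h1 : σ.im * (W1 + W2) = (σ * Q1).im - ((starRingEnd ℂ) σ * Q2).im := by
    have := congrArg Complex.im h
    simp only [Complex.mul_im, Complex.add_im, Complex.add_re, Complex.neg_im, Complex.neg_re,
      Complex.conj_re, Complex.conj_im, Complex.ofReal_im, Complex.ofReal_re] at this ⊢
    linear_combination this
  have h2 : (σ * Q1).im ≤ ‖σ‖ * ‖Q1‖ := by
    rw [← norm_mul]; exact (le_abs_self _).trans (Complex.abs_im_le_norm _)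
  have h3 : -((starRingEnd ℂ) σ * Q2).im ≤ ‖σ‖ * ‖Q2‖ := by
    rw [← Complex.norm_conj σ, ← norm_mul]; exact (neg_le_abs _).trans (Complex.abs_im_le_norm _)
  have h4 : 2 * (σ.im * (W1 + W2)) ≤ ‖σ‖ * (σ.im / ‖σ‖ * (W1 + W2) + (σ.im / ‖σ‖)⁻¹ * (F1 + F2)) := by
    have := mul_le_mul_of_nonneg_left (add_le_add q1 q2) hn.le
    linarith
  have h5 : σ.im * (‖σ‖ * (σ.im / ‖σ‖ * (W1 + W2) + (σ.im / ‖σ‖)⁻¹ * (F1 + F2))) =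
      σ.im ^ 2 * (W1 + W2) + ‖σ‖ ^ 2 * (F1 + F2) := by
    have := hσ.ne'
    have := hn.ne'
    field_simp
  have h6 := mul_le_mul_of_nonneg_left h4 hσ.le
  rw [h5] at h6
  linarith

/-- The estimate of `u` by `d̂(σ)u` and `δ̂(σ)u`. -/
lemma sq_mul_nsq_le {A : ℝ} (hA0 : 0 < A) (hA : ∀ x, S.α x ≤ A) :
    σ.im ^ 2 * (S.nsq u.1 + S.nsq u.2) ≤ A ^ 2 * (S.nsq w.1 + S.nsq (S.dHat σ u).2) := by
  have hu1 := isL2_left hσ hu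
  have hu2 := isL2_right hσ hu
  have hd2 := isL2_dHat_right hσ hu
  have h := energy_identity hσ hu hw hA
  have p1 := two_norm_ip_le (hu2.mulα hA) (isL2_deltaHat_left hσ hu hw)
    (div_pos hσ (pow_pos hA0 2))
  have p2 := two_norm_ip_le (hd2.mulα hA) hu1 (inv_pos.mpr hσ)
  have m1 := mul_le_mul_of_nonneg_left (nsq_mulα_le hu2 hA) (div_pos hσ (pow_pos hA0 2)).le
  have m2 := mul_le_mul_of_nonneg_left (nsq_mulα_le hd2 hA) (inv_pos.mpr hσ).le
  generalize S.ip (S.mulα u.2) w.1 = P1 at *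
  generalize S.ip (S.mulα (S.dHat σ u).2) u.1 = P2 at *
  generalize S.nsq (S.mulα u.2) = V1 at *
  generalize S.nsq (S.mulα (S.dHat σ u).2) = V2 at *
  generalize S.nsq u.1 = U1 at *
  generalize S.nsq u.2 = U2 at *
  generalize S.nsq w.1 = Z at *
  generalize S.nsq (S.dHat σ u).2 = W at *
  have h1 : σ.im * (U1 + U2) = P2.re - P1.re := by
    have := congrArg Complex.re h
    simp only [map_mul, Complex.conj_I, Complex.mul_im, Complex.mul_re, Complex.add_re,
      Complex.sub_re, Complex.neg_im, Complex.neg_re, Complex.I_re, Complex.I_im,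
      Complex.conj_re, Complex.conj_im, Complex.ofReal_im, Complex.ofReal_re] at this
    linear_combination -this
  have h2 : P2.re ≤ ‖P2‖ := Complex.re_le_norm P2
  have h3 : -P1.re ≤ ‖P1‖ := (neg_le_abs _).trans (Complex.abs_re_le_norm _)
  have h4 : 2 * (σ.im * (U1 + U2)) ≤ σ.im / A ^ 2 * (A ^ 2 * U2) + (σ.im / A ^ 2)⁻¹ * Z +
      (σ.im⁻¹ * (A ^ 2 * W) + σ.im⁻¹⁻¹ * U1) := by linarith
  have h5 : σ.im * (σ.im / A ^ 2 * (A ^ 2 * U2) + (σ.im / A ^ 2)⁻¹ * Z +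
      (σ.im⁻¹ * (A ^ 2 * W) + σ.im⁻¹⁻¹ * U1)) = σ.im ^ 2 * (U1 + U2) + A ^ 2 * (Z + W) := by
    have := hσ.ne'
    have := hA0.ne'
    field_simp
    ring
  have h6 := mul_le_mul_of_nonneg_left h4 hσ.le
  rw [h5] at h6
  linarith

lemma sqrt_nsq_le {A : ℝ} (hA0 : 0 < A) (hA : ∀ x, S.α x ≤ A) :
    Real.sqrt (S.nsq u.1 + S.nsq u.2) ≤ 2 * A * (‖σ‖ / |σ.im| ^ 2) *
      Real.sqrt (S.nsq (S.dHat σ u + w).1 + S.nsq (S.dHat σ u + w).2) := by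
  have hW := sq_mul_nsq_dHat_le hσ hu hw
  have hU := sq_mul_nsq_le hσ hu hw hA0 hA
  have hZ := nsq_lin_le (isL2_add_left hσ hu hw) (isL2_dHat_left hσ hu)
    fun k x _ => deltaHat_left_eq σ u w k x
  have hn : σ.im ≤ ‖σ‖ := (le_abs_self _).trans (Complex.abs_im_le_norm σ)
  have f1 := S.nsq_nonneg (S.dHat σ u + w).1
  have f2 := S.nsq_nonneg (S.dHat σ u + w).2
  have w2 := S.nsq_nonneg (S.dHat σ u).2
  rw [norm_neg, norm_one, one_pow, mul_one] at hZ
  generalize S.nsq (S.dHat σ u).1 = W1 at *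
  generalize S.nsq (S.dHat σ u).2 = W2 at *
  generalize S.nsq (S.dHat σ u + w).1 = F1 at *
  generalize S.nsq (S.dHat σ u + w).2 = F2 at *
  generalize S.nsq w.1 = Z at *
  generalize S.nsq u.1 + S.nsq u.2 = U at *
  rw [abs_of_pos hσ]
  have h1 : σ.im ^ 2 * (σ.im ^ 2 * U) ≤ 4 * A ^ 2 * ‖σ‖ ^ 2 * (F1 + F2) := by
    calc σ.im ^ 2 * (σ.im ^ 2 * U) ≤ σ.im ^ 2 * (A ^ 2 * (2 * (F1 + F2) + 2 * (W1 + W2))) := by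
          refine mul_le_mul_of_nonneg_left (hU.trans ?_) (sq_nonneg _)
          refine mul_le_mul_of_nonneg_left ?_ (sq_nonneg _)
          linarith
      _ = A ^ 2 * (2 * (σ.im ^ 2 * (F1 + F2)) + 2 * (σ.im ^ 2 * (W1 + W2))) := by ring
      _ ≤ A ^ 2 * (2 * (‖σ‖ ^ 2 * (F1 + F2)) + 2 * (‖σ‖ ^ 2 * (F1 + F2))) := by gcongr
      _ = 4 * A ^ 2 * ‖σ‖ ^ 2 * (F1 + F2) := by ring
  refine Real.sqrt_le_iff.mpr ⟨by positivity, ?_⟩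
  rw [mul_pow, Real.sq_sqrt (add_nonneg f1 f2)]
  have h2 : (2 * A * (‖σ‖ / σ.im ^ 2)) ^ 2 * (F1 + F2) =
      4 * A ^ 2 * ‖σ‖ ^ 2 * (F1 + F2) / (σ.im ^ 2 * σ.im ^ 2) := by
    have := hσ.ne'
    field_simp
    ring
  rw [h2, le_div_iff₀ (by positivity)]
  linarith

lemma L2norm_le {A : ℝ} (hA0 : 0 < A) (hA : ∀ x, S.α x ≤ A) :
    S.L2norm u ≤ ENNReal.ofReal (2 * A * (‖σ‖ / |σ.im| ^ 2)) * S.L2norm (S.dHat σ u + w) := by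
  rw [L2norm_eq (isL2_left hσ hu) (isL2_right hσ hu),
    L2norm_eq (isL2_add_left hσ hu hw) (isL2_add_right hσ hu hw),
    ← ENNReal.ofReal_mul (by positivity)]
  exact ENNReal.ofReal_le_ofReal (sqrt_nsq_le hσ hu hw hA0 hA)

omit hσ hu hw [T2Space X] [CompactSpace X] in
lemma L2norm_eq_zero {v : S.Form} (hv : ∀ x ∈ (𝓡∂ (m + 1)).interior X, ∀ k : ℕ,
    v.1 k x = 0 ∧ v.2 k x = 0) : S.L2norm v = 0 := by
  rw [L2norm, ENNReal.rpow_eq_zero_iff]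
  refine Or.inl ⟨?_, by norm_num⟩
  refine lintegral_eq_zero_of_ae_eq_zero (S.ae_intVol fun x hx => ?_)
  have h1 := mixedInner_smul_left (h := S.h) (ξ := v.1) (η := v.1) (a := 0) (x := x) v.1 fun k => by
    rw [(hv x hx k).1]; ext; simp
  have h2 := mixedInner_smul_left (h := S.h) (ξ := v.2) (η := v.2) (a := 0) (x := x) v.2 fun k => by
    rw [(hv x hx k).2]; ext; simp
  rw [mixedInner_self, zero_mul, Complex.ofReal_eq_zero] at h1 h2
  simp only [h1, h2, add_zero, mul_zero, ENNReal.ofReal_zero, Pi.zero_apply]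

omit hσ hw [T2Space X] in
lemma eq_zero_of_L2norm_eq_zero (h0 : S.L2norm u = 0) {x : X}
    (hx : x ∈ (𝓡∂ (m + 1)).interior X) (k : ℕ) : u.1 k x = 0 ∧ u.2 k x = 0 := by
  rw [L2norm, ENNReal.rpow_eq_zero_iff] at h0
  have h1 := h0.resolve_right fun h => absurd h.2 (by norm_num)
  have hc := ENNReal.continuous_ofReal.comp_continuousOn (S.α_smooth.continuous.continuousOn.mul
    ((continuousOn_fiberNormSq S.h hu.1).add (continuousOn_fiberNormSq S.h hu.2.1)))
  have h2 := eq_zero_of_lintegral_eq_zero S.h hc h1.1 hx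
  have n1 := fiberNormSq_nonneg S.h u.1 x
  have n2 := fiberNormSq_nonneg S.h u.2 x
  have h3 : fiberNormSq S.h u.1 x + fiberNormSq S.h u.2 x ≤ 0 :=
    nonpos_of_mul_nonpos_right (ENNReal.ofReal_eq_zero.mp h2) (S.α_pos x hx)
  exact ⟨eq_zero_of_fiberNormSq_eq_zero (h := S.h) (by linarith) k,
    eq_zero_of_fiberNormSq_eq_zero (h := S.h) (by linarith) k⟩

end StaticGeometry

end

theorem mainTheorem7 {m : ℕ}
    {X : Type*} [TopologicalSpace X] [T2Space X] [CompactSpace X]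
    [ChartedSpace (EuclideanHalfSpace (m + 1)) X] [IsManifold (𝓡∂ (m + 1)) ∞ X]
    [MeasurableSpace X] [BorelSpace X]
    {Y : Type*} [TopologicalSpace Y] [T2Space Y] [CompactSpace Y]
    [ChartedSpace (EuclideanSpace ℝ (Fin m)) Y] [IsManifold (𝓡 m) ∞ Y]
    (S : StaticGeometry m X Y) :
    (∃ C : ℝ, 0 < C ∧ ∀ σ : ℂ, 0 < σ.im → ∀ u ∈ S.asymptoticSpace σ,
      S.L2norm u < ⊤ ∧ ∀ w : S.Form, S.IsDeltaHat σ u w →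
        S.L2norm (S.dHat σ u + w) < ⊤ ∧
        S.L2norm u ≤ ENNReal.ofReal (C * (‖σ‖ / |σ.im| ^ 2)) * S.L2norm (S.dHat σ u + w)) ∧
    (∀ σ : ℂ, 0 < σ.im → ∀ u ∈ S.asymptoticSpace σ, ∀ w : S.Form,
      S.IsDeltaHat σ u w →
        (∀ x ∈ (𝓡∂ (m + 1)).interior X, ∀ k : ℕ,
          (S.dHat σ u + w).1 k x = 0 ∧ (S.dHat σ u + w).2 k x = 0) →
        ∀ x ∈ (𝓡∂ (m + 1)).interior X, ∀ k : ℕ, u.1 k x = 0 ∧ u.2 k x = 0) := by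
  obtain ⟨A, hA0, hA⟩ := S.exists_α_le
  refine ⟨⟨2 * A, by positivity, fun σ hσ u hu => ⟨?_, fun w hw => ⟨?_, ?_⟩⟩⟩,
    fun σ hσ u hu w hw hf x hx k => ?_⟩
  · rw [StaticGeometry.L2norm_eq (StaticGeometry.isL2_left hσ hu)
      (StaticGeometry.isL2_right hσ hu)]
    exact ENNReal.ofReal_lt_top
  · rw [StaticGeometry.L2norm_eq (StaticGeometry.isL2_add_left hσ hu hw)
      (StaticGeometry.isL2_add_right hσ hu hw)]
    exact ENNReal.ofReal_lt_top
  · exact StaticGeometry.L2norm_le hσ hu hw hA0 hA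
  · refine StaticGeometry.eq_zero_of_L2norm_eq_zero hu (le_antisymm ?_ zero_le) hx k
    have h := StaticGeometry.L2norm_le hσ hu hw hA0 hA
    rwa [StaticGeometry.L2norm_eq_zero hf, mul_zero] at h
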